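/- \textbf{Setting.} Let $k\ge 0$ and let $p_1,\dots,p_k\in\mathbb{R}^3$ be such that $0,\pm p_1,\dots,\pm p_k$ are $2k+1$ distinct points; put $P=\{\pm p_1,\dots,\pm p_k\}$. Fix $\delta\in(0,\tfrac12)$ with $\delta<|p_\nu|$ for all $\nu$. Let $\overline{\mathbb{R}^3}$ be the radial compactification of $\mathbb{R}^3$ (boundary defining function $1/|x|$ at infinity) and $[\overline{\mathbb{R}^3};0,P]$ its real blow-up in $\{0\}\cup P$. \emph{HA.} $\mathrm{HA}=\{Y\in\mathbb{C}^3: Y_1^2+Y_2^2+Y_3^2=1\}/(Y\sim -Y)$. Writing $Y=y+i\eta$, where $\eta\neq0$ it is a principal circle bundle $\psi$ over a part of $\mathbb{R}^3$: $x'=\psi(Y)$ has direction $m=y\times\eta/|y\times\eta|$ and length $|y|^2$, and $e^{i\theta}$ acts as the rotation by $\theta/2$ about $m$. $\overline{\mathrm{HA}}$ is its compactification by a circle bundle over the sphere at infinity of the $x'$-space. \emph{TN.} $\mathrm{TN}=\mathbb{C}^2$ with the scalar circle action and the Hopf map $z\mapsto x'\in\mathbb{R}^3$; $\overline{\mathrm{TN}}$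 is its compactification by $\partial\overline{\mathrm{TN}}=S^3$, fibred over $S^2$ by the Hopf map. \emph{Gibbons--Hawking manifolds.} For $\varepsilon>0$ let $\phi:M_\varepsilon\to\{|x|>2\varepsilon\}\subset\mathbb{R}^3$ be the smooth circle manifold that is a principal circle bundle off $P$, of degree $4$ around $0$ and $-1$ around each $p\in P$ (the bundle carrying a connection form $\alpha$ with $d\alpha=*_\varepsilon\,dh_\varepsilon$, where $*_\varepsilon$ is the Hodge star of $|dx|^2/\varepsilon^2$ and $h_\varepsilon=1-\frac{2\varepsilon}{|x|}+\sum_{p\in P}\frac{\varepsilon}{2|x-p|}$), and which over a neighbourhood of each $p\in P$ is the Hopf map $\mathbb{C}^2\to\mathbb{R}^3$. Let $\overline{M}_\varepsilon$ be its partial compactification by a circle bundle $\partial\overline{M}_\varepsilon$ over the sphere at infinity. \emph{Sen spaces.} For $0<\varepsilon<\delta^2$, $\widetilde{\mathrm{SEN}}_{k,\varepsilon}$ is obtained from $\mathrm{HA}\setminus\psi^{-1}\{|x'|\ge\delta/\varepsilon\}$ and $M_\varepsilon\setminus\phi^{-1}\{|x|\le\varepsilon/\delta\}$ by identifying $\phi^{-1}\{\varepsilon/\delta<|x|<\delta\}$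 with $\psi^{-1}\{1/\delta<|x'|<\delta/\varepsilon\}$ through a circle-equivariant diffeomorphism covering $x'=x/\varepsilon$; its compactification is obtained by using $\overline{M}_\varepsilon$ instead of $M_\varepsilon$. \textbf{Proposition.} There exist $\varepsilon_0\in(0,\delta^2]$ and a $5$-manifold $\widetilde{\mathcal W}$ with corners up to codimension $2$ having the following properties. \begin{enumerate} \item[(i)] There is a smooth proper $b$-fibration $\widetilde\pi:\widetilde{\mathcal W}\to I=[0,\varepsilon_0)$, and for $\varepsilon>0$ the fibre $\widetilde\pi^{-1}(\varepsilon)$ is the compactification of $\widetilde{\mathrm{SEN}}_{k,\varepsilon}$, its boundary being $\widetilde\pi^{-1}(\varepsilon)\cap\widetilde I_\infty$. \item[(ii)] The boundary of $\widetilde{\mathcal W}$ is the union of boundary hypersurfaces $\widetilde X_{\mathrm{ad}}$, $\widetilde X_0$, $\widetilde X_p$ $(p\in P)$ and $\widetilde I_\infty$, where $\widetilde X_0=\overline{\mathrm{HA}}$, $\widetilde X_p=\overline{\mathrm{TN}}$, and $\widetilde\pi^{-1}(0)=\widetilde X_{\mathrm{ad}}\cup\widetilde X_0\cup\bigcup_{p\in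 P}\widetilde X_p$. \item[(iii)] $\widetilde I_\infty$ is not compact, $\widetilde\pi|\widetilde I_\infty\to I$ is a smooth submersion onto $I$, and $\widetilde\pi^{-1}(\varepsilon)\cap\widetilde I_\infty=\partial\overline{M}_\varepsilon$ for $\varepsilon>0$. \item[(iv)] $\widetilde X_{\mathrm{ad}}$ and $\widetilde I_\infty$ are total spaces of principal circle bundles $\widetilde\phi_{\mathrm{ad}}:\widetilde X_{\mathrm{ad}}\to[\overline{\mathbb{R}^3};0,P]$ and $\widetilde\phi_\infty:\widetilde I_\infty\to S^2\times I$. There is an open set $\widetilde{\mathcal W}_1\subset\widetilde{\mathcal W}$ with a smooth circle action and a smooth invariant map $x:\widetilde{\mathcal W}_1\to\overline{\mathbb{R}^3}$, which contains $\widetilde X_{\mathrm{ad}}$, $\widetilde I_\infty$, all $\widetilde X_p$ $(p\in P)$, the part $|x'|>1/\delta$ of $\widetilde X_0$, and meets $\widetilde\pi^{-1}(\varepsilon)$, $\varepsilon>0$, in the piece that comes from $\overline{M}_\varepsilon$; the circle actions of all these spaces are the restrictions of the one on $\widetilde{\mathcal W}_1$; and $x$ restricts to $\phi$ on the fibres with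 $\varepsilon>0$, to the constant $p$ on $\widetilde X_p\cap\widetilde{\mathcal W}_1$ for $p\in P\cup\{0\}$, to $\widetilde\phi_{\mathrm{ad}}$ followed by the blow-down on $\widetilde X_{\mathrm{ad}}$, and to the first component of $\widetilde\phi_\infty$ on $\widetilde I_\infty$. \item[(v)] $\widetilde X_{\mathrm{ad}}$ is a manifold with boundary. The connected components of its boundary are $\partial_p\widetilde X_{\mathrm{ad}}=\partial\widetilde X_p=\widetilde X_{\mathrm{ad}}\cap\widetilde X_p$ for $p\in P\cup\{0\}$ and $\partial_\infty\widetilde X_{\mathrm{ad}}=\partial\widetilde I_\infty=\widetilde X_{\mathrm{ad}}\cap\widetilde I_\infty$; the hypersurfaces other than $\widetilde X_{\mathrm{ad}}$ are pairwise disjoint. On $\partial\widetilde X_p$, the fibration $\widetilde\phi_{\mathrm{ad}}$ is the one of $\partial\overline{\mathrm{TN}}$, respectively of $\partial\overline{\mathrm{HA}}$, over the front face of the blow-up of $p$. \item[(vi)] There is a smooth involution $\iota$ of $\widetilde{\mathcal W}$ with $\widetilde\pi\circ\iota=\widetilde\pi$, which maps $\widetilde X_{\mathrm{ad}}$, $\widetilde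 X_0$ and $\widetilde I_\infty$ to themselves, $\widetilde X_p$ to $\widetilde X_{-p}$ and $\widetilde{\mathcal W}_1$ to itself, and which covers $x\mapsto -x$ on $\overline{\mathbb{R}^3}$ and its lift to $[\overline{\mathbb{R}^3};0,P]$; on $\widetilde X_0$ it is the extension of $Y\mapsto\overline Y$. \end{enumerate} -/

import Mathlib

open Set Topology
open scoped Manifold ContDiff

noncomputable section

namespace GluingSpace

/-! ### Smooth maps between subsets of manifolds, manifolds with corners -/

section General

variable {E H M : Type*} [NormedAddCommGroup E] [NormedSpace ℝ E] [TopologicalSpace H]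
  [TopologicalSpace M] [ChartedSpace H M]
  {E' H' M' : Type*} [NormedAddCommGroup E'] [NormedSpace ℝ E'] [TopologicalSpace H']
  [TopologicalSpace M'] [ChartedSpace H' M']

/-- `f` restricts to a diffeomorphism of the subset `A` of a manifold onto the subset `B` of
another one (both with the induced topology and smooth structure). All subsets to which this is
applied are embedded submanifolds, possibly with boundary or corners; on such subsets
`ContMDiffOn` is smoothness in the usual sense. -/
def IsDiffeoOn (I : ModelWithCorners ℝ E H) (I' : ModelWithCorners ℝ E' H') (f : M → M')
    (A : Set M) (B : Set M') : Prop :=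
  ∃ g : M' → M, ContMDiffOn I I' ∞ f A ∧ ContMDiffOn I' I ∞ g B ∧
    MapsTo f A B ∧ MapsTo g B A ∧ InvOn g f A B

/-- `act` is a smooth action of the circle group on the subset `X` of a manifold. -/
structure IsCircleAction (I : ModelWithCorners ℝ E H) (X : Set M) (act : Circle → M → M) :
    Prop where
  smooth : ContMDiffOn ((𝓡 1).prod I) I ∞ (fun a : Circle × M => act a.1 a.2) (univ ×ˢ X)
  mapsTo : ∀ c, MapsTo (act c) X X
  one_act : ∀ w ∈ X, act 1 w = w
  mul_act : ∀ c d, ∀ w ∈ X, act (c * d) w = act c (act d w)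

/-- `φ : X → Y` is a smooth principal circle bundle with respect to the action `act`: locally over
`Y` there are smooth sections `σ` for which `(c, y) ↦ c · σ y` is a diffeomorphism onto the part of
`X` over the neighbourhood. -/
structure IsPrincipalCircleBundle (I : ModelWithCorners ℝ E H) (I' : ModelWithCorners ℝ E' H')
    (X : Set M) (Y : Set M') (act : Circle → M → M) (φ : M → M') : Prop where
  action : IsCircleAction I X act
  mapsTo : MapsTo φ X Y
  smooth : ContMDiffOn I I' ∞ φ X
  locallyTrivial : ∀ y ∈ Y, ∃ U : Set M', IsOpen U ∧ y ∈ U ∧ ∃ σ : M' → M,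
    ContMDiffOn I' I ∞ σ (Y ∩ U) ∧
    (∀ y' ∈ Y ∩ U, ∀ c, φ (act c (σ y')) = y') ∧
    IsDiffeoOn ((𝓡 1).prod I') I (fun a : Circle × M' => act a.1 (σ a.2))
      (univ ×ˢ (Y ∩ U)) (X ∩ φ ⁻¹' U)

/-- The differential of a real function. -/
def diff (I : ModelWithCorners ℝ E H) (f : M → ℝ) (w : M) : E →L[ℝ] ℝ :=
  mfderiv I 𝓘(ℝ, ℝ) f w

/-- The sets `X i` are the boundary hypersurfaces of the manifold with corners `M`, with boundary
defining functions `ρ i`: each is connected, their union is the boundary, and they meet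
transversally. -/
structure IsBoundaryFamily {ι : Type*} (I : ModelWithCorners ℝ E H) (X : ι → Set M)
    (ρ : ι → M → ℝ) : Prop where
  smooth : ∀ i, ContMDiff I 𝓘(ℝ, ℝ) ∞ (ρ i)
  nonneg : ∀ i w, 0 ≤ ρ i w
  zero_set : ∀ i, X i = {w | ρ i w = 0}
  connected : ∀ i, IsConnected (X i)
  iUnion_eq : ⋃ i, X i = I.boundary M
  transversal : ∀ w, LinearIndependent ℝ (fun i : {i // w ∈ X i} => diff I (ρ i.1) w)

/-- `f : M → [0, c)` is a `b`-fibration, `ρ` being boundary defining functions of the boundary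
hypersurfaces of `M`: it is a `b`-map (a positive smooth function times a monomial in the `ρ i`)
and its `b`-differential is onto at every point. Where `f` vanishes the latter is automatic, since
there some `ρ i` with positive exponent vanishes and `ρ i ∂/∂(ρ i)` is mapped to a nonzero multiple
of `t ∂/∂t`; elsewhere it says that `f` is a submersion on the boundary stratum of the point.
The remaining condition (no boundary hypersurface is mapped into a corner) is void for an interval
as target. -/
structure IsBFibration {ι : Type*} [Fintype ι] (I : ModelWithCorners ℝ E H) (ρ : ι → M → ℝ)
    (f : M → ℝ) : Prop where
  smooth : ContMDiff I 𝓘(ℝ, ℝ) ∞ f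
  bMap : ∃ (e : ι → ℕ) (a : M → ℝ), ContMDiff I 𝓘(ℝ, ℝ) ∞ a ∧ (∀ w, 0 < a w) ∧
    ∀ w, f w = a w * ∏ i, ρ i w ^ e i
  bSubmersion : ∀ w, 0 < f w → ∃ v : E, (∀ i, ρ i w = 0 → diff I (ρ i) w v = 0) ∧ diff I f w v ≠ 0

end General

/-- The local model `[0, ∞) × ([0, ∞) × ℝ³)` of 5-manifolds with corners up to codimension 2. -/
abbrev Corner5 : Type := ModelProd (EuclideanHalfSpace 1) (EuclideanHalfSpace 4)

/-- The model with corners on `Corner5`. -/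
abbrev J5 : ModelWithCorners ℝ (EuclideanSpace ℝ (Fin 1) × EuclideanSpace ℝ (Fin 4)) Corner5 :=
  (𝓡∂ 1).prod (𝓡∂ 4)

/-- The set of points of codimension 2. The boundary of a boundary hypersurface `X` (which is a
manifold with boundary) is `X ∩ corners W`. -/
def corners (W : Type*) [TopologicalSpace W] [ChartedSpace Corner5 W] : Set W :=
  {w | (chartAt Corner5 w w).1.val 0 = 0 ∧ (chartAt Corner5 w w).2.val 0 = 0}

/-! ### Euclidean space and its radial compactification -/

/-- Euclidean 3-space. -/
abbrev E3 : Type := EuclideanSpace ℝ (Fin 3)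

/-- The cross product of `ℝ³`. -/
def cross (a b : E3) : E3 := WithLp.toLp 2 (crossProduct a.ofLp b.ofLp)

/-- The radial compactification of `ℝ³`, as the closed upper hemisphere of `S³`: the point `(u, s)`
with `s > 0` is `x = u / s ∈ ℝ³`, and `s = 0` is the sphere at infinity. (Near infinity `1 / |x|` is
a boundary defining function.) -/
def Rbar : Set (E3 × ℝ) := {b | ‖b.1‖ ^ 2 + b.2 ^ 2 = 1 ∧ 0 ≤ b.2}

/-- The inclusion of `ℝ³` in its radial compactification. -/
def toRbar (x : E3) : E3 × ℝ := ((√(1 + ‖x‖ ^ 2))⁻¹ • x, (√(1 + ‖x‖ ^ 2))⁻¹)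

/-! ### The points of `P` and the blow-up -/

/-- Labels of the points of `P = {± p 1, …, ± p k}`. -/
abbrev Nut (k : ℕ) : Type := Fin k × Bool

/-- The points of `P ∪ {0}`; the label of `0` is `none`. -/
def pt {k : ℕ} (p : Fin k → E3) : Option (Nut k) → E3
  | none => 0
  | some (ν, true) => p ν
  | some (ν, false) => -p ν

/-- The involution of the labels that corresponds to `x ↦ -x`. -/
def negLabel {k : ℕ} : Option (Nut k) → Option (Nut k)
  | none => none
  | some (ν, b) => some (ν, !b)

/-- The real blow-up of the radial compactification of `ℝ³` in the points of `P ∪ {0}`: a point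
`(u, s)` of the compactification with, for each point `q = pt p l`, a unit vector `v l` such that
`u - s q` is a non-negative multiple of `v l`. -/
def Yad {k : ℕ} (p : Fin k → E3) : Set ((E3 × ℝ) × (Option (Nut k) → E3)) :=
  {a | a.1 ∈ Rbar ∧ ∀ l, ‖a.2 l‖ = 1 ∧
    a.1.1 - a.1.2 • pt p l = ‖a.1.1 - a.1.2 • pt p l‖ • a.2 l}

/-- The lift of `x ↦ -x` to the blow-up. -/
def negYad {k : ℕ} (a : (E3 × ℝ) × (Option (Nut k) → E3)) :
    (E3 × ℝ) × (Option (Nut k) → E3) :=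
  ((-a.1.1, a.1.2), fun l => -a.2 (negLabel l))

/-! ### Taub–NUT -/

/-- The Hopf map `ℂ² → ℝ³`. -/
def hopf (z : Fin 2 → ℂ) : E3 :=
  !₂[2 * (star (z 0) * z 1).re, 2 * (star (z 0) * z 1).im, ‖z 0‖ ^ 2 - ‖z 1‖ ^ 2]

/-- The compactified Taub–NUT space. Taub–NUT space is `ℂ² = ℝ⁴` with the scalar circle action and
the Hopf map `z ↦ x' = hopf z` as quotient map; in terms of the radial compactification
`x' = u / s` of the base, the point is written as `z / √s` with `hopf z = u`. The boundary
`s = 0` is `S³`, fibred over `S²` by the Hopf map. -/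
def TNbar : Set ((E3 × ℝ) × (Fin 2 → ℂ)) := {a | a.1 ∈ Rbar ∧ hopf a.2 = a.1.1}

/-! ### The manifold `HA` -/

/-- Real part of a vector of `ℂ³`. -/
def rePart (Y : Fin 3 → ℂ) : E3 := WithLp.toLp 2 fun i => (Y i).re

/-- Imaginary part of a vector of `ℂ³`. -/
def imPart (Y : Fin 3 → ℂ) : E3 := WithLp.toLp 2 fun i => (Y i).im

/-- Complex `3 × 3` matrices, as a normed space. -/
abbrev Mat3 : Type := Fin 3 → Fin 3 → ℂ

/-- The quadric `Y₁² + Y₂² + Y₃² = 1` in `ℂ³`. With `Y = y + iη` it says that `y ⊥ η` and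
`|y|² = 1 + |η|²`. -/
def AHhat : Set (Fin 3 → ℂ) := {Y | Y 0 ^ 2 + Y 1 ^ 2 + Y 2 ^ 2 = 1}

/-- `Y ↦ Y Yᵗ`. On nonzero vectors this is an immersion and identifies exactly `Y` and `-Y`,
so that the image of a submanifold is its quotient by `r : Y ↦ -Y`. -/
def sq (Y : Fin 3 → ℂ) : Mat3 := fun i j => Y i * Y j

theorem sq_eq_sq_iff (Y Y' : Fin 3 → ℂ) : sq Y = sq Y' ↔ Y = Y' ∨ Y = -Y' := by
  constructor
  · intro h
    have h' : ∀ i j, Y i * Y j = Y' i * Y' j := fun i j => congrFun (congrFun h i) j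
    by_cases h0 : Y = 0
    · left
      funext i
      have := h' i i
      simp [h0] at this
      simp [h0, this]
    · obtain ⟨i, hi⟩ := Function.ne_iff.1 h0
      have hi' : Y i ≠ 0 := by simpa using hi
      rcases mul_self_eq_mul_self_iff.1 (h' i i) with e | e
      · left
        funext j
        have := h' i j
        rw [← e] at this
        exact mul_left_cancel₀ hi' this
      · right
        funext j
        have := h' i j
        have e' : Y' i = -Y i := by rw [e, neg_neg]
        rw [e'] at this
        have : Y i * Y j = Y i * -Y' j := by rw [this]; ring
        simpa using mul_left_cancel₀ hi' this
  · rintro (rfl | rfl)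
    · rfl
    · funext i j
      simp [sq]

/-- `HA`, the quotient of the quadric by `r : Y ↦ -Y`. -/
def HA : Set Mat3 := sq '' AHhat

/-- The asymptotic direction `m = y × η / |y × η|` of `Y = y + iη` (for `η ≠ 0`). -/
def axis (Y : Fin 3 → ℂ) : E3 :=
  ‖cross (rePart Y) (imPart Y)‖⁻¹ • cross (rePart Y) (imPart Y)

/-- The radial coordinate `|x'|` used on `HA`; it is `1` on the core `η = 0`. (Another radial
coordinate, bijectively related to this one, leads to diffeomorphic spaces.) -/
def radius (Y : Fin 3 → ℂ) : ℝ := ‖rePart Y‖ ^ 2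

/-- The quotient map `x' = ψ(Y)` to `ℝ³` of the circle action on the asymptotic region. -/
def psi (Y : Fin 3 → ℂ) : E3 := radius Y • axis Y

/-- The rotation by the angle `t` about the axis `m` of `Y`, applied to `Y` (which is perpendicular
to `m`). As the rotation by `π` is `Y ↦ -Y`, the circle `ℝ / 2πℤ` acts freely on the part `η ≠ 0` of
`HA` by `θ · [Y] = [rot (θ / 2) Y]`. -/
def rot (t : ℝ) (Y : Fin 3 → ℂ) : Fin 3 → ℂ :=
  (Real.cos t : ℂ) • Y + (Real.sin t : ℂ) • crossProduct (fun i => (axis Y i : ℂ)) Y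

/-- The closed disc bundle `{n + iv : |n| = 1, n ⊥ v, |v| ≤ 1}`. -/
def AHhatBar : Set (Fin 3 → ℂ) :=
  {Z | ‖rePart Z‖ = 1 ∧ inner ℝ (rePart Z) (imPart Z) = 0 ∧ ‖imPart Z‖ ≤ 1}

/-- The compactification of `HA`, the quotient of `AHhatBar` by `Z ↦ -Z`. The map
`[Y] ↦ [Y / |Re Y|]` identifies `HA` with its interior `|Im Z| < 1`, and in terms of `Z` one has
`1 / |x'| = 1 - |Im Z|²`, which is a boundary defining function. -/
def HAbar : Set Mat3 := sq '' AHhatBar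

/-! ### The Gibbons–Hawking manifolds -/

/-- The vector space `(⨂_P ℂ²) ⊗ (ℂ³ ⊗ ℂ³)`. -/
abbrev Tensor (k : ℕ) : Type := (Nut k → Fin 2) → Mat3

/-- The manifold `M_ε` with its boundary at infinity adjoined, a circle manifold (by scalar
multiplication of `T`) with the map `(b, T) ↦ b = (u, s)` onto the part `|x| > 2ε` of the radial
compactification of `ℝ³` as quotient map.

Over the complement of `P` it is the tensor product of the following principal circle bundles: for
each point `q` of `P` the Hopf bundle pulled back by the direction of `x - q` (degree `-1` around
`q`), and the bundle of all `w ⊗ w` with `w = n - iv` and `(n, v, x / |x|)` a positive orthonormal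
frame (the square of the unit tangent bundle of `S²`, of degree `4` around `0`). A Hopf factor is
scaled to `hopf (z l) = u - s q`, so that the circle collapses over `q`, with the local model
`hopf : ℂ² → ℝ³`. These degrees are those of the bundle that carries a connection form `α` with
`dα = * dh` for
`h = 1 - 2ε / |x| + ∑ (ε / (2 |x - q|))`, the sum being over `q` in `P`. -/
def Mbar {k : ℕ} (p : Fin k → E3) (ε : ℝ) : Set ((E3 × ℝ) × Tensor k) :=
  {a | a.1 ∈ Rbar ∧ 2 * ε * a.1.2 < ‖a.1.1‖ ∧
    ∃ (w : Fin 3 → ℂ) (z : Nut k → Fin 2 → ℂ),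
      w 0 ^ 2 + w 1 ^ 2 + w 2 ^ 2 = 0 ∧
      cross (rePart w) (imPart w) = -(‖a.1.1‖⁻¹ • a.1.1) ∧
      (∀ l, hopf (z l) = a.1.1 - a.1.2 • pt p (some l)) ∧
      a.2 = fun f i j => (∏ l, z l (f l)) * (w i * w j)}

/-- The boundary at infinity of `Mbar p ε`. -/
def bdryMbar {k : ℕ} (p : Fin k → E3) (ε : ℝ) : Set ((E3 × ℝ) × Tensor k) :=
  {a ∈ Mbar p ε | a.1.2 = 0}

/-! ### The double covers of the Sen spaces -/

/-- The first piece: `HA` without the set `|x'| ≥ δ / ε`. -/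
def pieceHA (δ ε : ℝ) : Set Mat3 := sq '' {Y ∈ AHhat | radius Y < δ / ε}

/-- The second piece: compactified `M_ε` without the set `|x| ≤ ε / δ`. -/
def pieceM {k : ℕ} (p : Fin k → E3) (δ ε : ℝ) : Set ((E3 × ℝ) × Tensor k) :=
  {a ∈ Mbar p ε | ε / δ * a.1.2 < ‖a.1.1‖}

/-- `V₀`, the part `1 / δ < |x'| < δ / ε` of `HA`. -/
def overlapHA (δ ε : ℝ) : Set Mat3 :=
  sq '' {Y ∈ AHhat | 1 / δ < radius Y ∧ radius Y < δ / ε}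

/-- `V₁`, the part `ε / δ < |x| < δ` of `M_ε`. -/
def overlapM {k : ℕ} (p : Fin k → E3) (δ ε : ℝ) : Set ((E3 × ℝ) × Tensor k) :=
  {a ∈ Mbar p ε | 0 < a.1.2 ∧ ε / δ < ‖a.1.2⁻¹ • a.1.1‖ ∧ ‖a.1.2⁻¹ • a.1.1‖ < δ}

/-- `κ` is a diffeomorphism of `V₁` onto `V₀` that covers `x' = x / ε` and commutes with the circle
actions. -/
structure IsBundleGluing {k : ℕ} (p : Fin k → E3) (δ ε : ℝ)
    (κ : (E3 × ℝ) × Tensor k → Mat3) : Prop where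
  diffeo : IsDiffeoOn 𝓘(ℝ, (E3 × ℝ) × Tensor k) 𝓘(ℝ, Mat3) κ (overlapM p δ ε) (overlapHA δ ε)
  covers : ∀ a ∈ overlapM p δ ε, ∀ Y ∈ AHhat, κ a = sq Y → psi Y = ε⁻¹ • a.1.2⁻¹ • a.1.1
  equivariant : ∀ a ∈ overlapM p δ ε, ∀ Y ∈ AHhat, κ a = sq Y → ∀ θ : ℝ,
    κ (a.1, (Circle.exp θ : ℂ) • a.2) = sq (rot (θ / 2) Y)

section Sen

variable {E H W : Type*} [NormedAddCommGroup E] [NormedSpace ℝ E] [TopologicalSpace H]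
  [TopologicalSpace W] [ChartedSpace H W]

/-- The subset `F` of the manifold `W` is the compactification of the (double cover of the) Sen
space at scale `ε`, with boundary `B`: it is obtained by gluing the two pieces by a map `κ` as in
`IsBundleGluing`. Moreover `A` is the image of the piece coming from `M_ε`, on which `x` and `act`
are its map to the radial compactification of `ℝ³` and its circle action. -/
def IsCompactifiedSen {k : ℕ} (p : Fin k → E3) (δ ε : ℝ) (I : ModelWithCorners ℝ E H)
    (F A B : Set W) (x : W → E3 × ℝ) (act : Circle → W → W) : Prop :=
  ∃ (κ : (E3 × ℝ) × Tensor k → Mat3) (j₀ : Mat3 → W) (j₁ : (E3 × ℝ) × Tensor k → W) (A₀ : Set W),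
    IsBundleGluing p δ ε κ ∧
    IsDiffeoOn 𝓘(ℝ, Mat3) I j₀ (pieceHA δ ε) A₀ ∧
    IsDiffeoOn 𝓘(ℝ, (E3 × ℝ) × Tensor k) I j₁ (pieceM p δ ε) A ∧
    (∃ U, IsOpen U ∧ A₀ = F ∩ U) ∧ (∃ U, IsOpen U ∧ A = F ∩ U) ∧ F = A₀ ∪ A ∧
    (∀ z ∈ pieceHA δ ε, ∀ a ∈ pieceM p δ ε, j₀ z = j₁ a ↔ a ∈ overlapM p δ ε ∧ κ a = z) ∧
    IsDiffeoOn 𝓘(ℝ, (E3 × ℝ) × Tensor k) I j₁ (bdryMbar p ε) B ∧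
    (∀ a ∈ pieceM p δ ε, x (j₁ a) = a.1) ∧
    (∀ a ∈ pieceM p δ ε, ∀ c : Circle, act c (j₁ a) = j₁ (a.1, (c : ℂ) • a.2))

end Sen

/-! ### The boundary hypersurfaces -/

/-- Labels of the boundary hypersurfaces: `X_ad`, `X_q` for `q` in `P ∪ {0}`, and `I_∞`. -/
inductive Face (k : ℕ) : Type
  | ad : Face k
  | pt (l : Option (Nut k)) : Face k
  | infty : Face k

instance (k : ℕ) : Fintype (Face k) :=
  Fintype.ofEquiv (Option (Option (Option (Nut k))))
    { toFun := fun a => match a with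
        | none => .ad
        | some none => .infty
        | some (some l) => .pt l
      invFun := fun F => match F with
        | .ad => none
        | .infty => some none
        | .pt l => some (some l)
      left_inv := by rintro (_ | _ | _) <;> rfl
      right_inv := by rintro (_ | _ | _) <;> rfl }

/-- The permutation of the labels that corresponds to `x ↦ -x`. -/
def Face.neg {k : ℕ} : Face k → Face k
  | .ad => .ad
  | .pt l => .pt (negLabel l)
  | .infty => .infty

end GluingSpace

end

/-! The total space is written down as a subset `total` of a vector space `Amb k`, so that every
smoothness statement reduces to ambient formulas. Its base comes from the compactified `ℝ³` times
`[0, δ²)` by blowing up the points `(q, 0)`, `q ∈ P ∪ {0}`. A point records `x = u / s` as `(u, s)`,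
for each `q` a radius `r_q` and a direction `v_q` with `u - s q = r_q v_q`, and a number `t` with `ε
= t ∏ r_q`. So `t`, the `r_q` and `s` are defining functions of `X_ad`, the `X_q` and `I_∞`, and `ε`
is a monomial in them by definition. At `q ∈ P` the blow-up is spherical: `(u - s q, ε) = r_q (v_q,
ε / r_q)` with a unit vector on the right. At `0` the direction alone is a unit vector in the
circle-fibred part, and `s ε / r_0 = ε / |x| = 1 / |x'|` is a free coordinate.

The circle bundle consists of tensors `⨂ z_q ⊗ (w ⊗ w)`, where `z_q` is a spinor with Hopf image
`v_q` and `w` is a null vector made of an oriented orthonormal frame of the plane perpendicular to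
`v_0`. The Hopf image being `v_q` and not `u - s q`, the spinor does not degenerate as `r_q → 0`:
the face over `q` is `{(z, σ) : |z|⁴ + σ² = 1, σ ≥ 0}`, which is compactified Taub–NUT, and the
circle collapses only at `z = 0`. Where `t = 0` all `v_q` are unit vectors, hence the bundle is
principal over `[ℝ̄³; 0, P]`.

Over `|x| < δ` the Hopf bundles of `P` have fixed sections (`good_aref`), so a tensor is just a
matrix `w ⊗ w`. For `Z = n + iv` in the closed disc bundle that compactifies the double cover of
`HA`, the vector `w = n - iv / |v|` is a null frame, `1 - |v|² = 1 / |x'|`, and the rotation of `Z`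
by `θ / 2` multiplies `w ⊗ w` by `e^{iθ}` (`circ_alpha`). Replacing `1 / |v|` by a function that is
smooth at `v = 0` extends this across the core and gives the map `alpha`, by which all of `HA`
enters the same ambient space. The gluing maps `κ` are then transition maps and need not be
constructed separately (`isBundleGluing`).

Three parametrizations, `alpha` near the face over `0`, `bet` near a face over a point of `P`, and
`gam` elsewhere, each defined on an open part of a 4-dimensional level set with boundary times a
half-line, provide the charts (`locDiffeo_levelSet`, `exists_chart`, `HasCorners`). Transversality
of the faces and the submersion properties come from velocities of explicit curves in these
parametrizations (`hasTransversal`, `hasFibreTransversal`). Properness holds because `{ε ≤ e₁}` is a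
union of two compact sets (`isCompact_eps_le`). For `ε > 0` the radii are positive functions of `x`,
which identifies the fibres with the glued Sen spaces (`isCompactifiedSen`). The faces are connected
because they are images of `S³ × [0, 1]` or circle bundles over connected bases. The involution is
complex conjugation on `w` and the quaternionic structure on the spinors. -/

open Set Topology
open scoped Manifold ContDiff

noncomputable section

namespace GluingSpace

/-! ### Subsets of normed spaces that are locally diffeomorphic to a quadrant -/

section Corners

variable {V : Type*} [NormedAddCommGroup V] [NormedSpace ℝ V]
  {V' : Type*} [NormedAddCommGroup V'] [NormedSpace ℝ V']
  {V'' : Type*} [NormedAddCommGroup V''] [NormedSpace ℝ V'']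
  {V₃ : Type*} [NormedAddCommGroup V₃] [NormedSpace ℝ V₃]

/-- The sets `A` near `a` and `B` near `b` are diffeomorphic. -/
def LocDiffeo (A : Set V) (a : V) (B : Set V') (b : V') : Prop :=
  ∃ (Φ : V → V') (ψ : V' → V) (U : Set V) (U' : Set V'), IsOpen U ∧ IsOpen U' ∧ a ∈ U ∧ b ∈ U' ∧
    ContDiffOn ℝ ∞ Φ (A ∩ U) ∧ ContDiffOn ℝ ∞ ψ (B ∩ U') ∧ MapsTo Φ (A ∩ U) (B ∩ U') ∧
    MapsTo ψ (B ∩ U') (A ∩ U) ∧ InvOn ψ Φ (A ∩ U) (B ∩ U') ∧ Φ a = b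

/-- In practice two maps are given that invert each other only where both make sense. Shrinking `U`
to the points sent into `U'`, and `U'` to those sent into `U`, makes them mutually inverse. These
preimages are only relatively open, so ambient open sets `u`, `w` have to be chosen for them. -/
theorem LocDiffeo.of_inverse {A : Set V} {a : V} {B : Set V'} {b : V'} (Φ : V → V') (ψ : V' → V)
    {U : Set V} {U' : Set V'} (hU : IsOpen U) (hU' : IsOpen U') (haA : a ∈ A) (ha : a ∈ U)
    (hb : b ∈ U') (hΦ : ContDiffOn ℝ ∞ Φ (A ∩ U)) (hψ : ContDiffOn ℝ ∞ ψ (B ∩ U'))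
    (mΦ : MapsTo Φ (A ∩ U) B) (mψ : MapsTo ψ (B ∩ U') A)
    (hl : ∀ x ∈ A ∩ U, Φ x ∈ U' → ψ (Φ x) = x) (hr : ∀ y ∈ B ∩ U', ψ y ∈ U → Φ (ψ y) = y)
    (hab : Φ a = b) : LocDiffeo A a B b := by
  obtain ⟨u, hu, hu'⟩ := continuousOn_iff'.1 hΦ.continuousOn U' hU'
  obtain ⟨w, hw, hw'⟩ := continuousOn_iff'.1 hψ.continuousOn U hU
  have h1 : ∀ x, x ∈ A ∩ U → (Φ x ∈ U' ↔ x ∈ u) := fun x hx => by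
    have := Set.ext_iff.1 hu' x
    simp only [mem_inter_iff, mem_preimage] at this hx
    tauto
  have h2 : ∀ x, x ∈ B ∩ U' → (ψ x ∈ U ↔ x ∈ w) := fun x hx => by
    have := Set.ext_iff.1 hw' x
    simp only [mem_inter_iff, mem_preimage] at this hx
    tauto
  have m1 : MapsTo Φ (A ∩ (U ∩ u)) (B ∩ (U' ∩ w)) := fun x hx => by
    have hx' : x ∈ A ∩ U := ⟨hx.1, hx.2.1⟩
    have e := (h1 x hx').2 hx.2.2
    refine ⟨mΦ hx', e, (h2 _ ⟨mΦ hx', e⟩).1 ?_⟩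
    rw [hl x hx' e]
    exact hx.2.1
  have m2 : MapsTo ψ (B ∩ (U' ∩ w)) (A ∩ (U ∩ u)) := fun y hy => by
    have hy' : y ∈ B ∩ U' := ⟨hy.1, hy.2.1⟩
    have e := (h2 y hy').2 hy.2.2
    refine ⟨mψ hy', e, (h1 _ ⟨mψ hy', e⟩).1 ?_⟩
    rw [hr y hy' e]
    exact hy.2.1
  have hau : a ∈ u := (h1 a ⟨haA, ha⟩).1 (hab ▸ hb)
  refine ⟨Φ, ψ, U ∩ u, U' ∩ w, hU.inter hu, hU'.inter hw, ⟨ha, hau⟩, ?_,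
    hΦ.mono fun x hx => ⟨hx.1, hx.2.1⟩, hψ.mono fun x hx => ⟨hx.1, hx.2.1⟩, m1, m2, ⟨?_, ?_⟩, hab⟩
  · have := m1 (x := a) ⟨haA, ha, hau⟩
    rw [hab] at this
    exact this.2
  · exact fun x hx => hl x ⟨hx.1, hx.2.1⟩ (m1 hx).2.1
  · exact fun x hx => hr x ⟨hx.1, hx.2.1⟩ (m2 hx).2.1

theorem LocDiffeo.trans {A : Set V} {a : V} {B : Set V'} {b : V'} {C : Set V''} {c : V''}
    (h : LocDiffeo A a B b) (h' : LocDiffeo B b C c) (haA : a ∈ A) : LocDiffeo A a C c := by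
  obtain ⟨Φ, ψ, U, U', hU, hU', ha, hb, hΦ, hψ, mΦ, mψ, hi, hab⟩ := h
  obtain ⟨Φ', ψ', X, X', hX, hX', ha', hb', hΦ', hψ', mΦ', mψ', hi', hab'⟩ := h'
  obtain ⟨u, hu, hu'⟩ := continuousOn_iff'.1 hΦ.continuousOn X hX
  obtain ⟨w, hw, hw'⟩ := continuousOn_iff'.1 hψ'.continuousOn U' hU'
  have h1 : ∀ x, x ∈ A ∩ U → (Φ x ∈ X ↔ x ∈ u) := fun x hx => by
    have := Set.ext_iff.1 hu' x
    simp only [mem_inter_iff, mem_preimage] at this hx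
    tauto
  have h2 : ∀ x, x ∈ C ∩ X' → (ψ' x ∈ U' ↔ x ∈ w) := fun x hx => by
    have := Set.ext_iff.1 hw' x
    simp only [mem_inter_iff, mem_preimage] at this hx
    tauto
  have hΦX : MapsTo Φ (A ∩ (U ∩ u)) (B ∩ X) := fun x hx =>
    ⟨(mΦ ⟨hx.1, hx.2.1⟩).1, (h1 x ⟨hx.1, hx.2.1⟩).2 hx.2.2⟩
  have hψX : MapsTo ψ' (C ∩ (X' ∩ w)) (B ∩ U') := fun x hx =>
    ⟨(mψ' ⟨hx.1, hx.2.1⟩).1, (h2 x ⟨hx.1, hx.2.1⟩).2 hx.2.2⟩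
  have hc : c ∈ C := hab' ▸ (mΦ' ⟨hab ▸ (mΦ ⟨haA, ha⟩).1, ha'⟩).1
  have hbB : b ∈ B := hab ▸ (mΦ ⟨haA, ha⟩).1
  have ec : ψ' c = b := by rw [← hab']; exact hi'.1 ⟨hbB, ha'⟩
  refine LocDiffeo.of_inverse (Φ' ∘ Φ) (ψ ∘ ψ') (hU.inter hu) (hX'.inter hw) haA
    ⟨ha, (h1 a ⟨haA, ha⟩).1 (hab.symm ▸ ha')⟩ ⟨hb', (h2 c ⟨hc, hb'⟩).1 (ec.symm ▸ hb)⟩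
    (hΦ'.comp (hΦ.mono fun x hx => ⟨hx.1, hx.2.1⟩) hΦX)
    (hψ.comp (hψ'.mono fun x hx => ⟨hx.1, hx.2.1⟩) hψX)
    (fun x hx => (mΦ' (hΦX hx)).1) (fun y hy => (mψ (hψX hy)).1) ?_ ?_ ?_
  · intro x hx _
    simp only [Function.comp_apply]
    rw [hi'.1 (hΦX hx), hi.1 ⟨hx.1, hx.2.1⟩]
  · intro y hy _
    simp only [Function.comp_apply]
    rw [hi.2 (hψX hy), hi'.2 ⟨hy.1, hy.2.1⟩]
  · simp [hab, hab']

theorem LocDiffeo.congr {A A' : Set V} {a : V} {B : Set V'} {b : V'} (h : LocDiffeo A a B b)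
    {N : Set V} (hN : IsOpen N) (haN : a ∈ N) (haA : a ∈ A') (hAA : A' ∩ N = A ∩ N) :
    LocDiffeo A' a B b := by
  refine LocDiffeo.trans (B := A) (b := a) ?_ h haA
  have hA : a ∈ A := (hAA.subset ⟨haA, haN⟩).1
  exact LocDiffeo.of_inverse id id hN hN haA haN haN contDiffOn_id contDiffOn_id
    (fun x hx => (hAA.subset hx).1) (fun x hx => (hAA.symm.subset hx).1) (fun _ _ _ => rfl)
    (fun _ _ _ => rfl) rfl

theorem LocDiffeo.prod {A : Set V} {a : V} {B : Set V'} {b : V'} {A' : Set V''} {a' : V''}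
    {B' : Set V₃} {b' : V₃} (h : LocDiffeo A a B b) (h' : LocDiffeo A' a' B' b') :
    LocDiffeo (A ×ˢ A') (a, a') (B ×ˢ B') (b, b') := by
  obtain ⟨Φ, ψ, U, U', hU, hU', ha, hb, hΦ, hψ, mΦ, mψ, hi, hab⟩ := h
  obtain ⟨Φ', ψ', X, X', hX, hX', ha', hb', hΦ', hψ', mΦ', mψ', hi', hab'⟩ := h'
  refine ⟨Prod.map Φ Φ', Prod.map ψ ψ', U ×ˢ X, U' ×ˢ X', hU.prod hX, hU'.prod hX', ⟨ha, ha'⟩,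
    ⟨hb, hb'⟩, ?_, ?_, ?_, ?_, ?_, ?_⟩
  · rw [prod_inter_prod]
    exact hΦ.prodMap hΦ'
  · rw [prod_inter_prod]
    exact hψ.prodMap hψ'
  · rw [prod_inter_prod, prod_inter_prod]
    exact mΦ.prodMap mΦ'
  · rw [prod_inter_prod, prod_inter_prod]
    exact mψ.prodMap mψ'
  · rw [prod_inter_prod, prod_inter_prod]
    exact ⟨fun x hx => Prod.ext (hi.1 hx.1) (hi'.1 hx.2), fun x hx =>
      Prod.ext (hi.2 hx.1) (hi'.2 hx.2)⟩
  · simp [hab, hab']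

/-- The vector space that contains the model quadrant. -/
abbrev E5 : Type := EuclideanSpace ℝ (Fin 1) × EuclideanSpace ℝ (Fin 4)

/-- The model quadrant. -/
def quad : Set E5 := {v | 0 ≤ v.1 0} ×ˢ {v | 0 ≤ v 0}

theorem range_J5 : range J5 = quad := by
  rw [modelWithCorners_prod_coe, Set.range_prodMap, range_modelWithCornersEuclideanHalfSpace,
    range_modelWithCornersEuclideanHalfSpace]
  ext v
  simp [quad]

theorem mem_interior_quad (v : E5) : v ∈ interior quad ↔ 0 < v.1 0 ∧ 0 < v.2 0 := by
  rw [← range_J5, modelWithCorners_prod_coe, Set.range_prodMap, interior_prod_eq,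
    interior_range_modelWithCornersEuclideanHalfSpace,
    interior_range_modelWithCornersEuclideanHalfSpace]
  simp

/-- The set `S` is locally diffeomorphic to a quadrant. Its boundary is `B`, and its set of points
of codimension two is `C`. -/
class HasCorners (S : Set V) (B C : outParam (Set V)) : Prop where
  chart : ∀ s ∈ S, ∃ e : E5, LocDiffeo S s quad e ∧ (s ∈ B ↔ e.1 0 = 0 ∨ e.2 0 = 0) ∧
    (s ∈ C ↔ e.1 0 = 0 ∧ e.2 0 = 0)

/-- The extension of a map to a subtype by a fixed value. -/
def toSub (S : Set V) [Nonempty S] {X : Type*} (F : X → V) (x : X) : S :=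
  open Classical in if h : F x ∈ S then ⟨F x, h⟩ else Classical.arbitrary S

theorem toSub_of_mem {S : Set V} [Nonempty S] {X : Type*} {F : X → V} {x : X} (h : F x ∈ S) :
    toSub S F x = ⟨F x, h⟩ := dif_pos h

theorem coe_toSub {S : Set V} [Nonempty S] {X : Type*} {F : X → V} {x : X} (h : F x ∈ S) :
    (toSub S F x : V) = F x := by rw [toSub_of_mem h]

/-- The chart of a set with corners that is given by a local diffeomorphism. -/
def cornerChart (S : Set V) (Φ : V → E5) (ψ : E5 → V) (U : Set V) (U' : Set E5)
    (hU : IsOpen U) (hU' : IsOpen U') (s : S)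
    (hΦ : ContDiffOn ℝ ∞ Φ (S ∩ U)) (hψ : ContDiffOn ℝ ∞ ψ (quad ∩ U'))
    (mΦ : MapsTo Φ (S ∩ U) (quad ∩ U')) (mψ : MapsTo ψ (quad ∩ U') (S ∩ U))
    (hi : InvOn ψ Φ (S ∩ U) (quad ∩ U')) : OpenPartialHomeomorph S Corner5 :=
  haveI : Nonempty S := ⟨s⟩
  { toFun := fun w => J5.symm (Φ w)
    invFun := fun y => toSub S ψ (J5 y)
    source := Subtype.val ⁻¹' U
    target := J5 ⁻¹' U'
    map_source' := fun w hw => by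
      have := mΦ ⟨w.2, hw⟩
      rw [mem_preimage, J5.right_inv (range_J5 ▸ this.1)]
      exact this.2
    map_target' := fun y hy => by
      have := mψ ⟨range_J5 ▸ mem_range_self y, hy⟩
      rw [mem_preimage, coe_toSub this.1]
      exact this.2
    left_inv' := fun w hw => by
      have := mΦ ⟨w.2, hw⟩
      apply Subtype.ext
      rw [J5.right_inv (range_J5 ▸ this.1), coe_toSub (mψ this).1]
      exact hi.1 ⟨w.2, hw⟩
    right_inv' := fun y hy => by
      have h := (⟨range_J5 ▸ mem_range_self y, hy⟩ : J5 y ∈ quad ∩ U')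
      rw [coe_toSub (mψ h).1, hi.2 h, J5.left_inv]
    open_source := hU.preimage continuous_subtype_val
    open_target := hU'.preimage J5.continuous
    continuousOn_toFun := J5.continuous_symm.comp_continuousOn
      (hΦ.continuousOn.comp continuous_subtype_val.continuousOn fun w hw => ⟨w.2, hw⟩)
    continuousOn_invFun := by
      rw [Topology.IsInducing.subtypeVal.continuousOn_iff]
      have hm : ∀ y ∈ J5 ⁻¹' U', J5 y ∈ quad ∩ U' := fun y hy => ⟨range_J5 ▸ mem_range_self y, hy⟩
      refine (hψ.continuousOn.comp J5.continuous.continuousOn hm).congr fun y hy => ?_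
      exact coe_toSub (mψ (hm y hy)).1 }

/-- The defining property of the charts of a set with corners. -/
def IsCornerChart (S : Set V) (e : OpenPartialHomeomorph S Corner5) : Prop :=
  ∃ (Φ : V → E5) (ψ : E5 → V) (U : Set V) (U' : Set E5), IsOpen U ∧ IsOpen U' ∧
    ContDiffOn ℝ ∞ Φ (S ∩ U) ∧ ContDiffOn ℝ ∞ ψ (quad ∩ U') ∧
    e.source = Subtype.val ⁻¹' U ∧ e.target = J5 ⁻¹' U' ∧
    (∀ w ∈ e.source, J5 (e w) = Φ w) ∧ (∀ y ∈ e.target, (e.symm y : V) = ψ (J5 y))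

theorem HasCorners.exists_chart {S B C : Set V} [h : HasCorners S B C] (s : S) :
    ∃ e : OpenPartialHomeomorph S Corner5, IsCornerChart S e ∧ s ∈ e.source ∧
      ((s : V) ∈ B ↔ (J5 (e s)).1 0 = 0 ∨ (J5 (e s)).2 0 = 0) ∧
      ((s : V) ∈ C ↔ (J5 (e s)).1 0 = 0 ∧ (J5 (e s)).2 0 = 0) := by
  obtain ⟨b, ⟨Φ, ψ, U, U', hU, hU', ha, hb, hΦ, hψ, mΦ, mψ, hi, hab⟩, h1, h2⟩ := h.chart s s.2
  have : Nonempty S := ⟨s⟩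
  have hJ : ∀ w : S, (w : V) ∈ U → J5 (J5.symm (Φ w)) = Φ w := fun w hw =>
    J5.right_inv (range_J5 ▸ (mΦ ⟨w.2, hw⟩).1)
  refine ⟨cornerChart S Φ ψ U U' hU hU' s hΦ hψ mΦ mψ hi, ⟨Φ, ψ, U, U', hU, hU', hΦ, hψ, rfl, rfl,
    fun w hw => hJ w hw, fun y hy => coe_toSub (mψ ⟨range_J5 ▸ mem_range_self y, hy⟩).1⟩, ha, ?_, ?_⟩
  · rw [h1, ← hab, ← hJ s ha]
    rfl
  · rw [h2, ← hab, ← hJ s ha]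
    rfl

/-- The atlas consists of all charts that extend to smooth ambient maps. The chart chosen at a point
is one whose coordinates there vanish according to membership in `B` and `C`, so that the boundary
and `corners`, which are defined by the preferred chart, can be read off. -/
instance (S : Set V) (B C : Set V) [HasCorners S B C] : ChartedSpace Corner5 S where
  atlas := {e | IsCornerChart S e}
  chartAt s := (HasCorners.exists_chart s).choose
  mem_chart_source s := (HasCorners.exists_chart s).choose_spec.2.1
  chart_mem_atlas s := (HasCorners.exists_chart s).choose_spec.1

variable {S B C : Set V} [HasCorners S B C]

/-- A transition map is `Ψ ∘ ψ`, the composite of smooth maps into and out of the ambient space `V`.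
-/
instance : IsManifold J5 ∞ S := by
  apply isManifold_of_contDiffOn
  rintro e e' ⟨Φ, ψ, U, U', hU, hU', hΦ, hψ, hs, ht, h1, h2⟩
    ⟨Ψ, χ, X, X', hX, hX', hΨ, hχ, hs', ht', h1', h2'⟩
  have key : ∀ v ∈ J5.symm ⁻¹' (e.symm.trans e').source ∩ range J5, v ∈ quad ∩ U' ∧
      ψ v ∈ S ∩ X ∧ (J5 ∘ e.symm.trans e' ∘ J5.symm) v = (Ψ ∘ ψ) v := by
    rintro v ⟨hv, hv'⟩
    have e1 : J5 (J5.symm v) = v := J5.right_inv hv'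
    simp only [mem_preimage, OpenPartialHomeomorph.trans_source, OpenPartialHomeomorph.symm_source,
      mem_inter_iff] at hv
    have hv1 : v ∈ U' := by
      have := hv.1
      rw [ht, mem_preimage, e1] at this
      exact this
    have e2 := h2 _ hv.1
    rw [e1] at e2
    refine ⟨⟨range_J5 ▸ hv', hv1⟩, ⟨e2 ▸ (e.symm (J5.symm v)).2, ?_⟩, ?_⟩
    · have := hv.2
      rw [hs', mem_preimage, e2] at this
      exact this
    · simp only [Function.comp_apply, OpenPartialHomeomorph.coe_trans]
      rw [h1' _ hv.2, e2]
  exact (hΨ.comp (hψ.mono fun v hv => (key v hv).1) fun v hv => (key v hv).2.1).congr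
    fun v hv => (key v hv).2.2

theorem isCornerChart_chartAt (s : S) : IsCornerChart S (chartAt Corner5 s) :=
  (HasCorners.exists_chart s).choose_spec.1

/-- The preferred chart sends a point of `B` to a point of the quadrant with a vanishing coordinate,
and such points are exactly those outside the interior of the quadrant. -/
theorem mem_boundary_iff (s : S) : s ∈ J5.boundary S ↔ (s : V) ∈ B := by
  have h := (HasCorners.exists_chart s).choose_spec.2.2.1
  have e : extChartAt J5 s s = J5 (chartAt Corner5 s s) := rfl
  rw [ModelWithCorners.boundary, mem_ofPred_eq, ModelWithCorners.isBoundaryPoint_iff_not_isInteriorPoint,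
    ModelWithCorners.isInteriorPoint_iff]
  rw [h]
  have hi : extChartAt J5 s s ∈ interior (extChartAt J5 s).target ↔
      extChartAt J5 s s ∈ interior quad := by
    rw [← range_J5]
    exact (ModelWithCorners.isInteriorPoint_iff (I := J5) (x := s)).symm.trans Iff.rfl
  have hq : J5 (chartAt Corner5 s s) ∈ quad := range_J5 ▸ mem_range_self _
  rw [hi, mem_interior_quad, e]
  have h1 : 0 ≤ (J5 (chartAt Corner5 s s)).1 0 := hq.1
  have h2 : 0 ≤ (J5 (chartAt Corner5 s s)).2 0 := hq.2
  change ¬ _ ↔ (J5 (chartAt Corner5 s s)).1 0 = 0 ∨ (J5 (chartAt Corner5 s s)).2 0 = 0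
  constructor
  · intro h3
    by_contra! h4
    exact h3 ⟨lt_of_le_of_ne h1 h4.1.symm, lt_of_le_of_ne h2 h4.2.symm⟩
  · rintro (h3 | h3) ⟨h4, h5⟩
    · exact h4.ne' h3
    · exact h5.ne' h3

theorem mem_corners_iff (s : S) : s ∈ corners S ↔ (s : V) ∈ C :=
  (HasCorners.exists_chart s).choose_spec.2.2.2.symm

/-- In a chart the inclusion is the smooth map `ψ` from the quadrant to `V`. -/
theorem contMDiff_coe : ContMDiff J5 𝓘(ℝ, V) ∞ (Subtype.val : S → V) := by
  intro s
  rw [← contMDiffWithinAt_univ, contMDiffWithinAt_iff]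
  refine ⟨continuous_subtype_val.continuousWithinAt, ?_⟩
  obtain ⟨Φ, ψ, U, U', hU, hU', hΦ, hψ, hs, ht, h1, h2⟩ := isCornerChart_chartAt s
  have hm : chartAt Corner5 s s ∈ (chartAt Corner5 s).target := mem_chart_target _ _
  have hm' : J5 (chartAt Corner5 s s) ∈ quad ∩ U' :=
    ⟨range_J5 ▸ mem_range_self _, by rw [ht] at hm; exact hm⟩
  have h3 : ContDiffWithinAt ℝ ∞ ψ quad (J5 (chartAt Corner5 s s)) :=
    (hψ _ hm').mono_of_mem_nhdsWithin (inter_mem_nhdsWithin _ (hU'.mem_nhds hm'.2))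
  rw [preimage_univ, univ_inter, range_J5]
  refine h3.congr_of_eventuallyEq ?_ ?_
  · filter_upwards [inter_mem_nhdsWithin quad (hU'.mem_nhds hm'.2)] with v hv
    have e1 : J5 (J5.symm v) = v := J5.right_inv (range_J5 ▸ hv.1)
    have : J5.symm v ∈ (chartAt Corner5 s).target := by rw [ht, mem_preimage, e1]; exact hv.2
    have e2 := h2 _ this
    rw [e1] at e2
    exact e2
  · have e2 := h2 _ hm
    rw [← e2, (chartAt Corner5 s).left_inv (mem_chart_source _ s)]
    have e3 : (extChartAt J5 s).symm (extChartAt J5 s s) = s := extChartAt_to_inv s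
    exact congrArg Subtype.val e3

/-- The charts are restrictions of ambient smooth maps `Φ`, so smoothness into `V` implies
smoothness into `S`. With `contMDiff_coe` this reduces all smoothness on the total space to ambient
formulas. -/
theorem contMDiffWithinAt_of_coe {E H M : Type*} [NormedAddCommGroup E] [NormedSpace ℝ E]
    [TopologicalSpace H] [TopologicalSpace M] [ChartedSpace H M] {I : ModelWithCorners ℝ E H}
    {f : M → S} {s : Set M} {x : M}
    (hf : ContMDiffWithinAt I 𝓘(ℝ, V) ∞ (fun x => (f x : V)) s x) :
    ContMDiffWithinAt I J5 ∞ f s x := by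
  have hc : ContinuousWithinAt f s x :=
    (Topology.IsInducing.subtypeVal.continuousWithinAt_iff).2 hf.continuousWithinAt
  rw [contMDiffWithinAt_iff_target]
  refine ⟨hc, ?_⟩
  obtain ⟨Φ, ψ, U, U', hU, hU', hΦ, hψ, hs, ht, h1, h2⟩ := isCornerChart_chartAt (f x)
  have hm : f x ∈ (chartAt Corner5 (f x)).source := mem_chart_source _ _
  have hm' : (f x : V) ∈ S ∩ U := ⟨(f x).2, by rw [hs] at hm; exact hm⟩
  have h3 : ContMDiffWithinAt 𝓘(ℝ, V) 𝓘(ℝ, E5) ∞ Φ S (f x : V) :=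
    ((hΦ _ hm').mono_of_mem_nhdsWithin
      (inter_mem_nhdsWithin _ (hU.mem_nhds hm'.2))).contMDiffWithinAt
  refine (h3.comp x hf (fun y _ => (f y).2)).congr_of_eventuallyEq ?_ ?_
  · filter_upwards [hc.preimage_mem_nhdsWithin ((chartAt Corner5 (f x)).open_source.mem_nhds hm)]
      with y hy
    exact h1 _ hy
  · exact h1 _ hm

theorem contMDiffOn_of_coe {E H M : Type*} [NormedAddCommGroup E] [NormedSpace ℝ E]
    [TopologicalSpace H] [TopologicalSpace M] [ChartedSpace H M] {I : ModelWithCorners ℝ E H}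
    {f : M → S} {s : Set M} (hf : ContMDiffOn I 𝓘(ℝ, V) ∞ (fun x => (f x : V)) s) :
    ContMDiffOn I J5 ∞ f s := fun x hx => contMDiffWithinAt_of_coe (hf x hx)

theorem contMDiffOn_toSub [Nonempty S] {E H M : Type*} [NormedAddCommGroup E] [NormedSpace ℝ E]
    [TopologicalSpace H] [TopologicalSpace M] [ChartedSpace H M] {I : ModelWithCorners ℝ E H}
    {F : M → V} {s : Set M} (hf : ContMDiffOn I 𝓘(ℝ, V) ∞ F s) (hs : MapsTo F s S) :
    ContMDiffOn I J5 ∞ (toSub S F) s :=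
  contMDiffOn_of_coe (hf.congr fun _ hx => coe_toSub (hs hx))

theorem contMDiffOn_comp_coe {G : V → V'} {A : Set S}
    (hG : ContDiffOn ℝ ∞ G (Subtype.val '' A)) :
    ContMDiffOn J5 𝓘(ℝ, V') ∞ (fun w : S => G w) A :=
  hG.contMDiffOn.comp contMDiff_coe.contMDiffOn fun w hw => mem_image_of_mem _ hw

/-- All identifications of faces and fibres are produced in this way from two ambient formulas. The
default value in `toSub` plays no role, as `F` maps `A` into `S`. -/
theorem isDiffeoOn_toSub [Nonempty S] {A : Set V'} {A' : Set S} (F : V' → V) (G : V → V')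
    (hF : ContDiffOn ℝ ∞ F A) (hG : ContDiffOn ℝ ∞ G (Subtype.val '' A'))
    (mF : MapsTo F A (Subtype.val '' A')) (mG : MapsTo G (Subtype.val '' A') A)
    (hGF : ∀ x ∈ A, G (F x) = x) (hFG : ∀ w ∈ A', F (G w) = w) :
    IsDiffeoOn 𝓘(ℝ, V') J5 (toSub S F) A A' := by
  have hS : MapsTo F A S := fun x hx => by
    obtain ⟨w, _, e⟩ := mF hx
    exact e ▸ w.2
  refine ⟨fun w => G w, contMDiffOn_toSub hF.contMDiffOn hS, contMDiffOn_comp_coe hG, ?_, ?_, ?_, ?_⟩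
  · intro x hx
    obtain ⟨w, hw, e⟩ := mF hx
    have : toSub S F x = w := Subtype.ext ((coe_toSub (hS hx)).trans e.symm)
    exact this ▸ hw
  · exact fun w hw => mG (mem_image_of_mem _ hw)
  · intro x hx
    change G (toSub S F x) = x
    rw [coe_toSub (hS hx)]
    exact hGF x hx
  · intro w hw
    have := hFG w hw
    exact Subtype.ext ((coe_toSub (this ▸ w.2)).trans this)

/-- The vector is the one-sided derivative of the curve, and the claim is the chain rule. Curves are
one-sided because at a boundary point they can only run inwards. -/
theorem exists_tangent_vector [Nonempty S] (γ : ℝ → V) (w : S) (hw : γ 0 = w)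
    (hγ : ContDiffWithinAt ℝ ∞ γ (Ici 0) 0) (hS : ∀ᶠ t in 𝓝[≥] (0 : ℝ), γ t ∈ S) :
    ∃ v : E5, ∀ (f : V → ℝ) (c : ℝ), ContDiff ℝ ∞ f →
      HasDerivWithinAt (fun t => f (γ t)) c (Ici 0) 0 → diff J5 (fun x : S => f x) w v = c := by
  obtain ⟨u, hu, hu'⟩ := mem_nhdsGE_iff_exists_Ico_subset.1 hS
  -- On this interval the curve stays in `S`, so the default value of `toSub` does not occur; the
  -- interval also has unique derivatives at `0`.
  set s : Set ℝ := Ico 0 u with hs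
  replace hu' : ∀ t ∈ s, γ t ∈ S := fun t ht => hu' ht
  have hu0 : (0 : ℝ) < u := hu
  have h0s : (0 : ℝ) ∈ s := ⟨le_rfl, hu0⟩
  have hγ' : ContMDiffWithinAt 𝓘(ℝ, ℝ) 𝓘(ℝ, V) ∞ γ s 0 :=
    (hγ.mono fun t ht => ht.1).contMDiffWithinAt
  have e0 : toSub S γ 0 = w := Subtype.ext ((coe_toSub (hw ▸ w.2)).trans hw)
  have hdiff : MDifferentiableWithinAt 𝓘(ℝ, ℝ) J5 (toSub S γ) s 0 :=
    (contMDiffWithinAt_of_coe (hγ'.congr (fun t ht => coe_toSub (hu' t ht))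
      (coe_toSub (hu' 0 h0s)))).mdifferentiableWithinAt (by simp)
  have huniq : UniqueDiffWithinAt ℝ s 0 := (uniqueDiffOn_Ico 0 u) 0 h0s
  refine ⟨mfderivWithin 𝓘(ℝ, ℝ) J5 (toSub S γ) s 0 (1 : ℝ), fun f c hf hc => ?_⟩
  have hfS : MDifferentiableAt J5 𝓘(ℝ, ℝ) (fun x : S => f x) (toSub S γ 0) :=
    (((hf.contMDiff).comp contMDiff_coe).mdifferentiable (by simp)) _
  have hcomp := mfderiv_comp_mfderivWithin (0 : ℝ) hfS hdiff huniq.uniqueMDiffWithinAt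
  have h5 : mfderivWithin 𝓘(ℝ, ℝ) 𝓘(ℝ, ℝ) ((fun x : S => f x) ∘ toSub S γ) s 0 (1 : ℝ) = c := by
    rw [mfderivWithin_eq_fderivWithin]
    change derivWithin _ s 0 = c
    have h6 : HasDerivWithinAt ((fun x : S => f x) ∘ toSub S γ) c s 0 := by
      refine (hc.mono fun t ht => ht.1).congr (fun t ht => ?_) ?_
      · rw [Function.comp_apply, coe_toSub (hu' _ ht)]
      · rw [Function.comp_apply, coe_toSub (hu' _ h0s)]
    exact h6.derivWithin huniq
  rw [hcomp] at h5
  rw [← h5, diff]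
  subst e0
  rfl

end Corners

/-! ### Level sets -/

section LevelSets

variable {F : Type*} [NormedAddCommGroup F] [NormedSpace ℝ F] [FiniteDimensional ℝ F]
  {G : Type*} [NormedAddCommGroup G] [NormedSpace ℝ G] [FiniteDimensional ℝ G]

/-- The half-space of dimension 4. -/
def half4 : Set (EuclideanSpace ℝ (Fin 4)) := {v | 0 ≤ v 0}

/-- The kernel of `(f', g')` has dimension 3. A linear map `K` to `ℝ³` that is an isomorphism on
this kernel makes `(f', g', K)` injective, hence bijective by dimension. -/
theorem exists_linear_completion (f' : F →L[ℝ] G) (g' : F →L[ℝ] ℝ)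
    (hsurj : Function.Surjective (f'.prod g')) (hfin : Module.finrank ℝ F = Module.finrank ℝ G + 4) :
    ∃ (K : F →L[ℝ] (Fin 3 → ℝ)) (Λ : F ≃L[ℝ] G × EuclideanSpace ℝ (Fin 4)),
      ∀ v, Λ v = (f' v, WithLp.toLp 2 (Fin.cons (g' v) (K v))) := by
  set A : F →ₗ[ℝ] G × ℝ := (f'.prod g').toLinearMap with hA
  have hker : Module.finrank ℝ (LinearMap.ker A) = 3 := by
    have h1 := LinearMap.finrank_range_add_finrank_ker A
    rw [LinearMap.range_eq_top.2 hsurj, finrank_top, Module.finrank_prod, Module.finrank_self] at h1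
    omega
  obtain ⟨κ⟩ : Nonempty (LinearMap.ker A ≃ₗ[ℝ] (Fin 3 → ℝ)) :=
    ⟨LinearEquiv.ofFinrankEq _ _ (by rw [hker]; simp)⟩
  obtain ⟨P, hP⟩ := LinearMap.exists_leftInverse_of_injective (LinearMap.ker A).subtype
    (Submodule.ker_subtype _)
  set K : F →ₗ[ℝ] (Fin 3 → ℝ) := κ.toLinearMap ∘ₗ P with hK
  let L : F →ₗ[ℝ] G × EuclideanSpace ℝ (Fin 4) :=
    { toFun := fun v => (f' v, WithLp.toLp 2 (Fin.cons (g' v) (K v)))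
      map_add' := fun v w => by
        refine Prod.ext (by simp) ?_
        ext i
        refine Fin.cases ?_ (fun j => ?_) i <;> simp
      map_smul' := fun c v => by
        refine Prod.ext (by simp) ?_
        ext i
        refine Fin.cases ?_ (fun j => ?_) i <;> simp }
  have hL : Function.Injective L := by
    rw [injective_iff_map_eq_zero]
    intro v hv
    have h1 : f' v = 0 := congrArg Prod.fst hv
    have h2 : (WithLp.toLp 2 (Fin.cons (g' v) (K v)) : EuclideanSpace ℝ (Fin 4)) = 0 :=
      congrArg Prod.snd hv
    have h3 : g' v = 0 := by simpa using congrArg (fun x => x 0) h2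
    have h4 : K v = 0 := by
      funext j
      simpa using congrArg (fun x => x j.succ) h2
    have h5 : v ∈ LinearMap.ker A := by
      rw [LinearMap.mem_ker, hA]
      exact Prod.ext h1 h3
    have h6 : P v = ⟨v, h5⟩ := LinearMap.congr_fun hP ⟨v, h5⟩
    rw [hK, LinearMap.comp_apply, h6] at h4
    have h7 := κ.map_eq_zero_iff.1 h4
    exact congrArg Subtype.val h7
  let Λ := LinearEquiv.ofInjectiveOfFinrankEq L hL (by simp [hfin])
  exact ⟨LinearMap.toContinuousLinearMap K, Λ.toContinuousLinearEquiv, fun v => rfl⟩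

/-- The inverse function theorem applies to `Ψ = (f, (g, K))`, with `K` from
`exists_linear_completion`. On the level set the first component vanishes, and the second one is a
chart with first coordinate `g`. -/
theorem locDiffeo_levelSet_of_surjective {f : F → G} {g : F → ℝ} (hf : ContDiff ℝ ∞ f)
    (hg : ContDiff ℝ ∞ g) {x₀ : F} {f' : F →L[ℝ] G} {g' : F →L[ℝ] ℝ} (hf' : HasFDerivAt f f' x₀)
    (hg' : HasFDerivAt g g' x₀) (h₀ : f x₀ = 0) (h₁ : 0 ≤ g x₀)
    (hsurj : Function.Surjective (f'.prod g'))
    (hfin : Module.finrank ℝ F = Module.finrank ℝ G + 4) :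
    ∃ e : EuclideanSpace ℝ (Fin 4), LocDiffeo {x | f x = 0 ∧ 0 ≤ g x} x₀ half4 e ∧ e 0 = g x₀ := by
  obtain ⟨K, Λ, hΛ⟩ := exists_linear_completion f' g' hsurj hfin
  let Ψ : F → G × EuclideanSpace ℝ (Fin 4) := fun x => (f x, WithLp.toLp 2 (Fin.cons (g x) (K x)))
  have hΨ : ContDiff ℝ ∞ Ψ := by
    refine hf.prodMk ?_
    rw [contDiff_piLp]
    intro i
    refine Fin.cases ?_ (fun j => ?_) i
    · simpa using hg
    · simp only [Fin.cons_succ]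
      fun_prop
  have hΨ' : HasFDerivAt Ψ (Λ : F →L[ℝ] G × EuclideanSpace ℝ (Fin 4)) x₀ := by
    have h2 : HasFDerivAt (fun x => (WithLp.toLp 2 (Fin.cons (g x) (K x)) : EuclideanSpace ℝ (Fin 4)))
        ((ContinuousLinearMap.snd ℝ G _).comp (Λ : F →L[ℝ] G × EuclideanSpace ℝ (Fin 4))) x₀ := by
      rw [← hasFDerivWithinAt_univ, hasFDerivWithinAt_piLp]
      intro i
      rw [hasFDerivWithinAt_univ]
      refine Fin.cases ?_ (fun j => ?_) i
      · convert! hg' using 1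
        ext v
        simp [hΛ]
      · have : HasFDerivAt (fun x => K x j) ((ContinuousLinearMap.proj j).comp K) x₀ :=
          ((ContinuousLinearMap.proj j).comp K).hasFDerivAt
        convert! this using 1
        ext v
        simp [hΛ]
    convert! hf'.prodMk h2 using 1
    ext v <;> simp [hΛ]
  have h0 : (∞ : WithTop ℕ∞) ≠ 0 := by simp
  let Θ := hΨ.contDiffAt.toOpenPartialHomeomorph Ψ hΨ' h0
  have hx₀ : x₀ ∈ Θ.source := hΨ.contDiffAt.mem_toOpenPartialHomeomorph_source hΨ' h0
  have hΘ : ∀ x, Θ x = Ψ x := fun x => rfl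
  -- The inverse function theorem yields smoothness of the inverse only at points where the
  -- derivative is known to be invertible. Invertibility is an open condition, so it may be assumed
  -- on the whole neighbourhood.
  let N : Set F := Θ.source ∩ {x | (fderiv ℝ Ψ x).IsInvertible}
  have hN : N ∈ 𝓝 x₀ := by
    refine Filter.inter_mem (Θ.open_source.mem_nhds hx₀) ?_
    have hc : ContinuousAt (fderiv ℝ Ψ) x₀ := (hΨ.continuous_fderiv (by simp)).continuousAt
    have : {A : F →L[ℝ] G × EuclideanSpace ℝ (Fin 4) | A.IsInvertible} ∈ 𝓝 (fderiv ℝ Ψ x₀) := by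
      rw [hΨ'.fderiv]
      exact ContinuousLinearEquiv.nhds Λ
    exact hc this
  obtain ⟨U, hUN, hU, hxU⟩ := mem_nhds_iff.1 hN
  have hT : IsOpen (Θ.target ∩ Θ.symm ⁻¹' U) := Θ.symm.isOpen_inter_preimage hU
  have hsymm : ContDiffOn ℝ ∞ Θ.symm (Θ.target ∩ Θ.symm ⁻¹' U) := by
    intro y hy
    obtain ⟨M, hM⟩ := (hUN hy.2).2
    refine (Θ.contDiffAt_symm hy.1 (f₀' := M) ?_ hΨ.contDiffAt).contDiffWithinAt
    rw [hM]
    exact (hΨ.differentiable (by simp) _).hasFDerivAt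
  refine ⟨(Ψ x₀).2, ?_, by simp [Ψ]⟩
  let j : EuclideanSpace ℝ (Fin 4) → G × EuclideanSpace ℝ (Fin 4) := fun v => (0, v)
  have hj : ContDiff ℝ ∞ j := contDiff_const.prodMk contDiff_id
  have hj0 : j (Ψ x₀).2 = Ψ x₀ := Prod.ext h₀.symm rfl
  have hjx : ∀ x ∈ {x | f x = 0 ∧ 0 ≤ g x}, j (Ψ x).2 = Θ x := fun x hx => Prod.ext hx.1.symm rfl
  refine LocDiffeo.of_inverse (fun x => (Ψ x).2) (fun v => Θ.symm (j v)) hU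
    (hT.preimage hj.continuous) ⟨h₀, h₁⟩ hxU ?_ (contDiff_snd.comp hΨ).contDiffOn
    ((hsymm.comp hj.contDiffOn fun v hv => hv).mono fun v hv => hv.2) ?_ ?_ ?_ ?_ rfl
  · rw [mem_preimage, hj0, ← hΘ]
    exact ⟨Θ.map_source hx₀, by rw [mem_preimage, Θ.left_inv hx₀]; exact hxU⟩
  · intro x hx
    simpa [half4, Ψ] using hx.1.2
  · intro v hv
    have h1 : Ψ (Θ.symm (j v)) = j v := by rw [← hΘ]; exact Θ.right_inv hv.2.1
    have h2 : f (Θ.symm (j v)) = 0 := congrArg Prod.fst h1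
    have h3 : g (Θ.symm (j v)) = v 0 := by
      simpa [Ψ, j] using congrArg (fun x => x.2 0) h1
    exact ⟨h2, by rw [h3]; exact hv.1⟩
  · intro x hx _
    change Θ.symm (j (Ψ x).2) = x
    rw [hjx x hx.1, Θ.left_inv (hUN hx.2).1]
  · intro v hv _
    have h1 : Ψ (Θ.symm (j v)) = j v := by rw [← hΘ]; exact Θ.right_inv hv.2.1
    change (Ψ (Θ.symm (j v))).2 = v
    rw [h1]

/-- Where `g` vanishes it serves as the boundary coordinate. Where `g > 0` the inequality is locally
void, nothing need be known about `g'`, and another function takes the place of `g`. -/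
theorem locDiffeo_levelSet {f : F → G} {g : F → ℝ} (hf : ContDiff ℝ ∞ f)
    (hg : ContDiff ℝ ∞ g) {x₀ : F} {f' : F →L[ℝ] G} {g' : F →L[ℝ] ℝ} (hf' : HasFDerivAt f f' x₀)
    (hg' : HasFDerivAt g g' x₀) (h₀ : f x₀ = 0) (h₁ : 0 ≤ g x₀)
    (hsurj : Function.Surjective f') (hv : g x₀ = 0 → ∃ v, f' v = 0 ∧ g' v ≠ 0)
    (hfin : Module.finrank ℝ F = Module.finrank ℝ G + 4) :
    ∃ e : EuclideanSpace ℝ (Fin 4), LocDiffeo {x | f x = 0 ∧ 0 ≤ g x} x₀ half4 e ∧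
      (e 0 = 0 ↔ g x₀ = 0) := by
  have key : ∀ (β : F →L[ℝ] ℝ) (v : F), f' v = 0 → β v ≠ 0 →
      Function.Surjective (f'.prod β) := by
    rintro β v h1 h2 ⟨y, c⟩
    obtain ⟨u, rfl⟩ := hsurj y
    refine ⟨u + ((c - β u) / β v) • v, Prod.ext (by simp [h1]) ?_⟩
    simp [h2]
  rcases eq_or_ne (g x₀) 0 with h | h
  · obtain ⟨v, h1, h2⟩ := hv h
    obtain ⟨e, he, he'⟩ := locDiffeo_levelSet_of_surjective hf hg hf' hg' h₀ h₁ (key g' v h1 h2) hfin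
    exact ⟨e, he, by rw [he']⟩
  · obtain ⟨v, hv1, hv2⟩ : ∃ v, f' v = 0 ∧ v ≠ 0 := by
      by_contra! h1
      have h2 := LinearMap.finrank_le_finrank_of_injective (f := (f' : F →ₗ[ℝ] G))
        ((injective_iff_map_eq_zero _).2 h1)
      omega
    obtain ⟨β, -, hβ⟩ := exists_dual_vector ℝ v (by simpa using hv2)
    have hβv : β v ≠ 0 := by rw [hβ]; simpa using hv2
    -- The substitute for `g`: it is positive near `x₀`, and its derivative `β` does not vanish on
    -- the kernel of `f'`.
    have hg₁ : ContDiff ℝ ∞ fun x => 1 + β (x - x₀) := by fun_prop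
    have hg₁' : HasFDerivAt (fun x => 1 + β (x - x₀)) β x₀ := by
      have h1 : HasFDerivAt (fun x => x - x₀) (ContinuousLinearMap.id ℝ F) x₀ :=
        (hasFDerivAt_id x₀).sub_const x₀
      simpa using (β.hasFDerivAt.comp x₀ h1).const_add 1
    obtain ⟨e, he, he'⟩ := locDiffeo_levelSet_of_surjective hf hg₁ hf' hg₁' h₀ (by simp)
      (key β v hv1 hβv) hfin
    have hpos : 0 < g x₀ := lt_of_le_of_ne h₁ h.symm
    refine ⟨e, he.congr (N := {x | 0 < g x} ∩ {x | 0 < 1 + β (x - x₀)})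
      ((isOpen_lt continuous_const hg.continuous).inter
        (isOpen_lt continuous_const hg₁.continuous)) ⟨hpos, by simp⟩ ⟨h₀, h₁⟩ ?_, ?_⟩
    · ext x
      constructor
      · exact fun hx => ⟨⟨hx.1.1, hx.2.2.le⟩, hx.2⟩
      · exact fun hx => ⟨⟨hx.1.1, hx.2.1.le⟩, hx.2⟩
    · rw [he']
      simp [h]

/-- A product with a half-line of something that is locally diffeomorphic to a half-space. -/
theorem exists_locDiffeo_quad {V : Type*} [NormedAddCommGroup V] [NormedSpace ℝ V] {N : Set V}
    {x : V} {e : EuclideanSpace ℝ (Fin 4)} (h : LocDiffeo N x half4 e) {r : ℝ} (hr : 0 ≤ r) 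
    (hx : x ∈ N) :
    ∃ e' : E5, LocDiffeo (N ×ˢ Ici (0 : ℝ)) (x, r) quad e' ∧ e'.1 0 = r ∧ e'.2 0 = e 0 := by
  have h1 : LocDiffeo (Ici (0 : ℝ)) r {v : EuclideanSpace ℝ (Fin 1) | 0 ≤ v 0}
      (WithLp.toLp 2 fun _ => r) := by
    refine ⟨fun t => WithLp.toLp 2 fun _ => t, fun v => v 0, univ, univ, isOpen_univ, isOpen_univ,
      mem_univ _, mem_univ _, ?_, ?_, fun t ht => ⟨ht.1, mem_univ _⟩, fun t ht => ⟨ht.1, mem_univ _⟩,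
      ⟨fun t _ => rfl, fun v _ => ?_⟩, rfl⟩
    · apply ContDiff.contDiffOn
      fun_prop
    · apply ContDiff.contDiffOn
      fun_prop
    · ext i
      rw [Subsingleton.elim i 0]
  have h2 : LocDiffeo (N ×ˢ Ici (0 : ℝ)) (x, r) (Ici (0 : ℝ) ×ˢ N) (r, x) := by
    refine ⟨Prod.swap, Prod.swap, univ, univ, isOpen_univ, isOpen_univ,
      mem_univ _, mem_univ _, ?_, ?_, fun t ht => ⟨⟨ht.1.2, ht.1.1⟩, mem_univ _⟩,
      fun t ht => ⟨⟨ht.1.2, ht.1.1⟩, mem_univ _⟩, ⟨fun t _ => rfl, fun v _ => rfl⟩, rfl⟩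
    · exact (contDiff_snd.prodMk contDiff_fst).contDiffOn
    · exact (contDiff_snd.prodMk contDiff_fst).contDiffOn
  exact ⟨_, h2.trans (h1.prod h) ⟨hx, hr⟩, rfl, rfl⟩

end LevelSets

/-! ### Vector algebra -/

section VectorAlgebra

theorem inner_E3 (a b : E3) : inner ℝ a b = a 0 * b 0 + a 1 * b 1 + a 2 * b 2 := by
  simp [PiLp.inner_apply, Fin.sum_univ_three, mul_comm]

theorem normSq_E3 (a : E3) : ‖a‖ ^ 2 = a 0 ^ 2 + a 1 ^ 2 + a 2 ^ 2 := by
  rw [← real_inner_self_eq_norm_sq, inner_E3]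
  ring

theorem ext_E3 {a b : E3} (h0 : a 0 = b 0) (h1 : a 1 = b 1) (h2 : a 2 = b 2) : a = b := by
  ext i
  fin_cases i <;> assumption

@[simp] theorem cross_zero (a b : E3) : cross a b 0 = a 1 * b 2 - a 2 * b 1 := by
  simp [cross, crossProduct]
@[simp] theorem cross_one (a b : E3) : cross a b 1 = a 2 * b 0 - a 0 * b 2 := by
  simp [cross, crossProduct]
@[simp] theorem cross_two (a b : E3) : cross a b 2 = a 0 * b 1 - a 1 * b 0 := by
  simp [cross, crossProduct]

theorem cross_smul_right (t : ℝ) (a b : E3) : cross a (t • b) = t • cross a b := by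
  apply ext_E3 <;> simp <;> ring

theorem cross_neg_right (a b : E3) : cross a (-b) = -cross a b := by
  apply ext_E3 <;> simp <;> ring

theorem cross_smul_left (t : ℝ) (a b : E3) : cross (t • a) b = t • cross a b := by
  apply ext_E3 <;> simp <;> ring

theorem cross_neg_left (a b : E3) : cross (-a) b = -cross a b := by
  apply ext_E3 <;> simp <;> ring

theorem normSq_cross (a b : E3) : ‖cross a b‖ ^ 2 = ‖a‖ ^ 2 * ‖b‖ ^ 2 - inner ℝ a b ^ 2 := by
  simp only [normSq_E3, inner_E3, cross_zero, cross_one, cross_two]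
  ring

theorem norm_cross_of_inner_eq_zero {a b : E3} (h : inner ℝ a b = 0) :
    ‖cross a b‖ = ‖a‖ * ‖b‖ := by
  have := normSq_cross a b
  rw [h] at this
  rw [← sq_eq_sq₀ (norm_nonneg _) (by positivity), this]
  ring

theorem inner_cross_self (a b : E3) : inner ℝ a (cross a b) = 0 := by
  simp only [inner_E3, cross_zero, cross_one, cross_two]
  ring

theorem inner_cross_self_right (a b : E3) : inner ℝ b (cross a b) = 0 := by
  simp only [inner_E3, cross_zero, cross_one, cross_two]
  ring

theorem cross_cross_left (a b : E3) :
    cross (cross a b) a = ‖a‖ ^ 2 • b - inner ℝ a b • a := by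
  apply ext_E3 <;> simp [normSq_E3, inner_E3] <;> ring

theorem cross_cross_right (a b : E3) :
    cross (cross a b) b = inner ℝ a b • b - ‖b‖ ^ 2 • a := by
  apply ext_E3 <;> simp [normSq_E3, inner_E3] <;> ring

theorem contDiff_E3 {X : Type*} [NormedAddCommGroup X] [NormedSpace ℝ X] {f : X → E3} {s : Set X}
    (h0 : ContDiffOn ℝ ∞ (fun x => f x 0) s) (h1 : ContDiffOn ℝ ∞ (fun x => f x 1) s)
    (h2 : ContDiffOn ℝ ∞ (fun x => f x 2) s) : ContDiffOn ℝ ∞ f s := by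
  rw [contDiffOn_piLp]
  intro i
  fin_cases i <;> assumption

@[fun_prop]
theorem _root_.ContDiffOn.cross_E3 {X : Type*} [NormedAddCommGroup X] [NormedSpace ℝ X] {f g : X → E3}
    {s : Set X} (hf : ContDiffOn ℝ ∞ f s) (hg : ContDiffOn ℝ ∞ g s) :
    ContDiffOn ℝ ∞ (fun x => cross (f x) (g x)) s := by
  apply contDiff_E3 <;> simp <;> fun_prop

@[fun_prop]
theorem contDiff_rePart : ContDiff ℝ ∞ rePart := by
  rw [contDiff_piLp]
  intro i
  exact Complex.reCLM.contDiff.comp (contDiff_apply ℝ ℂ i)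

@[fun_prop]
theorem contDiff_imPart : ContDiff ℝ ∞ imPart := by
  rw [contDiff_piLp]
  intro i
  exact Complex.imCLM.contDiff.comp (contDiff_apply ℝ ℂ i)

@[simp] theorem rePart_apply (Y : Fin 3 → ℂ) (i : Fin 3) : rePart Y i = (Y i).re := rfl
@[simp] theorem imPart_apply (Y : Fin 3 → ℂ) (i : Fin 3) : imPart Y i = (Y i).im := rfl

/-- The complex vector with given real and imaginary parts. -/
def cvec (a b : E3) : Fin 3 → ℂ := fun i => ⟨a i, b i⟩

@[simp] theorem rePart_cvec (a b : E3) : rePart (cvec a b) = a := by ext i; simp [cvec]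
@[simp] theorem imPart_cvec (a b : E3) : imPart (cvec a b) = b := by ext i; simp [cvec]
@[simp] theorem cvec_re_im (Y : Fin 3 → ℂ) : cvec (rePart Y) (imPart Y) = Y := rfl
theorem neg_cvec (a b : E3) : -cvec a b = cvec (-a) (-b) := by
  funext i
  apply Complex.ext <;> simp [cvec]
@[simp] theorem rePart_neg (Y : Fin 3 → ℂ) : rePart (-Y) = -rePart Y := by ext i; simp
@[simp] theorem imPart_neg (Y : Fin 3 → ℂ) : imPart (-Y) = -imPart Y := by ext i; simp
theorem star_cvec (a b : E3) : star (cvec a b) = cvec a (-b) := by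
  funext i
  apply Complex.ext <;> simp [cvec]
@[simp] theorem rePart_star (Y : Fin 3 → ℂ) : rePart (star Y) = rePart Y := by ext i; simp
@[simp] theorem imPart_star (Y : Fin 3 → ℂ) : imPart (star Y) = -imPart Y := by ext i; simp
@[simp] theorem rePart_smul (t : ℝ) (Y : Fin 3 → ℂ) : rePart (t • Y) = t • rePart Y := by ext i; simp
@[simp] theorem imPart_smul (t : ℝ) (Y : Fin 3 → ℂ) : imPart (t • Y) = t • imPart Y := by ext i; simp

theorem smul_cvec (c : ℂ) (a b : E3) : c • cvec a b = cvec (c.re • a - c.im • b) (c.re • b + c.im • a) := by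
  funext i
  apply Complex.ext <;> simp [cvec]

theorem contDiff_cvec {X : Type*} [NormedAddCommGroup X] [NormedSpace ℝ X] {f g : X → E3} {s : Set X}
    (hf : ContDiffOn ℝ ∞ f s) (hg : ContDiffOn ℝ ∞ g s) :
    ContDiffOn ℝ ∞ (fun x => cvec (f x) (g x)) s := by
  rw [contDiffOn_pi]
  intro i
  have : (fun x => cvec (f x) (g x) i) = fun x => Complex.equivRealProdCLM.symm (f x i, g x i) := by
    funext x
    rfl
  rw [this]
  refine Complex.equivRealProdCLM.symm.contDiff.comp_contDiffOn (ContDiffOn.prodMk ?_ ?_) <;> fun_prop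

theorem sq_neg (w : Fin 3 → ℂ) : sq (-w) = sq w := (sq_eq_sq_iff _ _).2 (Or.inr rfl)

theorem sq_smul (c : ℂ) (w : Fin 3 → ℂ) : sq (c • w) = c ^ 2 • sq w := by
  funext i j
  simp [sq]
  ring

theorem sq_star (w : Fin 3 → ℂ) : sq (star w) = star (sq w) := by
  funext i j
  simp [sq]

theorem sq_ne_zero {w : Fin 3 → ℂ} (h : w ≠ 0) : sq w ≠ 0 := by
  intro h'
  have : sq w = sq 0 := by rw [h']; funext i j; simp [sq]
  rcases (sq_eq_sq_iff _ _).1 this with h1 | h1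
  · exact h h1
  · exact h (by simpa using h1)

@[fun_prop]
theorem contDiff_sq : ContDiff ℝ ∞ sq := by
  unfold sq
  fun_prop

/-- `w = n - iv` with `(n, v, c)` a positive orthonormal frame if `c` is a unit vector. -/
def IsNullFrame (w : Fin 3 → ℂ) (c : E3) : Prop :=
  w 0 ^ 2 + w 1 ^ 2 + w 2 ^ 2 = 0 ∧ cross (rePart w) (imPart w) = -c

theorem sum_sq_eq (w : Fin 3 → ℂ) : w 0 ^ 2 + w 1 ^ 2 + w 2 ^ 2 =
    (⟨‖rePart w‖ ^ 2 - ‖imPart w‖ ^ 2, 2 * inner ℝ (rePart w) (imPart w)⟩ : ℂ) := by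
  apply Complex.ext <;> simp only [normSq_E3, inner_E3] <;> simp [pow_two] <;> ring

theorem sum_sq_eq_zero_iff (w : Fin 3 → ℂ) : w 0 ^ 2 + w 1 ^ 2 + w 2 ^ 2 = 0 ↔
    ‖rePart w‖ = ‖imPart w‖ ∧ inner ℝ (rePart w) (imPart w) = 0 := by
  rw [sum_sq_eq, Complex.ext_iff]
  simp [sub_eq_zero, sq_eq_sq₀]

/-- The real and imaginary parts of a null vector are orthogonal and of equal length, so the length
of their cross product is the square of that length. -/
theorem IsNullFrame.norm_re {w : Fin 3 → ℂ} {c : E3} (h : IsNullFrame w c) (hc : ‖c‖ = 1) :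
    ‖rePart w‖ = 1 := by
  have h1 := (sum_sq_eq_zero_iff w).1 h.1
  have h2 := norm_cross_of_inner_eq_zero h1.2
  rw [h.2, norm_neg, hc, ← h1.1] at h2
  nlinarith [norm_nonneg (rePart w)]

theorem isNullFrame_iff {w : Fin 3 → ℂ} {c : E3} (hc : ‖c‖ = 1) : IsNullFrame w c ↔
    ‖rePart w‖ = 1 ∧ ‖imPart w‖ = 1 ∧ inner ℝ (rePart w) (imPart w) = 0 ∧
      cross (rePart w) (imPart w) = -c := by
  constructor
  · intro h
    have h1 := (sum_sq_eq_zero_iff w).1 h.1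
    exact ⟨h.norm_re hc, h1.1 ▸ h.norm_re hc, h1.2, h.2⟩
  · rintro ⟨h1, h2, h3, h4⟩
    exact ⟨(sum_sq_eq_zero_iff w).2 ⟨h1.trans h2.symm, h3⟩, h4⟩

theorem isNullFrame_of_orthonormal {w : Fin 3 → ℂ} (h1 : ‖rePart w‖ = 1) (h2 : ‖imPart w‖ = 1)
    (h3 : inner ℝ (rePart w) (imPart w) = 0) :
    IsNullFrame w (-cross (rePart w) (imPart w)) ∧ ‖-cross (rePart w) (imPart w)‖ = 1 := by
  refine ⟨⟨(sum_sq_eq_zero_iff w).2 ⟨h1.trans h2.symm, h3⟩, by simp⟩, ?_⟩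
  rw [norm_neg, norm_cross_of_inner_eq_zero h3, h1, h2, one_mul]

theorem IsNullFrame.ne_zero {w : Fin 3 → ℂ} {c : E3} (h : IsNullFrame w c) (hc : ‖c‖ = 1) :
    w ≠ 0 := by
  rintro rfl
  have := h.norm_re hc
  have h0 : rePart 0 = 0 := by ext i; simp
  rw [h0] at this
  simp at this

theorem IsNullFrame.smul {w : Fin 3 → ℂ} {c : E3} (h : IsNullFrame w c) {a : ℂ} (ha : ‖a‖ = 1) :
    IsNullFrame (a • w) c := by
  have ha' : a.re ^ 2 + a.im ^ 2 = 1 := by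
    have := Complex.sq_norm a
    rw [ha, Complex.normSq_apply] at this
    nlinarith
  constructor
  · have : (a • w) 0 ^ 2 + (a • w) 1 ^ 2 + (a • w) 2 ^ 2 = a ^ 2 * (w 0 ^ 2 + w 1 ^ 2 + w 2 ^ 2) := by
      simp only [Pi.smul_apply, smul_eq_mul]
      ring
    rw [this, h.1, mul_zero]
  · have h2 : cross (rePart (a • w)) (imPart (a • w)) =
        (a.re ^ 2 + a.im ^ 2) • cross (rePart w) (imPart w) := by
      apply ext_E3 <;> simp <;> ring
    rw [h2, h.2, ha', one_smul]

theorem IsNullFrame.star {w : Fin 3 → ℂ} {c : E3} (h : IsNullFrame w c) :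
    IsNullFrame (star w) (-c) := by
  constructor
  · have := congrArg (starRingEnd ℂ) h.1
    simpa using this
  · rw [rePart_star, imPart_star, cross_neg_right, h.2]

/-- Local sections of the bundle of null frames over the sphere. -/
def nullSec (b c : E3) : Fin 3 → ℂ :=
  cvec (‖cross b c‖⁻¹ • cross b c) (-(cross c (‖cross b c‖⁻¹ • cross b c)))

/-- With a unit vector `n` perpendicular to `c`, the frame is `(n, -c × n)`, and `n × (-(c × n)) =
(c × n) × n = -c`. -/
theorem isNullFrame_nullSec {b c : E3} (hc : ‖c‖ = 1) (hb : cross b c ≠ 0) :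
    IsNullFrame (nullSec b c) c := by
  set n := ‖cross b c‖⁻¹ • cross b c with hn
  have hn1 : ‖n‖ = 1 := by
    rw [hn, norm_smul, norm_inv, norm_norm, inv_mul_cancel₀ (norm_ne_zero_iff.2 hb)]
  have hnc : inner ℝ c n = 0 := by
    rw [hn, inner_smul_right, inner_cross_self_right, mul_zero]
  rw [isNullFrame_iff hc, nullSec, ← hn, rePart_cvec, imPart_cvec]
  refine ⟨hn1, ?_, ?_, ?_⟩
  · rw [norm_neg, norm_cross_of_inner_eq_zero hnc, hc, hn1, one_mul]
  · rw [inner_neg_right, inner_cross_self_right, neg_zero]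
  · have h1 : cross n (-cross c n) = cross (cross c n) n := by
      apply ext_E3 <;> simp <;> ring
    rw [h1, cross_cross_right, hnc, hn1]
    simp

theorem exists_cross_ne_zero {c : E3} (hc : c ≠ 0) : ∃ b, cross b c ≠ 0 := by
  by_contra! h
  apply hc
  have h1 := h (EuclideanSpace.single 0 1)
  have h2 := h (EuclideanSpace.single 1 1)
  have e1 := congrArg (fun x => x 1) h1
  have e2 := congrArg (fun x => x 2) h1
  have e3 := congrArg (fun x => x 2) h2
  apply ext_E3
  · simpa using e3
  · simpa using e2
  · simpa using e1

theorem contDiffOn_nullSec (b : E3) : ContDiffOn ℝ ∞ (nullSec b) {c | cross b c ≠ 0} := by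
  have h1 : ContDiffOn ℝ ∞ (fun c => cross b c) {c | cross b c ≠ 0} :=
    ContDiffOn.cross_E3 contDiffOn_const contDiffOn_id
  have h2 : ContDiffOn ℝ ∞ (fun c => ‖cross b c‖⁻¹ • cross b c) {c | cross b c ≠ 0} :=
    ((h1.norm ℝ fun x hx => hx).inv fun x hx => norm_ne_zero_iff.2 hx).smul h1
  exact contDiff_cvec h2 (ContDiffOn.cross_E3 contDiffOn_id h2).neg

theorem isOpen_cross_ne_zero (b : E3) : IsOpen {c | cross b c ≠ 0} := by
  have h : ContDiffOn ℝ ∞ (fun c => cross b c) univ := ContDiffOn.cross_E3 contDiffOn_const contDiffOn_id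
  exact isOpen_ne_fun (continuousOn_univ.1 h.continuousOn) continuous_const

/-- Both frames are orthonormal in the plane perpendicular to `c` with the same orientation, so they
differ by a rotation of that plane, which acts on null vectors as a phase. -/
theorem isNullFrame_eq_smul {w w' : Fin 3 → ℂ} {c : E3} (hc : ‖c‖ = 1) (h : IsNullFrame w c)
    (h' : IsNullFrame w' c) : ∃ a : ℂ, ‖a‖ = 1 ∧ w' = a • w := by
  rw [isNullFrame_iff hc] at h h'
  obtain ⟨h1, h2, h3, h4⟩ := h
  obtain ⟨h1', h2', h3', h4'⟩ := h'
  set n := rePart w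
  set v := imPart w
  set n' := rePart w'
  set v' := imPart w'
  have hcn : inner ℝ c n' = 0 := by
    have := inner_cross_self n' v'
    rw [h4', inner_neg_right, real_inner_comm] at this
    simpa using this
  have e1 : n' = inner ℝ n n' • n + inner ℝ v n' • v := by
    -- The expansion of `n'` in the basis `n`, `v`, `n × v`, as a polynomial identity without any
    -- orthonormality. Orthonormality of `n`, `v` and `n' ⊥ c` leave only the first two terms.
    have hid : ‖n‖ ^ 2 • (‖v‖ ^ 2 • n') = (inner ℝ n n' * ‖v‖ ^ 2 - inner ℝ n v * inner ℝ v n') • n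
        + (inner ℝ v n' * ‖n‖ ^ 2 - inner ℝ n v * inner ℝ n n') • v + inner ℝ (cross n v) n' • cross n v
        + (inner ℝ n v) ^ 2 • n' := by
      apply ext_E3 <;> simp [normSq_E3, inner_E3] <;> ring
    rw [h1, h2, h3, h4, inner_neg_left, hcn] at hid
    simpa using hid
  have e2 : v' = inner ℝ n n' • v - inner ℝ v n' • n := by
    have a1 : v' = cross (cross n' v') n' := by
      rw [cross_cross_left, h1', h3']; simp
    have a2 : ∀ x y : ℝ, cross (cross n v) (x • n + y • v) =
        x • cross (cross n v) n + y • cross (cross n v) v := fun x y => by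
      apply ext_E3 <;> simp <;> ring
    rw [a1, h4', ← h4]
    conv_lhs => rw [e1]
    rw [a2, cross_cross_left, cross_cross_right, h1, h2, h3]
    simp [sub_eq_add_neg]
  have hN : inner ℝ n n' ^ 2 + inner ℝ v n' ^ 2 = 1 := by
    have : ‖n'‖ ^ 2 = inner ℝ n n' * inner ℝ n n' + inner ℝ v n' * inner ℝ v n' := by
      rw [← real_inner_self_eq_norm_sq]
      conv_lhs => rw [e1]
      rw [inner_add_left, inner_smul_left, inner_smul_left]
      simp
      rw [← e1]
    rw [h1'] at this
    nlinarith
  refine ⟨⟨inner ℝ n n', -inner ℝ v n'⟩, ?_, ?_⟩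
  · rw [← sq_eq_sq₀ (norm_nonneg _) zero_le_one, Complex.sq_norm, Complex.normSq_mk]
    nlinarith
  · rw [← cvec_re_im w, ← cvec_re_im w', smul_cvec]
    change cvec n' v' = _
    simp only [neg_smul, sub_neg_eq_add]
    rw [← e1, ← sub_eq_add_neg, ← e2]

end VectorAlgebra

/-! ### The Hopf map and its sections -/

section Hopf

/-- The square of the norm of a spinor. -/
def nsq (z : Fin 2 → ℂ) : ℝ := ‖z 0‖ ^ 2 + ‖z 1‖ ^ 2

theorem nsq_eq (z : Fin 2 → ℂ) :
    nsq z = (z 0).re ^ 2 + (z 0).im ^ 2 + (z 1).re ^ 2 + (z 1).im ^ 2 := by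
  simp only [nsq, Complex.sq_norm, Complex.normSq_apply]
  ring

theorem nsq_nonneg (z : Fin 2 → ℂ) : 0 ≤ nsq z := by
  unfold nsq
  positivity

theorem nsq_eq_zero {z : Fin 2 → ℂ} : nsq z = 0 ↔ z = 0 := by
  constructor
  · intro h
    unfold nsq at h
    have h0 : ‖z 0‖ = 0 := by nlinarith [sq_nonneg ‖z 0‖, sq_nonneg ‖z 1‖]
    have h1 : ‖z 1‖ = 0 := by nlinarith [sq_nonneg ‖z 0‖, sq_nonneg ‖z 1‖]
    funext i
    fin_cases i
    · exact norm_eq_zero.1 h0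
    · exact norm_eq_zero.1 h1
  · rintro rfl
    simp [nsq]

theorem hopf_zero_coord (z : Fin 2 → ℂ) :
    hopf z 0 = 2 * ((z 0).re * (z 1).re + (z 0).im * (z 1).im) := by
  simp [hopf]

theorem hopf_one_coord (z : Fin 2 → ℂ) :
    hopf z 1 = 2 * ((z 0).re * (z 1).im - (z 0).im * (z 1).re) := by
  simp [hopf]
  ring

theorem hopf_two_coord (z : Fin 2 → ℂ) :
    hopf z 2 = (z 0).re ^ 2 + (z 0).im ^ 2 - (z 1).re ^ 2 - (z 1).im ^ 2 := by
  simp only [hopf, Complex.sq_norm, Complex.normSq_apply]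
  simp
  ring

theorem norm_hopf (z : Fin 2 → ℂ) : ‖hopf z‖ = nsq z := by
  rw [← sq_eq_sq₀ (norm_nonneg _) (nsq_nonneg _), normSq_E3, hopf_zero_coord, hopf_one_coord,
    hopf_two_coord, nsq_eq]
  ring

theorem hopf_eq_zero {z : Fin 2 → ℂ} : hopf z = 0 ↔ z = 0 := by
  rw [← norm_eq_zero, norm_hopf, nsq_eq_zero]

theorem hopf_smul (c : ℂ) (z : Fin 2 → ℂ) : hopf (c • z) = ‖c‖ ^ 2 • hopf z := by
  rw [Complex.sq_norm, Complex.normSq_apply]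
  apply ext_E3
  · simp only [hopf_zero_coord, PiLp.smul_apply, Pi.smul_apply, smul_eq_mul, Complex.mul_re,
      Complex.mul_im]
    ring
  · simp only [hopf_one_coord, PiLp.smul_apply, Pi.smul_apply, smul_eq_mul, Complex.mul_re,
      Complex.mul_im]
    ring
  · simp only [hopf_two_coord, PiLp.smul_apply, Pi.smul_apply, smul_eq_mul, Complex.mul_re,
      Complex.mul_im]
    ring

theorem hopf_smul_of_norm_one {c : ℂ} (hc : ‖c‖ = 1) (z : Fin 2 → ℂ) : hopf (c • z) = hopf z := by
  rw [hopf_smul, hc]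
  simp

theorem hopf_real_smul (t : ℝ) (z : Fin 2 → ℂ) : hopf (t • z) = t ^ 2 • hopf z := by
  have : t • z = (t : ℂ) • z := by
    funext i
    simp
  rw [this, hopf_smul]
  simp

@[fun_prop]
theorem contDiff_hopf : ContDiff ℝ ∞ hopf := by
  have hre : ∀ i, ContDiff ℝ ∞ fun z : Fin 2 → ℂ => (z i).re := fun i =>
    Complex.reCLM.contDiff.comp (contDiff_apply ℝ ℂ i)
  have him : ∀ i, ContDiff ℝ ∞ fun z : Fin 2 → ℂ => (z i).im := fun i =>
    Complex.imCLM.contDiff.comp (contDiff_apply ℝ ℂ i)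
  rw [← contDiffOn_univ]
  apply contDiff_E3
  · simp only [hopf_zero_coord]
    fun_prop
  · simp only [hopf_one_coord]
    fun_prop
  · simp only [hopf_two_coord]
    fun_prop

/-- The Hopf image and its norm determine `|z 0|`, `|z 1|` and `star (z 0) * z 1`. The phase is the
quotient of any coordinates that do not vanish. -/
theorem exists_smul_of_hopf_eq {z z' : Fin 2 → ℂ} (h : hopf z = hopf z') :
    ∃ c : ℂ, ‖c‖ = 1 ∧ z = c • z' := by
  have hn : nsq z = nsq z' := by rw [← norm_hopf, h, norm_hopf]
  have h2 : ‖z 0‖ ^ 2 - ‖z 1‖ ^ 2 = ‖z' 0‖ ^ 2 - ‖z' 1‖ ^ 2 := by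
    simpa [hopf] using congrArg (fun x => x 2) h
  unfold nsq at hn
  have n0 : ‖z 0‖ = ‖z' 0‖ := by
    rw [← sq_eq_sq₀ (norm_nonneg _) (norm_nonneg _)]; linarith
  have n1 : ‖z 1‖ = ‖z' 1‖ := by
    rw [← sq_eq_sq₀ (norm_nonneg _) (norm_nonneg _)]; linarith
  have hc : star (z 0) * z 1 = star (z' 0) * z' 1 := by
    have e0 := congrArg (fun x => x 0) h
    have e1 := congrArg (fun x => x 1) h
    simp only [hopf, PiLp.toLp_apply, Matrix.cons_val_zero, Matrix.cons_val_one] at e0 e1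
    apply Complex.ext
    · linarith
    · linarith
  by_cases h0 : z' 0 = 0
  · have hz0 : z 0 = 0 := by rw [h0, norm_zero] at n0; exact norm_eq_zero.1 n0
    by_cases h1 : z' 1 = 0
    · have hz1 : z 1 = 0 := by rw [h1, norm_zero] at n1; exact norm_eq_zero.1 n1
      refine ⟨1, by simp, ?_⟩
      funext i
      fin_cases i <;> simp [h0, hz0, h1, hz1]
    · refine ⟨z 1 / z' 1, by rw [norm_div, n1, div_self (norm_ne_zero_iff.2 h1)], ?_⟩
      funext i
      fin_cases i
      · simp [h0, hz0]
      · simp [h1]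
  · refine ⟨z 0 / z' 0, by rw [norm_div, n0, div_self (norm_ne_zero_iff.2 h0)], ?_⟩
    have hz0 : z 0 ≠ 0 := by rw [← norm_ne_zero_iff, n0]; exact norm_ne_zero_iff.2 h0
    funext i
    fin_cases i
    · simp [h0]
    · have hs0 : star (z 0) ≠ 0 := star_ne_zero.2 hz0
      have hm : z 0 * star (z 0) = z' 0 * star (z' 0) := by
        have a : z 0 * star (z 0) = ((‖z 0‖ ^ 2 : ℝ) : ℂ) := by
          simpa using Complex.mul_conj' (z 0)
        have b : z' 0 * star (z' 0) = ((‖z' 0‖ ^ 2 : ℝ) : ℂ) := by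
          simpa using Complex.mul_conj' (z' 0)
        rw [a, b, n0]
      apply mul_left_cancel₀ hs0
      change star (z 0) * z 1 = star (z 0) * (z 0 / z' 0 * z' 1)
      have : star (z 0) * (z 0 / z' 0 * z' 1) = (z 0 * star (z 0)) / z' 0 * z' 1 := by ring
      rw [this, hm, hc]
      field_simp

/-- The quaternionic structure on `ℂ²`, which covers the antipodal map. -/
def conjJ (z : Fin 2 → ℂ) : Fin 2 → ℂ := fun a => (if a = 0 then -1 else 1) * star (z a.rev)

@[simp] theorem conjJ_zero (z : Fin 2 → ℂ) : conjJ z 0 = -star (z 1) := by simp [conjJ]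
@[simp] theorem conjJ_one (z : Fin 2 → ℂ) : conjJ z 1 = star (z 0) := by simp [conjJ]

theorem hopf_conjJ (z : Fin 2 → ℂ) : hopf (conjJ z) = -hopf z := by
  apply ext_E3
  · simp only [hopf_zero_coord, PiLp.neg_apply, conjJ_zero, conjJ_one]
    simp
    ring
  · simp only [hopf_one_coord, PiLp.neg_apply, conjJ_zero, conjJ_one]
    simp
    ring
  · simp only [hopf_two_coord, PiLp.neg_apply, conjJ_zero, conjJ_one]
    simp
    ring

theorem conjJ_conjJ (z : Fin 2 → ℂ) : conjJ (conjJ z) = -z := by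
  funext i
  fin_cases i <;> simp

theorem conjJ_smul (c : ℂ) (z : Fin 2 → ℂ) : conjJ (c • z) = star c • conjJ z := by
  funext i
  fin_cases i <;> simp

/-- The domain of the section of the Hopf map that is determined by the spinor `a`. -/
def secDen (a : Fin 2 → ℂ) (v : E3) : ℝ := ‖v‖ * ‖hopf a‖ + inner ℝ v (hopf a)

/-- The section of the Hopf map, away from the negative multiples of `hopf a`, that is obtained by
projecting the spinor `a`. -/
def sec (a : Fin 2 → ℂ) (v : E3) : Fin 2 → ℂ :=
  (√(2 * secDen a v))⁻¹ • ![((‖v‖ + v 2 : ℝ) : ℂ) * a 0 + (⟨v 0, -v 1⟩ : ℂ) * a 1,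
    (⟨v 0, v 1⟩ : ℂ) * a 0 + ((‖v‖ - v 2 : ℝ) : ℂ) * a 1]

/-- With the Pauli matrices `σ`, the vector in `sec` is `(|v| + v·σ) a`, a multiple of the
projection of `a` to the eigenspace of `v·σ` for the eigenvalue `|v|`. Its Hopf image is therefore a
positive multiple of `v`, and its norm squared is `2 |v| · secDen a v`, which explains the
normalization. -/
theorem hopf_sec {a : Fin 2 → ℂ} {v : E3} (h : 0 < secDen a v) : hopf (sec a v) = v := by
  have hN : ‖v‖ ^ 2 = v 0 ^ 2 + v 1 ^ 2 + v 2 ^ 2 := normSq_E3 v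
  have hD : secDen a v = ‖v‖ * nsq a + (v 0 * hopf a 0 + v 1 * hopf a 1 + v 2 * hopf a 2) := by
    rw [secDen, norm_hopf, inner_E3]
  rw [sec, hopf_real_smul, inv_pow, Real.sq_sqrt (by positivity), inv_smul_eq_iff₀ (by positivity)]
  rw [nsq_eq, hopf_zero_coord, hopf_one_coord, hopf_two_coord] at hD
  apply ext_E3
  · rw [PiLp.smul_apply, hD, hopf_zero_coord]
    simp
    linear_combination (hopf a 0) * hN
      + (v 0 ^ 2 + v 1 ^ 2 + v 2 ^ 2 - ‖v‖ ^ 2) * hopf_zero_coord a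
  · rw [PiLp.smul_apply, hD, hopf_one_coord]
    simp
    linear_combination (hopf a 1) * hN
      + (v 0 ^ 2 + v 1 ^ 2 + v 2 ^ 2 - ‖v‖ ^ 2) * hopf_one_coord a
  · rw [PiLp.smul_apply, hD, hopf_two_coord]
    simp
    linear_combination (hopf a 2) * hN
      + (v 0 ^ 2 + v 1 ^ 2 + v 2 ^ 2 - ‖v‖ ^ 2) * hopf_two_coord a

theorem secDen_pos_self {a : Fin 2 → ℂ} (h : a ≠ 0) : 0 < secDen a (hopf a) := by
  rw [secDen, real_inner_self_eq_norm_sq]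
  have : 0 < ‖hopf a‖ := norm_pos_iff.2 (hopf_eq_zero.not.2 h)
  positivity

/-- The sections that belong to the spinors `(1, 0)` and `(0, 1)` are defined on the upper and on
the lower half-space. -/
theorem exists_hopf_eq (v : E3) : ∃ a, hopf a = v := by
  rcases eq_or_ne v 0 with rfl | hv
  · exact ⟨0, hopf_eq_zero.2 rfl⟩
  have h0 : hopf ![1, 0] = EuclideanSpace.single 2 1 := by
    apply ext_E3 <;> simp [hopf]
  have h1 : hopf ![0, 1] = -EuclideanSpace.single 2 1 := by
    apply ext_E3 <;> simp [hopf]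
  have n2 : 0 < ‖v‖ := norm_pos_iff.2 hv
  have hN : ‖v‖ ^ 2 = v 0 ^ 2 + v 1 ^ 2 + v 2 ^ 2 := normSq_E3 v
  rcases le_or_gt 0 (v 2) with h | h
  · refine ⟨sec ![1, 0] v, hopf_sec ?_⟩
    rw [secDen, h0, inner_E3]
    simp
    linarith
  · refine ⟨sec ![0, 1] v, hopf_sec ?_⟩
    rw [secDen, h1, inner_E3]
    simp
    linarith

theorem secDen_smul (a : Fin 2 → ℂ) {t : ℝ} (ht : 0 ≤ t) (v : E3) :
    secDen a (t • v) = t * secDen a v := by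
  rw [secDen, secDen, norm_smul, Real.norm_of_nonneg ht, inner_smul_left]
  simp
  ring

theorem ne_zero_of_secDen_pos {a : Fin 2 → ℂ} {v : E3} (h : 0 < secDen a v) : v ≠ 0 := by
  rintro rfl
  simp [secDen] at h

theorem sec_ne_zero {a : Fin 2 → ℂ} {v : E3} (h : 0 < secDen a v) : sec a v ≠ 0 := by
  intro h0
  have h1 := hopf_sec h
  rw [h0, hopf_eq_zero.2 rfl] at h1
  exact ne_zero_of_secDen_pos h h1.symm

/-- The quaternionic structure anticommutes with `v·σ`, hence exchanges the projections for `v` and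
`-v`. -/
theorem sec_conjJ (a : Fin 2 → ℂ) (v : E3) : sec (conjJ a) (-v) = conjJ (sec a v) := by
  have h : secDen (conjJ a) (-v) = secDen a v := by
    rw [secDen, secDen, hopf_conjJ]
    simp
  unfold sec
  rw [h, norm_neg]
  funext i
  fin_cases i
  · simp
    apply Complex.ext <;> simp <;> ring
  · simp
    apply Complex.ext <;> simp <;> ring

theorem sec_smul {c : ℂ} (hc : ‖c‖ = 1) (a : Fin 2 → ℂ) (v : E3) : sec (c • a) v = c • sec a v := by
  have h : secDen (c • a) v = secDen a v := by
    rw [secDen, secDen, hopf_smul_of_norm_one hc]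
  unfold sec
  rw [h]
  funext i
  fin_cases i <;> simp <;> ring

theorem continuous_secDen (a : Fin 2 → ℂ) : Continuous (secDen a) := by
  unfold secDen
  fun_prop

theorem contDiffOn_sec (a : Fin 2 → ℂ) : ContDiffOn ℝ ∞ (sec a) {v | 0 < secDen a v} := by
  have hn : ContDiffOn ℝ ∞ (fun v : E3 => ‖v‖) {v | 0 < secDen a v} :=
    contDiffOn_id.norm ℝ fun v hv => ne_zero_of_secDen_pos hv
  have hi : ContDiff ℝ ∞ fun v : E3 => inner ℝ v (hopf a) := contDiff_id.inner ℝ contDiff_const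
  have hD : ContDiffOn ℝ ∞ (secDen a) {v | 0 < secDen a v} :=
    (hn.mul contDiffOn_const).add hi.contDiffOn
  have hs : ContDiffOn ℝ ∞ (fun v => (√(2 * secDen a v))⁻¹) {v | 0 < secDen a v} := by
    refine ((contDiffOn_const.mul hD).sqrt fun v hv => ?_).inv fun v hv => ?_
    · have : 0 < secDen a v := hv
      positivity
    · have : 0 < secDen a v := hv
      positivity
  have hC : ∀ {f g : E3 → ℝ}, ContDiffOn ℝ ∞ f {v | 0 < secDen a v} →
      ContDiffOn ℝ ∞ g {v | 0 < secDen a v} →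
      ContDiffOn ℝ ∞ (fun v => (⟨f v, g v⟩ : ℂ)) {v | 0 < secDen a v} := fun hf hg =>
    Complex.equivRealProdCLM.symm.contDiff.comp_contDiffOn (hf.prodMk hg)
  have hR : ∀ {f : E3 → ℝ}, ContDiffOn ℝ ∞ f {v | 0 < secDen a v} →
      ContDiffOn ℝ ∞ (fun v => ((f v : ℝ) : ℂ)) {v | 0 < secDen a v} := fun hf =>
    Complex.ofRealCLM.contDiff.comp_contDiffOn hf
  refine hs.smul ?_
  rw [contDiffOn_pi]
  intro i
  have h0 : ContDiffOn ℝ ∞ (fun v : E3 => v 0) {v | 0 < secDen a v} := by fun_prop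
  have h1 : ContDiffOn ℝ ∞ (fun v : E3 => v 1) {v | 0 < secDen a v} := by fun_prop
  have h2 : ContDiffOn ℝ ∞ (fun v : E3 => v 2) {v | 0 < secDen a v} := by fun_prop
  fin_cases i
  · exact ((hR (hn.add h2)).mul contDiffOn_const).add ((hC h0 h1.neg).mul contDiffOn_const)
  · exact ((hC h0 h1).mul contDiffOn_const).add ((hR (hn.sub h2)).mul contDiffOn_const)

end Hopf

/-! ### Decomposable tensors -/

section Tensors

variable {k : ℕ}

/-- The tensor product of spinors and a matrix. -/
def tens (z : Nut k → Fin 2 → ℂ) (A : Mat3) : Tensor k := fun f i j => (∏ l, z l (f l)) * A i j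

/-- The hermitian inner product of spinors. -/
def hip (z y : Fin 2 → ℂ) : ℂ := ∑ a, star (z a) * y a

/-- The hermitian inner product of matrices. -/
def fip (A B : Mat3) : ℂ := ∑ i, ∑ j, star (A i j) * B i j

theorem hip_self (z : Fin 2 → ℂ) : hip z z = (nsq z : ℂ) := by
  have h : ∀ w : ℂ, star w * w = ((‖w‖ ^ 2 : ℝ) : ℂ) := fun w => by
    simpa using Complex.conj_mul' w
  rw [hip, Fin.sum_univ_two, h, h, nsq]
  push_cast
  ring

theorem hip_self_ne_zero {z : Fin 2 → ℂ} (h : z ≠ 0) : hip z z ≠ 0 := by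
  rw [hip_self]
  exact_mod_cast nsq_eq_zero.not.2 h

theorem fip_self_ne_zero {A : Mat3} (h : A ≠ 0) : fip A A ≠ 0 := by
  have h1 : ∀ w : ℂ, star w * w = ((‖w‖ ^ 2 : ℝ) : ℂ) := fun w => by
    simpa using Complex.conj_mul' w
  intro h0
  apply h
  have h2 : fip A A = ((∑ i, ∑ j, ‖A i j‖ ^ 2 : ℝ) : ℂ) := by
    rw [fip]
    push_cast
    refine Finset.sum_congr rfl fun i _ => Finset.sum_congr rfl fun j _ => ?_
    rw [h1]
    push_cast
    rfl
  rw [h2] at h0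
  have h3 : ∑ i, ∑ j, ‖A i j‖ ^ 2 = 0 := by exact_mod_cast h0
  funext i j
  have h4 := (Finset.sum_eq_zero_iff_of_nonneg
    fun i _ => Finset.sum_nonneg fun j _ => sq_nonneg ‖A i j‖).1 h3 i (Finset.mem_univ _)
  have h5 := (Finset.sum_eq_zero_iff_of_nonneg fun j _ => sq_nonneg ‖A i j‖).1 h4 j
    (Finset.mem_univ _)
  simpa using h5

theorem fip_smul (A B : Mat3) (c : ℂ) : fip A (c • B) = c * fip A B := by
  simp only [fip, Finset.mul_sum]
  refine Finset.sum_congr rfl fun i _ => Finset.sum_congr rfl fun j _ => ?_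
  simp
  ring

/-- Contraction of a tensor with spinors. -/
def pairing (z : Nut k → Fin 2 → ℂ) (T : Tensor k) : Mat3 :=
  fun i j => ∑ f, (∏ l, star (z l (f l))) * T f i j

/-- Expanding the product of the inner products over all choices of indices gives the contraction.
As `pairing` is linear in the tensor, factors of a tensor can be extracted smoothly by it. -/
theorem pairing_tens (z y : Nut k → Fin 2 → ℂ) (A : Mat3) :
    pairing z (tens y A) = (∏ l, hip (z l) (y l)) • A := by
  funext i j
  have h : ∏ l, hip (z l) (y l) = ∑ f : Nut k → Fin 2, ∏ l, star (z l (f l)) * y l (f l) := by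
    simp only [hip]
    rw [Finset.prod_univ_sum, Fintype.piFinset_univ]
  simp only [pairing, tens, Pi.smul_apply, smul_eq_mul]
  rw [h, Finset.sum_mul]
  refine Finset.sum_congr rfl fun f _ => ?_
  rw [Finset.prod_mul_distrib]
  ring

/-- The matrix factor of a tensor whose spinor factors are known. -/
def contr (z : Nut k → Fin 2 → ℂ) (T : Tensor k) : Mat3 :=
  (∏ l, hip (z l) (z l))⁻¹ • pairing z T

theorem contr_tens {z : Nut k → Fin 2 → ℂ} (hz : ∀ l, z l ≠ 0) (A : Mat3) :
    contr z (tens z A) = A := by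
  rw [contr, pairing_tens, inv_smul_smul₀]
  exact Finset.prod_ne_zero_iff.2 fun l _ => hip_self_ne_zero (hz l)

/-- The spinor factor in one slot of a tensor whose other factors are known. -/
def slot (l : Nut k) (z : Nut k → Fin 2 → ℂ) (A : Mat3) (T : Tensor k) : Fin 2 → ℂ := fun a =>
  ((∏ m ∈ Finset.univ.erase l, hip (z m) (z m)) * fip A A)⁻¹ *
    fip A (pairing (Function.update z l (Pi.single a 1)) T)

/-- Pairing with the other spinors and with `A` isolates the factor in slot `l`. That factor is
allowed to vanish, which is what a chart around a fixed point of the circle action needs. -/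
theorem slot_tens {l : Nut k} {z : Nut k → Fin 2 → ℂ} (hz : ∀ m, m ≠ l → z m ≠ 0) {A : Mat3}
    (hA : A ≠ 0) (y : Fin 2 → ℂ) : slot l z A (tens (Function.update z l y) A) = y := by
  funext a
  have h : ∏ m, hip (Function.update z l (Pi.single a 1) m) (Function.update z l y m) =
      y a * ∏ m ∈ Finset.univ.erase l, hip (z m) (z m) := by
    rw [← Finset.mul_prod_erase Finset.univ _ (Finset.mem_univ l)]
    congr 1
    · rw [Function.update_self, Function.update_self]
      fin_cases a <;> simp [hip]
    · refine Finset.prod_congr rfl fun m hm => ?_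
      rw [Function.update_of_ne (Finset.ne_of_mem_erase hm),
        Function.update_of_ne (Finset.ne_of_mem_erase hm)]
  rw [slot, pairing_tens, fip_smul, h]
  have h1 : ∏ m ∈ Finset.univ.erase l, hip (z m) (z m) ≠ 0 :=
    Finset.prod_ne_zero_iff.2 fun m hm => hip_self_ne_zero (hz m (Finset.ne_of_mem_erase hm))
  have h2 := fip_self_ne_zero hA
  field_simp

theorem smul_tens (c : ℂ) (z : Nut k → Fin 2 → ℂ) (A : Mat3) : c • tens z A = tens z (c • A) := by
  funext f i j
  simp [tens]
  ring

theorem tens_smul_left (c : Nut k → ℂ) (z : Nut k → Fin 2 → ℂ) (A : Mat3) :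
    tens (fun l => c l • z l) A = (∏ l, c l) • tens z A := by
  funext f i j
  simp [tens, Finset.prod_mul_distrib]
  ring

/-- Spinors with equal Hopf images differ by phases, and only the product of the phases is visible
in the tensor. -/
theorem tens_congr_phase {z y : Nut k → Fin 2 → ℂ} (h : ∀ l, hopf (z l) = hopf (y l)) (A : Mat3) :
    ∃ c : ℂ, ‖c‖ = 1 ∧ tens z A = c • tens y A := by
  choose c hc hzy using fun l => exists_smul_of_hopf_eq (h l)
  refine ⟨∏ l, c l, by simp [hc], ?_⟩
  rw [← tens_smul_left]
  congr
  exact funext hzy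

theorem tens_update_smul (c : ℂ) (z : Nut k → Fin 2 → ℂ) (l : Nut k) (y : Fin 2 → ℂ) (A : Mat3) :
    tens (Function.update z l (c • y)) A = c • tens (Function.update z l y) A := by
  have : Function.update z l (c • y) =
      fun m => (if m = l then c else 1) • Function.update z l y m := by
    funext m
    by_cases hm : m = l
    · subst hm; simp
    · simp [hm]
  rw [this, tens_smul_left]
  simp

/-- The involution of the labels of the points of `P`. -/
def negN (l : Nut k) : Nut k := (l.1, !l.2)

@[simp] theorem negN_negN (l : Nut k) : negN (negN l) = l := by simp [negN]

theorem negLabel_some (l : Nut k) : negLabel (some l) = some (negN l) := rfl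

@[simp] theorem negLabel_negLabel (l : Option (Nut k)) : negLabel (negLabel l) = l := by
  rcases l with _ | l
  · rfl
  · rw [negLabel_some, negLabel_some, negN_negN]

theorem pt_negLabel (p : Fin k → E3) (l : Option (Nut k)) : pt p (negLabel l) = -pt p l := by
  rcases l with _ | ⟨ν, _ | _⟩ <;> simp [negLabel, pt]

/-- `negN` as a permutation. -/
def negNEquiv (k : ℕ) : Nut k ≃ Nut k := ⟨negN, negN, negN_negN, negN_negN⟩

/-- The antilinear involution of the space of tensors that covers `x ↦ -x`. -/
def tconj (T : Tensor k) : Tensor k := fun f i j =>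
  (∏ l, if f l = 0 then -1 else 1) * star (T (fun l => (f (negN l)).rev) i j)

/-- Slot `l` receives the image under `J` of the spinor in slot `negN l`; reindexing the product by
`negN` moves the permutation from the indices to the spinors. -/
theorem tconj_tens (z : Nut k → Fin 2 → ℂ) (A : Mat3) :
    tconj (tens z A) = tens (fun l => conjJ (z (negN l))) (star A) := by
  funext f i j
  have h : ∏ l, star (z l (f (negN l)).rev) = ∏ l, star (z (negN l) (f l).rev) := by
    refine Fintype.prod_equiv (negNEquiv k) _ _ fun l => ?_
    simp [negNEquiv]
  simp only [tconj, tens, conjJ, Finset.prod_mul_distrib, star_mul', star_prod]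
  rw [h]
  change _ = _ * star (A i j)
  ring

theorem contDiff_star : ContDiff ℝ ∞ (fun z : ℂ => star z) := Complex.conjCLE.contDiff

theorem contDiff_tconj : ContDiff ℝ ∞ (tconj : Tensor k → Tensor k) := by
  rw [contDiff_pi]; intro f
  rw [contDiff_pi]; intro i
  rw [contDiff_pi]; intro j
  refine contDiff_const.mul (contDiff_star.comp ?_)
  fun_prop

variable {X : Type*} [NormedAddCommGroup X] [NormedSpace ℝ X] {s : Set X}

theorem contDiffOn_tens {z : X → Nut k → Fin 2 → ℂ} {A : X → Mat3}
    (hz : ∀ l, ContDiffOn ℝ ∞ (fun x => z x l) s) (hA : ContDiffOn ℝ ∞ A s) :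
    ContDiffOn ℝ ∞ (fun x => tens (z x) (A x)) s := by
  rw [contDiffOn_pi]; intro f
  rw [contDiffOn_pi]; intro i
  rw [contDiffOn_pi]; intro j
  refine ContDiffOn.mul (contDiffOn_prod fun l _ => ?_) (contDiffOn_pi.1 (contDiffOn_pi.1 hA i) j)
  exact contDiffOn_pi.1 (hz l) (f l)

theorem contDiffOn_hip {z y : X → Fin 2 → ℂ} (hz : ContDiffOn ℝ ∞ z s)
    (hy : ContDiffOn ℝ ∞ y s) : ContDiffOn ℝ ∞ (fun x => hip (z x) (y x)) s :=
  ContDiffOn.sum fun a _ => (contDiff_star.comp_contDiffOn (contDiffOn_pi.1 hz a)).mul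
    (contDiffOn_pi.1 hy a)

theorem contDiffOn_fip {A B : X → Mat3} (hA : ContDiffOn ℝ ∞ A s)
    (hB : ContDiffOn ℝ ∞ B s) : ContDiffOn ℝ ∞ (fun x => fip (A x) (B x)) s :=
  ContDiffOn.sum fun i _ => ContDiffOn.sum fun j _ =>
    (contDiff_star.comp_contDiffOn (contDiffOn_pi.1 (contDiffOn_pi.1 hA i) j)).mul
    (contDiffOn_pi.1 (contDiffOn_pi.1 hB i) j)

theorem contDiffOn_pairing {z : X → Nut k → Fin 2 → ℂ} {T : X → Tensor k}
    (hz : ∀ l, ContDiffOn ℝ ∞ (fun x => z x l) s) (hT : ContDiffOn ℝ ∞ T s) :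
    ContDiffOn ℝ ∞ (fun x => pairing (z x) (T x)) s := by
  rw [contDiffOn_pi]; intro i
  rw [contDiffOn_pi]; intro j
  refine ContDiffOn.sum fun f _ => ContDiffOn.mul (contDiffOn_prod fun l _ => ?_)
    (contDiffOn_pi.1 (contDiffOn_pi.1 (contDiffOn_pi.1 hT f) i) j)
  exact contDiff_star.comp_contDiffOn (contDiffOn_pi.1 (hz l) (f l))

theorem contDiffOn_contr {z : X → Nut k → Fin 2 → ℂ} {T : X → Tensor k}
    (hz : ∀ l, ContDiffOn ℝ ∞ (fun x => z x l) s) (h0 : ∀ x ∈ s, ∀ l, z x l ≠ 0)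
    (hT : ContDiffOn ℝ ∞ T s) : ContDiffOn ℝ ∞ (fun x => contr (z x) (T x)) s := by
  refine ContDiffOn.smul (ContDiffOn.inv (contDiffOn_prod fun l _ => contDiffOn_hip (hz l) (hz l))
    fun x hx => Finset.prod_ne_zero_iff.2 fun l _ => hip_self_ne_zero (h0 x hx l))
    (contDiffOn_pairing hz hT)

theorem contDiffOn_slot {l : Nut k} {z : X → Nut k → Fin 2 → ℂ} {A : X → Mat3} {T : X → Tensor k}
    (hz : ∀ m, m ≠ l → ContDiffOn ℝ ∞ (fun x => z x m) s) (h0 : ∀ x ∈ s, ∀ m, m ≠ l → z x m ≠ 0)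
    (hA : ContDiffOn ℝ ∞ A s) (hA0 : ∀ x ∈ s, A x ≠ 0)
    (hT : ContDiffOn ℝ ∞ T s) : ContDiffOn ℝ ∞ (fun x => slot l (z x) (A x) (T x)) s := by
  rw [contDiffOn_pi]; intro a
  refine ContDiffOn.mul (ContDiffOn.inv ((contDiffOn_prod fun m hm => ?_).mul
    (contDiffOn_fip hA hA)) fun x hx => mul_ne_zero (Finset.prod_ne_zero_iff.2 fun m hm => ?_)
    (fip_self_ne_zero (hA0 x hx))) (contDiffOn_fip hA (contDiffOn_pairing (fun m => ?_) hT))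
  · have := hz m (Finset.ne_of_mem_erase hm)
    exact contDiffOn_hip this this
  · exact hip_self_ne_zero (h0 x hx m (Finset.ne_of_mem_erase hm))
  · by_cases hm : m = l
    · subst hm
      simp only [Function.update_self]
      exact contDiffOn_const
    · simp only [Function.update_of_ne hm]
      exact hz m hm

end Tensors

/-! ### Lifting along `sq` -/

section Lift

/-- A choice of a preimage under `sq`. -/
def sqLift (A : Mat3) : Fin 3 → ℂ :=
  open Classical in if h : ∃ Y, sq Y = A then h.choose else 0

theorem sq_sqLift {A : Mat3} (h : ∃ Y, sq Y = A) : sq (sqLift A) = A := by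
  rw [sqLift, dif_pos h]
  exact h.choose_spec

theorem sqLift_sq (Y : Fin 3 → ℂ) : sqLift (sq Y) = Y ∨ sqLift (sq Y) = -Y :=
  (sq_eq_sq_iff _ _).1 (sq_sqLift ⟨Y, rfl⟩)

/-- A local smooth inverse of `sq`. -/
theorem exists_local_lift {w₀ : Fin 3 → ℂ} (h : w₀ ≠ 0) :
    ∃ (lam : Mat3 → Fin 3 → ℂ) (N : Set Mat3) (N' : Set (Fin 3 → ℂ)), IsOpen N ∧ IsOpen N' ∧
      sq w₀ ∈ N ∧ w₀ ∈ N' ∧ ContDiffOn ℝ ∞ lam N ∧ (∀ w ∈ N', lam (sq w) = w) ∧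
      (∀ w, sq w ∈ N → sq (lam (sq w)) = sq w) := by
  obtain ⟨i, hi⟩ := Function.ne_iff.1 h
  have hi' : w₀ i ≠ 0 := by simpa using hi
  -- At `sq w` the function `g` is `(w i / w₀ i)²`. Its principal square root near `1` recovers `w
  -- i`, and dividing the `i`-th row of the matrix by it recovers `w`.
  let g : Mat3 → ℂ := fun A => A i i / w₀ i ^ 2
  have hg : ContDiff ℝ ∞ g := by
    have : ContDiff ℝ ∞ fun A : Mat3 => A i i * (w₀ i ^ 2)⁻¹ := by fun_prop
    simpa only [g, div_eq_mul_inv] using this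
  let q : ℂ → ℂ := fun x => Complex.exp (Complex.log x / 2)
  have hq2 : ∀ x, x ≠ 0 → q x ^ 2 = x := fun x hx => by
    simp only [q]
    rw [← Complex.exp_nat_mul]
    push_cast
    rw [mul_div_cancel₀ _ two_ne_zero, Complex.exp_log hx]
  have hqs : ∀ x : ℂ, 0 < x.re → q (x ^ 2) = x := fun x hx => by
    have hx0 : x ≠ 0 := by rintro rfl; simp at hx
    simp only [q]
    have harg := Complex.abs_arg_lt_pi_div_two_iff.2 (Or.inl hx)
    rw [abs_lt] at harg
    have : Complex.log (x ^ 2) = 2 * Complex.log x := by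
      rw [pow_two, (Complex.log_mul_eq_add_log_iff hx0 hx0).2 ⟨by linarith [harg.1], by linarith [harg.2]⟩]
      ring
    rw [this, mul_div_cancel_left₀ _ two_ne_zero, Complex.exp_log hx0]
  have hq0 : ∀ x, q x ≠ 0 := fun x => Complex.exp_ne_zero _
  have hq : ContDiffOn ℝ ∞ q Complex.slitPlane := by
    have h1 : ContDiffOn ℂ ∞ Complex.log Complex.slitPlane := fun x hx =>
      (Complex.contDiffAt_log hx).contDiffWithinAt
    have h2 : ContDiffOn ℝ ∞ Complex.log Complex.slitPlane := h1.restrict_scalars ℝ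
    have h3 : ContDiff ℝ ∞ Complex.exp :=
      (Complex.contDiff_exp (𝕜 := ℂ)).restrict_scalars ℝ
    simp only [q]
    exact h3.comp_contDiffOn (h2.div_const 2)
  have hslit : ∀ x : ℂ, 0 < x.re → x ^ 2 ∈ Complex.slitPlane := fun x hx => by
    rw [Complex.mem_slitPlane_iff]
    by_contra! h1
    have e1 := h1.1
    have e2 := h1.2
    simp [pow_two] at e1 e2
    have : x.im = 0 := by
      have h3 : x.re * x.im = 0 := by linarith
      rcases mul_eq_zero.1 h3 with h4 | h4
      · exact absurd h4 hx.ne'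
      · exact h4
    rw [this] at e1
    nlinarith
  have hgs : ∀ w, g (sq w) = (w i / w₀ i) ^ 2 := fun w => by
    simp only [g, sq]
    field_simp
  refine ⟨fun A j => A i j / (w₀ i * q (g A)), g ⁻¹' Complex.slitPlane,
    {w | 0 < (w i / w₀ i).re}, Complex.isOpen_slitPlane.preimage hg.continuous, ?_, ?_, ?_, ?_, ?_, ?_⟩
  · refine isOpen_lt continuous_const (Complex.continuous_re.comp ?_)
    fun_prop
  · rw [mem_preimage, hgs, div_self hi']
    simp
  · simp [div_self hi']
  · rw [contDiffOn_pi]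
    intro j
    have h1 : ContDiffOn ℝ ∞ (fun A => w₀ i * q (g A)) (g ⁻¹' Complex.slitPlane) :=
      contDiffOn_const.mul (hq.comp hg.contDiffOn fun x hx => hx)
    have h2 : ContDiffOn ℝ ∞ (fun A : Mat3 => A i j) (g ⁻¹' Complex.slitPlane) := by fun_prop
    simp only [div_eq_mul_inv]
    exact h2.mul (h1.inv fun A _ => mul_ne_zero hi' (hq0 _))
  · intro w hw
    have hwi : w i ≠ 0 := by
      intro h0
      simp [h0] at hw
    funext j
    simp only [hgs, hqs _ hw, sq]
    field_simp
  · intro w hw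
    have h1 : g (sq w) ≠ 0 := Complex.slitPlane_ne_zero hw
    have h2 := hq2 _ h1
    have hwi : w i ≠ 0 := by
      intro h0
      rw [hgs] at h1
      simp [h0] at h1
    funext j l
    have h3 : (w₀ i * q (g (sq w))) ^ 2 = w i ^ 2 := by
      rw [mul_pow, h2, hgs]
      field_simp
    simp only [sq]
    rw [div_mul_div_comm, ← pow_two, h3]
    field_simp

/-- Even functions of the lift along `sq` are smooth. -/
theorem contDiffOn_comp_sqLift {X Y : Type*} [NormedAddCommGroup X] [NormedSpace ℝ X]
    [NormedAddCommGroup Y] [NormedSpace ℝ Y] {s : Set X} {f : X → Mat3} (hf : ContDiffOn ℝ ∞ f s)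
    (hfs : ∀ x ∈ s, ∃ w, w ≠ 0 ∧ sq w = f x) {g : (Fin 3 → ℂ) → X → Y}
    (heven : ∀ w x, g (-w) x = g w x) {t : Set ((Fin 3 → ℂ) × X)}
    (hg : ContDiffOn ℝ ∞ (fun q => g q.1 q.2) t) (ht : ∀ x ∈ s, ∀ w, sq w = f x → (w, x) ∈ t) :
    ContDiffOn ℝ ∞ (fun x => g (sqLift (f x)) x) s := by
  intro x hx
  obtain ⟨w₀, h0, h1⟩ := hfs x hx
  obtain ⟨lam, N, N', hN, hN', m1, m2, hl, h2, h3⟩ := exists_local_lift h0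
  obtain ⟨u, hu, hu'⟩ := continuousOn_iff'.1 hf.continuousOn N hN
  have hfu : ∀ y ∈ s ∩ u, f y ∈ N := fun y hy => (hu'.symm.subset ⟨hy.2, hy.1⟩).1
  have hxu : x ∈ u := (hu'.subset ⟨(h1 ▸ m1 : f x ∈ N), hx⟩).1
  have hlam : ∀ y ∈ s ∩ u, sq (lam (f y)) = f y := fun y hy => by
    obtain ⟨w, -, hw⟩ := hfs y hy.1
    rw [← hw]
    exact h3 w (hw ▸ hfu y hy)
  have key : ContDiffOn ℝ ∞ (fun y => g (lam (f y)) y) (s ∩ u) :=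
    hg.comp ((hl.comp (hf.mono inter_subset_left) hfu).prodMk contDiffOn_id)
      fun y hy => ht y hy.1 _ (hlam y hy)
  have : ContDiffOn ℝ ∞ (fun x => g (sqLift (f x)) x) (s ∩ u) := by
    refine key.congr fun y hy => ?_
    -- The chosen global lift need not be continuous, but it differs from the smooth local lift only
    -- by a sign, which `g` does not see.
    have e := sqLift_sq (lam (f y))
    rw [hlam y hy] at e
    rcases e with e | e
    · change g _ _ = g _ _
      rw [e]
    · change g _ _ = g _ _
      rw [e, heven]
  exact (this x ⟨hx, hxu⟩).mono_of_mem_nhdsWithin (inter_mem_nhdsWithin _ (hu.mem_nhds hxu))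

end Lift

/-! ### The total space -/

section Model

variable {k : ℕ}

/-- The vector space that contains the total space. Its points are `((u, s), t, r, v, T)`. -/
abbrev Amb (k : ℕ) : Type :=
  (E3 × ℝ) × ℝ × (Option (Nut k) → ℝ) × (Option (Nut k) → E3) × Tensor k

/-- The parameter `ε`. -/
def eps (a : Amb k) : ℝ := a.2.1 * ∏ l, a.2.2.1 l

/-- The quotient of `ε` by the defining function of the face over `0`. -/
def sigh (a : Amb k) : ℝ := a.2.1 * ∏ l, a.2.2.1 (some l)

/-- The quotient of `ε` by the defining function of the face over a point of `P`. -/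
def sden (a : Amb k) (l : Nut k) : ℝ := a.2.1 * ∏ m ∈ Finset.univ.erase (some l), a.2.2.1 m

theorem eps_eq_none (a : Amb k) : eps a = a.2.2.1 none * sigh a := by
  rw [eps, sigh, Fintype.prod_option]
  ring

theorem eps_eq_some (a : Amb k) (l : Nut k) : eps a = a.2.2.1 (some l) * sden a l := by
  rw [eps, sden, ← Finset.mul_prod_erase Finset.univ _ (Finset.mem_univ (some l))]
  ring

@[fun_prop]
theorem contDiff_eps : ContDiff ℝ ∞ (eps : Amb k → ℝ) :=
  ContDiff.mul (by fun_prop) (contDiff_prod fun l _ => by fun_prop)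

@[fun_prop]
theorem contDiff_sigh : ContDiff ℝ ∞ (sigh : Amb k → ℝ) :=
  ContDiff.mul (by fun_prop) (contDiff_prod fun l _ => by fun_prop)

@[fun_prop]
theorem contDiff_sden (l : Nut k) : ContDiff ℝ ∞ (fun a : Amb k => sden a l) :=
  ContDiff.mul (by fun_prop) (contDiff_prod fun l _ => by fun_prop)

/-- The part of the total space with a circle action. -/
structure IsOuter (p : Fin k → E3) (δ : ℝ) (a : Amb k) : Prop where
  base : a.1 ∈ Rbar
  t_nonneg : 0 ≤ a.2.1
  r_nonneg : ∀ l, 0 ≤ a.2.2.1 l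
  eps_lt : eps a < δ ^ 2
  sig_lt : a.1.2 * sigh a < δ
  r_smul : ∀ l, a.1.1 - a.1.2 • pt p l = a.2.2.1 l • a.2.2.2.1 l
  -- At `0` the direction alone is normalized, and `ε / r_0` is left free: this is a projective
  -- coordinate of the blow-up, valid because `1 / |x'| = s ε / r_0 < δ` here.
  norm_none : ‖a.2.2.2.1 none‖ = 1
  -- At a point of `P` the unit vector is `(v, ε / r)`, so the front face of the blow-up is a whole
  -- half-sphere.
  norm_some : ∀ l, ‖a.2.2.2.1 (some l)‖ ^ 2 + sden a l ^ 2 = 1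
  tensor : ∃ (w : Fin 3 → ℂ) (z : Nut k → Fin 2 → ℂ), IsNullFrame w (a.2.2.2.1 none) ∧
    (∀ l, hopf (z l) = a.2.2.2.1 (some l)) ∧ a.2.2.2.2 = tens z (sq w)

/-- The vector `u - s q`. -/
def dvec (p : Fin k → E3) (c : E3) (s r : ℝ) (l : Nut k) : E3 := r • c - s • pt p (some l)

/-- The radius of the blow-up of `q` in the space of all `(u - s q, ε)`. -/
def rad (p : Fin k → E3) (c : E3) (s r σ : ℝ) (l : Nut k) : ℝ :=
  √(‖dvec p c s r l‖ ^ 2 + (r * σ) ^ 2)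

/-- The unit vector `(u - s q, ε) / |(u - s q, ε)|`, without its last component. -/
def uvec (p : Fin k → E3) (c : E3) (s r σ : ℝ) (l : Nut k) : E3 :=
  (rad p c s r σ l)⁻¹ • dvec p c s r l

/-- The point of the total space with given polar coordinates `(c, s, r, σ)`, the spinor factors
being the sections that belong to the spinors `a`. -/
def theta (p : Fin k → E3) (a : Nut k → Fin 2 → ℂ) (A : Mat3) (c : E3) (s r σ : ℝ) : Amb k :=
  ((r • c, s), σ / ∏ l, rad p c s r σ l, fun l => l.elim r (rad p c s r σ),
    fun l => l.elim c (uvec p c s r σ), tens (fun l => sec (a l) (uvec p c s r σ l)) A)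

/-- The domain of `theta`. -/
def Good (p : Fin k → E3) (a : Nut k → Fin 2 → ℂ) (c : E3) (s r : ℝ) : Prop :=
  ∀ l, 0 < secDen (a l) (dvec p c s r l)

variable {p : Fin k → E3} {a : Nut k → Fin 2 → ℂ} {A : Mat3} {c : E3} {s r σ δ : ℝ}

theorem rad_pos_of_ne {l : Nut k} (h : dvec p c s r l ≠ 0) : 0 < rad p c s r σ l := by
  have : 0 < ‖dvec p c s r l‖ := norm_pos_iff.2 h
  exact Real.sqrt_pos.2 (by positivity)

theorem Good.rad_pos (h : Good p a c s r) (l : Nut k) : 0 < rad p c s r σ l :=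
  rad_pos_of_ne (ne_zero_of_secDen_pos (h l))

theorem Good.secDen_uvec_pos (h : Good p a c s r) (l : Nut k) :
    0 < secDen (a l) (uvec p c s r σ l) := by
  rw [uvec, secDen_smul _ (inv_nonneg.2 (h.rad_pos l).le)]
  exact mul_pos (inv_pos.2 (h.rad_pos l)) (h l)

theorem rad_nonneg (l : Nut k) : 0 ≤ rad p c s r σ l := Real.sqrt_nonneg _

theorem rad_sq (l : Nut k) : rad p c s r σ l ^ 2 = ‖dvec p c s r l‖ ^ 2 + (r * σ) ^ 2 :=
  Real.sq_sqrt (by positivity)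

theorem sigh_theta (h : ∀ l, rad p c s r σ l ≠ 0) : sigh (theta p a A c s r σ) = σ := by
  simp only [sigh, theta, Option.elim_some]
  exact div_mul_cancel₀ _ (Finset.prod_ne_zero_iff.2 fun l _ => h l)

theorem eps_theta (h : ∀ l, rad p c s r σ l ≠ 0) : eps (theta p a A c s r σ) = r * σ := by
  rw [eps_eq_none, sigh_theta h]
  rfl

theorem sden_theta (h : ∀ l, rad p c s r σ l ≠ 0) (l : Nut k) :
    sden (theta p a A c s r σ) l = r * σ / rad p c s r σ l := by
  rw [eq_div_iff (h l), mul_comm, ← eps_theta (a := a) (A := A) h, eps_eq_some _ l]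
  rfl

theorem norm_uvec (h : ∀ l, rad p c s r σ l ≠ 0) (l : Nut k) :
    ‖uvec p c s r σ l‖ ^ 2 + (r * σ / rad p c s r σ l) ^ 2 = 1 := by
  have h1 := rad_sq (p := p) (c := c) (s := s) (r := r) (σ := σ) l
  have h2 : ‖uvec p c s r σ l‖ ^ 2 = ‖dvec p c s r l‖ ^ 2 / rad p c s r σ l ^ 2 := by
    rw [uvec, norm_smul, norm_inv, Real.norm_eq_abs, mul_pow, inv_pow, sq_abs]
    ring
  rw [h2, div_pow, ← add_div, ← h1, div_self (pow_ne_zero 2 (h l))]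

theorem isOuter_theta (hG : Good p a c s r) (hc : ‖c‖ = 1) (hrs : r ^ 2 + s ^ 2 = 1) (hs : 0 ≤ s)
    (hr : 0 ≤ r) (hσ : 0 ≤ σ) (h1 : r * σ < δ ^ 2) (h2 : s * σ < δ) {w : Fin 3 → ℂ}
    (hw : IsNullFrame w c) : IsOuter p δ (theta p a (sq w) c s r σ) := by
  have hne : ∀ l, rad p c s r σ l ≠ 0 := fun l => (hG.rad_pos l).ne'
  refine ⟨⟨?_, hs⟩, div_nonneg hσ (Finset.prod_nonneg fun l _ => (hG.rad_pos l).le), ?_,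
    by rwa [eps_theta hne], by rwa [sigh_theta hne], ?_, hc, ?_,
    ⟨w, _, hw, fun l => hopf_sec (hG.secDen_uvec_pos l), rfl⟩⟩
  · change ‖r • c‖ ^ 2 + s ^ 2 = 1
    rw [norm_smul, hc, mul_one, Real.norm_eq_abs, sq_abs, hrs]
  · rintro (_ | l)
    · exact hr
    · exact (hG.rad_pos l).le
  · rintro (_ | l)
    · simp [theta, pt]
    · change dvec p c s r l = rad p c s r σ l • uvec p c s r σ l
      rw [uvec, smul_inv_smul₀ (hne l)]
  · intro l
    rw [sden_theta hne]
    exact norm_uvec hne l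

theorem IsOuter.u_eq {x : Amb k} (h : IsOuter p δ x) : x.1.1 = x.2.2.1 none • x.2.2.2.1 none := by
  simpa [pt] using h.r_smul none

theorem IsOuter.sq_add_sq {x : Amb k} (h : IsOuter p δ x) : x.2.2.1 none ^ 2 + x.1.2 ^ 2 = 1 := by
  have := h.base.1
  rwa [h.u_eq, norm_smul, h.norm_none, mul_one, Real.norm_eq_abs, sq_abs] at this

theorem IsOuter.dvec_eq {x : Amb k} (h : IsOuter p δ x) (l : Nut k) :
    dvec p (x.2.2.2.1 none) x.1.2 (x.2.2.1 none) l = x.2.2.1 (some l) • x.2.2.2.1 (some l) := by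
  rw [dvec, ← h.u_eq, h.r_smul]

/-- From `(u - s q, ε) = r (v, ε / r)` with a unit vector on the right, `r` is the length of the
left side. With `v_some_eq` and `t_eq` this shows that away from `P` only the tensor is not
determined by the polar coordinates. -/
theorem IsOuter.r_some_eq {x : Amb k} (h : IsOuter p δ x) (l : Nut k) :
    x.2.2.1 (some l) = rad p (x.2.2.2.1 none) x.1.2 (x.2.2.1 none) (sigh x) l := by
  have h1 := h.norm_some l
  have h3 := h.r_nonneg (some l)
  rw [← sq_eq_sq₀ h3 (rad_nonneg l), rad_sq, h.dvec_eq, ← eps_eq_none, eps_eq_some x l,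
    norm_smul, Real.norm_of_nonneg h3]
  linear_combination (- x.2.2.1 (some l) ^ 2) * h1

theorem IsOuter.v_some_eq {x : Amb k} (h : IsOuter p δ x) {l : Nut k} (hl : x.2.2.1 (some l) ≠ 0) :
    x.2.2.2.1 (some l) = uvec p (x.2.2.2.1 none) x.1.2 (x.2.2.1 none) (sigh x) l := by
  rw [uvec, ← h.r_some_eq, h.dvec_eq, inv_smul_smul₀ hl]

theorem IsOuter.t_eq {x : Amb k} (h : IsOuter p δ x) (hx : ∀ l, x.2.2.1 (some l) ≠ 0) :
    x.2.1 = sigh x / ∏ l, rad p (x.2.2.2.1 none) x.1.2 (x.2.2.1 none) (sigh x) l := by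
  have : ∏ l, rad p (x.2.2.2.1 none) x.1.2 (x.2.2.1 none) (sigh x) l = ∏ l, x.2.2.1 (some l) :=
    Finset.prod_congr rfl fun l _ => (h.r_some_eq l).symm
  rw [this, sigh, mul_div_assoc, div_self (Finset.prod_ne_zero_iff.2 fun l _ => hx l), mul_one]

theorem ext_Amb {x y : Amb k} (h1 : x.1 = y.1) (h2 : x.2.1 = y.2.1) (h3 : x.2.2.1 none = y.2.2.1 none)
    (h4 : ∀ l, x.2.2.1 (some l) = y.2.2.1 (some l)) (h5 : x.2.2.2.1 none = y.2.2.2.1 none)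
    (h6 : ∀ l, x.2.2.2.1 (some l) = y.2.2.2.1 (some l)) (h7 : x.2.2.2.2 = y.2.2.2.2) : x = y := by
  refine Prod.ext h1 (Prod.ext h2 (Prod.ext ?_ (Prod.ext ?_ h7)))
  · funext l
    rcases l with _ | l
    · exact h3
    · exact h4 l
  · funext l
    rcases l with _ | l
    · exact h5
    · exact h6 l

/-- A phase in front of `w ⊗ w` is absorbed into `w` by taking a square root. -/
theorem exists_sq_phase (w : Fin 3 → ℂ) {b : ℂ} (hb : ‖b‖ = 1) :
    ∃ d : ℂ, ‖d‖ = 1 ∧ b • sq w = sq (d • w) := by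
  refine ⟨Complex.exp (Complex.log b / 2), ?_, ?_⟩
  · have : Complex.exp (Complex.log b / 2) ^ 2 = b := by
      rw [← Complex.exp_nat_mul]
      push_cast
      rw [mul_div_cancel₀ _ two_ne_zero, Complex.exp_log (norm_ne_zero_iff.1 (by rw [hb]; simp))]
    have h2 := congrArg norm this
    rw [norm_pow, hb] at h2
    exact (pow_eq_one_iff_of_nonneg (norm_nonneg _) two_ne_zero).1 h2
  · rw [sq_smul]
    congr 1
    rw [← Complex.exp_nat_mul]
    push_cast
    rw [mul_div_cancel₀ _ two_ne_zero, Complex.exp_log (norm_ne_zero_iff.1 (by rw [hb]; simp))]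

/-- The spinor factors of the tensor can be prescribed. -/
theorem IsOuter.exists_frame {x : Amb k} (h : IsOuter p δ x) {z : Nut k → Fin 2 → ℂ}
    (hz : ∀ l, hopf (z l) = x.2.2.2.1 (some l)) :
    ∃ w, IsNullFrame w (x.2.2.2.1 none) ∧ x.2.2.2.2 = tens z (sq w) := by
  obtain ⟨w, y, hw, hy, hT⟩ := h.tensor
  obtain ⟨b, hb, hyz⟩ := tens_congr_phase (fun l => (hy l).trans (hz l).symm) (sq w)
  obtain ⟨d, hd, e⟩ := exists_sq_phase w hb
  exact ⟨d • w, hw.smul hd, by rw [hT, hyz, smul_tens, e]⟩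

/-- The spinor factors may be replaced by the prescribed sections at the cost of a phase, which is
moved into the null frame `w`. The other coordinates are functions of the polar ones. -/
theorem IsOuter.exists_eq_theta {x : Amb k} (h : IsOuter p δ x)
    (hG : Good p a (x.2.2.2.1 none) x.1.2 (x.2.2.1 none)) :
    ∃ w, IsNullFrame w (x.2.2.2.1 none) ∧
      x = theta p a (sq w) (x.2.2.2.1 none) x.1.2 (x.2.2.1 none) (sigh x) := by
  have hne : ∀ l, x.2.2.1 (some l) ≠ 0 := fun l => by
    rw [h.r_some_eq]
    exact (hG.rad_pos l).ne'
  obtain ⟨w, hw, hT⟩ := h.exists_frame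
    (z := fun l => sec (a l) (uvec p (x.2.2.2.1 none) x.1.2 (x.2.2.1 none) (sigh x) l))
    fun l => (hopf_sec (hG.secDen_uvec_pos l)).trans (h.v_some_eq (hne l)).symm
  exact ⟨w, hw, ext_Amb (Prod.ext h.u_eq rfl) (h.t_eq hne) rfl h.r_some_eq rfl
    (fun l => h.v_some_eq (hne l)) hT⟩

section Smooth

variable {X : Type*} [NormedAddCommGroup X] [NormedSpace ℝ X] {S : Set X} {c : X → E3}
  {s r σ : X → ℝ} {A : X → Mat3}

theorem contDiffOn_dvec (hc : ContDiffOn ℝ ∞ c S) (hs : ContDiffOn ℝ ∞ s S)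
    (hr : ContDiffOn ℝ ∞ r S) (l : Nut k) :
    ContDiffOn ℝ ∞ (fun x => dvec p (c x) (s x) (r x) l) S :=
  (hr.smul hc).sub (hs.smul contDiffOn_const)

theorem contDiffOn_rad (hc : ContDiffOn ℝ ∞ c S) (hs : ContDiffOn ℝ ∞ s S)
    (hr : ContDiffOn ℝ ∞ r S) (hσ : ContDiffOn ℝ ∞ σ S) {l : Nut k}
    (hne : ∀ x ∈ S, dvec p (c x) (s x) (r x) l ≠ 0) :
    ContDiffOn ℝ ∞ (fun x => rad p (c x) (s x) (r x) (σ x) l) S := by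
  refine ContDiffOn.sqrt (((contDiffOn_dvec hc hs hr l).norm_sq ℝ).add ((hr.mul hσ).pow 2))
    fun x hx => ?_
  have : 0 < ‖dvec p (c x) (s x) (r x) l‖ := norm_pos_iff.2 (hne x hx)
  positivity

theorem contDiffOn_uvec (hc : ContDiffOn ℝ ∞ c S) (hs : ContDiffOn ℝ ∞ s S)
    (hr : ContDiffOn ℝ ∞ r S) (hσ : ContDiffOn ℝ ∞ σ S) {l : Nut k}
    (hne : ∀ x ∈ S, dvec p (c x) (s x) (r x) l ≠ 0) :
    ContDiffOn ℝ ∞ (fun x => uvec p (c x) (s x) (r x) (σ x) l) S :=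
  ((contDiffOn_rad hc hs hr hσ hne).inv fun x hx => (rad_pos_of_ne (hne x hx)).ne').smul
    (contDiffOn_dvec hc hs hr l)

theorem contDiffOn_theta (hA : ContDiffOn ℝ ∞ A S) (hc : ContDiffOn ℝ ∞ c S)
    (hs : ContDiffOn ℝ ∞ s S) (hr : ContDiffOn ℝ ∞ r S) (hσ : ContDiffOn ℝ ∞ σ S)
    (hG : ∀ x ∈ S, Good p a (c x) (s x) (r x)) :
    ContDiffOn ℝ ∞ (fun x => theta p a (A x) (c x) (s x) (r x) (σ x)) S := by
  have hne : ∀ l, ∀ x ∈ S, dvec p (c x) (s x) (r x) l ≠ 0 := fun l x hx =>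
    ne_zero_of_secDen_pos (hG x hx l)
  have hrad := fun l => contDiffOn_rad hc hs hr hσ (hne l)
  have huv := fun l => contDiffOn_uvec hc hs hr hσ (hne l)
  refine ((hr.smul hc).prodMk hs).prodMk (ContDiffOn.prodMk ?_ (ContDiffOn.prodMk ?_
    (ContDiffOn.prodMk ?_ (contDiffOn_tens (fun l => ?_) hA))))
  · simp only [div_eq_mul_inv]
    exact hσ.mul (ContDiffOn.inv (contDiffOn_prod fun l _ => hrad l) fun x hx =>
      Finset.prod_ne_zero_iff.2 fun l _ => (rad_pos_of_ne (hne l x hx)).ne')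
  · rw [contDiffOn_pi]
    rintro (_ | l)
    · exact hr
    · exact hrad l
  · rw [contDiffOn_pi]
    rintro (_ | l)
    · exact hc
    · exact huv l
  · exact (contDiffOn_sec (a l)).comp (huv l) fun x hx => (hG x hx).secDen_uvec_pos l

end Smooth

end Model

/-! ### The part of the total space that comes from `HA` -/

section Inner

variable {k : ℕ}

/-- A smooth positive function that is the identity on `[1/2, ∞)`. -/
def cut (t : ℝ) : ℝ :=
  Real.smoothTransition (4 * t - 1) * t + (1 - Real.smoothTransition (4 * t - 1))

theorem cut_eq {t : ℝ} (h : 1 / 2 ≤ t) : cut t = t := by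
  rw [cut, Real.smoothTransition.one_of_one_le (by linarith)]
  ring

theorem cut_pos (t : ℝ) : 0 < cut t := by
  rcases le_or_gt t (1 / 4) with h | h
  · rw [cut, Real.smoothTransition.zero_of_nonpos (by linarith)]
    norm_num
  · rw [cut]
    have h1 := Real.smoothTransition.pos_of_pos (x := 4 * t - 1) (by linarith)
    have h2 := Real.smoothTransition.le_one (4 * t - 1)
    have h3 : 0 < Real.smoothTransition (4 * t - 1) * t := mul_pos h1 (by linarith)
    linarith

theorem le_cut {t : ℝ} (h : t ≤ 1) : t ≤ cut t := by
  rw [cut]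
  have h2 := Real.smoothTransition.le_one (4 * t - 1)
  nlinarith

theorem contDiff_cut : ContDiff ℝ ∞ cut := by
  have h : ContDiff ℝ ∞ fun t : ℝ => Real.smoothTransition (4 * t - 1) :=
    Real.smoothTransition.contDiff.comp (by fun_prop)
  unfold cut
  fun_prop

/-- The scaling factor of the imaginary part. -/
def scal (t : ℝ) : ℝ := (√(cut t))⁻¹

theorem scal_pos (t : ℝ) : 0 < scal t := inv_pos.2 (Real.sqrt_pos.2 (cut_pos t))

theorem contDiff_scal : ContDiff ℝ ∞ scal :=
  (contDiff_cut.sqrt fun t => (cut_pos t).ne').inv fun t => (Real.sqrt_pos.2 (cut_pos t)).ne'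

theorem scal_eq {t : ℝ} (h : 1 / 2 ≤ t) : scal t = (√t)⁻¹ := by rw [scal, cut_eq h]

/-- It keeps the extended axis in the closed unit ball, which is all that `good_aref` requires, so
the Hopf sections over the ball `|x| < δ` exist over the core of `HA` too. -/
theorem scal_mul_le {t : ℝ} (h0 : 0 ≤ t) (h : t ≤ 1) : scal (t ^ 2) * t ≤ 1 := by
  have h1 := le_cut (t := t ^ 2) (by nlinarith)
  rw [scal, inv_mul_le_iff₀ (Real.sqrt_pos.2 (cut_pos _)), mul_one]
  exact Real.le_sqrt_of_sq_le h1

/-- The rescaled complex conjugate of `Z`. It is a null frame in the asymptotic region. -/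
def scl (Z : Fin 3 → ℂ) : Fin 3 → ℂ := cvec (rePart Z) (-(scal (‖imPart Z‖ ^ 2) • imPart Z))

/-- The extension of the axis to all of `HA`. -/
def axA (Z : Fin 3 → ℂ) : E3 := cross (rePart Z) (scal (‖imPart Z‖ ^ 2) • imPart Z)

theorem scl_neg (Z : Fin 3 → ℂ) : scl (-Z) = -scl Z := by
  rw [scl, scl, neg_cvec, rePart_neg, imPart_neg, norm_neg, smul_neg]

theorem axA_neg (Z : Fin 3 → ℂ) : axA (-Z) = axA Z := by
  rw [axA, axA, rePart_neg, imPart_neg, norm_neg, smul_neg, cross_neg_right, cross_neg_left, neg_neg]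

theorem scl_star (Z : Fin 3 → ℂ) : scl (star Z) = star (scl Z) := by
  rw [scl, scl, star_cvec, rePart_star, imPart_star, norm_neg, smul_neg]

theorem axA_star (Z : Fin 3 → ℂ) : axA (star Z) = -axA Z := by
  rw [axA, axA, rePart_star, imPart_star, norm_neg, smul_neg, cross_neg_right]

theorem contDiff_scal_im : ContDiff ℝ ∞ fun Z : Fin 3 → ℂ => scal (‖imPart Z‖ ^ 2) :=
  contDiff_scal.comp (contDiff_imPart.norm_sq ℝ)

theorem contDiff_scl : ContDiff ℝ ∞ scl := by
  rw [← contDiffOn_univ]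
  exact contDiff_cvec contDiff_rePart.contDiffOn
    (contDiff_scal_im.smul contDiff_imPart).neg.contDiffOn

theorem contDiff_axA : ContDiff ℝ ∞ axA := by
  rw [← contDiffOn_univ]
  exact ContDiffOn.cross_E3 contDiff_rePart.contDiffOn
    (contDiff_scal_im.smul contDiff_imPart).contDiffOn

theorem norm_axA {Z : Fin 3 → ℂ} (hZ : Z ∈ AHhatBar) :
    ‖axA Z‖ = scal (‖imPart Z‖ ^ 2) * ‖imPart Z‖ := by
  rw [axA, norm_cross_of_inner_eq_zero (by rw [inner_smul_right, hZ.2.1, mul_zero]), hZ.1, one_mul,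
    norm_smul, Real.norm_of_nonneg (scal_pos _).le]

theorem norm_axA_le {Z : Fin 3 → ℂ} (hZ : Z ∈ AHhatBar) : ‖axA Z‖ ≤ 1 := by
  rw [norm_axA hZ]
  exact scal_mul_le (norm_nonneg _) hZ.2.2

theorem scl_ne_zero {Z : Fin 3 → ℂ} (hZ : Z ∈ AHhatBar) : scl Z ≠ 0 := by
  intro h
  have h1 : rePart (scl Z) = rePart Z := rePart_cvec _ _
  have h2 : rePart 0 = 0 := by ext i; simp
  rw [h, h2] at h1
  have := hZ.1
  rw [← h1] at this
  simp at this

theorem scal_mul_norm {Z : Fin 3 → ℂ} (h : 1 / 2 ≤ ‖imPart Z‖ ^ 2) :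
    scal (‖imPart Z‖ ^ 2) * ‖imPart Z‖ = 1 := by
  have h0 : 0 < ‖imPart Z‖ := by
    by_contra! h1
    have : ‖imPart Z‖ = 0 := le_antisymm h1 (norm_nonneg _)
    rw [this] at h
    norm_num at h
  rw [scal_eq h, Real.sqrt_sq h0.le, inv_mul_cancel₀ h0.ne']

/-- In this range the cutoff is inactive and the scaling factor is exactly `1 / |Im Z|`, so that
`scl Z` is made of unit vectors. -/
theorem isNullFrame_scl {Z : Fin 3 → ℂ} (hZ : Z ∈ AHhatBar) (h : 1 / 2 ≤ ‖imPart Z‖ ^ 2) :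
    IsNullFrame (scl Z) (axA Z) ∧ ‖axA Z‖ = 1 := by
  have h2 : ‖axA Z‖ = 1 := by rw [norm_axA hZ, scal_mul_norm h]
  refine ⟨?_, h2⟩
  rw [isNullFrame_iff h2, scl, rePart_cvec, imPart_cvec]
  refine ⟨hZ.1, ?_, ?_, ?_⟩
  · rw [norm_neg, norm_smul, Real.norm_of_nonneg (scal_pos _).le, scal_mul_norm h]
  · rw [inner_neg_right, inner_smul_right, hZ.2.1, mul_zero, neg_zero]
  · rw [cross_neg_right]
    rfl

theorem axA_eq_axis {Z : Fin 3 → ℂ} (hZ : Z ∈ AHhatBar) (h : 1 / 2 ≤ ‖imPart Z‖ ^ 2) :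
    axA Z = axis Z := by
  have h1 := scal_mul_norm h
  rw [axis, axA, cross_smul_right, norm_cross_of_inner_eq_zero hZ.2.1, hZ.1, one_mul]
  congr 1
  exact eq_inv_of_mul_eq_one_left h1

/-- Reference spinors for the points of `P`. -/
def aref (p : Fin k → E3) : Nut k → Fin 2 → ℂ
  | (ν, true) => (exists_hopf_eq (-p ν)).choose
  -- As `J² = -1`, the reference spinors of `p` and `-p` cannot simply be exchanged by `J`. With the
  -- factor `I` they are exchanged up to the phases `I` and `-I`, whose product is `1`; this makes
  -- the involution compatible with `alpha`.
  | (ν, false) => Complex.I • conjJ (exists_hopf_eq (-p ν)).choose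

theorem hopf_aref (p : Fin k → E3) (l : Nut k) : hopf (aref p l) = -pt p (some l) := by
  rcases l with ⟨ν, _ | _⟩
  · rw [aref, hopf_smul_of_norm_one (by simp), hopf_conjJ, (exists_hopf_eq (-p ν)).choose_spec]
    simp [pt]
  · rw [aref, (exists_hopf_eq (-p ν)).choose_spec]
    simp [pt]

theorem norm_pt {p : Fin k → E3} {δ : ℝ} (hp : ∀ ν, δ < ‖p ν‖) (l : Nut k) :
    δ < ‖pt p (some l)‖ := by
  rcases l with ⟨ν, _ | _⟩ <;> simpa [pt] using hp ν

/-- As `r < δ s < s |q|` and `|c| ≤ 1`, the vector `r c - s q` has negative inner product with `q`,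
so it avoids the excluded half-line of the section around `-q`. Only `|c| ≤ 1` matters, not that `c`
is a unit vector. -/
theorem good_aref {p : Fin k → E3} {δ : ℝ} (hp : ∀ ν, δ < ‖p ν‖) {c : E3} {s r : ℝ} (hc : ‖c‖ ≤ 1)
    (hs : 0 ≤ s) (hr : 0 ≤ r) (hrs : r < δ * s) : Good p (aref p) c s r := by
  intro l
  have hq := norm_pt hp l
  set q := pt p (some l) with hq'
  have hδ : 0 < δ * s := hr.trans_lt hrs
  have hs0 : 0 < s := by
    rcases hs.eq_or_lt with h | h
    · rw [← h] at hδ; simp at hδ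
    · exact h
  have hδ0 : 0 < δ := pos_of_mul_pos_left hδ hs
  have hq0 : 0 < ‖q‖ := hδ0.trans hq
  rw [secDen, hopf_aref, ← hq', norm_neg, inner_neg_right]
  have h1 : inner ℝ (dvec p c s r l) q = r * inner ℝ c q - s * ‖q‖ ^ 2 := by
    rw [dvec, ← hq', inner_sub_left, inner_smul_left, inner_smul_left, real_inner_self_eq_norm_sq]
    simp
  have h2 : inner ℝ c q ≤ ‖q‖ := (real_inner_le_norm c q).trans
    (mul_le_of_le_one_left hq0.le hc)
  have h3 : r * inner ℝ c q ≤ r * ‖q‖ := mul_le_mul_of_nonneg_left h2 hr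
  have h4 : r * ‖q‖ < s * ‖q‖ ^ 2 := by
    have : r < s * ‖q‖ := hrs.trans (by nlinarith)
    nlinarith
  have h5 : 0 ≤ ‖dvec p c s r l‖ * ‖q‖ := by positivity
  linarith

/-- The parametrization of a neighbourhood of the face over `0`. -/
def alpha (p : Fin k → E3) (Z : Fin 3 → ℂ) (r : ℝ) : Amb k :=
  theta p (aref p) (sq (scl Z)) (axA Z) (√(1 + r ^ 2))⁻¹ (r * (√(1 + r ^ 2))⁻¹)
    ((1 - ‖imPart Z‖ ^ 2) * √(1 + r ^ 2))

/-- The domain of `alpha`. -/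
def DomA (δ : ℝ) : Set ((Fin 3 → ℂ) × ℝ) :=
  {q | q.1 ∈ AHhatBar ∧ 0 ≤ q.2 ∧ q.2 < δ}

variable {p : Fin k → E3} {δ : ℝ}

theorem sqrt_one_add_pos (r : ℝ) : 0 < √(1 + r ^ 2) := Real.sqrt_pos.2 (by positivity)

theorem good_alpha (hp : ∀ ν, δ < ‖p ν‖) {q : (Fin 3 → ℂ) × ℝ} (hq : q ∈ DomA δ) :
    Good p (aref p) (axA q.1) (√(1 + q.2 ^ 2))⁻¹ (q.2 * (√(1 + q.2 ^ 2))⁻¹) := by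
  have h := inv_pos.2 (sqrt_one_add_pos q.2)
  exact good_aref hp (norm_axA_le hq.1) h.le (mul_nonneg hq.2.1 h.le)
    (mul_lt_mul_of_pos_right hq.2.2 h)

theorem contDiffOn_alpha (hp : ∀ ν, δ < ‖p ν‖) :
    ContDiffOn ℝ ∞ (fun q : (Fin 3 → ℂ) × ℝ => alpha p q.1 q.2) (DomA δ) := by
  have h1 : ContDiff ℝ ∞ fun q : (Fin 3 → ℂ) × ℝ => √(1 + q.2 ^ 2) :=
    ContDiff.sqrt (by fun_prop) fun q => by positivity
  have h2 : ContDiff ℝ ∞ fun q : (Fin 3 → ℂ) × ℝ => (√(1 + q.2 ^ 2))⁻¹ :=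
    h1.inv fun q => (sqrt_one_add_pos q.2).ne'
  refine contDiffOn_theta (contDiff_sq.comp (contDiff_scl.comp contDiff_fst)).contDiffOn
    (contDiff_axA.comp contDiff_fst).contDiffOn h2.contDiffOn (contDiff_snd.mul h2).contDiffOn
    (ContDiff.contDiffOn (ContDiff.mul (contDiff_const.sub
      ((contDiff_imPart.comp contDiff_fst).norm_sq ℝ)) h1)) fun q hq => good_alpha hp hq

section AlphaCoords

variable (hp : ∀ ν, δ < ‖p ν‖) {Z : Fin 3 → ℂ} {r : ℝ} (hq : (Z, r) ∈ DomA δ)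
include hp hq

theorem alpha_rad_ne (l : Nut k) :
    rad p (axA Z) (√(1 + r ^ 2))⁻¹ (r * (√(1 + r ^ 2))⁻¹) ((1 - ‖imPart Z‖ ^ 2) * √(1 + r ^ 2)) l
      ≠ 0 := ((good_alpha hp hq).rad_pos l).ne'

theorem sigh_alpha : sigh (alpha p Z r) = (1 - ‖imPart Z‖ ^ 2) * √(1 + r ^ 2) :=
  sigh_theta (alpha_rad_ne hp hq)

/-- In the region of the null frames `r = |x|` and `1 - |Im Z|² = 1 / |x'|`, so this is the relation
`x = ε x'`. The formula continues across the core of `HA`. -/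
theorem eps_alpha : eps (alpha p Z r) = r * (1 - ‖imPart Z‖ ^ 2) := by
  rw [alpha, eps_theta (alpha_rad_ne hp hq)]
  have := (sqrt_one_add_pos r).ne'
  field_simp

theorem sig_alpha : (alpha p Z r).1.2 * sigh (alpha p Z r) = 1 - ‖imPart Z‖ ^ 2 := by
  rw [sigh_alpha hp hq]
  change (√(1 + r ^ 2))⁻¹ * _ = _
  have := (sqrt_one_add_pos r).ne'
  field_simp

theorem contr_alpha : contr (fun l => sec (aref p l) ((alpha p Z r).2.2.2.1 (some l)))
    (alpha p Z r).2.2.2.2 = sq (scl Z) := by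
  exact contr_tens (fun l => sec_ne_zero ((good_alpha hp hq).secDen_uvec_pos l)) _

end AlphaCoords

theorem alpha_s (Z : Fin 3 → ℂ) (r : ℝ) : (alpha p Z r).1.2 = (√(1 + r ^ 2))⁻¹ := rfl

theorem alpha_r (Z : Fin 3 → ℂ) (r : ℝ) : (alpha p Z r).2.2.1 none = r * (√(1 + r ^ 2))⁻¹ := rfl

theorem alpha_c (Z : Fin 3 → ℂ) (r : ℝ) : (alpha p Z r).2.2.2.1 none = axA Z := rfl

theorem alpha_u (Z : Fin 3 → ℂ) (r : ℝ) :
    (alpha p Z r).1.1 = (r * (√(1 + r ^ 2))⁻¹) • axA Z := rfl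

theorem alpha_neg (Z : Fin 3 → ℂ) (r : ℝ) : alpha p (-Z) r = alpha p Z r := by
  rw [alpha, alpha, scl_neg, axA_neg, sq_neg, imPart_neg, norm_neg]

/-- The part of the total space that comes from `HA`. -/
def IsInner (p : Fin k → E3) (δ : ℝ) (x : Amb k) : Prop :=
  ∃ Z r, (Z, r) ∈ DomA δ ∧ r * (1 - ‖imPart Z‖ ^ 2) < δ ^ 2 ∧ x = alpha p Z r

theorem IsInner.lt {x : Amb k} (h : IsInner p δ x) : x.2.2.1 none < δ * x.1.2 := by
  obtain ⟨Z, r, hq, -, rfl⟩ := h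
  rw [alpha_r, alpha_s]
  exact mul_lt_mul_of_pos_right hq.2.2 (inv_pos.2 (sqrt_one_add_pos r))

theorem isOuter_alpha (hp : ∀ ν, δ < ‖p ν‖) (hδ : δ < 1 / 2) {Z : Fin 3 → ℂ} {r : ℝ}
    (hq : (Z, r) ∈ DomA δ) (h : r * (1 - ‖imPart Z‖ ^ 2) < δ ^ 2) (hZ : 1 - ‖imPart Z‖ ^ 2 < δ) :
    IsOuter p δ (alpha p Z r) := by
  have h1 : ‖imPart Z‖ ^ 2 ≤ 1 := pow_le_one₀ (norm_nonneg _) hq.1.2.2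
  obtain ⟨h2, h3⟩ := isNullFrame_scl hq.1 (by linarith)
  have h4 := sqrt_one_add_pos r
  refine isOuter_theta (good_alpha hp hq) h3 ?_ (inv_pos.2 h4).le
    (mul_nonneg hq.2.1 (inv_pos.2 h4).le) (mul_nonneg (by linarith) h4.le) ?_ ?_ h2
  · have h5 : √(1 + r ^ 2) ^ 2 = 1 + r ^ 2 := Real.sq_sqrt (by positivity)
    field_simp
    linarith
  · have : r * (√(1 + r ^ 2))⁻¹ * ((1 - ‖imPart Z‖ ^ 2) * √(1 + r ^ 2)) =
        r * (1 - ‖imPart Z‖ ^ 2) := by field_simp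
    rwa [this]
  · have : (√(1 + r ^ 2))⁻¹ * ((1 - ‖imPart Z‖ ^ 2) * √(1 + r ^ 2)) = 1 - ‖imPart Z‖ ^ 2 := by
      field_simp
    rwa [this]

theorem IsInner.isOuter (hp : ∀ ν, δ < ‖p ν‖) (hδ : δ < 1 / 2) {x : Amb k} (h : IsInner p δ x)
    (hx : x.1.2 * sigh x < δ) : IsOuter p δ x := by
  obtain ⟨Z, r, hq, h1, rfl⟩ := h
  rw [sig_alpha hp hq] at hx
  exact isOuter_alpha hp hδ hq h1 hx

/-- The inequality means `|x| < δ`, where the reference sections reduce the tensor to `w ⊗ w`; then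
`w` and `σ = 1 / |x'|` determine a point of the disc bundle. -/
theorem IsOuter.isInner (hp : ∀ ν, δ < ‖p ν‖) (hδ : δ < 1 / 2) {x : Amb k} (h : IsOuter p δ x)
    (hx : x.2.2.1 none < δ * x.1.2) : IsInner p δ x := by
  obtain ⟨w, hw, e⟩ := h.exists_eq_theta (good_aref hp h.norm_none.le h.base.2 (h.r_nonneg none) hx)
  obtain ⟨w1, w2, w3, w4⟩ := (isNullFrame_iff h.norm_none).1 hw
  have hδs : 0 < δ * x.1.2 := (h.r_nonneg none).trans_lt hx
  have hs0 : 0 < x.1.2 := by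
    rcases h.base.2.eq_or_lt with h' | h'
    · rw [← h'] at hδs; simp at hδs
    · exact h'
  set s := x.1.2 with hs
  set r₀ := x.2.2.1 none with hr₀
  set c := x.2.2.2.1 none with hc
  have hσ0 : 0 ≤ sigh x := mul_nonneg h.t_nonneg (Finset.prod_nonneg fun l _ => h.r_nonneg _)
  set σ := s * sigh x with hσ
  have hσ1 : σ < δ := h.sig_lt
  have hσ2 : 0 ≤ σ := mul_nonneg hs0.le hσ0
  have hsq : √(1 - σ) ^ 2 = 1 - σ := Real.sq_sqrt (by linarith)
  have hτ : 0 < √(1 - σ) := Real.sqrt_pos.2 (by linarith)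
  set τ := √(1 - σ) with hτ'
  -- The imaginary part gets length `√(1 - σ)`, so that `1 - |Im Z|² = σ`; as `σ < δ < 1 / 2`, the
  -- cutoff is inactive at `Z` and `scl Z = w`.
  set Z : Fin 3 → ℂ := cvec (rePart w) (-(τ • imPart w)) with hZ
  have hre : rePart Z = rePart w := rePart_cvec _ _
  have him : imPart Z = -(τ • imPart w) := imPart_cvec _ _
  have hnim : ‖imPart Z‖ = τ := by
    rw [him, norm_neg, norm_smul, w2, mul_one, Real.norm_of_nonneg hτ.le]
  have hZm : Z ∈ AHhatBar := by
    refine ⟨by rw [hre, w1], ?_, ?_⟩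
    · rw [hre, him, inner_neg_right, inner_smul_right, w3, mul_zero, neg_zero]
    · rw [hnim]
      nlinarith
  have hsc : scal (‖imPart Z‖ ^ 2) = τ⁻¹ := by
    rw [hnim, scal_eq (by rw [hsq]; linarith), Real.sqrt_sq hτ.le]
  have hscl : scl Z = w := by
    rw [scl, hsc, hre, him, smul_neg, neg_neg, inv_smul_smul₀ hτ.ne', cvec_re_im]
  have hax : axA Z = c := by
    rw [axA, hsc, hre, him, smul_neg, inv_smul_smul₀ hτ.ne', cross_neg_right, w4, neg_neg]
  have hrs := h.sq_add_sq
  have hsqrt : √(1 + (r₀ / s) ^ 2) = s⁻¹ := by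
    rw [Real.sqrt_eq_iff_mul_self_eq (by positivity) (by positivity)]
    field_simp
    linarith
  have h1 : r₀ / s * (1 - ‖imPart Z‖ ^ 2) = eps x := by
    rw [hnim, hsq, eps_eq_none]
    field_simp
    linarith
  refine ⟨Z, r₀ / s, ⟨hZm, div_nonneg (h.r_nonneg none) hs0.le, ?_⟩, ?_, ?_⟩
  · exact (div_lt_iff₀ hs0).2 hx
  · rw [h1]
    exact h.eps_lt
  · rw [alpha, hscl, hax, hsqrt, inv_inv, div_mul_cancel₀ _ hs0.ne', hnim, hsq]
    have : (1 - (1 - σ)) * s⁻¹ = sigh x := by rw [hσ]; field_simp; ring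
    rw [this]
    exact e

/-- The total space. -/
def total (p : Fin k → E3) (δ : ℝ) : Set (Amb k) := {x | IsOuter p δ x ∨ IsInner p δ x}

/-- Inside the total space the two parts are cut out by one strict inequality each, `1 / |x'| < δ`
here and `|x| < δ` in `isInner_iff`. Hence both are open and their overlap is the gluing region. -/
theorem isOuter_iff (hp : ∀ ν, δ < ‖p ν‖) (hδ : δ < 1 / 2) {x : Amb k} (h : x ∈ total p δ) :
    IsOuter p δ x ↔ x.1.2 * sigh x < δ :=
  ⟨fun h' => h'.sig_lt, fun h' => h.elim id fun h'' => h''.isOuter hp hδ h'⟩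

theorem isInner_iff (hp : ∀ ν, δ < ‖p ν‖) (hδ : δ < 1 / 2) {x : Amb k} (h : x ∈ total p δ) :
    IsInner p δ x ↔ x.2.2.1 none < δ * x.1.2 :=
  ⟨fun h' => h'.lt, fun h' => h.elim (fun h'' => h''.isInner hp hδ h') id⟩

end Inner

/-! ### Charts of the total space -/

section Charts

variable {k : ℕ} {p : Fin k → E3} {δ : ℝ}

/-- The real part as a linear map. -/
def reL : (Fin 3 → ℂ) →L[ℝ] E3 := LinearMap.toContinuousLinearMap
  { toFun := rePart
    map_add' := fun v w => by ext i; simp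
    map_smul' := fun c v => by ext i; simp }

/-- The imaginary part as a linear map. -/
def imL : (Fin 3 → ℂ) →L[ℝ] E3 := LinearMap.toContinuousLinearMap
  { toFun := imPart
    map_add' := fun v w => by ext i; simp
    map_smul' := fun c v => by ext i; simp }

@[simp] theorem reL_apply (Z : Fin 3 → ℂ) : reL Z = rePart Z := rfl
@[simp] theorem imL_apply (Z : Fin 3 → ℂ) : imL Z = imPart Z := rfl

theorem hasFDerivAt_rePart (Z : Fin 3 → ℂ) : HasFDerivAt rePart reL Z := reL.hasFDerivAt
theorem hasFDerivAt_imPart (Z : Fin 3 → ℂ) : HasFDerivAt imPart imL Z := imL.hasFDerivAt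

theorem AHhatBar_eq : AHhatBar = {Z | ((‖rePart Z‖ ^ 2 - 1, inner ℝ (rePart Z) (imPart Z)) : ℝ × ℝ) = 0
    ∧ 0 ≤ 1 - ‖imPart Z‖ ^ 2} := by
  ext Z
  simp only [AHhatBar, mem_ofPred_eq, Prod.mk_eq_zero, sub_eq_zero, sub_nonneg,
    pow_eq_one_iff_of_nonneg (norm_nonneg (rePart Z)) two_ne_zero,
    pow_le_one_iff_of_nonneg (norm_nonneg (imPart Z)) two_ne_zero, and_assoc]

/-- The disc bundle is given in `ℂ³ = ℝ⁶` by the equations `|n|² = 1`, `n ⊥ v` and the inequality `1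
- |v|² ≥ 0`. -/
theorem exists_locDiffeo_AHhatBar {Z : Fin 3 → ℂ} (hZ : Z ∈ AHhatBar) :
    ∃ e, LocDiffeo AHhatBar Z half4 e ∧ (e 0 = 0 ↔ ‖imPart Z‖ = 1) := by
  have h1 := (hasFDerivAt_rePart Z).norm_sq
  have h2 := (hasFDerivAt_imPart Z).norm_sq
  have h3 := (hasFDerivAt_rePart Z).inner ℝ (hasFDerivAt_imPart Z)
  have hin : inner ℝ (imPart Z) (rePart Z) = 0 := by rw [real_inner_comm]; exact hZ.2.1
  have h4 := (h1.sub_const 1).prodMk h3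
  have h5 := h2.const_sub 1
  have hfin : Module.finrank ℝ (Fin 3 → ℂ) = Module.finrank ℝ (ℝ × ℝ) + 4 := by
    simp [Module.finrank_pi_fintype]
  obtain ⟨e, he, he'⟩ := locDiffeo_levelSet
    (f := fun Z => ((‖rePart Z‖ ^ 2 - 1, inner ℝ (rePart Z) (imPart Z)) : ℝ × ℝ))
    (g := fun Z => 1 - ‖imPart Z‖ ^ 2)
    (((contDiff_rePart.norm_sq ℝ).sub contDiff_const).prodMk
      (contDiff_rePart.inner ℝ contDiff_imPart)) (contDiff_const.sub (contDiff_imPart.norm_sq ℝ))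
    h4 h5
    (by simp [hZ.1, hZ.2.1]) (sub_nonneg.2 (pow_le_one₀ (norm_nonneg _) hZ.2.2))
    (by
      rintro ⟨y, y'⟩
      -- Moving the real part along itself changes only its norm, and moving the imaginary part
      -- along `Re Z` changes only the inner product.
      refine ⟨cvec ((y / 2) • rePart Z) (y' • rePart Z), ?_⟩
      simp [inner_smul_right, hZ.1, hin, fderivInnerCLM_apply, inner_smul_left, hZ.2.1]
      ring)
    (by
      intro h
      have h' : ‖imPart Z‖ ^ 2 = 1 := by linarith [sub_eq_zero.1 h]
      -- The radial direction of the disc, tangent to the level set and transversal to its boundary.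
      refine ⟨cvec 0 (imPart Z), ?_, ?_⟩
      · simp [hZ.2.1, fderivInnerCLM_apply]
      · simp [h']) hfin
  refine ⟨e, AHhatBar_eq ▸ he, ?_⟩
  rw [he', sub_eq_zero, eq_comm, pow_eq_one_iff_of_nonneg (norm_nonneg _) two_ne_zero]

/-- The points of the boundary of the total space. -/
def bdry (k : ℕ) : Set (Amb k) := {x | x.1.2 = 0 ∨ x.2.1 = 0 ∨ ∃ l, x.2.2.1 l = 0}

/-- The points of codimension two of the total space. -/
def corn (k : ℕ) : Set (Amb k) := {x | x.2.1 = 0 ∧ (x.1.2 = 0 ∨ ∃ l, x.2.2.1 l = 0)}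

/-- The inverse of `scl`, given the norm of the imaginary part. -/
def unscl (t : ℝ) (w : Fin 3 → ℂ) : Fin 3 → ℂ := cvec (rePart w) (-((scal t)⁻¹ • imPart w))

theorem unscl_scl (Z : Fin 3 → ℂ) : unscl (‖imPart Z‖ ^ 2) (scl Z) = Z := by
  rw [unscl, scl, rePart_cvec, imPart_cvec, smul_neg, neg_neg, inv_smul_smul₀ (scal_pos _).ne',
    cvec_re_im]

theorem unscl_neg (t : ℝ) (w : Fin 3 → ℂ) : unscl t (-w) = -unscl t w := by
  rw [unscl, unscl, neg_cvec, rePart_neg, imPart_neg, smul_neg]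

theorem contDiffOn_unscl {X : Type*} [NormedAddCommGroup X] [NormedSpace ℝ X] {S : Set X}
    {t : X → ℝ} {w : X → Fin 3 → ℂ} (ht : ContDiffOn ℝ ∞ t S) (hw : ContDiffOn ℝ ∞ w S) :
    ContDiffOn ℝ ∞ (fun x => unscl (t x) (w x)) S :=
  contDiff_cvec (contDiff_rePart.comp_contDiffOn hw)
    (((contDiff_scal.comp_contDiffOn ht).inv fun x _ => (scal_pos _).ne').smul
      (contDiff_imPart.comp_contDiffOn hw)).neg

/-- The points where the sections that belong to the spinors `a` are defined. -/
def secDom (a : Nut k → Fin 2 → ℂ) : Set (Amb k) :=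
  {x | ∀ l, 0 < secDen (a l) (x.2.2.2.1 (some l))}

/-- The matrix factor of a point, with respect to the sections that belong to the spinors `a`. -/
def matOf (a : Nut k → Fin 2 → ℂ) (x : Amb k) : Mat3 :=
  contr (fun l => sec (a l) (x.2.2.2.1 (some l))) x.2.2.2.2

theorem isOpen_secDom (a : Nut k → Fin 2 → ℂ) : IsOpen (secDom a) := by
  simp only [secDom, ofPred_forall]
  refine isOpen_iInter_of_finite fun l => isOpen_lt continuous_const
    ((continuous_secDen (a l)).comp ?_)
  fun_prop

theorem contDiffOn_matOf (a : Nut k → Fin 2 → ℂ) : ContDiffOn ℝ ∞ (matOf a) (secDom a) := by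
  refine contDiffOn_contr (fun l => ?_) (fun x hx l => sec_ne_zero (hx l)) (by fun_prop)
  refine (contDiffOn_sec (a l)).comp (t := {v | 0 < secDen (a l) v}) ?_ fun x hx => hx l
  fun_prop

theorem theta_mem_secDom {a : Nut k → Fin 2 → ℂ} {A : Mat3} {c : E3} {s r σ : ℝ}
    (h : Good p a c s r) : theta p a A c s r σ ∈ secDom a := fun l => h.secDen_uvec_pos l

theorem matOf_theta {a : Nut k → Fin 2 → ℂ} {A : Mat3} {c : E3} {s r σ : ℝ}
    (h : Good p a c s r) : matOf a (theta p a A c s r σ) = A :=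
  contr_tens (fun l => sec_ne_zero (h.secDen_uvec_pos l)) A

/-- On the image of `alpha` both `s` and the radii at the points of `P` are positive. Only `X_ad`
and the face over `0` pass through this region, given by `|Im Z| = 1` and `r = 0`. -/
theorem alpha_mem_bdry (hp : ∀ ν, δ < ‖p ν‖) {Z : Fin 3 → ℂ} {r : ℝ} (hq : (Z, r) ∈ DomA δ) :
    (alpha p Z r ∈ bdry k ↔ r = 0 ∨ ‖imPart Z‖ = 1) ∧
    (alpha p Z r ∈ corn k ↔ r = 0 ∧ ‖imPart Z‖ = 1) ∧ (alpha p Z r).1.2 ≠ 0 ∧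
    ((alpha p Z r).2.1 = 0 ↔ ‖imPart Z‖ = 1) ∧ ((alpha p Z r).2.2.1 none = 0 ↔ r = 0) ∧
    ∀ l, (alpha p Z r).2.2.1 (some l) ≠ 0 := by
  have h0 := (sqrt_one_add_pos r).ne'
  have hs : (alpha p Z r).1.2 ≠ 0 := inv_ne_zero h0
  have hr : (alpha p Z r).2.2.1 none = 0 ↔ r = 0 := by
    rw [alpha_r]
    simp [h0]
  have hl : ∀ l, (alpha p Z r).2.2.1 (some l) ≠ 0 := fun l => alpha_rad_ne hp hq l
  have ht : (alpha p Z r).2.1 = 0 ↔ ‖imPart Z‖ = 1 := by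
    have h1 : sigh (alpha p Z r) = 0 ↔ (alpha p Z r).2.1 = 0 := by
      rw [sigh, mul_eq_zero, or_iff_left (Finset.prod_ne_zero_iff.2 fun l _ => hl l)]
    rw [← h1, sigh_alpha hp hq, mul_eq_zero, or_iff_left h0, sub_eq_zero, eq_comm,
      pow_eq_one_iff_of_nonneg (norm_nonneg _) two_ne_zero]
  refine ⟨?_, ?_, hs, ht, hr, hl⟩
  · rw [bdry, mem_ofPred_eq, or_iff_right hs, ht, or_comm]
    refine or_congr_left ⟨?_, fun h => ⟨none, hr.2 h⟩⟩
    rintro ⟨_ | l, h⟩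
    · exact hr.1 h
    · exact absurd h (hl l)
  · rw [corn, mem_ofPred_eq, or_iff_right hs, ht, and_comm]
    refine and_congr_left fun _ => ⟨?_, fun h => ⟨none, hr.2 h⟩⟩
    rintro ⟨_ | l, h⟩
    · exact hr.1 h
    · exact absurd h (hl l)

/-- The inverse of `alpha`, given a local inverse of `sq`. -/
def coordA (p : Fin k → E3) (lam : Mat3 → Fin 3 → ℂ) (x : Amb k) : (Fin 3 → ℂ) × ℝ :=
  (unscl (1 - x.1.2 * sigh x) (lam (matOf (aref p) x)), x.2.2.1 none / x.1.2)

theorem coordA_alpha (hp : ∀ ν, δ < ‖p ν‖) (lam : Mat3 → Fin 3 → ℂ) {Z : Fin 3 → ℂ} {r : ℝ}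
    (hq : (Z, r) ∈ DomA δ) :
    coordA p lam (alpha p Z r) = (unscl (‖imPart Z‖ ^ 2) (lam (sq (scl Z))), r) := by
  have h5 : (alpha p Z r).2.2.1 none / (alpha p Z r).1.2 = r := by
    rw [alpha_r, alpha_s]
    exact mul_div_cancel_right₀ _ (inv_pos.2 (sqrt_one_add_pos r)).ne'
  rw [coordA, h5, sig_alpha hp hq, matOf, contr_alpha hp hq, sub_sub_cancel]

theorem contDiffOn_coordA (p : Fin k → E3) {lam : Mat3 → Fin 3 → ℂ} {N : Set Mat3}
    (hl : ContDiffOn ℝ ∞ lam N) :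
    ContDiffOn ℝ ∞ (coordA p lam) ({x | 0 < x.1.2} ∩ (secDom (aref p) ∩ matOf (aref p) ⁻¹' N)) := by
  refine ContDiffOn.prodMk (contDiffOn_unscl ?_ (hl.comp ((contDiffOn_matOf _).mono
    fun x hx => hx.2.1) fun x hx => hx.2.2)) ?_
  · apply ContDiff.contDiffOn
    fun_prop
  · simp only [div_eq_mul_inv]
    refine ContDiffOn.mul (by fun_prop) (ContDiffOn.inv (by fun_prop) fun x hx => ?_)
    have : 0 < x.1.2 := hx.1
    exact this.ne'

theorem alpha_mem_secDom (hp : ∀ ν, δ < ‖p ν‖) {Z : Fin 3 → ℂ} {r : ℝ}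
    (hq : (Z, r) ∈ DomA δ) : alpha p Z r ∈ secDom (aref p) := by
  have h := good_alpha hp hq
  rw [alpha]
  exact theta_mem_secDom h

/-- The matrix factor, `1 / |x'|` and `r` can be read off from a point, so `alpha` is injective up
to `Z ↦ -Z`. A local inverse of `sq` selects the sheet. -/
theorem locDiffeo_alpha (hp : ∀ ν, δ < ‖p ν‖) (hδ : δ < 1 / 2) {Z : Fin 3 → ℂ} {r : ℝ}
    (hq : (Z, r) ∈ DomA δ) (hr : r * (1 - ‖imPart Z‖ ^ 2) < δ ^ 2) :
    LocDiffeo (total p δ) (alpha p Z r) (AHhatBar ×ˢ Ici (0 : ℝ)) (Z, r) := by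
  obtain ⟨lam, N, N', hN, hN', m1, m2, hl, l1, l2⟩ := exists_local_lift (scl_ne_zero hq.1)
  -- On the neighbourhood of the matrix the local lift is only known to be a lift, hence the sign.
  -- It is harmless in one direction because `alpha` is even; in the other, `N'` excludes it.
  have hcA : ∀ Z r, (Z, r) ∈ DomA δ → sq (scl Z) ∈ N →
      coordA p lam (alpha p Z r) = (Z, r) ∨ coordA p lam (alpha p Z r) = (-Z, r) := by
    intro Z r hq hqN
    rw [coordA_alpha hp lam hq]
    rcases (sq_eq_sq_iff _ _).1 (l2 _ hqN) with h7 | h7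
    · left
      rw [h7, unscl_scl]
    · right
      rw [h7, unscl_neg, unscl_scl]
  have hcA' : ∀ Z r, (Z, r) ∈ DomA δ → scl Z ∈ N' → coordA p lam (alpha p Z r) = (Z, r) := by
    intro Z r hq hqN
    rw [coordA_alpha hp lam hq, l1 _ hqN, unscl_scl]
  obtain ⟨U, hUd⟩ : ∃ U : Set (Amb k), U = {x : Amb k | x.2.2.1 none < δ * x.1.2} ∩
      ({x | 0 < x.1.2} ∩ (secDom (aref p) ∩ matOf (aref p) ⁻¹' N)) := ⟨_, rfl⟩
  obtain ⟨U', hUd'⟩ : ∃ U' : Set ((Fin 3 → ℂ) × ℝ), U' = {q : (Fin 3 → ℂ) × ℝ | q.2 < δ} ∩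
      {q | q.2 * (1 - ‖imPart q.1‖ ^ 2) < δ ^ 2} ∩ (fun q => scl q.1) ⁻¹' N' := ⟨_, rfl⟩
  have hU : IsOpen U := by
    rw [hUd]
    exact (isOpen_lt (by fun_prop) (by fun_prop)).inter
      ((isOpen_lt (by fun_prop) (by fun_prop)).inter
        ((contDiffOn_matOf _).continuousOn.isOpen_inter_preimage (isOpen_secDom _) hN))
  have hU' : IsOpen U' := by
    rw [hUd']
    have h1 := contDiff_imPart.continuous
    exact ((isOpen_lt (by fun_prop) (by fun_prop)).inter (isOpen_lt (by fun_prop)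
      (by fun_prop))).inter (hN'.preimage (contDiff_scl.continuous.comp continuous_fst))
  have hB : ∀ q ∈ (AHhatBar ×ˢ Ici (0 : ℝ)) ∩ U', (q.1, q.2) ∈ DomA δ ∧
      q.2 * (1 - ‖imPart q.1‖ ^ 2) < δ ^ 2 ∧ scl q.1 ∈ N' := by
    rintro ⟨Z, r⟩ ⟨⟨h1, h2⟩, h3⟩
    rw [hUd'] at h3
    exact ⟨⟨h1, h2, h3.1.1⟩, h3.1.2, h3.2⟩
  have hA : ∀ x ∈ total p δ ∩ U, ∃ Z r, (Z, r) ∈ DomA δ ∧ x = alpha p Z r ∧ 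
      sq (scl Z) ∈ N := by
    rintro x ⟨h1, h2⟩
    rw [hUd] at h2
    obtain ⟨Z', r', hq', hr', rfl⟩ := (isInner_iff hp hδ h1).2 h2.1
    refine ⟨Z', r', hq', rfl, ?_⟩
    have := h2.2.2.2
    rwa [mem_preimage, matOf, contr_alpha hp hq'] at this
  have haU : alpha p Z r ∈ U := by
    rw [hUd]
    refine ⟨IsInner.lt ⟨Z, r, hq, hr, rfl⟩, inv_pos.2 (sqrt_one_add_pos r),
      alpha_mem_secDom hp hq, ?_⟩
    rw [mem_preimage, matOf, contr_alpha hp hq]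
    exact m1
  have hbU : (Z, r) ∈ U' := by
    rw [hUd']
    exact ⟨⟨hq.2.2, hr⟩, m2⟩
  have h1 : ContDiffOn ℝ ∞ (coordA p lam) (total p δ ∩ U) :=
    (contDiffOn_coordA p hl).mono fun x hx => (hUd ▸ hx.2 :).2
  have h2 : ContDiffOn ℝ ∞ (fun q : (Fin 3 → ℂ) × ℝ => alpha p q.1 q.2)
      ((AHhatBar ×ˢ Ici (0 : ℝ)) ∩ U') := (contDiffOn_alpha hp).mono fun q hq => (hB q hq).1
  have h3 : MapsTo (coordA p lam) (total p δ ∩ U) (AHhatBar ×ˢ Ici (0 : ℝ)) := by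
    intro x hx
    obtain ⟨Z', r', hq', rfl, hm⟩ := hA x hx
    rcases hcA _ _ hq' hm with h | h
    · exact h ▸ ⟨hq'.1, hq'.2.1⟩
    · refine h ▸ ⟨⟨?_, ?_, ?_⟩, hq'.2.1⟩
      · simp [hq'.1.1]
      · simp [hq'.1.2.1]
      · simpa using hq'.1.2.2
  have h4 : MapsTo (fun q : (Fin 3 → ℂ) × ℝ => alpha p q.1 q.2)
      ((AHhatBar ×ˢ Ici (0 : ℝ)) ∩ U') (total p δ) := fun q hq =>
    Or.inr ⟨q.1, q.2, (hB q hq).1, (hB q hq).2.1, rfl⟩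
  have h5 : ∀ x ∈ total p δ ∩ U, coordA p lam x ∈ U' →
      alpha p (coordA p lam x).1 (coordA p lam x).2 = x := by
    intro x hx _
    obtain ⟨Z', r', hq', rfl, hm⟩ := hA x hx
    rcases hcA _ _ hq' hm with h | h
    · rw [h]
    · rw [h, alpha_neg]
  exact LocDiffeo.of_inverse (coordA p lam) (fun q => alpha p q.1 q.2) hU hU'
    (Or.inr ⟨Z, r, hq, hr, rfl⟩) haU hbU h1 h2 h3 h4 h5
    (fun q hq _ => hcA' q.1 q.2 (hB q hq).1 (hB q hq).2.2) (hcA' Z r hq m2)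

theorem chart_alpha (hp : ∀ ν, δ < ‖p ν‖) (hδ : δ < 1 / 2) {x : Amb k}
    (hx : IsInner p δ x) : ∃ e : E5, LocDiffeo (total p δ) x quad e ∧
      (x ∈ bdry k ↔ e.1 0 = 0 ∨ e.2 0 = 0) ∧ (x ∈ corn k ↔ e.1 0 = 0 ∧ e.2 0 = 0) := by
  have hxt : x ∈ total p δ := Or.inr hx
  obtain ⟨Z, r, hq, hr, rfl⟩ := hx
  obtain ⟨e₄, he, he'⟩ := exists_locDiffeo_AHhatBar hq.1
  obtain ⟨e, h1, h2, h3⟩ := exists_locDiffeo_quad he hq.2.1 hq.1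
  refine ⟨e, (locDiffeo_alpha hp hδ hq hr).trans h1 hxt, ?_, ?_⟩
  · rw [h2, h3, he', (alpha_mem_bdry hp hq).1]
  · rw [h2, h3, he', (alpha_mem_bdry hp hq).2.1]

end Charts

/-! ### Charts at points that do not lie over `P ∪ {0}`, including those at infinity. -/

section PolarCharts

variable {k : ℕ} {p : Fin k → E3} {δ : ℝ}

/-- The vectors `n - i v` for which `(n, v)` is orthonormal, together with a point of a half
circle. -/
def polSet : Set ((Fin 3 → ℂ) × ℝ × ℝ) :=
  {q | (‖rePart q.1‖ = 1 ∧ ‖imPart q.1‖ = 1 ∧ inner ℝ (rePart q.1) (imPart q.1) = 0) ∧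
    q.2.1 ^ 2 + q.2.2 ^ 2 = 1 ∧ 0 ≤ q.2.1}

theorem polSet_eq : polSet = {q | (((‖rePart q.1‖ ^ 2 - 1, ‖imPart q.1‖ ^ 2 - 1),
    (inner ℝ (rePart q.1) (imPart q.1), q.2.1 ^ 2 + q.2.2 ^ 2 - 1)) : (ℝ × ℝ) × ℝ × ℝ) = 0
    ∧ 0 ≤ q.2.1} := by
  ext q
  simp only [polSet, mem_ofPred_eq, Prod.mk_eq_zero, sub_eq_zero,
    pow_eq_one_iff_of_nonneg (norm_nonneg (rePart q.1)) two_ne_zero,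
    pow_eq_one_iff_of_nonneg (norm_nonneg (imPart q.1)) two_ne_zero, and_assoc]

/-- Four independent equations in `ℝ⁸`: the orthonormality of the frame and the equation of the
circle. -/
theorem exists_locDiffeo_polSet {q : (Fin 3 → ℂ) × ℝ × ℝ} (hq : q ∈ polSet) :
    ∃ e, LocDiffeo polSet q half4 e ∧ (e 0 = 0 ↔ q.2.1 = 0) := by
  obtain ⟨⟨g1, g2, g3⟩, g4, g5⟩ := hq
  have k1 : HasFDerivAt (fun q : (Fin 3 → ℂ) × ℝ × ℝ => rePart q.1)
      (reL ∘L ContinuousLinearMap.fst ℝ (Fin 3 → ℂ) (ℝ × ℝ)) q :=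
    (hasFDerivAt_rePart q.1).comp q hasFDerivAt_fst
  have k2 : HasFDerivAt (fun q : (Fin 3 → ℂ) × ℝ × ℝ => imPart q.1)
      (imL ∘L ContinuousLinearMap.fst ℝ (Fin 3 → ℂ) (ℝ × ℝ)) q :=
    (hasFDerivAt_imPart q.1).comp q hasFDerivAt_fst
  have k3 : HasFDerivAt (fun q : (Fin 3 → ℂ) × ℝ × ℝ => q.2.1)
      (ContinuousLinearMap.fst ℝ ℝ ℝ ∘L ContinuousLinearMap.snd ℝ (Fin 3 → ℂ) (ℝ × ℝ)) q :=
    (hasFDerivAt_fst (p := q.2)).comp q hasFDerivAt_snd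
  have k4 : HasFDerivAt (fun q : (Fin 3 → ℂ) × ℝ × ℝ => q.2.2)
      (ContinuousLinearMap.snd ℝ ℝ ℝ ∘L ContinuousLinearMap.snd ℝ (Fin 3 → ℂ) (ℝ × ℝ)) q :=
    (hasFDerivAt_snd (p := q.2)).comp q hasFDerivAt_snd
  have h4 := ((k1.norm_sq.sub_const 1).prodMk (k2.norm_sq.sub_const 1)).prodMk
    ((k1.inner ℝ k2).prodMk (((k3.pow 2).add (k4.pow 2)).sub_const 1))
  have hin : inner ℝ (imPart q.1) (rePart q.1) = 0 := by rw [real_inner_comm]; exact g3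
  have hre : ContDiff ℝ ∞ fun q : (Fin 3 → ℂ) × ℝ × ℝ => rePart q.1 :=
    contDiff_rePart.comp contDiff_fst
  have him : ContDiff ℝ ∞ fun q : (Fin 3 → ℂ) × ℝ × ℝ => imPart q.1 :=
    contDiff_imPart.comp contDiff_fst
  have hfin : Module.finrank ℝ ((Fin 3 → ℂ) × ℝ × ℝ) =
      Module.finrank ℝ ((ℝ × ℝ) × ℝ × ℝ) + 4 := by
    simp [Module.finrank_pi_fintype]
  obtain ⟨e, he, he'⟩ := locDiffeo_levelSet
    (f := fun q : (Fin 3 → ℂ) × ℝ × ℝ => (((‖rePart q.1‖ ^ 2 - 1, ‖imPart q.1‖ ^ 2 - 1),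
      (inner ℝ (rePart q.1) (imPart q.1), q.2.1 ^ 2 + q.2.2 ^ 2 - 1)) : (ℝ × ℝ) × ℝ × ℝ))
    (g := fun q => q.2.1)
    ((((hre.norm_sq ℝ).sub contDiff_const).prodMk ((him.norm_sq ℝ).sub contDiff_const)).prodMk
      ((hre.inner ℝ him).prodMk (by fun_prop))) (by fun_prop) h4 k3
    (by simp [g1, g2, g3, g4]) g5
    (by
      rintro ⟨⟨y₁, y₂⟩, y₃, y₄⟩
      -- The two halved multiples adjust the norms, the `y₃`-term adjusts the inner product, and the
      -- radial vector of the circle adjusts the last equation.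
      refine ⟨(cvec ((y₁ / 2) • rePart q.1 + y₃ • imPart q.1) ((y₂ / 2) • imPart q.1),
        (y₄ / 2 * q.2.1, y₄ / 2 * q.2.2)), ?_⟩
      refine Prod.ext (Prod.ext ?_ ?_) (Prod.ext ?_ ?_)
      · simp [inner_smul_right, g1, g3, inner_add_right]
        ring
      · simp [inner_smul_right, g2]
        ring
      · simp [inner_smul_right, fderivInnerCLM_apply, inner_smul_left, g3, inner_add_left, g2]
      · simp
        linear_combination y₄ * g4)
    (by
      intro h
      refine ⟨(0, (1, 0)), ?_, by simp⟩
      have h1 : rePart 0 = 0 := reL.map_zero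
      have h2 : imPart 0 = 0 := imL.map_zero
      simp [h, h1, h2]) hfin
  exact ⟨e, polSet_eq ▸ he, he'⟩

/-- The parametrization of a neighbourhood of a point which does not lie over a point of
`P ∪ {0}`. -/
def gam (p : Fin k → E3) (a : Nut k → Fin 2 → ℂ) (q : ((Fin 3 → ℂ) × ℝ × ℝ) × ℝ) : Amb k :=
  theta p a (sq q.1.1) (-cross (rePart q.1.1) (imPart q.1.1)) q.1.2.1 q.1.2.2 (q.2 / q.1.2.2)

/-- The domain of `gam`. -/
def DomG (p : Fin k → E3) (a : Nut k → Fin 2 → ℂ) (δ : ℝ) : Set (((Fin 3 → ℂ) × ℝ × ℝ) × ℝ) :=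
  {q | (Good p a (-cross (rePart q.1.1) (imPart q.1.1)) q.1.2.1 q.1.2.2 ∧ 0 < q.1.2.2) ∧
    q.2 < δ ^ 2 ∧ q.1.2.1 * q.2 < δ * q.1.2.2}

theorem isOpen_good {X : Type*} [TopologicalSpace X] {a : Nut k → Fin 2 → ℂ} {c : X → E3}
    {s r : X → ℝ} (hc : Continuous c) (hs : Continuous s) (hr : Continuous r) :
    IsOpen {x | Good p a (c x) (s x) (r x)} := by
  simp only [Good, ofPred_forall]
  refine isOpen_iInter_of_finite fun l => isOpen_lt continuous_const
    ((continuous_secDen (a l)).comp ?_)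
  unfold dvec
  fun_prop

theorem contDiff_axis : ContDiff ℝ ∞ fun w : Fin 3 → ℂ => -cross (rePart w) (imPart w) :=
  contDiffOn_univ.1 (contDiff_rePart.contDiffOn.cross_E3 contDiff_imPart.contDiffOn).neg

theorem isOpen_DomG (a : Nut k → Fin 2 → ℂ) : IsOpen (DomG p a δ) := by
  have h := contDiff_axis.continuous
  have h1 : IsOpen {q : ((Fin 3 → ℂ) × ℝ × ℝ) × ℝ |
      Good p a (-cross (rePart q.1.1) (imPart q.1.1)) q.1.2.1 q.1.2.2} :=
    isOpen_good (h.comp (by fun_prop)) (by fun_prop) (by fun_prop)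
  have h2 : IsOpen {q : ((Fin 3 → ℂ) × ℝ × ℝ) × ℝ | 0 < q.1.2.2} :=
    isOpen_lt (by fun_prop) (by fun_prop)
  have h3 : IsOpen {q : ((Fin 3 → ℂ) × ℝ × ℝ) × ℝ | q.2 < δ ^ 2} :=
    isOpen_lt (by fun_prop) (by fun_prop)
  have h4 : IsOpen {q : ((Fin 3 → ℂ) × ℝ × ℝ) × ℝ | q.1.2.1 * q.2 < δ * q.1.2.2} :=
    isOpen_lt (by fun_prop) (by fun_prop)
  exact (h1.inter h2).inter (h3.inter h4)

theorem contDiffOn_gam (a : Nut k → Fin 2 → ℂ) : ContDiffOn ℝ ∞ (gam p a) (DomG p a δ) := by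
  refine contDiffOn_theta ?_ ?_ (by fun_prop) (by fun_prop) ?_ fun q hq => hq.1.1
  · exact (contDiff_sq.comp (contDiff_fst.comp contDiff_fst)).contDiffOn
  · exact (contDiff_axis.comp (contDiff_fst.comp contDiff_fst)).contDiffOn
  · simp only [div_eq_mul_inv]
    exact ContDiffOn.mul (by fun_prop) (ContDiffOn.inv (by fun_prop) fun q hq => hq.1.2.ne')

theorem isOuter_gam {a : Nut k → Fin 2 → ℂ} {q : ((Fin 3 → ℂ) × ℝ × ℝ) × ℝ}
    (hq : q ∈ (polSet ×ˢ Ici (0 : ℝ)) ∩ DomG p a δ) : IsOuter p δ (gam p a q) := by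
  obtain ⟨⟨⟨⟨g1, g2, g3⟩, g4, g5⟩, g6 : 0 ≤ q.2⟩, ⟨g7, g8⟩, g9, g10⟩ := hq
  obtain ⟨h1, h2⟩ := isNullFrame_of_orthonormal g1 g2 g3
  refine isOuter_theta g7 h2 (by linarith) g5 g8.le (div_nonneg g6 g8.le) ?_ ?_ h1
  · rwa [mul_div_cancel₀ _ g8.ne']
  · rwa [← mul_div_assoc, div_lt_iff₀ g8]

/-- The inverse of `gam`, given a local inverse of `sq`. -/
def coordG (a : Nut k → Fin 2 → ℂ) (lam : Mat3 → Fin 3 → ℂ) (x : Amb k) :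
    ((Fin 3 → ℂ) × ℝ × ℝ) × ℝ := ((lam (matOf a x), x.1.2, x.2.2.1 none), eps x)

theorem coordG_gam {a : Nut k → Fin 2 → ℂ} {q : ((Fin 3 → ℂ) × ℝ × ℝ) × ℝ}
    (hq : q ∈ DomG p a δ) (lam : Mat3 → Fin 3 → ℂ) :
    coordG a lam (gam p a q) = ((lam (sq q.1.1), q.1.2.1, q.1.2.2), q.2) := by
  rw [coordG]
  refine Prod.ext (Prod.ext ?_ rfl) ?_
  · exact congrArg lam (matOf_theta hq.1.1)
  · change eps (gam p a q) = q.2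
    rw [gam, eps_theta fun l => (hq.1.1.rad_pos l).ne', mul_div_cancel₀ _ hq.1.2.ne']

theorem IsOuter.exists_eq_gam {x : Amb k} (h : IsOuter p δ x) {a : Nut k → Fin 2 → ℂ}
    (hG : Good p a (x.2.2.2.1 none) x.1.2 (x.2.2.1 none)) (h0 : 0 < x.2.2.1 none) :
    ∃ w, (((w, x.1.2, x.2.2.1 none), eps x) : ((Fin 3 → ℂ) × ℝ × ℝ) × ℝ) ∈
      (polSet ×ˢ Ici (0 : ℝ)) ∩ DomG p a δ ∧ x = gam p a ((w, x.1.2, x.2.2.1 none), eps x) := by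
  obtain ⟨w, hw, e⟩ := h.exists_eq_theta hG
  obtain ⟨w1, w2, w3, w4⟩ := (isNullFrame_iff h.norm_none).1 hw
  have hrs := h.sq_add_sq
  have hc : -cross (rePart w) (imPart w) = x.2.2.2.1 none := by rw [w4, neg_neg]
  have hsig : eps x / x.2.2.1 none = sigh x := by
    rw [eps_eq_none, mul_div_cancel_left₀ _ h0.ne']
  refine ⟨w, ⟨⟨⟨⟨w1, w2, w3⟩, by linarith, h.base.2⟩, ?_⟩, ⟨?_, h0⟩, h.eps_lt, ?_⟩, ?_⟩
  · exact mul_nonneg h.t_nonneg (Finset.prod_nonneg fun l _ => h.r_nonneg l)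
  · rwa [hc]
  · have := mul_lt_mul_of_pos_right h.sig_lt h0
    rw [eps_eq_none]
    linarith
  · rw [gam, hsig, hc]
    exact e

theorem IsOuter.mem_secDom {x : Amb k} (h : IsOuter p δ x) {a : Nut k → Fin 2 → ℂ}
    (hG : Good p a (x.2.2.2.1 none) x.1.2 (x.2.2.1 none)) : x ∈ secDom a := by
  intro l
  have h1 := hG l
  rw [h.dvec_eq, secDen_smul _ (h.r_nonneg _)] at h1
  exact pos_of_mul_pos_right h1 (h.r_nonneg _)

/-- As in `locDiffeo_alpha`, with the null frame `w` itself, `(s, r_0)` on a half circle and `ε` as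
coordinates; the sign of `w` is again fixed by a local inverse of `sq`. -/
theorem locDiffeo_gam (hp : ∀ ν, δ < ‖p ν‖) (hδ : δ < 1 / 2) {a : Nut k → Fin 2 → ℂ}
    {q : ((Fin 3 → ℂ) × ℝ × ℝ) × ℝ} (hq : q ∈ (polSet ×ˢ Ici (0 : ℝ)) ∩ DomG p a δ) :
    LocDiffeo (total p δ) (gam p a q) (polSet ×ˢ Ici (0 : ℝ)) q := by
  have hw0 : q.1.1 ≠ 0 := by
    obtain ⟨h1, h2⟩ := isNullFrame_of_orthonormal hq.1.1.1.1 hq.1.1.1.2.1 hq.1.1.1.2.2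
    exact h1.ne_zero h2
  obtain ⟨lam, N, N', hN, hN', m1, m2, hl, l1, l2⟩ := exists_local_lift hw0
  obtain ⟨U, hUd⟩ : ∃ U : Set (Amb k), U = ({x : Amb k | x.1.2 * sigh x < δ} ∩
      {x | Good p a (x.2.2.2.1 none) x.1.2 (x.2.2.1 none)} ∩ {x | 0 < x.2.2.1 none}) ∩
      (secDom a ∩ matOf a ⁻¹' N) := ⟨_, rfl⟩
  have hU : IsOpen U := by
    rw [hUd]
    exact (((isOpen_lt (by fun_prop) (by fun_prop)).inter
      (isOpen_good (by fun_prop) (by fun_prop) (by fun_prop))).inter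
      (isOpen_lt (by fun_prop) (by fun_prop))).inter
        ((contDiffOn_matOf _).continuousOn.isOpen_inter_preimage (isOpen_secDom _) hN)
  have hU' : IsOpen (DomG p a δ ∩ (fun q => q.1.1) ⁻¹' N') :=
    (isOpen_DomG a).inter (hN'.preimage (by fun_prop))
  have hA : ∀ x ∈ total p δ ∩ U, ∃ w, (((w, x.1.2, x.2.2.1 none), eps x) :
      ((Fin 3 → ℂ) × ℝ × ℝ) × ℝ) ∈ (polSet ×ˢ Ici (0 : ℝ)) ∩ DomG p a δ ∧
      x = gam p a ((w, x.1.2, x.2.2.1 none), eps x) ∧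
      (coordG a lam x = ((w, x.1.2, x.2.2.1 none), eps x) ∨
       coordG a lam x = ((-w, x.1.2, x.2.2.1 none), eps x)) := by
    rintro x ⟨h1, h2⟩
    rw [hUd] at h2
    obtain ⟨⟨⟨h3, h4⟩, h5⟩, h6, h7⟩ := h2
    obtain ⟨w, hw, e⟩ := ((isOuter_iff hp hδ h1).2 h3).exists_eq_gam h4 h5
    refine ⟨w, hw, e, ?_⟩
    have hm : matOf a x = sq w := by
      rw [e]
      exact matOf_theta hw.2.1.1
    rw [mem_preimage, hm] at h7
    rw [coordG, hm]
    rcases (sq_eq_sq_iff _ _).1 (l2 _ h7) with h8 | h8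
    · exact Or.inl (by rw [h8])
    · exact Or.inr (by rw [h8])
  have hneg' : ∀ q : ((Fin 3 → ℂ) × ℝ × ℝ) × ℝ, gam p a ((-q.1.1, q.1.2), q.2) = gam p a q :=
    fun q => by
      simp only [gam, sq_neg, rePart_neg, imPart_neg, cross_neg_left, cross_neg_right, neg_neg]
  have haU : gam p a q ∈ U := by
    rw [hUd]
    have ho := isOuter_gam hq
    refine ⟨⟨⟨ho.sig_lt, hq.2.1.1⟩, hq.2.1.2⟩, ho.mem_secDom hq.2.1.1, ?_⟩
    rw [mem_preimage, gam, matOf_theta hq.2.1.1]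
    exact m1
  have h1 : ContDiffOn ℝ ∞ (coordG a lam) (total p δ ∩ U) := by
    have h2 : ∀ x ∈ total p δ ∩ U, x ∈ secDom a ∩ matOf a ⁻¹' N := fun x hx => (hUd ▸ hx.2 :).2
    refine ContDiffOn.prodMk (ContDiffOn.prodMk (hl.comp ((contDiffOn_matOf a).mono
      fun x hx => (h2 x hx).1) fun x hx => (h2 x hx).2) (by fun_prop)) contDiff_eps.contDiffOn
  have h3 : MapsTo (coordG a lam) (total p δ ∩ U) (polSet ×ˢ Ici (0 : ℝ)) := by
    intro x hx
    obtain ⟨w, hw, -, e | e⟩ := hA x hx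
    · rw [e]
      exact hw.1
    · rw [e]
      obtain ⟨⟨⟨g1, g2, g3⟩, g4⟩, g5⟩ := hw.1
      refine ⟨⟨⟨?_, ?_, ?_⟩, g4⟩, g5⟩
      · simpa using g1
      · simpa using g2
      · simpa using g3
  have h5 : ∀ x ∈ total p δ ∩ U, coordG a lam x ∈ DomG p a δ ∩ (fun q => q.1.1) ⁻¹' N' →
      gam p a (coordG a lam x) = x := by
    intro x hx _
    obtain ⟨w, hw, e', e | e⟩ := hA x hx
    · rw [e]
      exact e'.symm
    · rw [e]
      exact (hneg' ((w, x.1.2, x.2.2.1 none), eps x)).trans e'.symm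
  exact LocDiffeo.of_inverse (coordG a lam) (gam p a) hU hU' (Or.inl (isOuter_gam hq)) haU
    ⟨hq.2, m2⟩ h1 ((contDiffOn_gam a).mono fun q hq => hq.2.1) h3
    (fun q hq => Or.inl (isOuter_gam ⟨hq.1, hq.2.1⟩)) h5
    (fun q hq _ => by rw [coordG_gam hq.2.1, l1 _ hq.2.2]) (by rw [coordG_gam hq.2, l1 _ m2])

/-- A spinor over the vector in question gives a section defined near that vector. -/
theorem exists_good {c : E3} {s r : ℝ} (h : ∀ l, dvec p c s r l ≠ 0) :
    ∃ a : Nut k → Fin 2 → ℂ, Good p a c s r := by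
  choose a ha using fun l => exists_hopf_eq (dvec p c s r l)
  refine ⟨a, fun l => ?_⟩
  rw [← ha l]
  refine secDen_pos_self fun h0 => h l ?_
  rw [← ha l, h0, hopf_eq_zero.2 rfl]

/-- All radii are positive here, so `t` and `ε` vanish together: the half-line coordinate `ε`
describes `X_ad`, and the half-circle coordinate `s` describes `I_∞`. -/
theorem chart_gam (hp : ∀ ν, δ < ‖p ν‖) (hδ : δ < 1 / 2) {x : Amb k} (hx : IsOuter p δ x)
    (h0 : x.2.2.1 none ≠ 0)
    (hd : ∀ l, dvec p (x.2.2.2.1 none) x.1.2 (x.2.2.1 none) l ≠ 0) :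
    ∃ e : E5, LocDiffeo (total p δ) x quad e ∧
      (x ∈ bdry k ↔ e.1 0 = 0 ∨ e.2 0 = 0) ∧ (x ∈ corn k ↔ e.1 0 = 0 ∧ e.2 0 = 0) := by
  obtain ⟨a, ha⟩ := exists_good hd
  obtain ⟨w, hw, e⟩ := hx.exists_eq_gam ha ((hx.r_nonneg none).lt_of_ne' h0)
  have hne : ∀ l, x.2.2.1 l ≠ 0 := by
    rintro (_ | l)
    · exact h0
    · intro h
      apply hd l
      rw [hx.dvec_eq, h, zero_smul]
  obtain ⟨e₄, he, he'⟩ := exists_locDiffeo_polSet hw.1.1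
  obtain ⟨e₅, h1, h2, h3⟩ := exists_locDiffeo_quad he hw.1.2 hw.1.1
  have h4 := (locDiffeo_gam hp hδ hw).trans h1 (e ▸ Or.inl hx)
  rw [← e] at h4
  have ht : eps x = 0 ↔ x.2.1 = 0 := by
    rw [eps, mul_eq_zero, or_iff_left (Finset.prod_ne_zero_iff.2 fun l _ => hne l)]
  refine ⟨e₅, h4, ?_, ?_⟩
  · rw [h2, h3, he', ht, bdry, mem_ofPred_eq, or_comm (a := x.2.1 = 0)]
    simp [hne]
    tauto
  · rw [h2, h3, he', ht, corn, mem_ofPred_eq]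
    simp [hne]

end PolarCharts

/-! ### Charts around the faces over the points of `P`. -/

section NutCharts

variable {k : ℕ} {p : Fin k → E3} {δ : ℝ}

/-- A half sphere, in the coordinates adapted to the Hopf map. -/
def nutSet : Set ((Fin 2 → ℂ) × ℝ) := {q | nsq q.1 ^ 2 + q.2 ^ 2 = 1 ∧ 0 ≤ q.2}

theorem nutSet_eq : nutSet = {q | (‖q.1 0‖ ^ 2 + ‖q.1 1‖ ^ 2) ^ 2 + q.2 ^ 2 - 1 = 0 ∧ 0 ≤ q.2} := by
  ext q
  simp only [nutSet, nsq, mem_ofPred_eq, sub_eq_zero]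

/-- The half-sphere `{|v|² + σ² = 1, σ ≥ 0}` pulled back by the Hopf map. The single equation is
regular also at `z = 0`, where the Hopf map is not a submersion, because `σ = 1` there. -/
theorem exists_locDiffeo_nutSet {q : (Fin 2 → ℂ) × ℝ} (hq : q ∈ nutSet) :
    ∃ e, LocDiffeo nutSet q half4 e ∧ (e 0 = 0 ↔ q.2 = 0) := by
  have k0 : ∀ i, HasFDerivAt (fun q : (Fin 2 → ℂ) × ℝ => q.1 i)
      (ContinuousLinearMap.proj (R := ℝ) (φ := fun _ : Fin 2 => ℂ) i ∘L
        ContinuousLinearMap.fst ℝ (Fin 2 → ℂ) ℝ) q := fun i =>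
    ((ContinuousLinearMap.proj (R := ℝ) (φ := fun _ : Fin 2 => ℂ) i).hasFDerivAt).comp q
      hasFDerivAt_fst
  have k3 : HasFDerivAt (fun q : (Fin 2 → ℂ) × ℝ => q.2)
      (ContinuousLinearMap.snd ℝ (Fin 2 → ℂ) ℝ) q := hasFDerivAt_snd
  have h4 := ((((k0 0).norm_sq.add (k0 1).norm_sq).pow 2).add (k3.pow 2)).sub_const 1
  have hfin : Module.finrank ℝ ((Fin 2 → ℂ) × ℝ) = Module.finrank ℝ ℝ + 4 := by
    simp [Module.finrank_pi_fintype]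
  have hpi : ∀ i, ContDiff ℝ ∞ fun q : (Fin 2 → ℂ) × ℝ => q.1 i := fun i => by fun_prop
  have hq1 : (‖q.1 0‖ ^ 2 + ‖q.1 1‖ ^ 2) ^ 2 + q.2 ^ 2 = 1 := hq.1
  obtain ⟨e, he, he'⟩ := locDiffeo_levelSet
    (f := fun q : (Fin 2 → ℂ) × ℝ => (‖q.1 0‖ ^ 2 + ‖q.1 1‖ ^ 2) ^ 2 + q.2 ^ 2 - 1)
    (g := fun q => q.2)
    ((((((hpi 0).norm_sq ℝ).add ((hpi 1).norm_sq ℝ)).pow 2).add (contDiff_snd.pow 2)).sub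
      contDiff_const) contDiff_snd h4 k3 (sub_eq_zero.2 hq.1) hq.2
    (by
      intro y
      have h0 : 0 < 4 * (‖q.1 0‖ ^ 2 + ‖q.1 1‖ ^ 2) ^ 2 + 2 * q.2 ^ 2 := by nlinarith
      -- Along the point itself the derivative of `|z|⁴ + σ²` is `4 |z|⁴ + 2 σ²`, which is positive.
      refine ⟨(y / (4 * (‖q.1 0‖ ^ 2 + ‖q.1 1‖ ^ 2) ^ 2 + 2 * q.2 ^ 2)) • q, ?_⟩
      simp [inner_smul_right]
      field_simp
      ring)
    (by
      intro h
      refine ⟨(0, 1), ?_, by simp⟩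
      simp [h]) hfin
  exact ⟨e, nutSet_eq ▸ he, he'⟩

/-- The point of `ℝ³` that belongs to spinor coordinates near `q`. -/
def nutPt (p : Fin k → E3) (l : Nut k) (z : Fin 2 → ℂ) (r : ℝ) : E3 := pt p (some l) + r • hopf z

/-- The parametrization of a neighbourhood of the face over a point of `P`. -/
def bet (p : Fin k → E3) (a : Nut k → Fin 2 → ℂ) (b : E3) (l : Nut k)
    (q : ((Fin 2 → ℂ) × ℝ) × ℝ) : Amb k :=
  let X := nutPt p l q.1.1 q.2
  let s := (√(1 + ‖X‖ ^ 2))⁻¹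
  let c := ‖X‖⁻¹ • X
  let σ := q.2 * q.1.2 / ‖X‖
  ((s • X, s), q.1.2 / (s * ‖X‖ * ∏ m ∈ Finset.univ.erase l, rad p c s (s * ‖X‖) σ m),
    fun m => m.elim (s * ‖X‖) (Function.update (rad p c s (s * ‖X‖) σ) l (s * q.2)),
    fun m => m.elim c (Function.update (uvec p c s (s * ‖X‖) σ) l (hopf q.1.1)),
    tens (Function.update (fun m => sec (a m) (uvec p c s (s * ‖X‖) σ m)) l q.1.1)
      (sq (nullSec b c)))

/-- The domain of `bet`. -/
def DomB (p : Fin k → E3) (a : Nut k → Fin 2 → ℂ) (b : E3) (l : Nut k) (δ : ℝ) :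
    Set (((Fin 2 → ℂ) × ℝ) × ℝ) :=
  {q | cross b (nutPt p l q.1.1 q.2) ≠ 0 ∧
    (∀ m, m ≠ l → 0 < secDen (a m) (nutPt p l q.1.1 q.2 - pt p (some m))) ∧
    (√(1 + ‖nutPt p l q.1.1 q.2‖ ^ 2))⁻¹ * (q.2 * q.1.2) < δ ^ 2 ∧
    (√(1 + ‖nutPt p l q.1.1 q.2‖ ^ 2))⁻¹ * (q.2 * q.1.2) < δ * ‖nutPt p l q.1.1 q.2‖}

theorem contDiff_nutPt (l : Nut k) :
    ContDiff ℝ ∞ fun q : ((Fin 2 → ℂ) × ℝ) × ℝ => nutPt p l q.1.1 q.2 :=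
  contDiff_const.add (contDiff_snd.smul (contDiff_hopf.comp (contDiff_fst.comp contDiff_fst)))

theorem sqrt_one_add_norm_pos (X : E3) : 0 < √(1 + ‖X‖ ^ 2) := sqrt_one_add_pos _

theorem continuous_cross : Continuous fun a : E3 × E3 => cross a.1 a.2 :=
  (contDiffOn_univ.1 (ContDiffOn.cross_E3 contDiff_fst.contDiffOn contDiff_snd.contDiffOn)).continuous

theorem isOpen_DomB (a : Nut k → Fin 2 → ℂ) (b : E3) (l : Nut k) : IsOpen (DomB p a b l δ) := by
  have h := (contDiff_nutPt (p := p) l).continuous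
  have h0 : Continuous fun q : ((Fin 2 → ℂ) × ℝ) × ℝ => (√(1 + ‖nutPt p l q.1.1 q.2‖ ^ 2))⁻¹ *
      (q.2 * q.1.2) := by
    refine Continuous.mul (Continuous.inv₀ (by fun_prop) fun q => (sqrt_one_add_norm_pos _).ne')
      (by fun_prop)
  have h1 : IsOpen {q : ((Fin 2 → ℂ) × ℝ) × ℝ | cross b (nutPt p l q.1.1 q.2) ≠ 0} :=
    isOpen_ne_fun (continuous_cross.comp (continuous_const.prodMk h)) continuous_const
  have h2 : IsOpen {q : ((Fin 2 → ℂ) × ℝ) × ℝ | ∀ m, m ≠ l →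
      0 < secDen (a m) (nutPt p l q.1.1 q.2 - pt p (some m))} := by
    simp only [ofPred_forall]
    exact isOpen_iInter_of_finite fun m => isOpen_iInter_of_finite fun _ =>
      isOpen_lt continuous_const ((continuous_secDen (a m)).comp (h.sub continuous_const))
  exact h1.inter (h2.inter ((isOpen_lt h0 continuous_const).inter
    (isOpen_lt h0 (continuous_const.mul h.norm))))

section Bet

variable {a : Nut k → Fin 2 → ℂ} {b : E3} {l : Nut k} {q : ((Fin 2 → ℂ) × ℝ) × ℝ}

theorem cross_zero_right' (b : E3) : cross b 0 = 0 := by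
  simpa using cross_smul_right (0 : ℝ) b 0

theorem DomB.ne_zero (hq : q ∈ DomB p a b l δ) : nutPt p l q.1.1 q.2 ≠ 0 := by
  intro h
  apply hq.1
  rw [h, cross_zero_right']

theorem dvec_polar {X : E3} (hX : X ≠ 0) (s : ℝ) (m : Nut k) :
    dvec p (‖X‖⁻¹ • X) s (s * ‖X‖) m = s • (X - pt p (some m)) := by
  rw [dvec, smul_smul, mul_assoc, mul_inv_cancel₀ (norm_ne_zero_iff.2 hX), mul_one, smul_sub]

theorem DomB.secDen_pos (hq : q ∈ DomB p a b l δ) {m : Nut k} (hm : m ≠ l) {s : ℝ} (hs : 0 < s) :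
    0 < secDen (a m) (dvec p (‖nutPt p l q.1.1 q.2‖⁻¹ • nutPt p l q.1.1 q.2) s
      (s * ‖nutPt p l q.1.1 q.2‖) m) := by
  rw [dvec_polar (DomB.ne_zero hq), secDen_smul _ hs.le]
  exact mul_pos hs (hq.2.1 m hm)

/-- Only `|X|`, `s` and the radii at the other points of `P` appear in denominators. In slot `l` the
polar expressions are replaced by `z`, `hopf z` and `s r`, so smoothness persists at `r = 0` and at
`z = 0`. -/
theorem contDiffOn_bet (a : Nut k → Fin 2 → ℂ) (b : E3) (l : Nut k) :
    ContDiffOn ℝ ∞ (bet p a b l) (DomB p a b l δ) := by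
  have hX := (contDiff_nutPt (p := p) l).contDiffOn (s := DomB p a b l δ)
  have hn : ContDiffOn ℝ ∞ (fun q : ((Fin 2 → ℂ) × ℝ) × ℝ => ‖nutPt p l q.1.1 q.2‖)
      (DomB p a b l δ) := hX.norm ℝ fun q hq => DomB.ne_zero hq
  have hn0 : ∀ q ∈ DomB p a b l δ, ‖nutPt p l q.1.1 q.2‖ ≠ 0 := fun q hq =>
    norm_ne_zero_iff.2 (DomB.ne_zero hq)
  have hs : ContDiffOn ℝ ∞ (fun q : ((Fin 2 → ℂ) × ℝ) × ℝ => (√(1 + ‖nutPt p l q.1.1 q.2‖ ^ 2))⁻¹)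
      (DomB p a b l δ) := by
    refine ContDiffOn.inv (ContDiffOn.sqrt (contDiffOn_const.add (hX.norm_sq ℝ)) fun q hq => ?_)
      fun q hq => (sqrt_one_add_norm_pos _).ne'
    positivity
  have hc := (hn.inv hn0).smul hX
  have hσ : ContDiffOn ℝ ∞ (fun q : ((Fin 2 → ℂ) × ℝ) × ℝ => q.2 * q.1.2 / ‖nutPt p l q.1.1 q.2‖)
      (DomB p a b l δ) := by
    simp only [div_eq_mul_inv]
    exact ContDiffOn.mul (by fun_prop) (hn.inv hn0)
  have hpos : ∀ q : ((Fin 2 → ℂ) × ℝ) × ℝ, 0 < (√(1 + ‖nutPt p l q.1.1 q.2‖ ^ 2))⁻¹ := fun q =>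
    inv_pos.2 (sqrt_one_add_norm_pos _)
  have hd : ∀ m, m ≠ l → ∀ q ∈ DomB p a b l δ, dvec p (‖nutPt p l q.1.1 q.2‖⁻¹ • nutPt p l q.1.1 q.2)
      (√(1 + ‖nutPt p l q.1.1 q.2‖ ^ 2))⁻¹
      ((√(1 + ‖nutPt p l q.1.1 q.2‖ ^ 2))⁻¹ * ‖nutPt p l q.1.1 q.2‖) m ≠ 0 := fun m hm q hq =>
    ne_zero_of_secDen_pos (DomB.secDen_pos hq hm (hpos q))
  have hrad := fun m hm => contDiffOn_rad hc hs (hs.mul hn) hσ (hd m hm)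
  have huv := fun m hm => contDiffOn_uvec hc hs (hs.mul hn) hσ (hd m hm)
  refine ((hs.smul hX).prodMk hs).prodMk (ContDiffOn.prodMk ?_ (ContDiffOn.prodMk ?_
    (ContDiffOn.prodMk ?_ (contDiffOn_tens (fun m => ?_) ?_))))
  · simp only [div_eq_mul_inv]
    refine ContDiffOn.mul (by fun_prop) (ContDiffOn.inv ((hs.mul hn).mul (contDiffOn_prod
      fun m hm => hrad m (Finset.ne_of_mem_erase hm))) fun q hq => mul_ne_zero (mul_ne_zero
        (hpos q).ne' (hn0 q hq)) (Finset.prod_ne_zero_iff.2 fun m hm =>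
        (rad_pos_of_ne (hd m (Finset.ne_of_mem_erase hm) q hq)).ne'))
  · rw [contDiffOn_pi]
    rintro (_ | m)
    · exact hs.mul hn
    · simp only [Option.elim_some]
      rcases eq_or_ne m l with rfl | hm
      · simp only [Function.update_self]
        exact hs.mul contDiffOn_snd
      · simp only [Function.update_of_ne hm]
        exact hrad m hm
  · rw [contDiffOn_pi]
    rintro (_ | m)
    · exact hc
    · simp only [Option.elim_some]
      rcases eq_or_ne m l with rfl | hm
      · simp only [Function.update_self]
        exact contDiff_hopf.comp_contDiffOn (contDiff_fst.comp contDiff_fst).contDiffOn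
      · simp only [Function.update_of_ne hm]
        exact huv m hm
  · rcases eq_or_ne m l with rfl | hm
    · simp only [Function.update_self]
      exact (contDiff_fst.comp contDiff_fst).contDiffOn
    · simp only [Function.update_of_ne hm]
      refine (contDiffOn_sec (a m)).comp (huv m hm) fun q hq => ?_
      have h1 := DomB.secDen_pos hq hm (hpos q)
      rw [mem_ofPred_eq, uvec, secDen_smul _ (inv_nonneg.2 (rad_nonneg _))]
      exact mul_pos (inv_pos.2 (rad_pos_of_ne (hd m hm q hq))) h1
  · refine contDiff_sq.comp_contDiffOn ((contDiffOn_nullSec b).comp hc fun q hq => ?_)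
    rw [mem_ofPred_eq, cross_smul_right]
    exact smul_ne_zero (inv_ne_zero (hn0 q hq)) hq.1

theorem sden_eq (x : Amb k) (l : Nut k) : sden x l =
    x.2.1 * (x.2.2.1 none * ∏ m ∈ Finset.univ.erase l, x.2.2.1 (some m)) := by
  have h : (Finset.univ.erase (some l) : Finset (Option (Nut k))) =
      insert none ((Finset.univ.erase l).map Function.Embedding.some) := by
    ext (_ | m) <;> simp
  rw [sden, h, Finset.prod_insert (by simp), Finset.prod_map]
  rfl

theorem bet_r_none : (bet p a b l q).2.2.1 none =
    (√(1 + ‖nutPt p l q.1.1 q.2‖ ^ 2))⁻¹ * ‖nutPt p l q.1.1 q.2‖ := rfl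

theorem bet_s : (bet p a b l q).1.2 = (√(1 + ‖nutPt p l q.1.1 q.2‖ ^ 2))⁻¹ := rfl

theorem bet_c : (bet p a b l q).2.2.2.1 none =
    ‖nutPt p l q.1.1 q.2‖⁻¹ • nutPt p l q.1.1 q.2 := rfl

theorem bet_s_pos : 0 < (bet p a b l q).1.2 := inv_pos.2 (sqrt_one_add_norm_pos _)

theorem bet_r_self : (bet p a b l q).2.2.1 (some l) = (bet p a b l q).1.2 * q.2 := by
  simp [bet]

theorem bet_v_self : (bet p a b l q).2.2.2.1 (some l) = hopf q.1.1 := by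
  simp [bet]

theorem bet_r_of_ne {m : Nut k} (hm : m ≠ l) : (bet p a b l q).2.2.1 (some m) =
    rad p ((bet p a b l q).2.2.2.1 none) (bet p a b l q).1.2 ((bet p a b l q).2.2.1 none)
      (q.2 * q.1.2 / ‖nutPt p l q.1.1 q.2‖) m := by
  simp [bet, hm]

theorem bet_v_of_ne {m : Nut k} (hm : m ≠ l) : (bet p a b l q).2.2.2.1 (some m) =
    uvec p ((bet p a b l q).2.2.2.1 none) (bet p a b l q).1.2 ((bet p a b l q).2.2.1 none)
      (q.2 * q.1.2 / ‖nutPt p l q.1.1 q.2‖) m := by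
  simp [bet, hm]

theorem bet_T : (bet p a b l q).2.2.2.2 = tens (Function.update
    (fun m => sec (a m) ((bet p a b l q).2.2.2.1 (some m))) l q.1.1)
    (sq (nullSec b ((bet p a b l q).2.2.2.1 none))) := by
  rw [bet]
  refine congrArg₂ tens ?_ rfl
  funext m
  rcases eq_or_ne m l with rfl | hm
  · simp
  · simp [hm]

theorem bet_r_pos (hq : q ∈ DomB p a b l δ) {m : Nut k} (hm : m ≠ l) :
    0 < (bet p a b l q).2.2.1 (some m) := by
  rw [bet_r_of_ne hm]
  exact rad_pos_of_ne (ne_zero_of_secDen_pos (DomB.secDen_pos hq hm bet_s_pos))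

theorem bet_r_none_pos (hq : q ∈ DomB p a b l δ) : 0 < (bet p a b l q).2.2.1 none :=
  mul_pos (bet_s_pos (a := a) (b := b)) (norm_pos_iff.2 (DomB.ne_zero hq))

theorem sden_bet (hq : q ∈ DomB p a b l δ) : sden (bet p a b l q) l = q.1.2 := by
  have h1 : ∏ m ∈ Finset.univ.erase l, (bet p a b l q).2.2.1 (some m) =
      ∏ m ∈ Finset.univ.erase l, rad p ((bet p a b l q).2.2.2.1 none) (bet p a b l q).1.2
        ((bet p a b l q).2.2.1 none) (q.2 * q.1.2 / ‖nutPt p l q.1.1 q.2‖) m :=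
    Finset.prod_congr rfl fun m hm => bet_r_of_ne (Finset.ne_of_mem_erase hm)
  have h2 : (bet p a b l q).2.2.1 none *
      ∏ m ∈ Finset.univ.erase l, (bet p a b l q).2.2.1 (some m) ≠ 0 :=
    mul_ne_zero (bet_r_none_pos hq).ne' (Finset.prod_ne_zero_iff.2 fun m hm =>
      (bet_r_pos hq (Finset.ne_of_mem_erase hm)).ne')
  have h3 : (bet p a b l q).2.1 = q.1.2 / ((bet p a b l q).2.2.1 none *
      ∏ m ∈ Finset.univ.erase l, (bet p a b l q).2.2.1 (some m)) := by
    rw [h1]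
    rfl
  rw [sden_eq, h3, div_mul_cancel₀ _ h2]

/-- The parametrization is the spherical blow-up `(x - q, ε / s) = r (hopf z, σ)` of the point `(q,
0)`. -/
theorem eps_bet (hq : q ∈ DomB p a b l δ) :
    eps (bet p a b l q) = (bet p a b l q).1.2 * (q.2 * q.1.2) := by
  rw [eps_eq_some _ l, sden_bet hq, bet_r_self, mul_assoc]

theorem sigh_bet (hq : q ∈ DomB p a b l δ) :
    sigh (bet p a b l q) = q.2 * q.1.2 / ‖nutPt p l q.1.1 q.2‖ := by
  have h := eps_bet hq
  rw [eps_eq_none, bet_r_none, ← bet_s (a := a) (b := b), mul_assoc] at h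
  rw [eq_div_iff (norm_ne_zero_iff.2 (DomB.ne_zero hq)), mul_comm]
  exact mul_left_cancel₀ bet_s_pos.ne' h

theorem isOuter_bet (hm : q ∈ (nutSet ×ˢ Ici (0 : ℝ)) ∩ DomB p a b l δ) :
    IsOuter p δ (bet p a b l q) := by
  obtain ⟨⟨⟨g1, g2⟩, g3 : 0 ≤ q.2⟩, hq⟩ := hm
  have hX := DomB.ne_zero hq
  have hXn := norm_pos_iff.2 hX
  have hs := bet_s_pos (p := p) (a := a) (b := b) (l := l) (q := q)
  have hr := bet_r_none_pos hq
  have hne : ∀ m, m ≠ l → rad p ((bet p a b l q).2.2.2.1 none) (bet p a b l q).1.2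
        ((bet p a b l q).2.2.1 none) (sigh (bet p a b l q)) m ≠ 0 := fun m hm => by
    have := bet_r_pos hq hm
    rw [bet_r_of_ne hm, ← sigh_bet hq] at this
    exact this.ne'
  have hcn : ‖(bet p a b l q).2.2.2.1 none‖ = 1 := by
    rw [bet_c, norm_smul, norm_inv, norm_norm, inv_mul_cancel₀ hXn.ne']
  refine ⟨⟨?_, hs.le⟩, ?_, ?_, ?_, ?_, ?_, hcn, ?_, ?_⟩
  · have h1 : (bet p a b l q).1.1 = (bet p a b l q).1.2 • nutPt p l q.1.1 q.2 := rfl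
    rw [h1, norm_smul, Real.norm_of_nonneg hs.le, bet_s, mul_pow, ← mul_add_one, inv_pow,
      Real.sq_sqrt (by positivity), add_comm (1 : ℝ), inv_mul_cancel₀ (by positivity)]
  · refine div_nonneg g2 (mul_nonneg hr.le (Finset.prod_nonneg fun m _ => rad_nonneg m))
  · rintro (_ | m)
    · exact hr.le
    · rcases eq_or_ne m l with rfl | hm
      · rw [bet_r_self]
        exact mul_nonneg hs.le g3
      · exact (bet_r_pos hq hm).le
  · rw [eps_bet hq]
    exact hq.2.2.1
  · rw [sigh_bet hq, ← mul_div_assoc, div_lt_iff₀ hXn]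
    exact hq.2.2.2
  · have h1 : (bet p a b l q).1.1 = (bet p a b l q).1.2 • nutPt p l q.1.1 q.2 := rfl
    rintro (_ | m)
    · simp only [pt, smul_zero, sub_zero]
      rw [bet_c, bet_r_none, smul_smul, mul_assoc, mul_inv_cancel₀ hXn.ne', mul_one]
      rfl
    · rw [h1, ← smul_sub]
      rcases eq_or_ne m l with rfl | hm
      · rw [bet_r_self, bet_v_self, nutPt, add_sub_cancel_left, smul_smul]
      · rw [bet_r_of_ne hm, bet_v_of_ne hm, ← sigh_bet hq, uvec, smul_inv_smul₀ (hne m hm)]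
        exact (dvec_polar hX _ m).symm
  · intro m
    rcases eq_or_ne m l with rfl | hm
    · rw [bet_v_self, sden_bet hq, norm_hopf]
      exact g1
    · have h2 : sden (bet p a b l q) m =
          (bet p a b l q).2.2.1 none * sigh (bet p a b l q) / rad p ((bet p a b l q).2.2.2.1 none)
          (bet p a b l q).1.2 ((bet p a b l q).2.2.1 none) (sigh (bet p a b l q)) m := by
        rw [eq_div_iff (hne m hm), ← eps_eq_none, eps_eq_some _ m, bet_r_of_ne hm, sigh_bet hq,
          mul_comm]
      rw [bet_v_of_ne hm, h2, ← sigh_bet hq, uvec, norm_smul, norm_inv,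
        Real.norm_of_nonneg (rad_nonneg m), mul_pow, inv_pow, div_pow]
      have h3 := rad_sq (p := p) (c := (bet p a b l q).2.2.2.1 none) (s := (bet p a b l q).1.2)
        (r := (bet p a b l q).2.2.1 none) (σ := sigh (bet p a b l q)) m
      have h4 := pow_ne_zero 2 (hne m hm)
      rw [inv_mul_eq_div, ← add_div, ← h3, div_self h4]
  · refine ⟨nullSec b ((bet p a b l q).2.2.2.1 none), _, isNullFrame_nullSec hcn ?_, fun m => ?_,
      bet_T⟩
    · rw [bet_c, cross_smul_right]
      exact smul_ne_zero (inv_ne_zero hXn.ne') hq.1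
    · rcases eq_or_ne m l with rfl | hm
      · rw [Function.update_self, bet_v_self]
      · rw [Function.update_of_ne hm]
        refine hopf_sec ?_
        rw [bet_v_of_ne hm, uvec, secDen_smul _ (inv_nonneg.2 (rad_nonneg _))]
        refine mul_pos (inv_pos.2 ?_) (DomB.secDen_pos hq hm bet_s_pos)
        rw [← bet_r_of_ne hm]
        exact bet_r_pos hq hm

/-- The inverse of `bet`. -/
def coordB (a : Nut k → Fin 2 → ℂ) (b : E3) (l : Nut k) (x : Amb k) : ((Fin 2 → ℂ) × ℝ) × ℝ :=
  ((slot l (fun m => sec (a m) (x.2.2.2.1 (some m))) (sq (nullSec b (x.2.2.2.1 none))) x.2.2.2.2,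
    sden x l), x.2.2.1 (some l) / x.1.2)

/-- The domain of `coordB`. -/
def CodB (a : Nut k → Fin 2 → ℂ) (b : E3) (l : Nut k) : Set (Amb k) :=
  {x | (0 < x.1.2 ∧ 0 < x.2.2.1 none) ∧ cross b (x.2.2.2.1 none) ≠ 0 ∧
    ∀ m, m ≠ l → 0 < secDen (a m) (x.2.2.2.1 (some m)) ∧ 0 < x.2.2.1 (some m)}

theorem isOpen_CodB (a : Nut k → Fin 2 → ℂ) (b : E3) (l : Nut k) : IsOpen (CodB a b l) := by
  have h1 : IsOpen {x : Amb k | 0 < x.1.2} := isOpen_lt (by fun_prop) (by fun_prop)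
  have h2 : ∀ m, IsOpen {x : Amb k | 0 < x.2.2.1 m} := fun m =>
    isOpen_lt (by fun_prop) (by fun_prop)
  have h3 : IsOpen {x : Amb k | cross b (x.2.2.2.1 none) ≠ 0} :=
    isOpen_ne_fun (continuous_cross.comp (f := fun x : Amb k => (b, x.2.2.2.1 none))
      (by fun_prop)) continuous_const
  have h4 : IsOpen {x : Amb k | ∀ m, m ≠ l → 0 < secDen (a m) (x.2.2.2.1 (some m)) ∧
      0 < x.2.2.1 (some m)} := by
    simp only [ofPred_forall]
    exact isOpen_iInter_of_finite fun m => isOpen_iInter_of_finite fun _ =>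
      (isOpen_lt continuous_const ((continuous_secDen (a m)).comp (by fun_prop))).inter
        (h2 (some m))
  exact (h1.inter (h2 none)).inter (h3.inter h4)

theorem contDiffOn_coordB (a : Nut k → Fin 2 → ℂ) (b : E3) (l : Nut k) :
    ContDiffOn ℝ ∞ (coordB a b l) {x | x ∈ CodB a b l ∧ ‖x.2.2.2.1 none‖ = 1} := by
  refine ContDiffOn.prodMk (ContDiffOn.prodMk (contDiffOn_slot (fun m hm => ?_)
    (fun x hx m hm => sec_ne_zero (hx.1.2.2 m hm).1) ?_ (fun x hx h0 => ?_) (by fun_prop))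
    (contDiff_sden l).contDiffOn) ?_
  · refine (contDiffOn_sec (a m)).comp (t := {v | 0 < secDen (a m) v}) ?_
      fun x hx => (hx.1.2.2 m hm).1
    fun_prop
  · refine contDiff_sq.comp_contDiffOn ((contDiffOn_nullSec b).comp (by fun_prop)
      fun x hx => hx.1.2.1)
  · exact sq_ne_zero ((isNullFrame_nullSec hx.2 hx.1.2.1).ne_zero hx.2) h0
  · simp only [div_eq_mul_inv]
    exact ContDiffOn.mul (by fun_prop) (ContDiffOn.inv (by fun_prop) fun x hx => hx.1.1.1.ne')

theorem bet_mem_CodB (hq : q ∈ DomB p a b l δ) : bet p a b l q ∈ CodB a b l := by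
  refine ⟨⟨bet_s_pos, bet_r_none_pos hq⟩, ?_, fun m hm => ⟨?_, bet_r_pos hq hm⟩⟩
  · rw [bet_c, cross_smul_right]
    exact smul_ne_zero (inv_ne_zero (norm_ne_zero_iff.2 (DomB.ne_zero hq))) hq.1
  · rw [bet_v_of_ne hm, uvec, secDen_smul _ (inv_nonneg.2 (rad_nonneg _))]
    refine mul_pos (inv_pos.2 ?_) (DomB.secDen_pos hq hm bet_s_pos)
    rw [← bet_r_of_ne hm]
    exact bet_r_pos hq hm

/-- The spinor in slot `l` is recovered by `slot_tens`, which does not need it to be nonzero. The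
null frame is a fixed section here, so no sign has to be chosen. -/
theorem coordB_bet (hq : q ∈ DomB p a b l δ) : coordB a b l (bet p a b l q) = q := by
  have h := bet_mem_CodB hq
  have hcn : ‖(bet p a b l q).2.2.2.1 none‖ = 1 := by
    rw [bet_c, norm_smul, norm_inv, norm_norm,
      inv_mul_cancel₀ (norm_ne_zero_iff.2 (DomB.ne_zero hq))]
  refine Prod.ext (Prod.ext ?_ (sden_bet hq)) ?_
  · rw [coordB, bet_T]
    exact slot_tens (fun m hm => sec_ne_zero (h.2.2 m hm).1)
      (sq_ne_zero ((isNullFrame_nullSec hcn h.2.1).ne_zero hcn)) _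
  · rw [coordB, bet_r_self]
    exact mul_div_cancel_left₀ _ bet_s_pos.ne'

end Bet

/-- All phases of the tensor are collected in the spinor of slot `l`, and not in the null frame as
in `exists_eq_theta`. This choice makes the spinor a coordinate, also where it vanishes. -/
theorem IsOuter.exists_eq_bet {x : Amb k} (h : IsOuter p δ x) {a : Nut k → Fin 2 → ℂ} {b : E3}
    {l : Nut k} (hx : x ∈ CodB a b l) : ∃ z, coordB a b l x = ((z, sden x l), x.2.2.1 (some l) / x.1.2)
      ∧ hopf z = x.2.2.2.1 (some l) ∧
      ((z, sden x l), x.2.2.1 (some l) / x.1.2) ∈ (nutSet ×ˢ Ici (0 : ℝ)) ∩ DomB p a b l δ ∧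
      x = bet p a b l ((z, sden x l), x.2.2.1 (some l) / x.1.2) := by
  obtain ⟨⟨hs, hr⟩, hb, hm⟩ := hx
  obtain ⟨y, hy⟩ := exists_hopf_eq (x.2.2.2.1 (some l))
  obtain ⟨w, hw, hT⟩ := h.exists_frame
    (z := Function.update (fun m => sec (a m) (x.2.2.2.1 (some m))) l y) (fun m => by
      rcases eq_or_ne m l with rfl | hml
      · rw [Function.update_self, hy]
      · rw [Function.update_of_ne hml, hopf_sec (hm m hml).1])
  have hN := isNullFrame_nullSec h.norm_none hb
  obtain ⟨d, hd, rfl⟩ := isNullFrame_eq_smul h.norm_none hN hw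
  -- The frame is `d` times the section, so the tensor carries the phase `d²`, which is passed on to
  -- the spinor `y`.
  rw [sq_smul, ← smul_tens, ← tens_update_smul] at hT
  have hz : hopf (d ^ 2 • y) = x.2.2.2.1 (some l) := by
    rw [hopf_smul_of_norm_one (by rw [norm_pow, hd, one_pow]), hy]
  have hX : nutPt p l (d ^ 2 • y) (x.2.2.1 (some l) / x.1.2) = x.1.2⁻¹ • x.1.1 := by
    rw [nutPt, hz, div_eq_inv_mul, ← smul_smul, ← h.r_smul (some l), smul_sub,
      inv_smul_smul₀ hs.ne', add_sub_cancel]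
  have hXn : ‖x.1.2⁻¹ • x.1.1‖ = x.2.2.1 none / x.1.2 := by
    rw [h.u_eq, norm_smul, norm_smul, h.norm_none, norm_inv, Real.norm_of_nonneg hs.le,
      Real.norm_of_nonneg hr.le]
    field_simp
  have hsq := h.sq_add_sq
  have hsX : √(1 + (x.2.2.1 none / x.1.2) ^ 2) = x.1.2⁻¹ := by
    rw [Real.sqrt_eq_iff_mul_self_eq (by positivity) (by positivity)]
    field_simp
    linarith
  have hc : (x.2.2.1 none / x.1.2)⁻¹ • x.1.2⁻¹ • x.1.1 = x.2.2.2.1 none := by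
    rw [h.u_eq, smul_smul, smul_smul]
    field_simp
    simp
  have hε : x.2.2.1 (some l) / x.1.2 * sden x l = eps x / x.1.2 := by
    rw [eps_eq_some x l]
    ring
  have hσ : x.2.2.1 (some l) / x.1.2 * sden x l / (x.2.2.1 none / x.1.2) = sigh x := by
    rw [hε, eps_eq_none]
    field_simp
  have hrs : x.1.2 * (x.2.2.1 none / x.1.2) = x.2.2.1 none := mul_div_cancel₀ _ hs.ne'
  refine ⟨d ^ 2 • y, ?_, hz, ⟨⟨⟨?_, ?_⟩, div_nonneg (h.r_nonneg _) hs.le⟩, ?_, ?_, ?_, ?_⟩, ?_⟩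
  · rw [coordB, hT, slot_tens (fun m hml => sec_ne_zero (hm m hml).1)
      (sq_ne_zero (hN.ne_zero h.norm_none))]
  · rw [← norm_hopf, hz]
    exact h.norm_some l
  · exact mul_nonneg h.t_nonneg (Finset.prod_nonneg fun l _ => h.r_nonneg l)
  · change cross b (nutPt p l (d ^ 2 • y) (x.2.2.1 (some l) / x.1.2)) ≠ 0
    rw [hX, h.u_eq, cross_smul_right, cross_smul_right]
    exact smul_ne_zero (inv_ne_zero hs.ne') (smul_ne_zero hr.ne' hb)
  · intro m hml
    change 0 < secDen (a m) (nutPt p l (d ^ 2 • y) (x.2.2.1 (some l) / x.1.2) - pt p (some m))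
    have : x.1.2⁻¹ • x.1.1 - pt p (some m) = x.1.2⁻¹ • x.2.2.1 (some m) • x.2.2.2.1 (some m) := by
      rw [← h.r_smul (some m), smul_sub, inv_smul_smul₀ hs.ne']
    rw [hX, this, secDen_smul _ (inv_pos.2 hs).le, secDen_smul _ (h.r_nonneg _)]
    exact mul_pos (inv_pos.2 hs) (mul_pos (hm m hml).2 (hm m hml).1)
  · change (√(1 + ‖nutPt p l (d ^ 2 • y) (x.2.2.1 (some l) / x.1.2)‖ ^ 2))⁻¹ *
      (x.2.2.1 (some l) / x.1.2 * sden x l) < δ ^ 2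
    rw [hX, hXn, hsX, hε, inv_inv, mul_div_cancel₀ _ hs.ne']
    exact h.eps_lt
  · change (√(1 + ‖nutPt p l (d ^ 2 • y) (x.2.2.1 (some l) / x.1.2)‖ ^ 2))⁻¹ *
      (x.2.2.1 (some l) / x.1.2 * sden x l) < δ *
      ‖nutPt p l (d ^ 2 • y) (x.2.2.1 (some l) / x.1.2)‖
    rw [hX, hXn, hsX, hε, inv_inv, mul_div_cancel₀ _ hs.ne', eps_eq_none, ← mul_div_assoc,
      lt_div_iff₀ hs]
    have := mul_lt_mul_of_pos_right h.sig_lt hr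
    linarith
  · have e1 := h.r_some_eq
    have e2 : ∀ m, m ≠ l → x.2.2.2.1 (some m) = _ := fun m hml => h.v_some_eq (hm m hml).2.ne'
    simp only [bet, hX, hXn, hsX, hc, hσ, inv_inv, hrs]
    refine ext_Amb (Prod.ext (smul_inv_smul₀ hs.ne' _).symm rfl) ?_ rfl (fun m => ?_) rfl
      (fun m => ?_) ?_
    · have h1 : ∏ m ∈ Finset.univ.erase l,
          rad p (x.2.2.2.1 none) x.1.2 (x.2.2.1 none) (sigh x) m =
          ∏ m ∈ Finset.univ.erase l, x.2.2.1 (some m) :=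
        Finset.prod_congr rfl fun m _ => (e1 m).symm
      have h2 : x.2.2.1 none * ∏ m ∈ Finset.univ.erase l, x.2.2.1 (some m) ≠ 0 :=
        mul_ne_zero hr.ne' (Finset.prod_ne_zero_iff.2 fun m hml =>
          (hm m (Finset.ne_of_mem_erase hml)).2.ne')
      simp only [h1]
      rw [sden_eq, mul_div_cancel_right₀ _ h2]
    · rcases eq_or_ne m l with rfl | hml
      · simp [mul_div_cancel₀ _ hs.ne']
      · simp [hml, ← e1]
    · rcases eq_or_ne m l with rfl | hml
      · simp [hz]
      · simp [hml, ← e2]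
    · rw [hT]
      refine congrArg₂ tens ?_ rfl
      funext m
      rcases eq_or_ne m l with rfl | hml
      · simp
      · simp [hml, ← e2]

theorem locDiffeo_bet (hp : ∀ ν, δ < ‖p ν‖) (hδ : δ < 1 / 2) {a : Nut k → Fin 2 → ℂ} {b : E3}
    {l : Nut k} {q : ((Fin 2 → ℂ) × ℝ) × ℝ}
    (hq : q ∈ (nutSet ×ˢ Ici (0 : ℝ)) ∩ DomB p a b l δ) :
    LocDiffeo (total p δ) (bet p a b l q) (nutSet ×ˢ Ici (0 : ℝ)) q := by
  have hU : IsOpen ({x : Amb k | x.1.2 * sigh x < δ} ∩ CodB a b l) :=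
    (isOpen_lt (by fun_prop) (by fun_prop)).inter (isOpen_CodB a b l)
  have hA : ∀ x ∈ total p δ ∩ ({x : Amb k | x.1.2 * sigh x < δ} ∩ CodB a b l),
      IsOuter p δ x ∧ coordB a b l x ∈ (nutSet ×ˢ Ici (0 : ℝ)) ∩ DomB p a b l δ ∧
      bet p a b l (coordB a b l x) = x := by
    rintro x ⟨h1, h2, h3⟩
    have h4 := (isOuter_iff hp hδ h1).2 h2
    obtain ⟨z, e1, -, e2, e3⟩ := h4.exists_eq_bet h3
    rw [e1]
    exact ⟨h4, e2, e3.symm⟩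
  exact LocDiffeo.of_inverse (coordB a b l) (bet p a b l) hU (isOpen_DomB a b l)
    (Or.inl (isOuter_bet hq)) ⟨(isOuter_bet hq).sig_lt, bet_mem_CodB hq.2⟩ hq.2
    ((contDiffOn_coordB a b l).mono fun x hx => ⟨hx.2.2, (hA x hx).1.norm_none⟩)
    ((contDiffOn_bet a b l).mono fun q hq => hq.2) (fun x hx => (hA x hx).2.1.1)
    (fun q hq => Or.inl (isOuter_bet hq)) (fun x hx _ => (hA x hx).2.2)
    (fun q hq _ => coordB_bet hq.2) (coordB_bet hq.2)

/-- The points to which the chart around a face over a point of `P` applies. -/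
theorem IsOuter.exists_mem_CodB (hp : Function.Injective (pt p)) {x : Amb k} (h : IsOuter p δ x)
    {l : Nut k} (hl : x.1.1 = x.1.2 • pt p (some l)) : ∃ a b, x ∈ CodB a b l := by
  have hq : pt p (some l) ≠ 0 := fun h0 => by simpa using hp (a₁ := some l) (a₂ := none) h0
  have hs : 0 < x.1.2 := by
    refine h.base.2.lt_of_ne fun h0 => ?_
    have := h.base.1
    rw [hl, ← h0] at this
    simp at this
  have hr : x.2.2.1 none ≠ 0 := fun h0 => by
    have := h.u_eq
    rw [h0, hl, zero_smul] at this
    exact smul_ne_zero hs.ne' hq this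
  obtain ⟨b, hb⟩ := exists_cross_ne_zero (c := x.2.2.2.1 none) (by
    intro h0
    have := h.norm_none
    rw [h0, norm_zero] at this
    exact zero_ne_one this)
  choose a ha using fun m : Nut k => exists_hopf_eq (x.2.2.2.1 (some m))
  refine ⟨a, b, ⟨hs, (h.r_nonneg none).lt_of_ne' hr⟩, hb, fun m hm => ?_⟩
  have h1 : x.2.2.1 (some m) • x.2.2.2.1 (some m) ≠ 0 := by
    rw [← h.r_smul, hl, ← smul_sub]
    refine smul_ne_zero hs.ne' (sub_ne_zero.2 fun h0 => hm ?_)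
    simpa using (hp h0).symm
  refine ⟨?_, (h.r_nonneg _).lt_of_ne' (left_ne_zero_of_smul h1)⟩
  rw [← ha m]
  refine secDen_pos_self fun h0 => right_ne_zero_of_smul h1 ?_
  rw [← ha m, h0, hopf_eq_zero.2 rfl]

/-- All factors of `ε / r_l` other than `t` are positive here. So the half-space coordinate `ε /
r_l` describes `X_ad`, and the half-line coordinate `r_l / s` describes the face over the point of
`P`. -/
theorem chart_bet (hp : ∀ ν, δ < ‖p ν‖) (hδ : δ < 1 / 2) (hi : Function.Injective (pt p))
    {x : Amb k} (hx : IsOuter p δ x) {l : Nut k} (hl : x.1.1 = x.1.2 • pt p (some l)) :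
    ∃ e : E5, LocDiffeo (total p δ) x quad e ∧
      (x ∈ bdry k ↔ e.1 0 = 0 ∨ e.2 0 = 0) ∧ (x ∈ corn k ↔ e.1 0 = 0 ∧ e.2 0 = 0) := by
  obtain ⟨a, b, hc⟩ := hx.exists_mem_CodB hi hl
  obtain ⟨z, -, -, hz, e⟩ := hx.exists_eq_bet hc
  obtain ⟨e₄, he, he'⟩ := exists_locDiffeo_nutSet hz.1.1
  obtain ⟨e₅, h1, h2, h3⟩ := exists_locDiffeo_quad he hz.1.2 hz.1.1
  have h4 := (locDiffeo_bet hp hδ hz).trans h1 (e ▸ Or.inl hx)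
  rw [← e] at h4
  obtain ⟨⟨hs, hr⟩, -, hm⟩ := hc
  have h0 : x.2.2.1 none * ∏ m ∈ Finset.univ.erase l, x.2.2.1 (some m) ≠ 0 :=
    mul_ne_zero hr.ne' (Finset.prod_ne_zero_iff.2 fun m hml =>
      (hm m (Finset.ne_of_mem_erase hml)).2.ne')
  have h5 : sden x l = 0 ↔ x.2.1 = 0 := by
    rw [sden_eq, mul_eq_zero, or_iff_left h0]
  have h6 : x.2.2.1 (some l) / x.1.2 = 0 ↔ x.2.2.1 (some l) = 0 := by
    rw [div_eq_zero_iff, or_iff_left hs.ne']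
  have h7 : (∃ l, x.2.2.1 l = 0) ↔ x.2.2.1 (some l) = 0 := by
    refine ⟨?_, fun h => ⟨_, h⟩⟩
    rintro ⟨_ | m, h⟩
    · exact absurd h hr.ne'
    · rcases eq_or_ne m l with rfl | hml
      · exact h
      · exact absurd h (hm m hml).2.ne'
  refine ⟨e₅, h4, ?_, ?_⟩
  · rw [h2, h3, he', h5, h6, bdry, mem_ofPred_eq, h7, or_iff_right hs.ne', or_comm]
  · rw [h2, h3, he', h5, h6, corn, mem_ofPred_eq, h7, or_iff_right hs.ne', and_comm]

end NutCharts

/-! ### The total space as a manifold with corners. -/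

section Total

variable {k : ℕ} {p : Fin k → E3} {δ : ℝ}

/-- An outer point with `r_0 = 0` has `s > 0`, hence satisfies `|x| < δ` and belongs to the part
parametrized by `alpha`. The remaining outer points lie over a point of `P` or over none. -/
theorem exists_chart (hp : ∀ ν, δ < ‖p ν‖) (hδ₀ : 0 < δ) (hδ : δ < 1 / 2)
    (hi : Function.Injective (pt p)) {x : Amb k} (hx : x ∈ total p δ) :
    ∃ e : E5, LocDiffeo (total p δ) x quad e ∧
      (x ∈ bdry k ↔ e.1 0 = 0 ∨ e.2 0 = 0) ∧ (x ∈ corn k ↔ e.1 0 = 0 ∧ e.2 0 = 0) := by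
  rcases hx with hx | hx
  · by_cases h0 : x.2.2.1 none = 0
    · have h1 := hx.sq_add_sq
      have hs : 0 < x.1.2 := hx.base.2.lt_of_ne fun h2 => by
        rw [h0, ← h2] at h1
        simp at h1
      refine chart_alpha hp hδ (hx.isInner hp hδ ?_)
      rw [h0]
      positivity
    · by_cases h2 : ∃ l, x.1.1 = x.1.2 • pt p (some l)
      · obtain ⟨l, hl⟩ := h2
        exact chart_bet hp hδ hi hx hl
      · refine chart_gam hp hδ hx h0 fun l h3 => h2 ⟨l, ?_⟩
        rw [dvec, ← hx.u_eq, sub_eq_zero] at h3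
        exact h3
  · exact chart_alpha hp hδ hx

/-- The hypotheses on the parameters. -/
class Admissible (p : Fin k → E3) (δ : ℝ) : Prop where
  inj : Function.Injective (pt p)
  pos : 0 < δ
  lt_half : δ < 1 / 2
  lt_norm : ∀ ν, δ < ‖p ν‖

instance [H : Admissible p δ] : HasCorners (total p δ) (bdry k) (corn k) :=
  ⟨fun _ hx => exists_chart H.lt_norm H.pos H.lt_half H.inj hx⟩

end Total

/-! ### The structure of the total space -/

section Structure

variable {k : ℕ} {p : Fin k → E3} {δ : ℝ}

/-- The boundary defining functions. -/
def faceFun : Face k → Amb k → ℝ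
  | .ad => fun x => x.2.1
  | .pt l => fun x => x.2.2.1 l
  | .infty => fun x => x.1.2

theorem contDiff_faceFun (F : Face k) : ContDiff ℝ ∞ (faceFun F) := by
  rcases F with _ | l | _ <;> simp only [faceFun] <;> fun_prop

/-- The circle action on the ambient space. -/
def circ (c : ℂ) (x : Amb k) : Amb k := (x.1, x.2.1, x.2.2.1, x.2.2.2.1, c • x.2.2.2.2)

/-- The involution of the ambient space. -/
def invol (x : Amb k) : Amb k := ((-x.1.1, x.1.2), x.2.1, fun l => x.2.2.1 (negLabel l),
  fun l => -x.2.2.2.1 (negLabel l), tconj x.2.2.2.2)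

theorem contDiff_circ : ContDiff ℝ ∞ fun a : ℂ × Amb k => circ a.1 a.2 := by
  unfold circ
  fun_prop

theorem contDiff_invol : ContDiff ℝ ∞ (invol : Amb k → Amb k) := by
  have := contDiff_tconj (k := k)
  unfold invol
  fun_prop

theorem conjJ_aref (p : Fin k → E3) (l : Nut k) : conjJ (aref p (negN l)) =
    (if l.2 then Complex.I else -Complex.I) • aref p l := by
  rcases l with ⟨ν, _ | _⟩
  · simp [negN, aref, smul_smul]
  · simp [negN, aref, conjJ_smul, conjJ_conjJ]

theorem dvec_neg (c : E3) (s r : ℝ) (l : Nut k) : dvec p (-c) s r l = -dvec p c s r (negN l) := by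
  have := pt_negLabel p (some l)
  rw [negLabel_some] at this
  rw [dvec, dvec, this]
  simp only [smul_neg, neg_sub, sub_neg_eq_add, neg_add_rev]
  abel

theorem rad_neg (c : E3) (s r σ : ℝ) (l : Nut k) : rad p (-c) s r σ l = rad p c s r σ (negN l) := by
  rw [rad, rad, dvec_neg, norm_neg]

theorem uvec_neg (c : E3) (s r σ : ℝ) (l : Nut k) :
    uvec p (-c) s r σ l = -uvec p c s r σ (negN l) := by
  rw [uvec, uvec, dvec_neg, rad_neg, smul_neg]

/-- On the null frame the involution is complex conjugation, and the reference sections are carried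
to each other by `J` up to the phases of `conjJ_aref`. -/
theorem invol_alpha (p : Fin k → E3) (Z : Fin 3 → ℂ) (r : ℝ) :
    invol (alpha p Z r) = alpha p (star Z) r := by
  rw [alpha, alpha, axA_star, scl_star, imPart_star, norm_neg, sq_star]
  set c := axA Z
  set s := (√(1 + r ^ 2))⁻¹
  set r₀ := r * s
  set σ := (1 - ‖imPart Z‖ ^ 2) * √(1 + r ^ 2)
  have h1 : ∏ l, rad p (-c) s r₀ σ l = ∏ l, rad p c s r₀ σ l :=
    Fintype.prod_equiv (negNEquiv k) _ _ fun l => rad_neg c s r₀ σ l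
  refine ext_Amb (Prod.ext ?_ rfl) ?_ rfl (fun l => (rad_neg c s r₀ σ l).symm) rfl
    (fun l => (uvec_neg c s r₀ σ l).symm) ?_
  · exact (smul_neg r₀ c).symm
  · change σ / _ = σ / _
    rw [h1]
  · change tconj (tens _ _) = tens _ _
    rw [tconj_tens]
    have h2 : (fun l => conjJ (sec (aref p (negN l)) (uvec p c s r₀ σ (negN l)))) =
        fun l => (if l.2 then Complex.I else -Complex.I) • sec (aref p l) (uvec p (-c) s r₀ σ l) := by
      funext l
      rw [← sec_conjJ, ← uvec_neg, conjJ_aref, sec_smul]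
      split_ifs <;> simp
    -- The two members of each pair `± p ν` contribute `I` and `-I`.
    have h3 : ∏ l : Nut k, (if l.2 then Complex.I else -Complex.I) = 1 := by
      rw [Fintype.prod_prod_type]
      simp
    rw [h2, tens_smul_left (fun l : Nut k => if l.2 then Complex.I else -Complex.I), h3, one_smul]

theorem sden_invol (x : Amb k) (l : Nut k) : sden (invol x) l = sden x (negN l) := by
  rw [sden_eq, sden_eq]
  have : ∏ m ∈ Finset.univ.erase l, (invol x).2.2.1 (some m) =
      ∏ m ∈ Finset.univ.erase (negN l), x.2.2.1 (some m) := by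
    refine Finset.prod_bij (fun m _ => negN m) (fun m hm => ?_) (fun m _ n _ h => ?_)
      (fun m hm => ⟨negN m, ?_, negN_negN m⟩) fun m _ => rfl
    · refine Finset.mem_erase.2 ⟨fun h => Finset.ne_of_mem_erase hm ?_, Finset.mem_univ _⟩
      rw [← negN_negN m, h, negN_negN]
    · rw [← negN_negN m, h, negN_negN]
    · refine Finset.mem_erase.2 ⟨fun h => Finset.ne_of_mem_erase hm ?_, Finset.mem_univ _⟩
      rw [← h, negN_negN]
  rw [this]
  rfl

theorem sigh_invol (x : Amb k) : sigh (invol x) = sigh x := by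
  rw [sigh, sigh]
  congr 1
  exact Fintype.prod_equiv (negNEquiv k) _ _ fun l => rfl

theorem eps_invol (x : Amb k) : eps (invol x) = eps x := by
  rw [eps_eq_none, eps_eq_none, sigh_invol]
  rfl

/-- `J² = -1` in every slot, and the number `2k` of slots is even. -/
theorem tconj_tconj (T : Tensor k) : tconj (tconj T) = T := by
  funext f i j
  simp only [tconj, star_mul', star_prod, star_star, negN_negN, Fin.rev_rev]
  have h1 : ∏ l : Nut k, (star (if (f (negN l)).rev = 0 then -1 else 1) : ℂ) =
      ∏ l, if (f l).rev = 0 then -1 else 1 := by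
    refine Fintype.prod_equiv (negNEquiv k) _ _ fun l => ?_
    simp only [negNEquiv, Equiv.coe_fn_mk]
    split_ifs with h <;> simp [h]
  have h2 : (∏ l : Nut k, if f l = 0 then (-1 : ℂ) else 1) * ∏ l, (if (f l).rev = 0 then -1 else 1) =
      1 := by
    rw [← Finset.prod_mul_distrib]
    have : ∀ l : Nut k, ((if f l = 0 then (-1 : ℂ) else 1) * if (f l).rev = 0 then -1 else 1) = -1 := by
      intro l
      generalize f l = i
      fin_cases i <;> simp
    rw [Finset.prod_congr rfl fun l _ => this l, Finset.prod_const, Finset.card_univ,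
      Fintype.card_prod, Fintype.card_bool, mul_comm, pow_mul]
    simp
  rw [h1, ← mul_assoc, h2, one_mul]

theorem invol_invol (x : Amb k) : invol (invol x) = x := by
  refine Prod.ext (Prod.ext (neg_neg _) rfl) (Prod.ext rfl (Prod.ext ?_ (Prod.ext ?_ ?_)))
  · funext l
    simp [invol]
  · funext l
    simp [invol]
  · exact tconj_tconj _

theorem IsOuter.circ {x : Amb k} (h : IsOuter p δ x) {c : ℂ} (hc : ‖c‖ = 1) :
    IsOuter p δ (circ c x) := by
  obtain ⟨w, z, hw, hz, hT⟩ := h.tensor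
  obtain ⟨d, hd, e⟩ := exists_sq_phase w hc
  refine ⟨h.base, h.t_nonneg, h.r_nonneg, h.eps_lt, h.sig_lt, h.r_smul, h.norm_none, h.norm_some,
    ⟨d • w, z, hw.smul hd, hz, ?_⟩⟩
  change c • x.2.2.2.2 = _
  rw [hT, smul_tens, e]

theorem IsOuter.invol {x : Amb k} (h : IsOuter p δ x) : IsOuter p δ (invol x) := by
  obtain ⟨w, z, hw, hz, hT⟩ := h.tensor
  refine ⟨⟨?_, h.base.2⟩, h.t_nonneg, fun l => h.r_nonneg _, ?_, ?_, fun l => ?_, ?_, fun l => ?_,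
    ⟨star w, fun l => conjJ (z (negN l)), hw.star, fun l => ?_, ?_⟩⟩
  · change ‖-x.1.1‖ ^ 2 + x.1.2 ^ 2 = 1
    rw [norm_neg]
    exact h.base.1
  · rw [eps_invol]
    exact h.eps_lt
  · rw [sigh_invol]
    exact h.sig_lt
  · have h1 := h.r_smul (negLabel l)
    rw [pt_negLabel] at h1
    change -x.1.1 - x.1.2 • pt p l = x.2.2.1 (negLabel l) • -x.2.2.2.1 (negLabel l)
    rw [smul_neg, ← h1]
    simp
    abel
  · exact (norm_neg _).trans h.norm_none
  · rw [sden_invol]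
    change ‖-x.2.2.2.1 (some (negN l))‖ ^ 2 + _ = 1
    rw [norm_neg]
    exact h.norm_some _
  · rw [hopf_conjJ, hz]
    rfl
  · change tconj x.2.2.2.2 = _
    rw [hT, tconj_tens, sq_star]

theorem IsInner.invol {x : Amb k} (h : IsInner p δ x) : IsInner p δ (invol x) := by
  obtain ⟨Z, r, hq, hr, rfl⟩ := h
  refine ⟨star Z, r, ⟨⟨?_, ?_, ?_⟩, hq.2⟩, ?_, invol_alpha p Z r⟩
  · rw [rePart_star]
    exact hq.1.1
  · rw [rePart_star, imPart_star, inner_neg_right, hq.1.2.1, neg_zero]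
  · rw [imPart_star, norm_neg]
    exact hq.1.2.2
  · rw [imPart_star, norm_neg]
    exact hr

theorem invol_mem {x : Amb k} (h : x ∈ total p δ) : invol x ∈ total p δ :=
  h.imp IsOuter.invol IsInner.invol

variable [H : Admissible p δ]

theorem total_nonneg {x : Amb k} (hx : x ∈ total p δ) (F : Face k) : 0 ≤ faceFun F x := by
  rcases hx with hx | ⟨Z, r, hq, hr, rfl⟩
  · rcases F with _ | l | _
    · exact hx.t_nonneg
    · exact hx.r_nonneg l
    · exact hx.base.2
  · have h1 : ‖imPart Z‖ ^ 2 ≤ 1 := pow_le_one₀ (norm_nonneg _) hq.1.2.2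
    have h0 := sqrt_one_add_pos r
    rcases F with _ | (_ | l) | _
    · exact div_nonneg (mul_nonneg (by linarith) h0.le)
        (Finset.prod_nonneg fun l _ => rad_nonneg l)
    · exact mul_nonneg hq.2.1 (inv_pos.2 h0).le
    · exact rad_nonneg l
    · exact (inv_pos.2 h0).le

theorem eps_mem {x : Amb k} (hx : x ∈ total p δ) : eps x ∈ Ico 0 (δ ^ 2) := by
  refine ⟨mul_nonneg (total_nonneg hx .ad) (Finset.prod_nonneg fun l _ => total_nonneg hx (.pt l)), ?_⟩
  rcases hx with hx | ⟨Z, r, hq, hr, rfl⟩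
  · exact hx.eps_lt
  · rw [eps_alpha H.lt_norm hq]
    exact hr

/-- Points on a face over a point of `P ∪ {0}` lie over that point. -/
theorem base_of_r_eq_zero {x : Amb k} (hx : x ∈ total p δ) {l : Option (Nut k)}
    (h : x.2.2.1 l = 0) : x.1.1 = x.1.2 • pt p l ∧ 0 < x.1.2 := by
  rcases hx with hx | ⟨Z, r, hq, hr, rfl⟩
  · have h1 := hx.r_smul l
    rw [h, zero_smul, sub_eq_zero] at h1
    refine ⟨h1, hx.base.2.lt_of_ne fun h2 => ?_⟩
    have := hx.base.1
    rw [h1, ← h2] at this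
    simp at this
  · obtain ⟨-, -, -, -, h4, h5⟩ := alpha_mem_bdry H.lt_norm hq
    rcases l with _ | l
    · have h6 := h4.1 h
      refine ⟨?_, inv_pos.2 (sqrt_one_add_pos r)⟩
      rw [alpha_u, h6]
      simp [pt]
    · exact absurd h (h5 l)

theorem label_eq_of_r_eq_zero {x : Amb k} (hx : x ∈ total p δ) {l m : Option (Nut k)}
    (h : x.2.2.1 l = 0) (h' : x.2.2.1 m = 0) : l = m := by
  obtain ⟨h1, h2⟩ := base_of_r_eq_zero hx h
  obtain ⟨h3, -⟩ := base_of_r_eq_zero hx h'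
  exact H.inj (smul_right_injective _ h2.ne' (h1.symm.trans h3))

/-- A point of the face over `q` satisfies `u = s q` with `s > 0`. So it is not at infinity, and it
determines `q`. -/
theorem face_eq_of_zero {x : Amb k} (hx : x ∈ total p δ) {F G : Face k} (hF : F ≠ .ad)
    (hG : G ≠ .ad) (h : faceFun F x = 0) (h' : faceFun G x = 0) : F = G := by
  rcases F with _ | l | _
  · exact absurd rfl hF
  · rcases G with _ | m | _
    · exact absurd rfl hG
    · rw [label_eq_of_r_eq_zero hx h h']
    · exact absurd h' (base_of_r_eq_zero hx h).2.ne'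
  · rcases G with _ | m | _
    · exact absurd rfl hG
    · exact absurd h (base_of_r_eq_zero hx h').2.ne'
    · rfl

theorem base_eq_toRbar {x : Amb k} (hx : IsOuter p δ x) {q : E3} (h : x.1.1 = x.1.2 • q) :
    x.1 = toRbar q := by
  have h1 := hx.base.1
  rw [h, norm_smul, Real.norm_of_nonneg hx.base.2, mul_pow] at h1
  have h2 : x.1.2 = (√(1 + ‖q‖ ^ 2))⁻¹ := by
    refine eq_inv_of_mul_eq_one_left ?_
    rw [← sq_eq_sq₀ (mul_nonneg hx.base.2 (Real.sqrt_nonneg _)) zero_le_one, mul_pow,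
      Real.sq_sqrt (by positivity)]
    linarith
  refine Prod.ext ?_ h2
  rw [h, h2]
  rfl

theorem mem_bdry_iff (x : Amb k) : x ∈ bdry k ↔ ∃ F, faceFun F x = 0 := by
  constructor
  · rintro (h | h | ⟨l, h⟩)
    · exact ⟨.infty, h⟩
    · exact ⟨.ad, h⟩
    · exact ⟨.pt l, h⟩
  · rintro ⟨_ | l | _, h⟩
    · exact Or.inr (Or.inl h)
    · exact Or.inr (Or.inr ⟨l, h⟩)
    · exact Or.inl h

theorem mem_corn_iff (x : Amb k) :
    x ∈ corn k ↔ faceFun .ad x = 0 ∧ ∃ F, F ≠ .ad ∧ faceFun F x = 0 := by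
  refine and_congr_right fun _ => ⟨?_, ?_⟩
  · rintro (h | ⟨l, h⟩)
    · exact ⟨.infty, by simp, h⟩
    · exact ⟨.pt l, by simp, h⟩
  · rintro ⟨_ | l | _, h1, h⟩
    · exact absurd rfl h1
    · exact Or.inr ⟨l, h⟩
    · exact Or.inl h

theorem eps_eq_zero_iff (x : Amb k) : eps x = 0 ↔ faceFun .ad x = 0 ∨ ∃ l, faceFun (.pt l) x = 0 := by
  rw [eps, mul_eq_zero, Finset.prod_eq_zero_iff]
  simp [faceFun]

end Structure

/-! ### Tangent vectors -/

section Tangent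

variable {k : ℕ} {p : Fin k → E3} {δ : ℝ}

/-- The properties of the velocity vector at `w` of a curve `γ` in the set `S`. -/
def IsVelocity (S : Set (Amb k)) [HasCorners S (bdry k) (corn k)] (γ : ℝ → Amb k) (w : S)
    (v : E5) : Prop :=
  (∀ f g : Amb k → ℝ, ContDiff ℝ ∞ f → ContDiff ℝ ∞ g →
    (∀ᶠ τ in 𝓝[≥] (0 : ℝ), f (γ τ) = f w + τ * g (γ τ)) →
      diff J5 (fun x : S => f x) w v = g w) ∧
  ∀ f g : Amb k → ℝ, ContDiff ℝ ∞ f → ContDiff ℝ ∞ g → f w = 0 →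
    diff J5 (fun x : S => f x * g x) w v = diff J5 (fun x : S => f x) w v * g w

/-- The two rules suffice to evaluate all differentials below without differentiating a chart: a
function of the form `f(w) + τ g` along the curve has derivative `g(w)`, and a product whose first
factor vanishes has derivative `f' g`. -/
theorem exists_isVelocity {S : Set (Amb k)} [HasCorners S (bdry k) (corn k)] (γ : ℝ → Amb k)
    (w : S) (hw : γ 0 = w) (hγ : ContDiffWithinAt ℝ ∞ γ (Ici 0) 0)
    (hS : ∀ᶠ t in 𝓝[≥] (0 : ℝ), γ t ∈ S) : ∃ v, IsVelocity S γ w v := by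
  have : Nonempty S := ⟨w⟩
  obtain ⟨v, hv⟩ := exists_tangent_vector γ w hw hγ hS
  have hd : ∀ f : Amb k → ℝ, ContDiff ℝ ∞ f →
      HasDerivWithinAt (fun t => f (γ t)) (derivWithin (fun t => f (γ t)) (Ici 0) 0) (Ici 0) 0 :=
    fun f hf => ((hf.contDiffAt.comp_contDiffWithinAt 0 hγ).differentiableWithinAt
      (by simp)).hasDerivWithinAt
  refine ⟨v, fun f g hf hg h => ?_, fun f g hf hg h0 => ?_⟩
  · refine hv f _ hf ?_
    have h1 := (((hasDerivWithinAt_id (0 : ℝ) (Ici 0)).mul (hd g hg)).const_add (f w))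
    simp only [id_eq, one_mul, zero_mul, add_zero, hw] at h1
    refine h1.congr_of_eventuallyEq h ?_
    simp [hw]
  · rw [hv f _ hf (hd f hf)]
    refine hv (fun x => f x * g x) _ (hf.mul hg) ?_
    have h1 := (hd f hf).mul (hd g hg)
    simp only [hw, h0, zero_mul, add_zero] at h1
    exact h1

theorem exists_isVelocity_comp {X : Type*} [NormedAddCommGroup X] [NormedSpace ℝ X]
    {S : Set (Amb k)} [HasCorners S (bdry k) (corn k)] {ψ : X → Amb k} {M D : Set X}
    (hψ : ContDiffOn ℝ ∞ ψ (M ∩ D)) (hD : IsOpen D) (hS : MapsTo ψ (M ∩ D) S) {κ : ℝ → X}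
    (hκ : ContDiffWithinAt ℝ ∞ κ (Ici 0) 0) (hM : ∀ᶠ τ in 𝓝[≥] (0 : ℝ), κ τ ∈ M) (h0 : κ 0 ∈ D)
    {w : S} (hw : ψ (κ 0) = w) :
    (∀ᶠ τ in 𝓝[≥] (0 : ℝ), κ τ ∈ M ∩ D) ∧ ∃ v, IsVelocity S (fun τ => ψ (κ τ)) w v := by
  have h1 : ∀ᶠ τ in 𝓝[≥] (0 : ℝ), κ τ ∈ M ∩ D :=
    hM.and (hκ.continuousWithinAt (hD.mem_nhds h0))
  refine ⟨h1, exists_isVelocity _ w hw ?_ (h1.mono fun τ hτ => hS hτ)⟩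
  exact (hψ _ (h1.self_of_nhdsWithin self_mem_Ici)).comp_of_preimage_mem_nhdsWithin 0 hκ h1

variable [H : Admissible p δ]

theorem exists_isVelocity_alpha {κ : ℝ → (Fin 3 → ℂ) × ℝ}
    (hκ : ContDiffWithinAt ℝ ∞ κ (Ici 0) 0)
    (hM : ∀ᶠ τ in 𝓝[≥] (0 : ℝ), κ τ ∈ AHhatBar ×ˢ Ici (0 : ℝ)) (h0 : (κ 0).2 < δ)
    (h1 : (κ 0).2 * (1 - ‖imPart (κ 0).1‖ ^ 2) < δ ^ 2)
    {w : total p δ} (hw : alpha p (κ 0).1 (κ 0).2 = w) :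
    (∀ᶠ τ in 𝓝[≥] (0 : ℝ), ((κ τ).1, (κ τ).2) ∈ DomA δ) ∧
      ∃ v, IsVelocity (total p δ) (fun τ => alpha p (κ τ).1 (κ τ).2) w v := by
  have hD : IsOpen {q : (Fin 3 → ℂ) × ℝ | q.2 < δ ∧ q.2 * (1 - ‖imPart q.1‖ ^ 2) < δ ^ 2} := by
    have h1 := contDiff_imPart.continuous
    have h2 : IsOpen {q : (Fin 3 → ℂ) × ℝ | q.2 < δ} := isOpen_lt (by fun_prop) (by fun_prop)
    have h3 : IsOpen {q : (Fin 3 → ℂ) × ℝ | q.2 * (1 - ‖imPart q.1‖ ^ 2) < δ ^ 2} :=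
      isOpen_lt (by fun_prop) (by fun_prop)
    exact h2.inter h3
  obtain ⟨h2, h3⟩ := exists_isVelocity_comp (ψ := fun q : (Fin 3 → ℂ) × ℝ => alpha p q.1 q.2)
    ((contDiffOn_alpha H.lt_norm).mono fun q hq => ⟨hq.1.1, hq.1.2, hq.2.1⟩) hD
    (fun q hq => Or.inr ⟨q.1, q.2, ⟨hq.1.1, hq.1.2, hq.2.1⟩, hq.2.2, rfl⟩) hκ hM ⟨h0, h1⟩ hw
  exact ⟨h2.mono fun τ hτ => ⟨hτ.1.1, hτ.1.2, hτ.2.1⟩, h3⟩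

theorem exists_isVelocity_gam {a : Nut k → Fin 2 → ℂ} {κ : ℝ → ((Fin 3 → ℂ) × ℝ × ℝ) × ℝ}
    (hκ : ContDiffWithinAt ℝ ∞ κ (Ici 0) 0)
    (hM : ∀ᶠ τ in 𝓝[≥] (0 : ℝ), κ τ ∈ polSet ×ˢ Ici (0 : ℝ)) (h0 : κ 0 ∈ DomG p a δ)
    {w : total p δ} (hw : gam p a (κ 0) = w) :
    (∀ᶠ τ in 𝓝[≥] (0 : ℝ), κ τ ∈ DomG p a δ) ∧
      ∃ v, IsVelocity (total p δ) (fun τ => gam p a (κ τ)) w v := by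
  obtain ⟨h2, h3⟩ := exists_isVelocity_comp ((contDiffOn_gam a).mono fun q hq => hq.2)
    (isOpen_DomG a) (fun q hq => Or.inl (isOuter_gam hq)) hκ hM h0 hw
  exact ⟨h2.mono fun τ hτ => hτ.2, h3⟩

theorem exists_isVelocity_bet {a : Nut k → Fin 2 → ℂ} {b : E3} {l : Nut k}
    {κ : ℝ → ((Fin 2 → ℂ) × ℝ) × ℝ} (hκ : ContDiffWithinAt ℝ ∞ κ (Ici 0) 0)
    (hM : ∀ᶠ τ in 𝓝[≥] (0 : ℝ), κ τ ∈ nutSet ×ˢ Ici (0 : ℝ)) (h0 : κ 0 ∈ DomB p a b l δ)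
    {w : total p δ} (hw : bet p a b l (κ 0) = w) :
    (∀ᶠ τ in 𝓝[≥] (0 : ℝ), κ τ ∈ DomB p a b l δ) ∧
      ∃ v, IsVelocity (total p δ) (fun τ => bet p a b l (κ τ)) w v := by
  obtain ⟨h2, h3⟩ := exists_isVelocity_comp ((contDiffOn_bet a b l).mono fun q hq => hq.2)
    (isOpen_DomB a b l) (fun q hq => Or.inl (isOuter_bet hq)) hκ hM h0 hw
  exact ⟨h2.mono fun τ hτ => hτ.2, h3⟩

theorem contDiff_prod_r : ContDiff ℝ ∞ fun x : Amb k => ∏ l, x.2.2.1 l :=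
  contDiff_prod fun l _ => by fun_prop

theorem contDiff_prod_r_some : ContDiff ℝ ∞ fun x : Amb k => ∏ l, x.2.2.1 (some l) :=
  contDiff_prod fun l _ => by fun_prop

theorem contDiff_prod_r_erase (l : Nut k) :
    ContDiff ℝ ∞ fun x : Amb k => ∏ m ∈ Finset.univ.erase (some l), x.2.2.1 m :=
  contDiff_prod fun l _ => by fun_prop

theorem eventually_nonneg : ∀ᶠ τ in 𝓝[≥] (0 : ℝ), 0 ≤ τ := eventually_mem_nhdsWithin

theorem eventually_lt_one : ∀ᶠ τ in 𝓝[≥] (0 : ℝ), τ < 1 :=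
  nhdsWithin_le_nhds (Iio_mem_nhds zero_lt_one)

/-- A tangent vector that is transversal to the face `F` and tangential to the other faces. -/
def HasTransversal (S : Set (Amb k)) [HasCorners S (bdry k) (corn k)] (F : Face k) (w : S) : Prop :=
  ∃ v, diff J5 (fun x : S => faceFun F x) w v ≠ 0 ∧
    ∀ G, G ≠ F → faceFun G w = 0 → diff J5 (fun x : S => faceFun G x) w v = 0

/-- A tangent vector that is transversal to the fibres and tangential to the face at infinity. -/
def HasFibreTransversal (S : Set (Amb k)) [HasCorners S (bdry k) (corn k)] (w : S) : Prop :=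
  ∃ v, diff J5 (fun x : S => eps (x : Amb k)) w v ≠ 0 ∧
    (faceFun .infty (w : Amb k) = 0 →
      diff J5 (fun x : S => faceFun .infty (x : Amb k)) w v = 0)

theorem IsVelocity.const {S : Set (Amb k)} [HasCorners S (bdry k) (corn k)] {γ : ℝ → Amb k} {w : S}
    {v : E5} (h : IsVelocity S γ w v) {f : Amb k → ℝ} (hf : ContDiff ℝ ∞ f)
    (hc : ∀ᶠ τ in 𝓝[≥] (0 : ℝ), f (γ τ) = f w) : diff J5 (fun x : S => f x) w v = 0 :=
  h.1 f (fun _ => 0) hf contDiff_const (hc.mono fun τ hτ => by rw [hτ]; simp)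

/-- Meant for `f = t`, which is not itself an explicit function of the curve parameter, while its
product with suitable radii is. -/
theorem IsVelocity.ne_zero_of_mul {S : Set (Amb k)} [HasCorners S (bdry k) (corn k)] {γ : ℝ → Amb k}
    {w : S} {v : E5} (h : IsVelocity S γ w v) {f g : Amb k → ℝ} (hf : ContDiff ℝ ∞ f)
    (hg : ContDiff ℝ ∞ g) (h0 : f w = 0) {c : ℝ} (hc : c ≠ 0)
    (he : ∀ᶠ τ in 𝓝[≥] (0 : ℝ), f (γ τ) * g (γ τ) = τ * c) :
    diff J5 (fun x : S => f x) w v ≠ 0 := by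
  intro h1
  have h2 := h.2 f g hf hg h0
  rw [h1, zero_mul] at h2
  refine hc ?_
  rw [← h2]
  exact (h.1 (fun x => f x * g x) (fun _ => c) (hf.mul hg) contDiff_const
    (he.mono fun τ hτ => by rw [hτ, h0]; simp)).symm

/-! #### The region near the face over `0` -/

theorem hasTransversal_alpha_ad {Z : Fin 3 → ℂ} {r : ℝ} (hq : (Z, r) ∈ DomA δ)
    (hr : r * (1 - ‖imPart Z‖ ^ 2) < δ ^ 2) {w : total p δ} (hw : alpha p Z r = w)
    (h0 : faceFun .ad (w : Amb k) = 0) : HasTransversal (total p δ) .ad w := by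
  have hZ : ‖imPart Z‖ = 1 := (alpha_mem_bdry H.lt_norm hq).2.2.2.1.1 (hw ▸ h0)
  -- Shrinking the imaginary part by `√(1 - τ)` gives `1 - |Im Z|² = τ`, so `t` times the radii at
  -- `P` is `τ √(1 + r²)`.
  set κ : ℝ → (Fin 3 → ℂ) × ℝ := fun τ => (cvec (rePart Z) (√(1 - τ) • imPart Z), r) with hκ
  have k0 : κ 0 = (Z, r) := by simp [hκ, cvec_re_im]
  have hs : ContDiffAt ℝ ∞ (fun τ : ℝ => √(1 - τ)) 0 :=
    ContDiffAt.sqrt (by fun_prop) (by norm_num)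
  have k1 : ContDiffWithinAt ℝ ∞ κ (Ici 0) 0 := by
    refine ContDiffWithinAt.prodMk ?_ contDiffWithinAt_const
    have : ContDiffOn ℝ ∞ (fun t : ℝ => cvec (rePart Z) (t • imPart Z)) univ :=
      contDiff_cvec contDiffOn_const (contDiffOn_id.smul contDiffOn_const)
    exact ((contDiffOn_univ.1 this).contDiffAt.comp 0 hs).contDiffWithinAt
  have k2 : ∀ τ : ℝ, 0 ≤ τ → τ < 1 → ‖imPart (κ τ).1‖ ^ 2 = 1 - τ := fun τ h1 h2 => by
    rw [hκ]
    simp only [imPart_cvec]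
    rw [norm_smul, hZ, mul_one, Real.norm_of_nonneg (Real.sqrt_nonneg _),
      Real.sq_sqrt (by linarith)]
  have k3 : ∀ᶠ τ in 𝓝[≥] (0 : ℝ), κ τ ∈ AHhatBar ×ˢ Ici (0 : ℝ) := by
    filter_upwards [eventually_nonneg, eventually_lt_one] with τ h1 h2
    refine ⟨⟨?_, ?_, ?_⟩, hq.2.1⟩
    · simpa [hκ] using hq.1.1
    · simp [hκ, inner_smul_right, hq.1.2.1]
    · have := k2 τ h1 h2
      nlinarith [norm_nonneg (imPart (κ τ).1)]
  obtain ⟨h1, v, hv⟩ := exists_isVelocity_alpha (p := p) (w := w) k1 k3 (by rw [k0]; exact hq.2.2)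
    (by rw [k0]; exact hr) (by rw [k0]; exact hw)
  refine ⟨v, ?_, fun G hG h2 => ?_⟩
  · refine hv.ne_zero_of_mul (contDiff_faceFun _) contDiff_prod_r_some h0 (sqrt_one_add_pos r).ne' ?_
    filter_upwards [eventually_nonneg, eventually_lt_one, h1] with τ h1 h2 h3
    have := sigh_alpha H.lt_norm h3
    rw [sigh] at this
    rw [faceFun, this, k2 τ h1 h2]
    simp [hκ]
  · rw [← hw] at h2
    obtain ⟨-, -, g1, -, g2, g3⟩ := alpha_mem_bdry H.lt_norm hq
    rcases G with _ | (_ | l) | _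
    · exact absurd rfl hG
    · refine hv.const (contDiff_faceFun (.pt none)) (Filter.Eventually.of_forall fun τ => ?_)
      rw [← hw]
      rfl
    · exact absurd h2 (g3 l)
    · exact absurd h2 g1

/-- The face over `0` is the only one besides `X_ad` in this region. Along `r = τ` with `Z` fixed,
`r_0 = τ s`, where `s` is a smooth positive function; a curve that starts in `X_ad` stays there, as
this depends on `Z` only. -/
theorem hasTransversal_alpha_pt {Z : Fin 3 → ℂ} {r : ℝ} (hq : (Z, r) ∈ DomA δ)
    (hr : r * (1 - ‖imPart Z‖ ^ 2) < δ ^ 2) {w : total p δ} (hw : alpha p Z r = w) {F : Face k}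
    (hF : F ≠ .ad) (h0 : faceFun F (w : Amb k) = 0) : HasTransversal (total p δ) F w := by
  obtain ⟨-, -, g1, g2, g3, g4⟩ := alpha_mem_bdry H.lt_norm hq
  rw [← hw] at h0
  rcases F with _ | (_ | l) | _
  · exact absurd rfl hF
  · have hr0 : r = 0 := g3.1 h0
    subst hr0
    obtain ⟨h1, v, hv⟩ := exists_isVelocity_alpha (p := p) (w := w) (κ := fun τ => (Z, τ))
      (by fun_prop) (eventually_nonneg.mono fun τ hτ => ⟨hq.1, hτ⟩) hq.2.2 hr hw
    refine ⟨v, ?_, fun G hG h2 => ?_⟩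
    · rw [hv.1 (faceFun (.pt none)) (faceFun .infty) (contDiff_faceFun _) (contDiff_faceFun _)
        (Filter.Eventually.of_forall fun τ => ?_)]
      · rw [← hw]
        exact g1
      · rw [← hw, h0, zero_add]
        rfl
    · have hx := w.2
      rcases G with _ | m | _
      · refine hv.const (contDiff_faceFun .ad) (h1.mono fun τ hτ => ?_)
        rw [h2]
        exact (alpha_mem_bdry H.lt_norm hτ).2.2.2.1.2 (g2.1 (hw ▸ h2))
      · exact absurd (face_eq_of_zero hx (by simp) (by simp) h2 (hw ▸ h0)) hG
      · exact absurd (face_eq_of_zero hx (by simp) (by simp) h2 (hw ▸ h0)) hG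
  · exact absurd h0 (g4 l)
  · exact absurd h0 g1

/-- With `Z` fixed, `ε = (r + τ)(1 - |Im Z|²)` is affine in `τ`, and `ε > 0` makes the slope
nonzero. -/
theorem hasFibreTransversal_alpha {Z : Fin 3 → ℂ} {r : ℝ} (hq : (Z, r) ∈ DomA δ)
    (hr : r * (1 - ‖imPart Z‖ ^ 2) < δ ^ 2) {w : total p δ} (hw : alpha p Z r = w)
    (h0 : 0 < eps (w : Amb k)) : HasFibreTransversal (total p δ) w := by
  have h5 : 1 - ‖imPart Z‖ ^ 2 ≠ 0 := by
    intro h6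
    rw [← hw, eps_alpha H.lt_norm hq, h6, mul_zero] at h0
    exact lt_irrefl _ h0
  obtain ⟨h1, v, hv⟩ := exists_isVelocity_alpha (p := p) (w := w) (κ := fun τ => (Z, r + τ))
    (by fun_prop) (eventually_nonneg.mono fun τ hτ => ⟨hq.1, add_nonneg hq.2.1 hτ⟩)
    (by simpa using hq.2.2) (by simpa using hr) (by simpa using hw)
  refine ⟨v, ?_, fun h2 => absurd (hw ▸ h2) (alpha_mem_bdry H.lt_norm hq).2.2.1⟩
  refine ne_of_eq_of_ne (hv.1 eps (fun _ => 1 - ‖imPart Z‖ ^ 2) contDiff_eps contDiff_const ?_) ?_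
  · filter_upwards [h1] with τ hτ
    rw [← hw, eps_alpha H.lt_norm hτ, eps_alpha H.lt_norm hq]
    ring
  · exact h5

/-! #### The region away from the points of `P ∪ {0}` -/

section Gam

variable {a : Nut k → Fin 2 → ℂ} {q : ((Fin 3 → ℂ) × ℝ × ℝ) × ℝ}

theorem eps_gam (hq : q ∈ DomG p a δ) : eps (gam p a q) = q.2 := by
  rw [gam, eps_theta fun l => (hq.1.1.rad_pos l).ne', mul_div_cancel₀ _ hq.1.2.ne']

theorem r_gam_ne_zero (hq : q ∈ DomG p a δ) (l : Option (Nut k)) : (gam p a q).2.2.1 l ≠ 0 := by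
  rcases l with _ | l
  · exact hq.1.2.ne'
  · exact (hq.1.1.rad_pos l).ne'

variable (hq : q ∈ (polSet ×ˢ Ici (0 : ℝ)) ∩ DomG p a δ) {w : total p δ} (hw : gam p a q = w)
include hq hw

theorem exists_isVelocity_gam_eps : ∃ v, IsVelocity (total p δ)
    (fun τ => gam p a (q.1, q.2 + τ)) w v ∧
    ∀ᶠ τ in 𝓝[≥] (0 : ℝ), eps (gam p a (q.1, q.2 + τ)) = q.2 + τ := by
  obtain ⟨h1, v, hv⟩ := exists_isVelocity_gam (p := p) (a := a) (w := w)
    (κ := fun τ => (q.1, q.2 + τ)) (by fun_prop)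
    (eventually_nonneg.mono fun τ hτ => ⟨hq.1.1, add_nonneg hq.1.2 hτ⟩)
    (by simpa using hq.2) (by simpa using hw)
  exact ⟨v, hv, h1.mono fun τ hτ => eps_gam hτ⟩

theorem hasFibreTransversal_gam : HasFibreTransversal (total p δ) w := by
  obtain ⟨v, hv, h1⟩ := exists_isVelocity_gam_eps hq hw
  refine ⟨v, ?_, fun h2 => hv.const (contDiff_faceFun .infty)
    (Filter.Eventually.of_forall fun τ => by rw [← hw]; rfl)⟩
  refine ne_of_eq_of_ne (hv.1 eps (fun _ => 1) contDiff_eps contDiff_const ?_) one_ne_zero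
  · filter_upwards [h1] with τ hτ
    rw [← hw, hτ, eps_gam hq.2, mul_one]

/-- All radii are positive in this region, so `X_ad` and `I_∞` are the only possible faces. They are
left by increasing `ε` and by moving along the half circle. -/
theorem hasTransversal_gam {F : Face k} (h0 : faceFun F (w : Amb k) = 0) :
    HasTransversal (total p δ) F w := by
  have hr := r_gam_ne_zero hq.2
  have ht : ∀ {q}, q ∈ DomG p a δ → (q.2 = 0 ↔ faceFun .ad (gam p a q) = 0) := fun {q} hq => by
    have := eps_eq_zero_iff (gam p a q)
    rw [eps_gam hq] at this
    rw [this, or_iff_left]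
    rintro ⟨l, h⟩
    exact r_gam_ne_zero hq l h
  rcases F with _ | l | _
  · obtain ⟨v, hv, h1⟩ := exists_isVelocity_gam_eps hq hw
    have hq0 : q.2 = 0 := (ht hq.2).2 (hw ▸ h0)
    refine ⟨v, ?_, fun G hG h2 => ?_⟩
    · refine hv.ne_zero_of_mul (contDiff_faceFun _) contDiff_prod_r h0 one_ne_zero ?_
      filter_upwards [h1] with τ hτ
      rw [hq0, zero_add] at hτ
      rw [mul_one, hq0, zero_add]
      exact hτ
    · rcases G with _ | m | _
      · exact absurd rfl hG
      · exact absurd (hw ▸ h2) (hr m)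
      · exact hv.const (contDiff_faceFun .infty)
          (Filter.Eventually.of_forall fun τ => by rw [← hw]; rfl)
  · exact absurd (hw ▸ h0) (hr l)
  · have hs0 : q.1.2.1 = 0 := by
      rw [← hw] at h0
      exact h0
    have hr1 : q.1.2.2 = 1 := by
      have := hq.1.1.2.1
      rw [hs0] at this
      have h3 : q.1.2.2 ^ 2 = 1 := by linarith
      exact (pow_eq_one_iff_of_nonneg hq.2.1.2.le two_ne_zero).1 h3
    have k0 : ((q.1.1, ((0 : ℝ), √(1 - (0 : ℝ) ^ 2))), q.2) = q := by
      refine Prod.ext (Prod.ext rfl (Prod.ext hs0.symm ?_)) rfl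
      simp [hr1]
    have hs : ContDiffAt ℝ ∞ (fun τ : ℝ => √(1 - τ ^ 2)) 0 :=
      ContDiffAt.sqrt (by fun_prop) (by norm_num)
    obtain ⟨h1, v, hv⟩ := exists_isVelocity_gam (p := p) (a := a) (w := w)
      -- The half circle parametrized by `s = τ`, starting at infinity, with the frame and `ε`
      -- fixed; fixing `ε = 0` keeps the curve in `X_ad`.
      (κ := fun τ => ((q.1.1, (τ, √(1 - τ ^ 2))), q.2))
      (ContDiffWithinAt.prodMk (contDiffWithinAt_const.prodMk (contDiffWithinAt_id.prodMk
        hs.contDiffWithinAt)) contDiffWithinAt_const) (by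
        filter_upwards [eventually_nonneg, eventually_lt_one] with τ h1 h2
        refine ⟨⟨hq.1.1.1, ?_, h1⟩, hq.1.2⟩
        change τ ^ 2 + √(1 - τ ^ 2) ^ 2 = 1
        rw [Real.sq_sqrt (by nlinarith)]
        ring) (by rw [k0]; exact hq.2) (by rw [k0]; exact hw)
    refine ⟨v, ?_, fun G hG h2 => ?_⟩
    · rw [hv.1 (faceFun .infty) (fun _ => 1) (contDiff_faceFun _) contDiff_const
        (Filter.Eventually.of_forall fun τ => ?_)]
      · exact one_ne_zero
      · rw [h0, zero_add, mul_one]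
        rfl
    · rcases G with _ | m | _
      · refine hv.const (contDiff_faceFun .ad) (h1.mono fun τ hτ => ?_)
        rw [h2]
        exact (ht hτ).1 ((ht hq.2).2 (hw ▸ h2))
      · exact absurd (hw ▸ h2) (hr m)
      · exact absurd rfl hG

end Gam

/-! #### The region near the faces over the points of `P` -/

section Bet

variable {a : Nut k → Fin 2 → ℂ} {b : E3} {l : Nut k} {q : ((Fin 2 → ℂ) × ℝ) × ℝ}

theorem bet_t_eq_zero_iff (hq : q ∈ DomB p a b l δ) :
    faceFun .ad (bet p a b l q) = 0 ↔ q.1.2 = 0 := by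
  rw [← sden_bet hq, sden_eq, mul_eq_zero, or_iff_left]
  · rfl
  · exact mul_ne_zero (bet_r_none_pos hq).ne' (Finset.prod_ne_zero_iff.2 fun m hm =>
      (bet_r_pos hq (Finset.ne_of_mem_erase hm)).ne')

theorem bet_face_eq_zero_iff (hq : q ∈ DomB p a b l δ) {F : Face k} (hF : F ≠ .ad) :
    faceFun F (bet p a b l q) = 0 ↔ F = .pt (some l) ∧ q.2 = 0 := by
  rcases F with _ | (_ | m) | _
  · exact absurd rfl hF
  · simpa [faceFun] using (bet_r_none_pos hq).ne'
  · rcases eq_or_ne m l with rfl | hm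
    · have hs := bet_s_pos (p := p) (a := a) (b := b) (l := m) (q := q)
      simp only [faceFun, bet_r_self, mul_eq_zero, true_and]
      exact or_iff_right hs.ne'
    · simpa [hm, faceFun] using (bet_r_pos hq hm).ne'
  · simpa [faceFun] using (bet_s_pos (p := p) (a := a) (b := b) (l := l) (q := q)).ne'

variable (hq : q ∈ (nutSet ×ˢ Ici (0 : ℝ)) ∩ DomB p a b l δ) {w : total p δ}
  (hw : bet p a b l q = w) (h : w.1.1.1 = w.1.1.2 • pt p (some l))
include hq hw h

/-- Lying over `q` means `x - q = r · hopf z = 0`: the point is on the face, or it is fixed by the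
circle. The chart is used only at such points. -/
theorem bet_smul_hopf_eq_zero : q.2 • hopf q.1.1 = 0 := by
  have h1 := (isOuter_bet hq).r_smul (some l)
  rw [hw, h, sub_self, ← hw, bet_r_self, bet_v_self, ← smul_smul] at h1
  exact (smul_eq_zero.1 h1.symm).resolve_left bet_s_pos.ne'

theorem hasTransversal_bet_ad (h0 : faceFun .ad (w : Amb k) = 0) :
    HasTransversal (total p δ) .ad w := by
  have h2 : q.1.2 = 0 := (bet_t_eq_zero_iff hq.2).1 (hw ▸ h0)
  have h3 : nsq q.1.1 = 1 := by
    have := hq.1.1.1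
    rw [h2] at this
    have h4 : nsq q.1.1 ^ 2 = 1 := by linarith
    exact (pow_eq_one_iff_of_nonneg (nsq_nonneg _) two_ne_zero).1 h4
  have h4 : q.2 = 0 := (smul_eq_zero.1 (bet_smul_hopf_eq_zero hq hw h)).resolve_right fun h5 => by
    rw [← norm_hopf, h5, norm_zero] at h3
    exact zero_ne_one h3
  -- The Hopf map is quadratic and its norm enters squared, hence a fourth root is needed to stay on
  -- `|z|⁴ + σ² = 1` with `σ = τ`.
  have hs : ContDiffAt ℝ ∞ (fun τ : ℝ => √√(1 - τ ^ 2)) 0 :=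
    ContDiffAt.sqrt (ContDiffAt.sqrt (by fun_prop) (by norm_num)) (by norm_num)
  have k0 : ((√√(1 - (0 : ℝ) ^ 2) • q.1.1, (0 : ℝ)), q.2) = q := by
    refine Prod.ext (Prod.ext ?_ h2.symm) rfl
    simp
  obtain ⟨h1, v, hv⟩ := exists_isVelocity_bet (p := p) (a := a) (b := b) (l := l) (w := w)
    (κ := fun τ => ((√√(1 - τ ^ 2) • q.1.1, τ), q.2))
    (((hs.contDiffWithinAt.smul contDiffWithinAt_const).prodMk contDiffWithinAt_id).prodMk
      contDiffWithinAt_const) (by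
      filter_upwards [eventually_nonneg, eventually_lt_one] with τ h5 h6
      refine ⟨⟨?_, h5⟩, hq.1.2⟩
      change nsq (√√(1 - τ ^ 2) • q.1.1) ^ 2 + τ ^ 2 = 1
      rw [← norm_hopf, hopf_real_smul, norm_smul, norm_hopf, h3, mul_one,
        Real.sq_sqrt (Real.sqrt_nonneg _), Real.norm_of_nonneg (Real.sqrt_nonneg _),
        Real.sq_sqrt (by nlinarith)]
      ring) (by rw [k0]; exact hq.2) (by rw [k0]; exact hw)
  refine ⟨v, ?_, fun G hG h2 => ?_⟩
  · refine hv.ne_zero_of_mul (contDiff_faceFun _) (contDiff_prod_r_erase l) h0 one_ne_zero ?_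
    filter_upwards [h1] with τ hτ
    rw [mul_one]
    exact sden_bet hτ
  · obtain ⟨rfl, -⟩ := (bet_face_eq_zero_iff hq.2 hG).1 (hw ▸ h2)
    refine hv.const (contDiff_faceFun (.pt (some l))) (h1.mono fun τ hτ => ?_)
    rw [h2]
    exact (bet_face_eq_zero_iff hτ hG).2 ⟨rfl, h4⟩

theorem hasTransversal_bet_pt {F : Face k} (hF : F ≠ .ad) (h0 : faceFun F (w : Amb k) = 0) :
    HasTransversal (total p δ) F w := by
  obtain ⟨rfl, h4⟩ := (bet_face_eq_zero_iff hq.2 hF).1 (hw ▸ h0)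
  have k0 : (q.1, (0 : ℝ)) = q := Prod.ext rfl h4.symm
  obtain ⟨h1, v, hv⟩ := exists_isVelocity_bet (p := p) (a := a) (b := b) (l := l) (w := w)
    (κ := fun τ => (q.1, τ)) (by fun_prop) (eventually_nonneg.mono fun τ hτ => ⟨hq.1.1, hτ⟩)
    (by rw [k0]; exact hq.2) (by rw [k0]; exact hw)
  refine ⟨v, ?_, fun G hG h2 => ?_⟩
  · rw [hv.1 (faceFun (.pt (some l))) (faceFun .infty) (contDiff_faceFun _) (contDiff_faceFun _)
      (Filter.Eventually.of_forall fun τ => ?_)]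
    · rw [← hw]
      exact bet_s_pos.ne'
    · rw [h0, zero_add, mul_comm]
      exact bet_r_self
  · rcases eq_or_ne G .ad with rfl | hG'
    · refine hv.const (contDiff_faceFun .ad) (h1.mono fun τ hτ => ?_)
      rw [h2]
      exact (bet_t_eq_zero_iff hτ).2 ((bet_t_eq_zero_iff hq.2).1 (hw ▸ h2))
    · exact absurd (face_eq_of_zero w.2 hG' hF h2 h0) hG

/-- Here `ε > 0` forces `r ≠ 0`, thus `hopf z = 0`. Changing `r` then leaves `x` and `s` fixed, and
`ε = s (r + τ) σ` is affine in `τ`. -/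
theorem hasFibreTransversal_bet (h0 : 0 < eps (w : Amb k)) :
    HasFibreTransversal (total p δ) w := by
  have h1 := eps_bet hq.2
  rw [hw] at h1
  have h2 : q.2 * q.1.2 ≠ 0 := by
    intro h2
    rw [h1, h2, mul_zero] at h0
    exact lt_irrefl _ h0
  have h3 := (smul_eq_zero.1 (bet_smul_hopf_eq_zero hq hw h)).resolve_left (left_ne_zero_of_mul h2)
  have hs := bet_s_pos (p := p) (a := a) (b := b) (l := l) (q := q)
  obtain ⟨h1, v, hv⟩ := exists_isVelocity_bet (p := p) (a := a) (b := b) (l := l) (w := w)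
    (κ := fun τ => (q.1, q.2 + τ)) (by fun_prop)
    (eventually_nonneg.mono fun τ hτ => ⟨hq.1.1, add_nonneg hq.1.2 hτ⟩)
    (by simpa using hq.2) (by simpa using hw)
  refine ⟨v, ?_, fun h5 => absurd h5 ?_⟩
  · refine ne_of_eq_of_ne (hv.1 eps (fun _ => (bet p a b l q).1.2 * q.1.2) contDiff_eps
      contDiff_const ?_) (mul_ne_zero hs.ne' (right_ne_zero_of_mul h2))
    · filter_upwards [h1] with τ hτ
      have h6 : (bet p a b l (q.1, q.2 + τ)).1.2 = (bet p a b l q).1.2 := by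
        rw [bet_s, bet_s, nutPt, nutPt, h3, smul_zero, smul_zero]
      rw [← hw, eps_bet hτ, eps_bet hq.2, h6]
      ring
  · rw [← hw]
    exact hs.ne'

end Bet

theorem hasTransversal {F : Face k} (w : total p δ) (h0 : faceFun F (w : Amb k) = 0) :
    HasTransversal (total p δ) F w := by
  by_cases hI : IsInner p δ (w : Amb k)
  · obtain ⟨Z, r, hq, hr, hw⟩ := hI
    rcases eq_or_ne F .ad with rfl | hF
    · exact hasTransversal_alpha_ad hq hr hw.symm h0
    · exact hasTransversal_alpha_pt hq hr hw.symm hF h0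
  have hx := w.2.resolve_right hI
  by_cases h2 : ∃ l, w.1.1.1 = w.1.1.2 • pt p (some l)
  · obtain ⟨l, hl⟩ := h2
    obtain ⟨a, b, hc⟩ := hx.exists_mem_CodB H.inj hl
    obtain ⟨z, -, -, hz, e⟩ := hx.exists_eq_bet hc
    rcases eq_or_ne F .ad with rfl | hF
    · exact hasTransversal_bet_ad hz e.symm hl h0
    · exact hasTransversal_bet_pt hz e.symm hl hF h0
  · obtain ⟨a, ha⟩ := exists_good (p := p) (c := w.1.2.2.2.1 none) (s := w.1.1.2)
      (r := w.1.2.2.1 none) fun l h3 => h2 ⟨l, by rwa [dvec, ← hx.u_eq, sub_eq_zero] at h3⟩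
    have hr : w.1.2.2.1 none ≠ 0 := fun h3 => hI ((isInner_iff H.lt_norm H.lt_half w.2).2 (by
      rw [h3]
      exact mul_pos H.pos (base_of_r_eq_zero w.2 h3).2))
    obtain ⟨v, hv, e⟩ := hx.exists_eq_gam ha ((hx.r_nonneg none).lt_of_ne' hr)
    exact hasTransversal_gam hv e.symm h0

theorem hasFibreTransversal (w : total p δ) (h0 : 0 < eps (w : Amb k) ∨ faceFun .infty (w : Amb k) = 0) :
    HasFibreTransversal (total p δ) w := by
  by_cases hI : IsInner p δ (w : Amb k)
  · obtain ⟨Z, r, hq, hr, hw⟩ := hI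
    refine hasFibreTransversal_alpha hq hr hw.symm (h0.resolve_right fun h1 => ?_)
    rw [hw] at h1
    exact (alpha_mem_bdry H.lt_norm hq).2.2.1 h1
  have hx := w.2.resolve_right hI
  by_cases h2 : ∃ l, w.1.1.1 = w.1.1.2 • pt p (some l)
  · obtain ⟨l, hl⟩ := h2
    obtain ⟨a, b, hc⟩ := hx.exists_mem_CodB H.inj hl
    have hs : w.1.1.2 ≠ 0 := hc.1.1.ne'
    obtain ⟨z, -, -, hz, e⟩ := hx.exists_eq_bet hc
    exact hasFibreTransversal_bet hz e.symm hl (h0.resolve_right hs)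
  · obtain ⟨a, ha⟩ := exists_good (p := p) (c := w.1.2.2.2.1 none) (s := w.1.1.2)
      (r := w.1.2.2.1 none) fun l h3 => h2 ⟨l, by rwa [dvec, ← hx.u_eq, sub_eq_zero] at h3⟩
    have hr : w.1.2.2.1 none ≠ 0 := fun h3 => hI ((isInner_iff H.lt_norm H.lt_half w.2).2 (by
      rw [h3]
      exact mul_pos H.pos (base_of_r_eq_zero w.2 h3).2))
    obtain ⟨v, hv, e⟩ := hx.exists_eq_gam ha ((hx.r_nonneg none).lt_of_ne' hr)
    exact hasFibreTransversal_gam hv e.symm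

/-- For each face through the point there is a vector on which its differential is nonzero while
those of the other faces vanish. -/
theorem linearIndependent_faces (w : total p δ) : LinearIndependent ℝ
    (fun F : {F : Face k // faceFun F (w : Amb k) = 0} =>
      diff J5 (fun x : total p δ => faceFun F.1 x) w) := by
  rw [linearIndependent_iff']
  intro s g hg F hF
  obtain ⟨v, h1, h2⟩ := hasTransversal w F.2
  have h3 := congrArg (fun L => L v) hg
  simp only [sum_apply, smul_apply, zero_apply] at h3
  rw [Finset.sum_eq_single_of_mem F hF fun G _ hG => ?_] at h3
  · exact (smul_eq_zero.1 h3).resolve_right h1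
  · rw [h2 G.1 (fun e => hG (Subtype.ext e)) G.2, smul_zero]

end Tangent

/-! ### Properness -/

section Proper

variable {k : ℕ} {p : Fin k → E3} {δ : ℝ}

theorem isCompact_Rbar : IsCompact Rbar := by
  refine Metric.isCompact_of_isClosed_isBounded ?_ ?_
  · have h1 : IsClosed {b : E3 × ℝ | ‖b.1‖ ^ 2 + b.2 ^ 2 = 1} :=
      isClosed_eq (by fun_prop) continuous_const
    exact h1.inter (isClosed_le continuous_const continuous_snd)
  · refine isBounded_iff_forall_norm_le.2 ⟨1, fun b hb => ?_⟩
    have h := hb.1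
    rw [norm_prod_le_iff, Real.norm_eq_abs, abs_le]
    refine ⟨?_, ?_, ?_⟩ <;> nlinarith [norm_nonneg b.1, sq_nonneg b.2, sq_nonneg ‖b.1‖, hb.2]

/-- For two different points the sum of the distances is continuous and positive on the compact
`Rbar`, so it has a positive minimum. Consequently no two radii can be small simultaneously. -/
theorem exists_pos_lt_norm_add (hi : Function.Injective (pt p)) : ∃ ρ : ℝ, 0 < ρ ∧ ρ < 1 / 2 ∧
    ∀ l m, l ≠ m → ∀ b ∈ Rbar, 2 * ρ ≤ ‖b.1 - b.2 • pt p l‖ + ‖b.1 - b.2 • pt p m‖ := by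
  have h : ∀ l m, l ≠ m → ∀ᶠ ρ in 𝓝[>] (0 : ℝ), ∀ b ∈ Rbar,
      2 * ρ ≤ ‖b.1 - b.2 • pt p l‖ + ‖b.1 - b.2 • pt p m‖ := by
    intro l m hlm
    obtain ⟨b₀, hb₀, hmin⟩ := isCompact_Rbar.exists_isMinOn
      (f := fun b : E3 × ℝ => ‖b.1 - b.2 • pt p l‖ + ‖b.1 - b.2 • pt p m‖)
      ⟨(0, 1), by simp [Rbar]⟩ (by fun_prop)
    have hpos : 0 < ‖b₀.1 - b₀.2 • pt p l‖ + ‖b₀.1 - b₀.2 • pt p m‖ := by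
      by_contra! h0
      have h1 : ‖b₀.1 - b₀.2 • pt p l‖ = 0 := by
        linarith [norm_nonneg (b₀.1 - b₀.2 • pt p l), norm_nonneg (b₀.1 - b₀.2 • pt p m)]
      have h2 : ‖b₀.1 - b₀.2 • pt p m‖ = 0 := by
        linarith [norm_nonneg (b₀.1 - b₀.2 • pt p l), norm_nonneg (b₀.1 - b₀.2 • pt p m)]
      rw [norm_eq_zero, sub_eq_zero] at h1 h2
      have h3 : b₀.2 ≠ 0 := fun h3 => by
        have := hb₀.1
        rw [h1, h3] at this
        simp at this
      exact hlm (hi (smul_right_injective _ h3 (h1.symm.trans h2)))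
    filter_upwards [Ioo_mem_nhdsGT (half_pos hpos)] with ρ hρ b hb
    have := hmin hb
    simp only [mem_ofPred_eq] at this
    linarith [hρ.2]
  have h' := (Filter.eventually_all.2 fun l => Filter.eventually_all.2 fun m =>
    Filter.eventually_imp_distrib_left.2 (h l m)).and
      (Ioo_mem_nhdsGT (show (0 : ℝ) < 1 / 2 by norm_num))
  obtain ⟨ρ, h1, h2⟩ := h'.exists
  exact ⟨ρ, h2.1, h2.2, h1⟩

theorem IsOuter.norm_v_le {x : Amb k} (hx : IsOuter p δ x) (l : Option (Nut k)) :
    ‖x.2.2.2.1 l‖ ≤ 1 := by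
  rcases l with _ | l
  · exact hx.norm_none.le
  · nlinarith [hx.norm_some l, sq_nonneg (sden x l), norm_nonneg (x.2.2.2.1 (some l))]

theorem IsOuter.norm_sub_le {x : Amb k} (hx : IsOuter p δ x) (l : Option (Nut k)) :
    ‖x.1.1 - x.1.2 • pt p l‖ ≤ x.2.2.1 l := by
  rw [hx.r_smul, norm_smul, Real.norm_of_nonneg (hx.r_nonneg l)]
  exact mul_le_of_le_one_right (hx.r_nonneg l) (hx.norm_v_le l)

/-- If all radii are bounded below, `t` is bounded because `ε` is. Otherwise exactly one radius is
small, and `t` times the product of the other ones is `ε` divided by that radius, which the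
equations bound. -/
theorem exists_t_le (hi : Function.Injective (pt p)) (hδ₀ : 0 < δ) (hδ : δ < 1 / 2) :
    ∃ C : ℝ, ∀ x : Amb k, IsOuter p δ x → x.2.1 ≤ C := by
  obtain ⟨ρ, hρ, hρ', h⟩ := exists_pos_lt_norm_add hi
  set N := Fintype.card (Option (Nut k)) with hN
  refine ⟨2 / ρ ^ N, fun x hx => ?_⟩
  have ht := hx.t_nonneg
  have hρ1 : ρ ≤ 1 := by linarith
  have key : ∀ (S : Finset (Option (Nut k))), (∀ m ∈ S, ρ ≤ x.2.2.1 m) →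
      x.2.1 * ∏ m ∈ S, x.2.2.1 m ≤ 2 → x.2.1 ≤ 2 / ρ ^ N := by
    intro S hS h2
    have h3 : ρ ^ N ≤ ∏ m ∈ S, x.2.2.1 m := calc
      ρ ^ N ≤ ρ ^ S.card := pow_le_pow_of_le_one hρ.le hρ1 (Finset.card_le_univ S)
      _ = ∏ m ∈ S, ρ := by simp
      _ ≤ _ := Finset.prod_le_prod (fun _ _ => hρ.le) hS
    rw [le_div_iff₀ (by positivity)]
    exact (mul_le_mul_of_nonneg_left h3 ht).trans h2
  by_cases hall : ∀ m, ρ ≤ x.2.2.1 m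
  · refine key Finset.univ (fun m _ => hall m) ?_
    have := hx.eps_lt
    rw [eps] at this
    nlinarith
  · push Not at hall
    obtain ⟨l, hl⟩ := hall
    have hother : ∀ m ∈ Finset.univ.erase l, ρ ≤ x.2.2.1 m := fun m hm => by
      have h1 := h l m (Finset.ne_of_mem_erase hm).symm x.1 hx.base
      have h2 := hx.norm_sub_le l
      have h3 := hx.norm_sub_le m
      linarith
    refine key _ hother ?_
    -- At `0` the quotient is bounded by `s · sigh < δ` with `s` close to `1`; at a point of `P` it
    -- is a component of a unit vector.
    rcases l with _ | l
    · have h1 : x.2.1 * ∏ m ∈ Finset.univ.erase none, x.2.2.1 m = sigh x := by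
        have : (Finset.univ.erase none : Finset (Option (Nut k))) =
            Finset.univ.map Function.Embedding.some := by
          ext (_ | m) <;> simp
        rw [this, Finset.prod_map]
        rfl
      rw [h1]
      have h2 := hx.sq_add_sq
      have h3 := hx.r_nonneg none
      have h4 := hx.base.2
      have h5 := hx.sig_lt
      have h6 : 1 / 2 < x.1.2 := by nlinarith
      have h7 : 0 ≤ sigh x := mul_nonneg ht (Finset.prod_nonneg fun l _ => hx.r_nonneg _)
      nlinarith
    · have h1 := hx.norm_some l
      have h2 : sden x l ≤ 1 := by nlinarith [sq_nonneg ‖x.2.2.2.1 (some l)‖]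
      exact h2.trans (by norm_num)

theorem IsOuter.r_le {x : Amb k} (hx : IsOuter p δ x) (hδ₀ : 0 < δ) (hδ : δ < 1 / 2)
    (l : Option (Nut k)) : x.2.2.1 l ≤ 2 + ‖pt p l‖ := by
  have hu : ‖x.1.1‖ ≤ 1 := by nlinarith [hx.base.1, sq_nonneg x.1.2, norm_nonneg x.1.1]
  have hs : x.1.2 ≤ 1 := by nlinarith [hx.base.1, sq_nonneg ‖x.1.1‖]
  have hr := hx.r_nonneg l
  rcases l with _ | l
  · have := hx.sq_add_sq
    have : x.2.2.1 none ≤ 1 := by nlinarith [sq_nonneg x.1.2]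
    linarith [norm_nonneg (pt p none)]
  · have h1 := hx.r_some_eq l
    have h2 := rad_sq (p := p) (c := x.2.2.2.1 none) (s := x.1.2) (r := x.2.2.1 none)
      (σ := sigh x) l
    rw [← h1, dvec, ← hx.u_eq, ← eps_eq_none] at h2
    have h3 : ‖x.1.1 - x.1.2 • pt p (some l)‖ ≤ 1 + ‖pt p (some l)‖ := by
      refine (_root_.norm_sub_le _ _).trans (add_le_add hu ?_)
      rw [norm_smul, Real.norm_of_nonneg hx.base.2]
      exact mul_le_of_le_one_left (norm_nonneg _) hs
    have h4 := hx.eps_lt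
    have h5 : 0 ≤ eps x := mul_nonneg hx.t_nonneg (Finset.prod_nonneg fun l _ => hx.r_nonneg l)
    have h6 : eps x ≤ 1 := by nlinarith
    have h7 := norm_nonneg (pt p (some l))
    have h8 : ‖x.1.1 - x.1.2 • pt p (some l)‖ ^ 2 ≤ (1 + ‖pt p (some l)‖) ^ 2 :=
      pow_le_pow_left₀ (norm_nonneg _) h3 2
    nlinarith

/-- The space of parameters of `outerMap`. -/
abbrev OuterPar (k : ℕ) : Type := (E3 × ℝ) × ℝ × (Option (Nut k) → ℝ) × (Option (Nut k) → E3) ×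
  (Fin 3 → ℂ) × (Nut k → Fin 2 → ℂ)

/-- A parametrization of the part of the total space with a circle action. -/
def outerMap (y : OuterPar k) : Amb k :=
  (y.1, y.2.1, y.2.2.1, y.2.2.2.1, tens y.2.2.2.2.2 (sq y.2.2.2.2.1))

theorem continuous_outerMap : Continuous (outerMap : _ → Amb k) := by
  have h1 : Continuous fun y : OuterPar k => tens y.2.2.2.2.2 (sq y.2.2.2.2.1) := by
    rw [← continuousOn_univ]
    refine (contDiffOn_tens (fun l => ?_) ?_).continuousOn
    · apply ContDiff.contDiffOn
      fun_prop
    · exact (contDiff_sq.comp (by fun_prop)).contDiffOn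
  unfold outerMap
  fun_prop

/-- The set is a continuous image of the set of its parameters, spinors and frame included. The
latter is closed, as only weak inequalities remain, and bounded by `exists_t_le` and `IsOuter.r_le`.
-/
theorem isCompact_outer (hi : Function.Injective (pt p)) (hδ₀ : 0 < δ) (hδ : δ < 1 / 2) {e₁ e₂ : ℝ}
    (h₁ : e₁ < δ ^ 2) (h₂ : e₂ < δ) :
    IsCompact {x : Amb k | IsOuter p δ x ∧ eps x ≤ e₁ ∧ x.1.2 * sigh x ≤ e₂} := by
  set B := {y : OuterPar k | ((y.1 ∈ Rbar ∧ 0 ≤ y.2.1) ∧ (∀ l, 0 ≤ y.2.2.1 l) ∧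
      eps (outerMap y) ≤ e₁ ∧ y.1.2 * sigh (outerMap y) ≤ e₂) ∧
      (∀ l, y.1.1 - y.1.2 • pt p l = y.2.2.1 l • y.2.2.2.1 l) ∧
      (‖y.2.2.2.1 none‖ = 1 ∧ ∀ l, ‖y.2.2.2.1 (some l)‖ ^ 2 + sden (outerMap y) l ^ 2 = 1) ∧
      (y.2.2.2.2.1 0 ^ 2 + y.2.2.2.2.1 1 ^ 2 + y.2.2.2.2.1 2 ^ 2 = 0 ∧
        cross (rePart y.2.2.2.2.1) (imPart y.2.2.2.2.1) = -y.2.2.2.1 none) ∧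
      ∀ l, hopf (y.2.2.2.2.2 l) = y.2.2.2.1 (some l)} with hB
  have hout : ∀ y ∈ B, IsOuter p δ (outerMap y) := by
    rintro y ⟨⟨⟨h1, h2⟩, h3, h4, h5⟩, h6, ⟨h7, h8⟩, h9, h10⟩
    exact ⟨h1, h2, h3, h4.trans_lt h₁, h5.trans_lt h₂, h6, h7, h8,
      ⟨y.2.2.2.2.1, y.2.2.2.2.2, h9, h10, rfl⟩⟩
  have himg : {x : Amb k | IsOuter p δ x ∧ eps x ≤ e₁ ∧ x.1.2 * sigh x ≤ e₂} = outerMap '' B := by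
    ext x
    constructor
    · rintro ⟨hx, h1, h2⟩
      obtain ⟨w, z, hw, hz, hT⟩ := hx.tensor
      have e : outerMap (x.1, x.2.1, x.2.2.1, x.2.2.2.1, w, z) = x :=
        Prod.ext rfl (Prod.ext rfl (Prod.ext rfl (Prod.ext rfl hT.symm)))
      exact ⟨(x.1, x.2.1, x.2.2.1, x.2.2.2.1, w, z), ⟨⟨⟨hx.base, hx.t_nonneg⟩, hx.r_nonneg,
        by rw [e]; exact h1, by rw [e]; exact h2⟩, hx.r_smul, ⟨hx.norm_none,
        by rw [e]; exact hx.norm_some⟩, hw, hz⟩, e⟩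
    · rintro ⟨y, hy, rfl⟩
      exact ⟨hout y hy, hy.1.2.2.1, hy.1.2.2.2⟩
  rw [himg]
  refine IsCompact.image ?_ continuous_outerMap
  refine Metric.isCompact_of_isClosed_isBounded ?_ ?_
  · have hm := continuous_outerMap (k := k)
    have he := (contDiff_eps (k := k)).continuous.comp hm
    have hs := (contDiff_sigh (k := k)).continuous.comp hm
    have hd := fun l => (contDiff_sden (k := k) l).continuous.comp hm
    have hre := contDiff_rePart.continuous
    have him := contDiff_imPart.continuous
    have hh := contDiff_hopf.continuous
    simp only [Function.comp_def] at he hs hd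
    simp only [hB, ofPred_and, ofPred_forall]
    refine IsClosed.inter (IsClosed.inter (IsClosed.inter ?_ ?_) (IsClosed.inter ?_
      (IsClosed.inter ?_ ?_))) (IsClosed.inter ?_ (IsClosed.inter (IsClosed.inter ?_ ?_)
      (IsClosed.inter (IsClosed.inter ?_ ?_) ?_)))
    · exact isCompact_Rbar.isClosed.preimage continuous_fst
    · exact isClosed_le (by fun_prop) (by fun_prop)
    · exact isClosed_iInter fun l => isClosed_le (by fun_prop) (by fun_prop)
    · exact isClosed_le he (by fun_prop)
    · exact isClosed_le ((by fun_prop : Continuous _).mul hs) (by fun_prop)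
    · exact isClosed_iInter fun l => isClosed_eq (by fun_prop) (by fun_prop)
    · exact isClosed_eq (by fun_prop) (by fun_prop)
    · exact isClosed_iInter fun l => isClosed_eq ((by fun_prop : Continuous _).add ((hd l).pow 2))
        (by fun_prop)
    · exact isClosed_eq (by fun_prop) (by fun_prop)
    · exact isClosed_eq (continuous_cross.comp ((hre.comp (by fun_prop)).prodMk
        (him.comp (by fun_prop)))) (by fun_prop)
    · exact isClosed_iInter fun l => isClosed_eq (hh.comp (by fun_prop)) (by fun_prop)
  · obtain ⟨C, hC⟩ := exists_t_le (p := p) hi hδ₀ hδ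
    refine isBounded_iff_forall_norm_le.2 ⟨|C| + (2 + ∑ l, ‖pt p l‖), fun y hy => ?_⟩
    have hx := hout y hy
    have hS : 0 ≤ ∑ l, ‖pt p l‖ := Finset.sum_nonneg fun l _ => norm_nonneg _
    have hR : 2 ≤ |C| + (2 + ∑ l, ‖pt p l‖) := by linarith [abs_nonneg C]
    have h0 : 0 ≤ |C| + (2 + ∑ l, ‖pt p l‖) := by linarith
    have hus : ‖y.1.1‖ ^ 2 + y.1.2 ^ 2 = 1 := hx.base.1
    have hu : ‖y.1.1‖ ≤ 1 := by nlinarith [sq_nonneg y.1.2, norm_nonneg y.1.1]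
    have hs : y.1.2 ≤ 1 := by nlinarith [sq_nonneg ‖y.1.1‖]
    have hs0 : 0 ≤ y.1.2 := hx.base.2
    simp only [norm_prod_le_iff, pi_norm_le_iff_of_nonneg h0]
    refine ⟨⟨by linarith, ?_⟩, ?_, fun l => ?_, fun l => ?_, fun i => ?_, fun l i => ?_⟩
    · rw [Real.norm_of_nonneg hs0]
      linarith
    · have h1 : y.2.1 ≤ C := hC _ hx
      have h2 : 0 ≤ y.2.1 := hx.t_nonneg
      rw [Real.norm_of_nonneg h2]
      linarith [le_abs_self C]
    · have h1 : y.2.2.1 l ≤ 2 + ‖pt p l‖ := hx.r_le hδ₀ hδ l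
      have h2 : 0 ≤ y.2.2.1 l := hx.r_nonneg l
      have h3 : ‖pt p l‖ ≤ ∑ l, ‖pt p l‖ :=
        Finset.single_le_sum (f := fun l => ‖pt p l‖) (fun _ _ => norm_nonneg _) (Finset.mem_univ l)
      rw [Real.norm_of_nonneg h2]
      linarith [abs_nonneg C]
    · have h1 : ‖y.2.2.2.1 l‖ ≤ 1 := hx.norm_v_le l
      linarith
    · obtain ⟨h1, h2, -⟩ := (isNullFrame_iff hy.2.2.1.1).1 hy.2.2.2.1
      have h3 : |(y.2.2.2.2.1 i).re| ≤ 1 := by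
        have := PiLp.norm_apply_le (rePart y.2.2.2.2.1) i
        rw [h1] at this
        exact this
      have h4 : |(y.2.2.2.2.1 i).im| ≤ 1 := by
        have := PiLp.norm_apply_le (imPart y.2.2.2.2.1) i
        rw [h2] at this
        exact this
      have := Complex.norm_le_abs_re_add_abs_im (y.2.2.2.2.1 i)
      linarith
    · have h1 : nsq (y.2.2.2.2.2 l) ≤ 1 := by
        rw [← norm_hopf, hy.2.2.2.2 l]
        exact hx.norm_v_le (some l)
      have h2 : ‖y.2.2.2.2.2 l i‖ ^ 2 ≤ 1 := by
        refine le_trans ?_ h1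
        rw [nsq]
        fin_cases i
        · simp
        · simp
      nlinarith [norm_nonneg (y.2.2.2.2.2 l i)]

theorem isCompact_AHhatBar : IsCompact AHhatBar := by
  have hre := contDiff_rePart.continuous
  have him := contDiff_imPart.continuous
  refine Metric.isCompact_of_isClosed_isBounded ?_ ?_
  · simp only [AHhatBar, ofPred_and]
    refine IsClosed.inter ?_ (IsClosed.inter ?_ ?_)
    · exact isClosed_eq (by fun_prop) (by fun_prop)
    · exact isClosed_eq (by fun_prop) (by fun_prop)
    · exact isClosed_le (by fun_prop) (by fun_prop)
  · refine isBounded_iff_forall_norm_le.2 ⟨2, fun Z hZ => ?_⟩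
    rw [pi_norm_le_iff_of_nonneg (by norm_num)]
    intro i
    have h3 : |(Z i).re| ≤ 1 := by
      have := PiLp.norm_apply_le (rePart Z) i
      rw [hZ.1] at this
      exact this
    have h4 : |(Z i).im| ≤ 1 := (PiLp.norm_apply_le (imPart Z) i).trans hZ.2.2
    have := Complex.norm_le_abs_re_add_abs_im (Z i)
    linarith

variable [H : Admissible p δ]

/-- Since `|x| · (1 / |x'|) = ε ≤ e₁`, one of the factors is at most `√e₁ < δ`. This covers the set
by a compact part of the image of `alpha` and a compact outer part. -/
theorem isCompact_eps_le {e₁ : ℝ} (h0 : 0 < e₁) (h₁ : e₁ < δ ^ 2) :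
    IsCompact {x : Amb k | x ∈ total p δ ∧ eps x ≤ e₁} := by
  have hsq : √e₁ ^ 2 = e₁ := Real.sq_sqrt h0.le
  have hpos : 0 < √e₁ := Real.sqrt_pos.2 h0
  have hlt : √e₁ < δ := Real.sqrt_lt_sqrt h0.le h₁ |>.trans_eq (Real.sqrt_sq H.pos.le)
  have him := contDiff_imPart.continuous
  have hA : IsCompact ((AHhatBar ×ˢ Icc 0 √e₁) ∩ {q : (Fin 3 → ℂ) × ℝ |
      q.2 * (1 - ‖imPart q.1‖ ^ 2) ≤ e₁}) :=
    (isCompact_AHhatBar.prod isCompact_Icc).inter_right (isClosed_le (by fun_prop) (by fun_prop))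
  have hA' := hA.image_of_continuousOn (f := fun q : (Fin 3 → ℂ) × ℝ => alpha p q.1 q.2)
    ((contDiffOn_alpha H.lt_norm).continuousOn.mono fun q hq =>
      ⟨hq.1.1, hq.1.2.1, hq.1.2.2.trans_lt hlt⟩)
  convert hA'.union (isCompact_outer H.inj H.pos H.lt_half h₁ hlt) using 1
  ext x
  constructor
  · rintro ⟨hx, he⟩
    by_cases h1 : x.1.2 * sigh x ≤ √e₁
    · exact Or.inr ⟨(isOuter_iff H.lt_norm H.lt_half hx).2 (h1.trans_lt hlt), he, h1⟩
    · push Not at h1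
      have hs0 : 0 ≤ x.1.2 := total_nonneg hx .infty
      have hs : 0 < x.1.2 := hs0.lt_of_ne fun h => by
        rw [← h, zero_mul] at h1
        linarith
      have hr0 : 0 ≤ x.2.2.1 none := total_nonneg hx (.pt none)
      have h2 : x.2.2.1 none ≤ √e₁ * x.1.2 := by
        rw [eps_eq_none] at he
        have h3 : x.2.2.1 none * √e₁ ≤ x.1.2 * e₁ := by nlinarith
        rw [← hsq] at h3
        nlinarith
      obtain ⟨Z, r, hq, hr, rfl⟩ := (isInner_iff H.lt_norm H.lt_half hx).2
        (h2.trans_lt (mul_lt_mul_of_pos_right hlt hs))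
      rw [eps_alpha H.lt_norm hq] at he
      rw [alpha_r, alpha_s] at h2
      exact Or.inl ⟨(Z, r), ⟨⟨hq.1, hq.2.1,
        le_of_mul_le_mul_right h2 (inv_pos.2 (sqrt_one_add_pos r))⟩, he⟩, rfl⟩
  · rintro (⟨q, ⟨⟨h1, h2⟩, h3⟩, rfl⟩ | ⟨h1, h2, -⟩)
    · have hq : (q.1, q.2) ∈ DomA δ := ⟨h1, h2.1, h2.2.trans_lt hlt⟩
      refine ⟨Or.inr ⟨q.1, q.2, hq, lt_of_le_of_lt h3 h₁, rfl⟩, ?_⟩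
      change eps (alpha p q.1 q.2) ≤ e₁
      rw [eps_alpha H.lt_norm hq]
      exact h3
    · exact ⟨Or.inl h1, h2⟩

/-- The projection to the parameter interval. -/
def proj (p : Fin k → E3) (δ : ℝ) [Admissible p δ] (w : total p δ) : Ico (0 : ℝ) (δ ^ 2) :=
  ⟨eps (w : Amb k), eps_mem w.2⟩

theorem continuous_proj : Continuous (proj p δ) :=
  Continuous.subtype_mk (contDiff_eps.continuous.comp continuous_subtype_val) _

/-- A compact subset of the half-open interval stays below some `e₁ < δ²`. -/
theorem isProperMap_proj : IsProperMap (proj p δ) := by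
  have : LocallyCompactSpace (Ico (0 : ℝ) (δ ^ 2)) :=
    (isLocallyClosed_Ico (X := ℝ)).locallyCompactSpace
  rw [isProperMap_iff_isCompact_preimage]
  refine ⟨continuous_proj, fun K hK => ?_⟩
  obtain ⟨e₁, h0, h1, h2⟩ : ∃ e₁ : ℝ, 0 < e₁ ∧ e₁ < δ ^ 2 ∧ ∀ e ∈ K, (e : ℝ) ≤ e₁ := by
    have hδ : 0 < δ ^ 2 := pow_pos H.pos 2
    rcases K.eq_empty_or_nonempty with rfl | hne
    · exact ⟨δ ^ 2 / 2, by linarith, by linarith, by simp⟩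
    · obtain ⟨m, hm, hmax⟩ := hK.exists_isMaxOn hne (f := fun e => (e : ℝ)) (by fun_prop)
      have := m.2.2
      refine ⟨max (m : ℝ) (δ ^ 2 / 2), ?_, max_lt m.2.2 (by linarith), fun e he =>
        le_max_of_le_left (hmax he)⟩
      exact lt_max_of_lt_right (by linarith)
  have hc : IsCompact {w : total p δ | eps (w : Amb k) ≤ e₁} := by
    rw [Topology.IsInducing.subtypeVal.isCompact_iff]
    convert isCompact_eps_le (p := p) h0 h1 using 1
    ext x
    exact ⟨fun ⟨w, hw, e⟩ => e ▸ ⟨w.2, hw⟩, fun h => ⟨⟨x, h.1⟩, h.2, rfl⟩⟩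
  exact hc.of_isClosed_subset (hK.isClosed.preimage continuous_proj) fun w hw => h2 _ hw

end Proper

/-! ### The circle action near the face over `0` -/

section Rotation

theorem rot_eq_cvec (t : ℝ) (Y : Fin 3 → ℂ) : rot t Y =
    cvec (Real.cos t • rePart Y + Real.sin t • cross (axis Y) (rePart Y))
      (Real.cos t • imPart Y + Real.sin t • cross (axis Y) (imPart Y)) := by
  funext i
  fin_cases i <;> apply Complex.ext <;>
    simp [rot, cvec, crossProduct, Complex.cos_ofReal_re, Complex.sin_ofReal_re,
      Complex.cos_ofReal_im, Complex.sin_ofReal_im]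

theorem axis_smul {l : ℝ} (hl : l ≠ 0) (Y : Fin 3 → ℂ) : axis (l • Y) = axis Y := by
  have h : cross (rePart (l • Y)) (imPart (l • Y)) = (l * l) • cross (rePart Y) (imPart Y) := by
    rw [rePart_smul, imPart_smul, cross_smul_right, cross_smul_left, smul_smul]
  have h0 : 0 < l * l := mul_self_pos.2 hl
  rw [axis, axis, h, norm_smul, Real.norm_of_nonneg h0.le, smul_smul, mul_inv, mul_right_comm,
    inv_mul_cancel₀ h0.ne', one_mul]

theorem rot_smul {l : ℝ} (hl : l ≠ 0) (t : ℝ) (Y : Fin 3 → ℂ) : rot t (l • Y) = l • rot t Y := by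
  have h : ∀ a b : E3, l • cvec a b = cvec (l • a) (l • b) := fun a b => by
    funext i
    apply Complex.ext <;> simp [cvec]
  rw [rot_eq_cvec, rot_eq_cvec, axis_smul hl, h, rePart_smul, imPart_smul, cross_smul_right,
    cross_smul_right, smul_add, smul_add]
  congr 2 <;> simp only [smul_smul, mul_comm]

variable {Z : Fin 3 → ℂ}

theorem rot_eq (hZ : Z ∈ AHhatBar) (h0 : imPart Z ≠ 0) (t : ℝ) : rot t Z =
    cvec (Real.cos t • rePart Z + (Real.sin t * ‖imPart Z‖⁻¹) • imPart Z)
      (Real.cos t • imPart Z - (Real.sin t * ‖imPart Z‖) • rePart Z) := by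
  have h1 := norm_ne_zero_iff.2 h0
  rw [rot_eq_cvec, axis, norm_cross_of_inner_eq_zero hZ.2.1, hZ.1, one_mul, cross_smul_left,
    cross_smul_left, cross_cross_left, cross_cross_right, hZ.1, hZ.2.1, smul_smul, smul_smul]
  simp only [one_pow, one_smul, zero_smul, sub_zero, zero_sub, smul_neg, smul_smul]
  congr 2
  rw [sub_eq_add_neg]
  congr 3
  field_simp

theorem normSq_add_smul {a b : E3} (h : inner ℝ a b = 0) (s t : ℝ) :
    ‖s • a + t • b‖ ^ 2 = s ^ 2 * ‖a‖ ^ 2 + t ^ 2 * ‖b‖ ^ 2 := by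
  rw [norm_add_sq_real, inner_smul_left, inner_smul_right, h, norm_smul, norm_smul, mul_pow, mul_pow]
  simp

theorem rot_mem (hZ : Z ∈ AHhatBar) (h0 : imPart Z ≠ 0) (t : ℝ) :
    rot t Z ∈ AHhatBar ∧ ‖imPart (rot t Z)‖ = ‖imPart Z‖ := by
  have h1 := norm_ne_zero_iff.2 h0
  have hcs := Real.cos_sq_add_sin_sq t
  have h2 : ‖rePart (rot t Z)‖ = 1 := by
    rw [← pow_eq_one_iff_of_nonneg (norm_nonneg _) two_ne_zero, rot_eq hZ h0, rePart_cvec,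
      normSq_add_smul hZ.2.1, hZ.1]
    field_simp
    linarith
  have h3 : ‖imPart (rot t Z)‖ = ‖imPart Z‖ := by
    rw [← sq_eq_sq₀ (norm_nonneg _) (norm_nonneg _), rot_eq hZ h0, imPart_cvec, sub_eq_add_neg,
      ← neg_smul, normSq_add_smul (by rw [real_inner_comm]; exact hZ.2.1), hZ.1]
    linear_combination ‖imPart Z‖ ^ 2 * hcs
  refine ⟨⟨h2, ?_, h3.trans_le hZ.2.2⟩, h3⟩
  rw [rot_eq hZ h0, rePart_cvec, imPart_cvec]
  simp only [inner_add_left, inner_sub_right, inner_smul_left, inner_smul_right, hZ.2.1,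
    real_inner_self_eq_norm_sq, hZ.1]
  have := hZ.2.1
  have h4 : inner ℝ (imPart Z) (rePart Z) = 0 := by rw [real_inner_comm]; exact hZ.2.1
  simp only [this, h4, conj_trivial]
  field_simp
  ring

/-- In its plane the pair `(n, -v / |v|)` is orthonormal, so a rotation by `t` about the axis
multiplies the null vector by `e^{it}`. Passing to the conjugate of `Z` is what gives the sign `+`.
-/
theorem scl_rot (hZ : Z ∈ AHhatBar) (h : 1 / 2 ≤ ‖imPart Z‖ ^ 2) (t : ℝ) :
    scl (rot t Z) = Complex.exp (t * Complex.I) • scl Z ∧ axA (rot t Z) = axA Z := by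
  have h1 := scal_mul_norm h
  have hn : ‖imPart Z‖ ≠ 0 := right_ne_zero_of_mul (h1.trans_ne one_ne_zero)
  have h0 : imPart Z ≠ 0 := norm_ne_zero_iff.1 hn
  obtain ⟨h2, h3⟩ := rot_mem hZ h0 t
  have h4 : scal (‖imPart Z‖ ^ 2) = ‖imPart Z‖⁻¹ := eq_inv_of_mul_eq_one_left h1
  constructor
  · have h5 : (Complex.exp (t * Complex.I)).re = Real.cos t := Complex.exp_ofReal_mul_I_re t
    have h6 : (Complex.exp (t * Complex.I)).im = Real.sin t := Complex.exp_ofReal_mul_I_im t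
    rw [scl, scl, h3, h4, smul_cvec, h5, h6, rot_eq hZ h0, rePart_cvec, imPart_cvec]
    congr 1
    · rw [smul_neg, sub_neg_eq_add, smul_smul]
    · rw [smul_sub, smul_smul, smul_smul, smul_neg, smul_smul, neg_sub, mul_comm _ (Real.cos t)]
      have : ‖imPart Z‖⁻¹ * (Real.sin t * ‖imPart Z‖) = Real.sin t := by field_simp
      rw [this]
      abel
  · rw [axA, axA, h3, h4, rot_eq hZ h0, rePart_cvec, imPart_cvec, cross_smul_right, cross_smul_right]
    congr 1
    have h7 := Real.cos_sq_add_sin_sq t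
    set n := rePart Z
    set v := imPart Z
    have e : ∀ a b c d : ℝ, cross (a • n + b • v) (c • v - d • n) = (a * c + b * d) • cross n v := by
      intro a b c d
      apply ext_E3 <;> simp <;> ring
    rw [e]
    have : Real.cos t * Real.cos t + Real.sin t * ‖v‖⁻¹ * (Real.sin t * ‖v‖) = 1 := by
      field_simp
      linarith
    rw [this, one_smul]

/-- The rotation by `θ / 2` multiplies the null frame by `e^{iθ/2}`, hence its square in the tensor
by `e^{iθ}`. -/
theorem circ_alpha {k : ℕ} (p : Fin k → E3) (hZ : Z ∈ AHhatBar) (h : 1 / 2 ≤ ‖imPart Z‖ ^ 2)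
    (θ r : ℝ) : circ (Circle.exp θ : ℂ) (alpha p Z r) = alpha p (rot (θ / 2) Z) r := by
  obtain ⟨h1, h2⟩ := scl_rot hZ h (θ / 2)
  have h0 : imPart Z ≠ 0 := by
    intro h0
    rw [h0] at h
    norm_num at h
  have h3 := (rot_mem hZ h0 (θ / 2)).2
  have h4 : Complex.exp ((θ / 2 : ℝ) * Complex.I) ^ 2 = (Circle.exp θ : ℂ) := by
    rw [← Complex.exp_nat_mul, Circle.coe_exp]
    congr 1
    push_cast
    ring
  rw [alpha, alpha, h1, h2, h3, sq_smul, h4]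
  refine Prod.ext rfl (Prod.ext rfl (Prod.ext rfl (Prod.ext rfl ?_)))
  exact smul_tens _ _ _

end Rotation

/-! ### The faces over the points of `P ∪ {0}` -/

section Faces

variable {k : ℕ} {p : Fin k → E3} {δ : ℝ}

/-- The left inverse of `alpha` on the matrix level. -/
def matA (p : Fin k → E3) (x : Amb k) : Mat3 :=
  sq (unscl (1 - x.1.2 * sigh x) (sqLift (matOf (aref p) x)))

/-- Reference spinors and reference vector for the face over a point of `P`. -/
def nutRef (p : Fin k → E3) (l m : Nut k) : Fin 2 → ℂ :=
  (exists_hopf_eq (pt p (some l) - pt p (some m))).choose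

theorem hopf_nutRef (p : Fin k → E3) (l m : Nut k) :
    hopf (nutRef p l m) = pt p (some l) - pt p (some m) :=
  (exists_hopf_eq (pt p (some l) - pt p (some m))).choose_spec

/-- A vector that is not parallel to the point `l` of `P`. -/
def nutVec (p : Fin k → E3) (l : Nut k) : E3 :=
  open Classical in if h : ∃ b, cross b (pt p (some l)) ≠ 0 then h.choose else 0

theorem cross_nutVec (hi : Function.Injective (pt p)) (l : Nut k) :
    cross (nutVec p l) (pt p (some l)) ≠ 0 := by
  have h : ∃ b, cross b (pt p (some l)) ≠ 0 := exists_cross_ne_zero fun h0 => by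
    simpa using hi (a₁ := some l) (a₂ := none) h0
  rw [nutVec, dif_pos h]
  exact h.choose_spec

theorem secDen_nutRef (hi : Function.Injective (pt p)) {l m : Nut k} (h : m ≠ l) :
    0 < secDen (nutRef p l m) (pt p (some l) - pt p (some m)) := by
  have h1 := hopf_nutRef p l m
  rw [← h1]
  refine secDen_pos_self fun h0 => h ?_
  rw [h0, hopf_eq_zero.2 rfl, eq_comm, sub_eq_zero] at h1
  simpa using (hi h1).symm

variable [H : Admissible p δ]

instance : Nonempty (total p δ) := by
  have H' := H
  refine ⟨⟨alpha p (cvec (EuclideanSpace.single 0 1) 0) 0, Or.inr ⟨_, 0, ⟨⟨?_, ?_, ?_⟩, le_rfl,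
    H.pos⟩, ?_, rfl⟩⟩⟩
  · simp
  · simp
  · simp
  · rw [zero_mul]
    exact pow_pos H.pos 2

/-- The sign left open by `sqLift` disappears again under `sq`. So, in contrast to `coordA`, no
local choice is needed, and the result is smooth as an even function of the lift. -/
theorem matA_alpha {Z : Fin 3 → ℂ} {r : ℝ} (hq : (Z, r) ∈ DomA δ) : matA p (alpha p Z r) = sq Z := by
  rw [matA, sig_alpha H.lt_norm hq, matOf, contr_alpha H.lt_norm hq, sub_sub_cancel]
  rcases sqLift_sq (scl Z) with h | h
  · rw [h, unscl_scl]
  · rw [h, unscl_neg, unscl_scl, sq_neg]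

theorem contDiffOn_matA : ContDiffOn ℝ ∞ (matA p) {x | IsInner p δ x} := by
  refine contDiffOn_comp_sqLift (f := matOf (aref p)) (t := univ)
    (g := fun w x => sq (unscl (1 - x.1.2 * sigh x) w)) ?_ ?_ (fun w x => ?_) ?_
    fun _ _ _ _ => mem_univ _
  · refine (contDiffOn_matOf (aref p)).mono ?_
    rintro x ⟨Z, r, hq, -, rfl⟩
    exact alpha_mem_secDom H.lt_norm hq
  · rintro x ⟨Z, r, hq, -, rfl⟩
    exact ⟨scl Z, scl_ne_zero hq.1, (contr_alpha H.lt_norm hq).symm⟩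
  · rw [unscl_neg, sq_neg]
  · refine contDiff_sq.comp_contDiffOn (contDiffOn_unscl ?_ contDiffOn_fst)
    apply ContDiff.contDiffOn
    fun_prop

theorem exists_mem_of_HAbar {A : Mat3} (hA : A ∈ HAbar) :
    sqLift A ∈ AHhatBar ∧ sq (sqLift A) = A := by
  obtain ⟨Z, hZ, rfl⟩ := hA
  refine ⟨?_, sq_sqLift ⟨Z, rfl⟩⟩
  rcases sqLift_sq Z with h | h
  · rw [h]
    exact hZ
  · rw [h]
    exact ⟨by simp [hZ.1], by simp [hZ.2.1], by simpa using hZ.2.2⟩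

theorem alpha_sqLift_sq (Z : Fin 3 → ℂ) (r : ℝ) : alpha p (sqLift (sq Z)) r = alpha p Z r := by
  rcases sqLift_sq Z with h | h
  · rw [h]
  · rw [h, alpha_neg]

theorem domA_zero {Z : Fin 3 → ℂ} (hδ : 0 < δ) (hZ : Z ∈ AHhatBar) : (Z, (0 : ℝ)) ∈ DomA δ :=
  ⟨hZ, le_rfl, hδ⟩

theorem isInner_alpha_zero {Z : Fin 3 → ℂ} (hZ : Z ∈ AHhatBar) : IsInner p δ (alpha p Z 0) :=
  ⟨Z, 0, domA_zero H.pos hZ, by rw [zero_mul]; exact pow_pos H.pos 2, rfl⟩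

theorem eq_alpha_zero {x : Amb k} (hx : x ∈ total p δ) (h : x.2.2.1 none = 0) :
    ∃ Z ∈ AHhatBar, x = alpha p Z 0 := by
  obtain ⟨Z, r, hq, -, rfl⟩ := (isInner_iff H.lt_norm H.lt_half hx).2 (by
    rw [h]
    exact mul_pos H.pos (base_of_r_eq_zero hx h).2)
  have h0 := (alpha_mem_bdry H.lt_norm hq).2.2.2.2.1.1 h
  exact ⟨Z, hq.1, by rw [h0]⟩

/-- The identification of the compactification of `HA` with the face over `0`. -/
def faceHA (p : Fin k → E3) (δ : ℝ) [Admissible p δ] : Mat3 → total p δ :=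
  toSub (total p δ) fun A => alpha p (sqLift A) 0

theorem coe_faceHA {Z : Fin 3 → ℂ} (hZ : Z ∈ AHhatBar) :
    (faceHA p δ (sq Z) : Amb k) = alpha p Z 0 := by
  have h : (alpha p (sqLift (sq Z)) 0 : Amb k) = alpha p Z 0 := alpha_sqLift_sq Z 0
  rw [faceHA, coe_toSub, h]
  rw [h]
  exact Or.inr (isInner_alpha_zero hZ)

theorem isDiffeoOn_faceHA : IsDiffeoOn 𝓘(ℝ, Mat3) J5 (faceHA p δ) HAbar
    {w : total p δ | faceFun (.pt none) (w : Amb k) = 0} := by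
  have hA : ∀ A ∈ HAbar, ∃ w : total p δ, faceFun (.pt none) (w : Amb k) = 0 ∧
      (w : Amb k) = alpha p (sqLift A) 0 := fun A hA =>
    ⟨⟨_, Or.inr (isInner_alpha_zero (exists_mem_of_HAbar hA).1)⟩,
      (alpha_mem_bdry H.lt_norm (domA_zero H.pos (exists_mem_of_HAbar hA).1)).2.2.2.2.1.2 rfl, rfl⟩
  refine isDiffeoOn_toSub _ (matA p) ?_ ((contDiffOn_matA (δ := δ)).mono ?_) (fun A h => ?_) ?_ ?_ ?_
  · refine contDiffOn_comp_sqLift (f := fun A : Mat3 => A) (g := fun w _ => alpha p w 0)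
      (t := {q | (q.1, (0 : ℝ)) ∈ DomA δ}) contDiffOn_id ?_ (fun w x => alpha_neg w 0) ?_ ?_
    · rintro _ ⟨Z, hZ, rfl⟩
      refine ⟨Z, ?_, rfl⟩
      rintro rfl
      have := hZ.1
      rw [show rePart 0 = 0 from reL.map_zero, norm_zero] at this
      exact zero_ne_one this
    · exact (contDiffOn_alpha H.lt_norm).comp (contDiffOn_fst.prodMk contDiffOn_const) fun q hq => hq
    · rintro _ ⟨Z, hZ, rfl⟩ w hw
      rcases (sq_eq_sq_iff _ _).1 hw with rfl | rfl
      · exact domA_zero H.pos hZ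
      · exact domA_zero H.pos ⟨by simp [hZ.1], by simp [hZ.2.1], by simpa using hZ.2.2⟩
  · rintro _ ⟨w, hw, rfl⟩
    obtain ⟨Z, hZ, e⟩ := eq_alpha_zero w.2 hw
    rw [mem_ofPred_eq, e]
    exact isInner_alpha_zero hZ
  · obtain ⟨w, h1, h2⟩ := hA A h
    exact ⟨w, h1, h2⟩
  · rintro _ ⟨w, hw, rfl⟩
    obtain ⟨Z, hZ, e⟩ := eq_alpha_zero w.2 hw
    rw [e, matA_alpha (domA_zero H.pos hZ)]
    exact ⟨Z, hZ, rfl⟩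
  · intro A h
    have h1 := exists_mem_of_HAbar h
    exact (matA_alpha (domA_zero H.pos h1.1)).trans h1.2
  · intro w hw
    obtain ⟨Z, hZ, e⟩ := eq_alpha_zero w.2 hw
    rw [e, matA_alpha (domA_zero H.pos hZ), alpha_sqLift_sq]

theorem mem_DomB_zero (l : Nut k) (q : (Fin 2 → ℂ) × ℝ) :
    (q, (0 : ℝ)) ∈ DomB p (nutRef p l) (nutVec p l) l δ := by
  have h1 : nutPt p l q.1 0 = pt p (some l) := by rw [nutPt, zero_smul, add_zero]
  have h2 := cross_nutVec H.inj l
  refine ⟨?_, fun m hm => ?_, ?_, ?_⟩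
  · rw [h1]
    exact h2
  · rw [h1]
    exact secDen_nutRef H.inj hm
  · simp only [zero_mul, mul_zero]
    exact pow_pos H.pos 2
  · rw [h1, zero_mul, mul_zero]
    refine mul_pos H.pos (norm_pos_iff.2 fun h0 => h2 ?_)
    rw [h0, cross_zero_right']

/-- All points of the face lie over the same `q`, so the direction of `q` and the differences `q -
q'` govern all factors but one. One set of reference spinors serves the entire face. -/
theorem mem_CodB_of_r_eq_zero {x : Amb k} (hx : x ∈ total p δ) {l : Nut k}
    (h : x.2.2.1 (some l) = 0) : IsOuter p δ x ∧ x ∈ CodB (nutRef p l) (nutVec p l) l := by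
  obtain ⟨h1, h2⟩ := base_of_r_eq_zero hx h
  have ho : IsOuter p δ x := hx.resolve_right fun ⟨Z, r, hq, _, e⟩ =>
    (alpha_mem_bdry H.lt_norm hq).2.2.2.2.2 l (e ▸ h)
  have hu := ho.u_eq
  rw [h1] at hu
  have hb := cross_nutVec H.inj l
  have hr : x.2.2.1 none ≠ 0 := fun h3 => by
    simpa using label_eq_of_r_eq_zero hx h h3
  refine ⟨ho, ⟨h2, (ho.r_nonneg none).lt_of_ne' hr⟩, fun h3 => ?_, fun m hm => ?_⟩
  · have := congrArg (cross (nutVec p l)) hu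
    rw [cross_smul_right, cross_smul_right, h3, smul_zero] at this
    exact smul_ne_zero h2.ne' hb this
  · have h4 : x.2.2.1 (some m) ≠ 0 := fun h3 => hm (by simpa using label_eq_of_r_eq_zero hx h3 h)
    have h5 := (ho.r_nonneg (some m)).lt_of_ne' h4
    refine ⟨?_, h5⟩
    have h6 := ho.r_smul (some m)
    rw [h1, ← smul_sub] at h6
    have h7 := congrArg (secDen (nutRef p l m)) h6
    rw [secDen_smul _ h2.le, secDen_smul _ h5.le] at h7
    have h8 := mul_pos h2 (secDen_nutRef H.inj hm)
    rw [h7] at h8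
    exact pos_of_mul_pos_right h8 h5.le

/-- The parametrization of the face over a point of `P`. -/
def nutMap (p : Fin k → E3) (l : Nut k) (a : (E3 × ℝ) × (Fin 2 → ℂ)) : Amb k :=
  bet p (nutRef p l) (nutVec p l) l ((a.2, a.1.2), 0)

/-- The identification of compactified Taub–NUT space with the face over a point of `P`. -/
def faceTN (p : Fin k → E3) (δ : ℝ) [Admissible p δ] (l : Nut k) :
    (E3 × ℝ) × (Fin 2 → ℂ) → total p δ := toSub (total p δ) (nutMap p l)

theorem TNbar_mem {a : (E3 × ℝ) × (Fin 2 → ℂ)} (ha : a ∈ TNbar) (l : Nut k) :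
    ((a.2, a.1.2), (0 : ℝ)) ∈ (nutSet ×ˢ Ici (0 : ℝ)) ∩
      DomB p (nutRef p l) (nutVec p l) l δ := by
  refine ⟨⟨⟨?_, ha.1.2⟩, self_mem_Ici⟩, mem_DomB_zero l _⟩
  change nsq a.2 ^ 2 + a.1.2 ^ 2 = 1
  rw [← norm_hopf, ha.2]
  exact ha.1.1

theorem coe_faceTN {a : (E3 × ℝ) × (Fin 2 → ℂ)} (ha : a ∈ TNbar) (l : Nut k) :
    (faceTN p δ l a : Amb k) = nutMap p l a :=
  coe_toSub (Or.inl (isOuter_bet (TNbar_mem ha l)))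

theorem nutMap_face (δ : ℝ) [Admissible p δ] {a : (E3 × ℝ) × (Fin 2 → ℂ)} (l : Nut k) :
    (nutMap p l a).2.2.1 (some l) = 0 ∧
      ((nutMap p l a).2.1 = 0 ↔ a.1.2 = 0) := by
  refine ⟨?_, bet_t_eq_zero_iff (δ := δ) (mem_DomB_zero l (a.2, a.1.2))⟩
  rw [nutMap, bet_r_self, mul_zero]

theorem exists_eq_nutMap {x : Amb k} (hx : x ∈ total p δ) {l : Nut k} (h : x.2.2.1 (some l) = 0) :
    ∃ a ∈ TNbar, x = nutMap p l a ∧ coordB (nutRef p l) (nutVec p l) l x = ((a.2, a.1.2), 0) := by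
  obtain ⟨ho, hc⟩ := mem_CodB_of_r_eq_zero hx h
  obtain ⟨z, h1, h2, h3, h4⟩ := ho.exists_eq_bet hc
  rw [h, zero_div] at h1 h3 h4
  refine ⟨((hopf z, sden x l), z), ⟨⟨?_, h3.1.1.2⟩, rfl⟩, h4, h1⟩
  rw [norm_hopf]
  exact h3.1.1.1

/-- At `r = 0` the chart `bet` is defined on the whole of `{|z|⁴ + σ² = 1, σ ≥ 0}`, and this is
`TNbar` with `σ = s`, where `u = hopf z` is redundant. -/
theorem isDiffeoOn_faceTN (l : Nut k) : IsDiffeoOn 𝓘(ℝ, (E3 × ℝ) × (Fin 2 → ℂ)) J5 (faceTN p δ l)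
    TNbar {w : total p δ | faceFun (.pt (some l)) (w : Amb k) = 0} := by
  have hG : ∀ a ∈ TNbar, ((hopf a.2, a.1.2), a.2) = a := fun a ha =>
    Prod.ext (Prod.ext ha.2 rfl) rfl
  refine isDiffeoOn_toSub _ (fun x => ((hopf (coordB (nutRef p l) (nutVec p l) l x).1.1,
    (coordB (nutRef p l) (nutVec p l) l x).1.2), (coordB (nutRef p l) (nutVec p l) l x).1.1))
    ?_ ?_ (fun a ha => ?_) ?_ (fun a ha => ?_) ?_
  · exact (contDiffOn_bet (δ := δ) _ _ _).comp (ContDiff.contDiffOn (by fun_prop))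
      fun a ha => (TNbar_mem ha l).2
  · have h1 : ContDiffOn ℝ ∞ (coordB (nutRef p l) (nutVec p l) l) (Subtype.val ''
        {w : total p δ | faceFun (.pt (some l)) (w : Amb k) = 0}) := by
      refine (contDiffOn_coordB _ _ _).mono ?_
      rintro _ ⟨w, hw, rfl⟩
      obtain ⟨h1, h2⟩ := mem_CodB_of_r_eq_zero w.2 hw
      exact ⟨h2, h1.norm_none⟩
    exact ((contDiff_hopf.comp_contDiffOn (h1.fst.fst)).prodMk h1.fst.snd).prodMk h1.fst.fst
  · exact ⟨⟨_, Or.inl (isOuter_bet (TNbar_mem ha l))⟩, (nutMap_face δ l).1, rfl⟩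
  · rintro _ ⟨w, hw, rfl⟩
    obtain ⟨a, ha, -, e⟩ := exists_eq_nutMap w.2 hw
    simp only [e, hG a ha]
    exact ha
  · change ((hopf (coordB _ _ l (nutMap p l a)).1.1, (coordB _ _ l (nutMap p l a)).1.2),
      (coordB _ _ l (nutMap p l a)).1.1) = a
    rw [nutMap, coordB_bet (mem_DomB_zero (δ := δ) l _)]
    exact hG a ha
  · intro w hw
    obtain ⟨a, ha, e', e⟩ := exists_eq_nutMap w.2 hw
    simp only [e, hG a ha]
    exact e'.symm

theorem circ_nutMap (c : ℂ) (l : Nut k) (a : (E3 × ℝ) × (Fin 2 → ℂ)) (hc : ‖c‖ = 1) :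
    circ c (nutMap p l a) = nutMap p l (a.1, c • a.2) := by
  have h1 : nutPt p l (c • a.2) 0 = nutPt p l a.2 0 := by rw [nutPt, nutPt, zero_smul, zero_smul]
  simp only [nutMap, circ, bet, h1, hopf_smul_of_norm_one hc]
  refine Prod.ext rfl (Prod.ext rfl (Prod.ext rfl (Prod.ext rfl ?_)))
  exact (tens_update_smul _ _ _ _ _).symm

end Faces

/-! ### The fibres over positive parameters -/

section Fibres

theorem IsDiffeoOn.restrict {E H M : Type*} [NormedAddCommGroup E] [NormedSpace ℝ E]
    [TopologicalSpace H] [TopologicalSpace M] [ChartedSpace H M]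
    {E' H' M' : Type*} [NormedAddCommGroup E'] [NormedSpace ℝ E'] [TopologicalSpace H']
    [TopologicalSpace M'] [ChartedSpace H' M'] {I : ModelWithCorners ℝ E H}
    {I' : ModelWithCorners ℝ E' H'} {f : M → M'} {A A' : Set M} {B B' : Set M'}
    (h : IsDiffeoOn I I' f A B) (hA : A' ⊆ A) (hB : B' ⊆ B) (hAB : ∀ a ∈ A, a ∈ A' ↔ f a ∈ B') :
    IsDiffeoOn I I' f A' B' := by
  obtain ⟨g, h1, h2, h3, h4, h5, h6⟩ := h
  refine ⟨g, h1.mono hA, h2.mono hB, fun a ha => (hAB a (hA ha)).1 ha, fun b hb => ?_,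
    h5.mono hA, h6.mono hB⟩
  rw [hAB _ (h4 (hB hb)), h6 (hB hb)]
  exact hb

variable {k : ℕ} {p : Fin k → E3} {δ ε : ℝ}

/-- The blow-up radius of the point `l` of `P` in the fibre over `ε`. -/
def radM (p : Fin k → E3) (ε : ℝ) (b : E3 × ℝ) (l : Nut k) : ℝ :=
  √(‖b.1 - b.2 • pt p (some l)‖ ^ 2 + ε ^ 2)

/-- The map of the Gibbons–Hawking manifold to the fibre over `ε`. -/
def fibM (p : Fin k → E3) (ε : ℝ) (a : (E3 × ℝ) × Tensor k) : Amb k :=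
  (a.1, ε / (‖a.1.1‖ * ∏ l, radM p ε a.1 l), fun l => l.elim ‖a.1.1‖ (radM p ε a.1),
    fun l => l.elim (‖a.1.1‖⁻¹ • a.1.1)
      fun l => (radM p ε a.1 l)⁻¹ • (a.1.1 - a.1.2 • pt p (some l)),
    (∏ l, (√(radM p ε a.1 l))⁻¹) • a.2)

/-- The inverse of `fibM`. -/
def invM (x : Amb k) : (E3 × ℝ) × Tensor k := (x.1, (∏ l, √(x.2.2.1 (some l))) • x.2.2.2.2)

theorem radM_pos (hε : 0 < ε) (b : E3 × ℝ) (l : Nut k) : 0 < radM p ε b l :=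
  Real.sqrt_pos.2 (by positivity)

/-- In `Mbar` a Hopf factor lies over `u - s q`, in the total space over `(u - s q) / r_q`. Spinors
are therefore rescaled by `r_q^{-1/2}`, and for `ε > 0` the radii are positive, so this can be
undone. -/
theorem invM_fibM (hε : 0 < ε) (a : (E3 × ℝ) × Tensor k) : invM (fibM p ε a) = a := by
  refine Prod.ext rfl ?_
  change (∏ l, √(radM p ε a.1 l)) • (∏ l, (√(radM p ε a.1 l))⁻¹) • a.2 = a.2
  rw [smul_smul, Finset.prod_inv_distrib, mul_inv_cancel₀, one_smul]
  exact Finset.prod_ne_zero_iff.2 fun l _ => (Real.sqrt_pos.2 (radM_pos hε a.1 l)).ne'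

theorem circ_fibM (c : ℂ) (a : (E3 × ℝ) × Tensor k) :
    circ c (fibM p ε a) = fibM p ε (a.1, c • a.2) := by
  refine Prod.ext rfl (Prod.ext rfl (Prod.ext rfl (Prod.ext rfl ?_)))
  exact smul_comm _ _ _

theorem contDiffOn_fibM (hε : 0 < ε) :
    ContDiffOn ℝ ∞ (fibM p ε) {a : (E3 × ℝ) × Tensor k | a.1.1 ≠ 0} := by
  have hu : ContDiffOn ℝ ∞ (fun a : (E3 × ℝ) × Tensor k => ‖a.1.1‖) {a | a.1.1 ≠ 0} :=
    ContDiffOn.norm ℝ (by fun_prop) fun a ha => ha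
  have hu0 : ∀ a ∈ {a : (E3 × ℝ) × Tensor k | a.1.1 ≠ 0}, ‖a.1.1‖ ≠ 0 :=
    fun a ha => norm_ne_zero_iff.2 ha
  have hr : ∀ l, ContDiff ℝ ∞ fun a : (E3 × ℝ) × Tensor k => radM p ε a.1 l := fun l => by
    refine ContDiff.sqrt ?_ fun a => by positivity
    exact (ContDiff.norm_sq ℝ (by fun_prop)).add contDiff_const
  have hr' : ∀ l, ContDiff ℝ ∞ fun a : (E3 × ℝ) × Tensor k => (radM p ε a.1 l)⁻¹ := fun l =>
    (hr l).inv fun a => (radM_pos hε a.1 l).ne'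
  have hs : ∀ l, ContDiff ℝ ∞ fun a : (E3 × ℝ) × Tensor k => (√(radM p ε a.1 l))⁻¹ := fun l =>
    ((hr l).sqrt fun a => (radM_pos hε a.1 l).ne').inv
      fun a => (Real.sqrt_pos.2 (radM_pos hε a.1 l)).ne'
  have hP : ContDiff ℝ ∞ fun a : (E3 × ℝ) × Tensor k => ∏ l, radM p ε a.1 l :=
    contDiff_prod fun l _ => hr l
  refine contDiffOn_fst.prodMk (ContDiffOn.prodMk ?_ (ContDiffOn.prodMk ?_ (ContDiffOn.prodMk ?_ ?_)))
  · exact contDiffOn_const.div (hu.mul hP.contDiffOn) fun a ha => mul_ne_zero (hu0 a ha)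
      (Finset.prod_ne_zero_iff.2 fun l _ => (radM_pos hε a.1 l).ne')
  · refine contDiffOn_pi.2 fun l => ?_
    rcases l with _ | l
    · exact hu
    · exact (hr l).contDiffOn
  · refine contDiffOn_pi.2 fun l => ?_
    rcases l with _ | l
    · exact (hu.inv hu0).smul (by fun_prop)
    · exact ((hr' l).smul (by fun_prop)).contDiffOn
  · exact ((contDiff_prod fun l _ => hs l).smul contDiff_snd).contDiffOn

theorem contDiffOn_invM (hε : 0 < ε) : ContDiffOn ℝ ∞ (invM : Amb k → _) {x | eps x = ε} := by
  have hT : ContDiff ℝ ∞ fun x : Amb k => x.2.2.2.2 := by fun_prop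
  have hr : ContDiffOn ℝ ∞ (fun x : Amb k => ∏ l : Nut k, √(x.2.2.1 (some l))) {x | eps x = ε} := by
    refine contDiffOn_prod fun l _ => ContDiffOn.sqrt (by fun_prop) fun x hx h => ?_
    rw [mem_ofPred_eq, eps_eq_some x l, h, zero_mul] at hx
    exact hε.ne hx
  exact contDiffOn_fst.prodMk (hr.smul hT.contDiffOn)

variable [H : Admissible p δ]

theorem pieceM_norm_pos (hε : 0 < ε) {a : (E3 × ℝ) × Tensor k} (ha : a ∈ pieceM p δ ε) :
    0 < ‖a.1.1‖ :=
  (mul_nonneg (div_nonneg hε.le H.pos.le) ha.1.1.2).trans_lt ha.2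

theorem eps_fibM (hε : 0 < ε) {a : (E3 × ℝ) × Tensor k} (ha : a ∈ pieceM p δ ε) :
    eps (fibM p ε a) = ε ∧ ∀ l, sden (fibM p ε a) l = ε / radM p ε a.1 l := by
  have h0 := pieceM_norm_pos hε ha
  have h1 : ∏ l, radM p ε a.1 l ≠ 0 :=
    Finset.prod_ne_zero_iff.2 fun l _ => (radM_pos hε a.1 l).ne'
  have h2 : eps (fibM p ε a) = ε := by
    rw [eps, Fintype.prod_option]
    exact div_mul_cancel₀ _ (mul_ne_zero h0.ne' h1)
  refine ⟨h2, fun l => ?_⟩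
  rw [eq_div_iff (radM_pos hε a.1 l).ne', mul_comm]
  exact (eps_eq_some _ l).symm.trans h2

theorem sig_fibM (hε : 0 < ε) {a : (E3 × ℝ) × Tensor k} (ha : a ∈ pieceM p δ ε) :
    a.1.2 * sigh (fibM p ε a) = a.1.2 * ε / ‖a.1.1‖ := by
  have h0 := pieceM_norm_pos hε ha
  rw [eq_div_iff h0.ne', mul_assoc, mul_comm (sigh _)]
  exact congrArg _ ((eps_eq_none _).symm.trans (eps_fibM hε ha).1)

theorem isOuter_fibM (hε : 0 < ε) (hε' : ε < δ ^ 2) {a : (E3 × ℝ) × Tensor k}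
    (ha : a ∈ pieceM p δ ε) : IsOuter p δ (fibM p ε a) := by
  have h0 := pieceM_norm_pos hε ha
  have hr := radM_pos (p := p) hε a.1
  obtain ⟨h1, h2⟩ := eps_fibM hε ha
  obtain ⟨hb, -, w, z, hw1, hw2, hz, hT⟩ := ha.1
  refine ⟨hb, ?_, ?_, h1.trans_lt hε', ?_, ?_, ?_, fun l => ?_, ?_⟩
  · exact div_nonneg hε.le (mul_nonneg h0.le (Finset.prod_nonneg fun l _ => (hr l).le))
  · rintro (_ | l)
    · exact h0.le
    · exact (hr l).le
  · have h3 := ha.2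
    change a.1.2 * _ < δ
    rw [sig_fibM hε ha, div_lt_iff₀ h0, mul_comm δ]
    rw [div_mul_eq_mul_div, div_lt_iff₀ H.pos] at h3
    linarith
  · rintro (_ | l)
    · change a.1.1 - a.1.2 • (0 : E3) = ‖a.1.1‖ • ‖a.1.1‖⁻¹ • a.1.1
      rw [smul_zero, sub_zero, smul_inv_smul₀ h0.ne']
    · exact (smul_inv_smul₀ (hr l).ne' _).symm
  · change ‖‖a.1.1‖⁻¹ • a.1.1‖ = 1
    rw [norm_smul, norm_inv, norm_norm, inv_mul_cancel₀ h0.ne']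
  · rw [h2]
    change ‖(radM p ε a.1 l)⁻¹ • (a.1.1 - a.1.2 • pt p (some l))‖ ^ 2 + _ = 1
    have h4 : radM p ε a.1 l ^ 2 = ‖a.1.1 - a.1.2 • pt p (some l)‖ ^ 2 + ε ^ 2 :=
      Real.sq_sqrt (by positivity)
    have h5 := (hr l).ne'
    rw [norm_smul, norm_inv, Real.norm_of_nonneg (hr l).le, mul_pow, inv_pow, div_pow]
    field_simp
    exact h4.symm
  · refine ⟨w, fun l => (((√(radM p ε a.1 l))⁻¹ : ℝ) : ℂ) • z l, ⟨hw1, hw2⟩, fun l => ?_, ?_⟩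
    · rw [hopf_smul, hz, Complex.norm_real, norm_inv, Real.norm_of_nonneg (Real.sqrt_nonneg _),
        inv_pow, Real.sq_sqrt (hr l).le]
      rfl
    · rw [tens_smul_left, ← Complex.ofReal_prod, Complex.coe_smul]
      change _ • a.2 = _
      rw [hT]
      rfl

theorem invM_mem {x : Amb k} (hε : 0 < ε) (hx : IsOuter p δ x) (h : eps x = ε) :
    invM x ∈ pieceM p δ ε := by
  have h0 : 0 < x.2.2.1 none := (hx.r_nonneg none).lt_of_ne' fun h0 => by
    rw [eps_eq_none, h0, zero_mul] at h
    exact hε.ne h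
  have hn : ‖x.1.1‖ = x.2.2.1 none := by
    rw [hx.u_eq, norm_smul, hx.norm_none, mul_one, Real.norm_of_nonneg h0.le]
  have h1 : ε / δ * x.1.2 < ‖x.1.1‖ := by
    have h2 := mul_lt_mul_of_pos_left hx.sig_lt h0
    rw [mul_left_comm, ← eps_eq_none, h] at h2
    rw [hn, div_mul_eq_mul_div, div_lt_iff₀ H.pos]
    linarith
  obtain ⟨w, z, hw, hz, hT⟩ := hx.tensor
  refine ⟨⟨hx.base, lt_of_le_of_lt ?_ h1, w, fun l => ((√(x.2.2.1 (some l)) : ℝ) : ℂ) • z l, hw.1,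
    ?_, fun l => ?_, ?_⟩, h1⟩
  -- The part `|x| > ε / δ` lies in `|x| > 2ε` because `δ < 1 / 2`.
  · refine mul_le_mul_of_nonneg_right ?_ hx.base.2
    rw [le_div_iff₀ H.pos]
    nlinarith [H.lt_half]
  · have : x.2.2.2.1 none = ‖x.1.1‖⁻¹ • x.1.1 := by
      rw [hn, hx.u_eq, inv_smul_smul₀ h0.ne']
    rw [hw.2, this]
    rfl
  · rw [hopf_smul, hz, Complex.norm_real, Real.norm_of_nonneg (Real.sqrt_nonneg _),
      Real.sq_sqrt (hx.r_nonneg _)]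
    exact (hx.r_smul (some l)).symm
  · change (∏ l, √(x.2.2.1 (some l))) • x.2.2.2.2 =
      tens (fun l => ((√(x.2.2.1 (some l)) : ℝ) : ℂ) • z l) (sq w)
    rw [tens_smul_left, ← Complex.ofReal_prod, Complex.coe_smul, hT]

omit H in
theorem fibM_invM {x : Amb k} (hε : 0 < ε) (hx : IsOuter p δ x) (h : eps x = ε) :
    fibM p ε (invM x) = x := by
  have h0 : ∀ l, 0 < x.2.2.1 l := fun l => (hx.r_nonneg l).lt_of_ne' fun h0 => by
    rw [eps, Finset.prod_eq_zero (Finset.mem_univ l) h0, mul_zero] at h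
    exact hε.ne h
  have hn : ‖x.1.1‖ = x.2.2.1 none := by
    rw [hx.u_eq, norm_smul, hx.norm_none, mul_one, Real.norm_of_nonneg (h0 _).le]
  have hr : ∀ l, radM p ε x.1 l = x.2.2.1 (some l) := fun l => by
    have h1 := hx.norm_some l
    rw [radM, hx.r_smul, norm_smul, Real.norm_of_nonneg (h0 _).le, ← h, eps_eq_some x l, mul_pow,
      mul_pow, ← mul_add, h1, mul_one, Real.sqrt_sq (h0 _).le]
  refine ext_Amb rfl ?_ hn hr ?_ (fun l => ?_) ?_
  · change ε / (‖x.1.1‖ * ∏ l, radM p ε x.1 l) = x.2.1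
    simp only [hn, hr]
    rw [← h, eps, Fintype.prod_option, mul_div_cancel_right₀]
    exact mul_ne_zero (h0 _).ne' (Finset.prod_ne_zero_iff.2 fun l _ => (h0 _).ne')
  · change ‖x.1.1‖⁻¹ • x.1.1 = _
    rw [hn, hx.u_eq, inv_smul_smul₀ (h0 _).ne']
  · change (radM p ε x.1 l)⁻¹ • (x.1.1 - x.1.2 • pt p (some l)) = _
    rw [hr, hx.r_smul, inv_smul_smul₀ (h0 _).ne']
  · change (∏ l, (√(radM p ε x.1 l))⁻¹) • (∏ l, √(x.2.2.1 (some l))) • x.2.2.2.2 = _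
    simp only [hr]
    rw [smul_smul, Finset.prod_inv_distrib, inv_mul_cancel₀, one_smul]
    exact Finset.prod_ne_zero_iff.2 fun l _ => (Real.sqrt_pos.2 (h0 _)).ne'

theorem isDiffeoOn_fibM (hε : 0 < ε) (hε' : ε < δ ^ 2) :
    IsDiffeoOn 𝓘(ℝ, (E3 × ℝ) × Tensor k) J5 (toSub (total p δ) (fibM p ε)) (pieceM p δ ε)
      {w : total p δ | eps (w : Amb k) = ε ∧ IsOuter p δ (w : Amb k)} := by
  refine isDiffeoOn_toSub _ invM ?_ ?_ ?_ ?_ (fun a _ => invM_fibM hε a) ?_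
  · exact (contDiffOn_fibM hε).mono fun a ha => norm_pos_iff.1 (pieceM_norm_pos hε ha)
  · refine (contDiffOn_invM hε).mono ?_
    rintro _ ⟨w, hw, rfl⟩
    exact hw.1
  · intro a ha
    have h := isOuter_fibM hε hε' ha
    exact ⟨⟨_, Or.inl h⟩, ⟨(eps_fibM hε ha).1, h⟩, rfl⟩
  · rintro _ ⟨w, hw, rfl⟩
    exact invM_mem hε hw.2 hw.1
  · exact fun w hw => fibM_invM hε hw.2 hw.1

/-- The map of `HA` to the fibre over `ε`. -/
def fibH (p : Fin k → E3) (ε : ℝ) (A : Mat3) : Amb k :=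
  alpha p (‖rePart (sqLift A)‖⁻¹ • sqLift A) (ε * radius (sqLift A))

/-- The inverse of `fibH`. -/
def invH (p : Fin k → E3) (x : Amb k) : Mat3 := (x.1.2 * sigh x)⁻¹ • matA p x

theorem mem_AHhat_iff (Y : Fin 3 → ℂ) : Y ∈ AHhat ↔
    ‖rePart Y‖ ^ 2 = 1 + ‖imPart Y‖ ^ 2 ∧ inner ℝ (rePart Y) (imPart Y) = 0 := by
  rw [AHhat, mem_ofPred_eq, sum_sq_eq, Complex.ext_iff]
  refine and_congr ?_ ?_
  · rw [Complex.one_re, sub_eq_iff_eq_add]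
  · rw [Complex.one_im, mul_eq_zero]
    norm_num

theorem AHhat_norm_pos {Y : Fin 3 → ℂ} (hY : Y ∈ AHhat) : 0 < ‖rePart Y‖ := by
  have := ((mem_AHhat_iff Y).1 hY).1
  refine (norm_nonneg _).lt_of_ne' fun h => ?_
  rw [h] at this
  nlinarith [sq_nonneg ‖imPart Y‖]

/-- The point of the disc bundle that corresponds to a point of the quadric. -/
theorem unit_mem {Y : Fin 3 → ℂ} (hY : Y ∈ AHhat) : ‖rePart Y‖⁻¹ • Y ∈ AHhatBar ∧
    1 - ‖imPart (‖rePart Y‖⁻¹ • Y)‖ ^ 2 = (radius Y)⁻¹ := by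
  have h0 := AHhat_norm_pos hY
  obtain ⟨h1, h2⟩ := (mem_AHhat_iff Y).1 hY
  have h3 : 1 - ‖imPart (‖rePart Y‖⁻¹ • Y)‖ ^ 2 = (radius Y)⁻¹ := by
    rw [imPart_smul, norm_smul, norm_inv, norm_norm, mul_pow, radius, inv_pow]
    have := pow_ne_zero 2 h0.ne'
    field_simp
    linarith
  refine ⟨⟨?_, ?_, ?_⟩, h3⟩
  · rw [rePart_smul, norm_smul, norm_inv, norm_norm, inv_mul_cancel₀ h0.ne']
  · rw [rePart_smul, imPart_smul, inner_smul_left, inner_smul_right, h2, mul_zero, mul_zero]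
  · have : 0 < (radius Y)⁻¹ := inv_pos.2 (pow_pos h0 2)
    rw [← pow_le_one_iff_of_nonneg (norm_nonneg _) two_ne_zero]
    linarith

theorem unit_smul_mem {Z : Fin 3 → ℂ} (hZ : Z ∈ AHhatBar) (h : 0 < 1 - ‖imPart Z‖ ^ 2) :
    (√(1 - ‖imPart Z‖ ^ 2))⁻¹ • Z ∈ AHhat ∧
      ‖rePart ((√(1 - ‖imPart Z‖ ^ 2))⁻¹ • Z)‖ = (√(1 - ‖imPart Z‖ ^ 2))⁻¹ := by
  have h1 := Real.sqrt_pos.2 h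
  have h2 := Real.sq_sqrt h.le
  have h3 : ‖rePart ((√(1 - ‖imPart Z‖ ^ 2))⁻¹ • Z)‖ = (√(1 - ‖imPart Z‖ ^ 2))⁻¹ := by
    rw [rePart_smul, norm_smul, hZ.1, mul_one, Real.norm_of_nonneg (inv_pos.2 h1).le]
  refine ⟨(mem_AHhat_iff _).2 ⟨?_, ?_⟩, h3⟩
  · rw [h3, imPart_smul, norm_smul, mul_pow, Real.norm_of_nonneg (inv_pos.2 h1).le, inv_pow, h2]
    field_simp
    ring
  · rw [rePart_smul, imPart_smul, inner_smul_left, inner_smul_right, hZ.2.1, mul_zero, mul_zero]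

theorem fibH_sq (Y : Fin 3 → ℂ) : fibH p ε (sq Y) =
    alpha p (‖rePart Y‖⁻¹ • Y) (ε * radius Y) := by
  rcases sqLift_sq Y with h | h
  · rw [fibH, h]
  · rw [fibH, h, radius, rePart_neg, norm_neg, smul_neg, alpha_neg]
    rfl

theorem domA_unit (hε : 0 < ε) {Y : Fin 3 → ℂ} (hY : Y ∈ AHhat) (h : radius Y < δ / ε) :
    (‖rePart Y‖⁻¹ • Y, ε * radius Y) ∈ DomA δ :=
  ⟨(unit_mem hY).1, mul_nonneg hε.le (sq_nonneg _), by rwa [lt_div_iff₀' hε] at h⟩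

theorem isInner_fibH (hε : 0 < ε) (hε' : ε < δ ^ 2) {A : Mat3} (hA : A ∈ pieceHA δ ε) :
    IsInner p δ (fibH p ε A) ∧ eps (fibH p ε A) = ε ∧ invH p (fibH p ε A) = A := by
  obtain ⟨Y, ⟨hY, h⟩, rfl⟩ := hA
  have h1 := domA_unit hε hY h
  have h2 := (unit_mem hY).2
  have h0 := AHhat_norm_pos hY
  have h3 : 0 < radius Y := pow_pos h0 2
  have h4 : ε * radius Y * (radius Y)⁻¹ = ε := by field_simp
  rw [fibH_sq]
  refine ⟨⟨_, _, h1, by rwa [h2, h4], rfl⟩, by rw [eps_alpha H.lt_norm h1, h2, h4], ?_⟩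
  rw [invH, sig_alpha H.lt_norm h1, h2, inv_inv, matA_alpha h1, ← Complex.coe_smul ‖rePart Y‖⁻¹,
    sq_smul, ← Complex.ofReal_pow, Complex.coe_smul, smul_smul, radius, inv_pow,
    mul_inv_cancel₀ (pow_pos h0 2).ne', one_smul]

/-- The point of the quadric is `Y = Z / √(1 - |Im Z|²)`. On the matrix `Y Yᵗ` this is the division
by `1 - |Im Z|² = 1 / |x'|`, which is the scalar factor in `invH`. -/
theorem fibH_invH (hε : 0 < ε) {x : Amb k} (hx : IsInner p δ x) (h : eps x = ε) :
    ∃ Y ∈ AHhat, radius Y < δ / ε ∧ invH p x = sq Y ∧ fibH p ε (sq Y) = x ∧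
      x.1.2 * sigh x = (radius Y)⁻¹ := by
  obtain ⟨Z, r, hq, -, rfl⟩ := hx
  rw [eps_alpha H.lt_norm hq] at h
  have h1 : 0 < 1 - ‖imPart Z‖ ^ 2 := pos_of_mul_pos_right (h ▸ hε) hq.2.1
  obtain ⟨h2, h3⟩ := unit_smul_mem hq.1 h1
  set τ := 1 - ‖imPart Z‖ ^ 2
  have h4 := Real.sqrt_pos.2 h1
  have h5 : radius ((√τ)⁻¹ • Z) = τ⁻¹ := by rw [radius, h3, inv_pow, Real.sq_sqrt h1.le]
  refine ⟨(√τ)⁻¹ • Z, h2, ?_, ?_, ?_, ?_⟩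
  · rw [h5, lt_div_iff₀ hε, ← h]
    calc τ⁻¹ * (r * τ) = r := by field_simp
      _ < δ := hq.2.2
  · rw [invH, sig_alpha H.lt_norm hq, matA_alpha hq, ← Complex.coe_smul (√τ)⁻¹, sq_smul,
      ← Complex.ofReal_pow, Complex.coe_smul, inv_pow, Real.sq_sqrt h1.le]
  · rw [fibH_sq, h3, h5, inv_inv, smul_inv_smul₀ h4.ne', ← h, mul_assoc, mul_inv_cancel₀ h1.ne',
      mul_one]
  · rw [sig_alpha H.lt_norm hq, h5, inv_inv]

theorem contDiffOn_invH (hε : 0 < ε) :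
    ContDiffOn ℝ ∞ (invH p) {x | IsInner p δ x ∧ eps x = ε} := by
  have hσ : ContDiff ℝ ∞ fun x : Amb k => x.1.2 * sigh x := by fun_prop
  have hA := (contDiffOn_matA (p := p) (δ := δ)).mono
    (fun x (hx : x ∈ {x | IsInner p δ x ∧ eps x = ε}) => hx.1)
  refine (hσ.contDiffOn.inv ?_).smul hA
  rintro x ⟨hx, h⟩
  obtain ⟨Y, hY, -, -, -, e⟩ := fibH_invH hε hx h
  rw [e]
  exact inv_ne_zero (pow_pos (AHhat_norm_pos hY) 2).ne'

theorem contDiffOn_fibH (hε : 0 < ε) : ContDiffOn ℝ ∞ (fibH p ε) (pieceHA δ ε) := by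
  refine contDiffOn_comp_sqLift (f := fun A : Mat3 => A)
    (g := fun w _ => alpha p (‖rePart w‖⁻¹ • w) (ε * radius w))
    (t := {q | q.1 ∈ AHhat ∧ radius q.1 < δ / ε}) contDiffOn_id ?_ (fun w x => ?_) ?_ ?_
  · rintro _ ⟨Y, hY, rfl⟩
    refine ⟨Y, ?_, rfl⟩
    rintro rfl
    have := AHhat_norm_pos hY.1
    rw [show rePart 0 = 0 from reL.map_zero, norm_zero] at this
    exact lt_irrefl _ this
  · rw [radius, rePart_neg, norm_neg, smul_neg, alpha_neg]
    rfl
  · refine (contDiffOn_alpha H.lt_norm).comp (ContDiffOn.prodMk (ContDiffOn.smul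
      (ContDiffOn.inv (ContDiffOn.norm ℝ ?_ ?_) ?_) contDiffOn_fst) ?_) fun q hq => domA_unit hε hq.1 hq.2
    · exact contDiff_rePart.comp_contDiffOn contDiffOn_fst
    · exact fun q hq => norm_pos_iff.1 (AHhat_norm_pos hq.1)
    · exact fun q hq => (AHhat_norm_pos hq.1).ne'
    · exact contDiffOn_const.mul ((contDiff_rePart.comp_contDiffOn contDiffOn_fst).norm_sq ℝ)
  · rintro _ ⟨Y, hY, rfl⟩ w hw
    rcases (sq_eq_sq_iff _ _).1 hw with rfl | rfl
    · exact hY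
    · refine ⟨?_, by rw [radius, rePart_neg, norm_neg]; exact hY.2⟩
      have := hY.1
      simpa [AHhat] using this

theorem isDiffeoOn_fibH (hε : 0 < ε) (hε' : ε < δ ^ 2) :
    IsDiffeoOn 𝓘(ℝ, Mat3) J5 (toSub (total p δ) (fibH p ε)) (pieceHA δ ε)
      {w : total p δ | eps (w : Amb k) = ε ∧ IsInner p δ (w : Amb k)} := by
  refine isDiffeoOn_toSub _ (invH p) (contDiffOn_fibH hε) ((contDiffOn_invH (δ := δ) hε).mono ?_)
    (fun A hA => ?_) ?_ (fun A hA => (isInner_fibH hε hε' hA).2.2) ?_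
  · rintro _ ⟨w, hw, rfl⟩
    exact ⟨hw.2, hw.1⟩
  · obtain ⟨h1, h2, -⟩ := isInner_fibH hε hε' hA (p := p)
    exact ⟨⟨_, Or.inr h1⟩, ⟨h2, h1⟩, rfl⟩
  · rintro _ ⟨w, hw, rfl⟩
    obtain ⟨Y, hY, h1, h2, -⟩ := fibH_invH hε hw.2 hw.1
    rw [h2]
    exact ⟨Y, ⟨hY, h1⟩, rfl⟩
  · intro w hw
    obtain ⟨Y, hY, h1, h2, h3, -⟩ := fibH_invH hε hw.2 hw.1
    rw [h2, h3]

end Fibres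

/-! ### The circle action and the gluing of the fibres -/

section Action

variable {k : ℕ}

attribute [local instance] finrank_real_complex_fact'

theorem contMDiff_coe_circle : ContMDiff (𝓡 1) 𝓘(ℝ, ℂ) ∞ (fun c : Circle => (c : ℂ)) :=
  contMDiff_coe_sphere

variable (p : Fin k → E3) (δ : ℝ) [H : Admissible p δ]

/-- The part of the total space with a circle action. -/
def outer : Set (total p δ) := {w | IsOuter p δ (w : Amb k)}

/-- The circle action. -/
def actT (c : Circle) (w : total p δ) : total p δ :=
  toSub (total p δ) (fun w : total p δ => circ (c : ℂ) (w : Amb k)) w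

/-- The map to the radial compactification of `ℝ³`. -/
def baseT (w : total p δ) : E3 × ℝ := (w : Amb k).1

variable {p δ}

theorem coe_actT {w : total p δ} (hw : w ∈ outer p δ) (c : Circle) :
    (actT p δ c w : Amb k) = circ (c : ℂ) (w : Amb k) :=
  coe_toSub (Or.inl (IsOuter.circ hw (Circle.norm_coe c)))

theorem actT_mem {w : total p δ} (hw : w ∈ outer p δ) (c : Circle) : actT p δ c w ∈ outer p δ := by
  rw [outer, mem_ofPred_eq, coe_actT hw]
  exact IsOuter.circ hw (Circle.norm_coe c)

theorem outer_eq :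
    outer p δ = {w : total p δ | (w : Amb k).1.2 * sigh (w : Amb k) < δ} := by
  ext w
  exact isOuter_iff H.lt_norm H.lt_half w.2

theorem isOpen_outer : IsOpen (outer p δ) := by
  rw [outer_eq]
  have h : ContDiff ℝ ∞ fun x : Amb k => x.1.2 * sigh x := by fun_prop
  exact isOpen_lt (h.continuous.comp continuous_subtype_val) continuous_const

theorem isOpen_isInner : IsOpen {w : total p δ | IsInner p δ (w : Amb k)} := by
  have h : {w : total p δ | IsInner p δ (w : Amb k)} =
      {w : total p δ | (w : Amb k).2.2.1 none < δ * (w : Amb k).1.2} := by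
    ext w
    exact isInner_iff H.lt_norm H.lt_half w.2
  rw [h]
  have h1 : ContDiff ℝ ∞ fun x : Amb k => x.2.2.1 none := by fun_prop
  have h2 : ContDiff ℝ ∞ fun x : Amb k => δ * x.1.2 := by fun_prop
  exact isOpen_lt (h1.continuous.comp continuous_subtype_val)
    (h2.continuous.comp continuous_subtype_val)

theorem isCircleAction_subset {X : Set (total p δ)} (hX : X ⊆ outer p δ)
    (hm : ∀ w ∈ X, ∀ c, actT p δ c w ∈ X) : IsCircleAction J5 X (actT p δ) where
  smooth := by
    refine contMDiffOn_of_coe ?_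
    have h1 : ContMDiff ((𝓡 1).prod J5) 𝓘(ℝ, ℂ × Amb k) ∞
        fun a : Circle × total p δ => ((a.1 : ℂ), (a.2 : Amb k)) :=
      (contMDiff_coe_circle.comp contMDiff_fst).prodMk_space (contMDiff_coe.comp contMDiff_snd)
    refine ((contDiff_circ.contMDiff.comp h1).contMDiffOn).congr fun a ha => ?_
    exact coe_actT (hX ha.2) a.1
  mapsTo := fun c w hw => hm w hw c
  one_act := fun w hw => Subtype.ext <| by
    rw [coe_actT (hX hw), circ, Circle.coe_one, one_smul]
  mul_act := fun c d w hw => Subtype.ext <| by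
    rw [coe_actT (hX hw), coe_actT (actT_mem (hX hw) d), coe_actT (hX hw), circ, circ, circ,
      Circle.coe_mul, mul_smul]

theorem mem_overlapM_iff {ε : ℝ} (hε : 0 < ε) {a : (E3 × ℝ) × Tensor k} (ha : a ∈ pieceM p δ ε) :
    a ∈ overlapM p δ ε ↔ ‖a.1.1‖ < δ * a.1.2 := by
  have h0 := pieceM_norm_pos hε ha
  have hs : ∀ h : 0 < a.1.2, ‖a.1.2⁻¹ • a.1.1‖ = ‖a.1.1‖ / a.1.2 := fun h => by
    rw [norm_smul, norm_inv, Real.norm_of_nonneg h.le, div_eq_inv_mul]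
  constructor
  · rintro ⟨-, h1, -, h2⟩
    rwa [hs h1, div_lt_iff₀ h1] at h2
  · intro h
    have h1 : 0 < a.1.2 := pos_of_mul_pos_right (h0.trans h) H.pos.le
    refine ⟨ha.1, h1, ?_, ?_⟩
    · rw [hs h1, lt_div_iff₀ h1]
      exact ha.2
    · rwa [hs h1, div_lt_iff₀ h1]

theorem overlapM_subset {ε : ℝ} : overlapM p δ ε ⊆ pieceM p δ ε := by
  rintro a ⟨ha, h1, h2, -⟩
  refine ⟨ha, ?_⟩
  rwa [norm_smul, norm_inv, Real.norm_of_nonneg h1.le, ← div_eq_inv_mul, lt_div_iff₀ h1] at h2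

theorem isInner_fibM {ε : ℝ} (hε : 0 < ε) (hε' : ε < δ ^ 2) {a : (E3 × ℝ) × Tensor k}
    (ha : a ∈ pieceM p δ ε) : IsInner p δ (fibM p ε a) ↔ a ∈ overlapM p δ ε := by
  rw [mem_overlapM_iff hε ha, isInner_iff H.lt_norm H.lt_half (Or.inl (isOuter_fibM hε hε' ha))]
  rfl

theorem overlapHA_subset {ε : ℝ} : overlapHA δ ε ⊆ pieceHA δ ε :=
  image_mono fun _ hY => ⟨hY.1, hY.2.2⟩

theorem isOuter_fibH {ε : ℝ} (hε : 0 < ε) (hε' : ε < δ ^ 2) {A : Mat3} (hA : A ∈ pieceHA δ ε) :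
    IsOuter p δ (fibH p ε A) ↔ A ∈ overlapHA δ ε := by
  obtain ⟨h1, h2, h3⟩ := isInner_fibH (p := p) hε hε' hA
  obtain ⟨Y, hY, h4, h5, -, h6⟩ := fibH_invH hε h1 h2
  rw [h3] at h5
  have h0 : 0 < radius Y := pow_pos (AHhat_norm_pos hY) 2
  have h7 : IsOuter p δ (fibH p ε A) ↔ 1 / δ < radius Y := by
    rw [isOuter_iff H.lt_norm H.lt_half (Or.inr h1), h6, one_div, inv_lt_comm₀ h0 H.pos]
  rw [h7, h5]
  refine ⟨fun h => ⟨Y, ⟨hY, h, h4⟩, rfl⟩, ?_⟩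
  rintro ⟨Y', ⟨-, h, -⟩, e⟩
  rcases (sq_eq_sq_iff _ _).1 e with rfl | rfl
  · exact h
  · rwa [radius, rePart_neg, norm_neg] at h

/-- Both pieces are embedded in the same fibre of the total space, and the gluing map is the
transition between them. It covers `x' = x / ε` because the two pieces share the coordinate `(u,
s)`, and it is equivariant by `circ_alpha`. -/
theorem isBundleGluing {ε : ℝ} (hε : 0 < ε) (hε' : ε < δ ^ 2) :
    IsBundleGluing p δ ε fun a => invH p (fibM p ε a) := by
  have hM : ∀ a ∈ overlapM p δ ε, a ∈ pieceM p δ ε := fun a ha => overlapM_subset (p := p) ha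
  have hF : ∀ a ∈ overlapM p δ ε, IsOuter p δ (fibM p ε a) ∧ IsInner p δ (fibM p ε a) ∧
      eps (fibM p ε a) = ε := fun a ha => ⟨isOuter_fibM hε hε' (hM a ha),
    (isInner_fibM hε hε' (hM a ha)).2 ha, (eps_fibM hε (hM a ha)).1⟩
  have hV : ∀ a ∈ overlapM p δ ε, invH p (fibM p ε a) ∈ overlapHA δ ε ∧
      fibH p ε (invH p (fibM p ε a)) = fibM p ε a := fun a ha => by
    obtain ⟨h1, h2, h3⟩ := hF a ha
    obtain ⟨Y, hY, h4, h5, h6, -⟩ := fibH_invH hε h2 h3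
    rw [h5]
    exact ⟨(isOuter_fibH (p := p) hε hε' ⟨Y, ⟨hY, h4⟩, rfl⟩).1 (by rwa [h6]), h6⟩
  have hA : ∀ A ∈ overlapHA δ ε, invM (fibH p ε A) ∈ overlapM p δ ε ∧
      fibM p ε (invM (fibH p ε A)) = fibH p ε A ∧ invH p (fibH p ε A) = A := fun A hA => by
    obtain ⟨h1, h2, h3⟩ := isInner_fibH (p := p) hε hε' (overlapHA_subset hA)
    have h4 := (isOuter_fibH (p := p) hε hε' (overlapHA_subset hA)).2 hA
    have h5 := fibM_invM hε h4 h2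
    refine ⟨(isInner_fibM hε hε' (invM_mem hε h4 h2)).1 (by rwa [h5]), h5, h3⟩
  -- the standard form of a point of the overlap
  have hN : ∀ a ∈ overlapM p δ ε, ∀ Y ∈ AHhat, invH p (fibM p ε a) = sq Y →
      (‖rePart Y‖⁻¹ • Y, ε * radius Y) ∈ DomA δ ∧ 1 / 2 ≤ ‖imPart (‖rePart Y‖⁻¹ • Y)‖ ^ 2 ∧
      fibM p ε a = alpha p (‖rePart Y‖⁻¹ • Y) (ε * radius Y) := fun a ha Y hY e => by
    obtain ⟨⟨Y', ⟨-, h1, h2⟩, e'⟩, h3⟩ := hV a ha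
    rw [e] at e' h3
    have h4 : radius Y' = radius Y := by
      rcases (sq_eq_sq_iff _ _).1 e' with rfl | rfl
      · rfl
      · rw [radius, radius, rePart_neg, norm_neg]
    rw [h4] at h1 h2
    refine ⟨domA_unit hε hY h2, ?_, by rw [← h3, fibH_sq]⟩
    have h5 := (unit_mem hY).2
    have h7 : 0 < radius Y := pow_pos (AHhat_norm_pos hY) 2
    have h6 : (radius Y)⁻¹ < δ := by
      rwa [inv_lt_comm₀ h7 H.pos, ← one_div]
    have := H.lt_half
    linarith
  constructor
  · refine ⟨fun A => invM (fibH p ε A), ?_, ?_, fun a ha => (hV a ha).1, fun A h => (hA A h).1,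
      fun a ha => ?_, fun A h => ?_⟩
    · exact ((contDiffOn_invH (δ := δ) hε).comp ((contDiffOn_fibM hε).mono
        fun a ha => norm_pos_iff.1 (pieceM_norm_pos hε (hM a ha)))
        fun a ha => ⟨(hF a ha).2.1, (hF a ha).2.2⟩).contMDiffOn
    · refine ((contDiffOn_invM hε).comp ((contDiffOn_fibH hε).mono overlapHA_subset)
        fun A h => ?_).contMDiffOn
      exact (isInner_fibH (p := p) hε hε' (overlapHA_subset h)).2.1
    · change invM (fibH p ε (invH p (fibM p ε a))) = a
      rw [(hV a ha).2, invM_fibM hε]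
    · change invH p (fibM p ε (invM (fibH p ε A))) = A
      rw [(hA A h).2.1, (hA A h).2.2]
  · intro a ha Y hY e
    obtain ⟨h1, h2, h3⟩ := hN a ha Y hY e
    have h4 : a.1 = (alpha p (‖rePart Y‖⁻¹ • Y) (ε * radius Y)).1 := by rw [← h3]; rfl
    rw [h4, alpha_u, alpha_s, axA_eq_axis h1.1 h2,
      axis_smul (inv_ne_zero (AHhat_norm_pos hY).ne'), psi, smul_smul, smul_smul]
    have := (sqrt_one_add_pos (ε * radius Y)).ne'
    congr 1
    field_simp
  · intro a ha Y hY e θ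
    obtain ⟨h1, h2, h3⟩ := hN a ha Y hY e
    have hm := (rot_mem h1.1 (fun h0 => by rw [h0] at h2; norm_num at h2) (θ / 2))
    have h4 : (rot (θ / 2) (‖rePart Y‖⁻¹ • Y), ε * radius Y) ∈ DomA δ := ⟨hm.1, h1.2⟩
    have h0 := AHhat_norm_pos hY
    change invH p (fibM p ε (a.1, _)) = _
    rw [← circ_fibM, h3, circ_alpha p h1.1 h2, invH, sig_alpha H.lt_norm h4, hm.2,
      (unit_mem hY).2, inv_inv, matA_alpha h4, rot_smul (inv_ne_zero h0.ne'),
      ← Complex.coe_smul ‖rePart Y‖⁻¹, sq_smul, ← Complex.ofReal_pow, Complex.coe_smul, smul_smul,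
      radius, inv_pow, mul_inv_cancel₀ (pow_pos h0 2).ne', one_smul]

theorem bdryMbar_subset {ε : ℝ} : bdryMbar p ε ⊆ pieceM p δ ε := fun a ha => by
  refine ⟨ha.1, ?_⟩
  have h := ha.1.1.1
  rw [ha.2] at h ⊢
  rw [mul_zero]
  refine (norm_nonneg _).lt_of_ne' fun h0 => ?_
  rw [h0] at h
  norm_num at h

theorem isDiffeoOn_bdry {ε : ℝ} (hε : 0 < ε) (hε' : ε < δ ^ 2) :
    IsDiffeoOn 𝓘(ℝ, (E3 × ℝ) × Tensor k) J5 (toSub (total p δ) (fibM p ε)) (bdryMbar p ε)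
      ({w : total p δ | eps (w : Amb k) = ε} ∩ {w | faceFun .infty (w : Amb k) = 0}) := by
  refine (isDiffeoOn_fibM hε hε').restrict bdryMbar_subset ?_ fun a ha => ?_
  · rintro w ⟨h1, h2⟩
    refine ⟨h1, (isOuter_iff H.lt_norm H.lt_half w.2).2 ?_⟩
    change (w : Amb k).1.2 = 0 at h2
    rw [h2, zero_mul]
    exact H.pos
  · have h1 : (toSub (total p δ) (fibM p ε) a : Amb k) = fibM p ε a :=
      coe_toSub (Or.inl (isOuter_fibM hε hε' ha))
    simp only [mem_inter_iff, mem_ofPred_eq, h1, (eps_fibM hε ha).1, true_and]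
    exact ⟨fun h => h.2, fun h => ⟨ha.1, h⟩⟩

/-- The fibre is the union of its outer and inner parts, which are open in it, and two points of the
pieces coincide exactly on the overlap, where `κ` is the transition map. -/
theorem isCompactifiedSen {ε : ℝ} (hε : 0 < ε) (hε' : ε < δ ^ 2) :
    IsCompactifiedSen p δ ε J5 {w : total p δ | eps (w : Amb k) = ε}
      ({w : total p δ | eps (w : Amb k) = ε} ∩ outer p δ)
      ({w : total p δ | eps (w : Amb k) = ε} ∩ {w | faceFun .infty (w : Amb k) = 0})
      (baseT p δ) (actT p δ) := by
  have hc : ∀ a ∈ pieceM p δ ε, (toSub (total p δ) (fibM p ε) a : Amb k) = fibM p ε a := fun a ha =>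
    coe_toSub (Or.inl (isOuter_fibM hε hε' ha))
  refine ⟨fun a => invH p (fibM p ε a), toSub (total p δ) (fibH p ε),
    toSub (total p δ) (fibM p ε), {w : total p δ | eps (w : Amb k) = ε ∧ IsInner p δ (w : Amb k)},
    isBundleGluing hε hε', isDiffeoOn_fibH hε hε', isDiffeoOn_fibM hε hε',
    ⟨_, isOpen_isInner, rfl⟩, ⟨_, isOpen_outer, rfl⟩, ?_, ?_, isDiffeoOn_bdry hε hε', ?_, ?_⟩
  · ext w
    have := w.2
    exact ⟨fun h => (this.symm).imp (fun h1 => ⟨h, h1⟩) fun h1 => ⟨h, h1⟩,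
      fun h => h.elim (fun h1 => h1.1) fun h1 => h1.1⟩
  · intro z hz a ha
    obtain ⟨h1, h2, h3⟩ := isInner_fibH (p := p) hε hε' hz
    have h0 : (toSub (total p δ) (fibH p ε) z : Amb k) = fibH p ε z := coe_toSub (Or.inr h1)
    rw [Subtype.ext_iff, hc a ha, h0]
    constructor
    · intro e
      refine ⟨(isInner_fibM hε hε' ha).1 (e ▸ h1), ?_⟩
      change invH p (fibM p ε a) = z
      rw [← e, h3]
    · rintro ⟨h4, h5⟩
      obtain ⟨Y, -, -, h6, h7, -⟩ :=
        fibH_invH hε ((isInner_fibM hε hε' ha).2 h4) (eps_fibM hε ha).1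
      rw [← h5, ← h7]
      exact congrArg _ h6
  · intro a ha
    rw [baseT, hc a ha]
    rfl
  · intro a ha c
    have h1 : toSub (total p δ) (fibM p ε) a ∈ outer p δ := by
      rw [outer, mem_ofPred_eq, hc a ha]
      exact isOuter_fibM hε hε' ha
    have h2 : IsOuter p δ (fibM p ε (a.1, (c : ℂ) • a.2)) := by
      rw [← circ_fibM]
      exact (isOuter_fibM hε hε' ha).circ (Circle.norm_coe c)
    have h3 : (toSub (total p δ) (fibM p ε) (a.1, (c : ℂ) • a.2) : Amb k) = fibM p ε _ :=
      coe_toSub (Or.inl h2)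
    refine Subtype.ext ?_
    rw [coe_actT h1, hc a ha, h3, circ_fibM]

end Action

/-! ### Principal circle bundles -/

section Principal

attribute [local instance] finrank_real_complex_fact'

/-- The phase of a complex number. -/
def phase (z : ℂ) : Circle := Circle.exp z.arg

theorem coe_phase {z : ℂ} (hz : ‖z‖ = 1) : (phase z : ℂ) = z := by
  have := Complex.norm_mul_exp_arg_mul_I z
  rwa [hz, Complex.ofReal_one, one_mul] at this

theorem phase_coe (c : Circle) : phase c = c := Circle.ext (coe_phase (Circle.norm_coe c))

theorem norm_mul_phase (z : ℂ) : (‖z‖ : ℂ) * phase z = z := Complex.norm_mul_exp_arg_mul_I z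

theorem phase_mul {z w : ℂ} (hz : z ≠ 0) (hw : w ≠ 0) : phase (z * w) = phase z * phase w := by
  refine Circle.ext ?_
  have h1 : (‖z * w‖ : ℂ) * phase (z * w) = ‖z‖ * phase z * (‖w‖ * phase w) := by
    rw [norm_mul_phase, norm_mul_phase, norm_mul_phase]
  have h2 : (‖z‖ : ℂ) ≠ 0 := by exact_mod_cast norm_ne_zero_iff.2 hz
  have h3 : (‖w‖ : ℂ) ≠ 0 := by exact_mod_cast norm_ne_zero_iff.2 hw
  rw [norm_mul, Complex.ofReal_mul] at h1
  rw [Circle.coe_mul]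
  exact mul_left_cancel₀ (mul_ne_zero h2 h3) (h1.trans (by ring))

/-- The argument is smooth only off the negative real axis. Multiplicativity reduces to a
neighbourhood of `1`, by writing the phase of `z` as that of `z / z₀` times a constant. -/
theorem contMDiffOn_phase : ContMDiffOn 𝓘(ℝ, ℂ) (𝓡 1) ∞ phase {z | z ≠ 0} := by
  intro z₀ hz₀
  refine ContMDiffAt.contMDiffWithinAt ?_
  have h1 : ContDiffAt ℝ ∞ (fun z : ℂ => (z / z₀).arg) z₀ := by
    have h2 : ContDiffAt ℝ ∞ Complex.log (z₀ / z₀) := by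
      rw [div_self hz₀]
      exact (Complex.contDiffAt_log Complex.one_mem_slitPlane).restrict_scalars ℝ
    have h3 : ContDiffAt ℝ ∞ (fun z : ℂ => z / z₀) z₀ := contDiffAt_id.div_const z₀
    have h5 := ContDiffAt.comp z₀ (f := fun z : ℂ => z / z₀) h2 h3
    exact (Complex.imCLM.contDiff.contDiffAt.comp z₀ h5).congr_of_eventuallyEq
      (Filter.Eventually.of_forall fun z => (Complex.log_im (z / z₀)).symm)
  have h4 : ContMDiffAt 𝓘(ℝ, ℂ) (𝓡 1) ∞ (fun z : ℂ => Circle.exp (z / z₀).arg * phase z₀) z₀ :=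
    ((contMDiff_circleExp (m := ∞)).contMDiffAt.comp z₀ h1.contMDiffAt).mul contMDiffAt_const
  refine h4.congr_of_eventuallyEq ?_
  filter_upwards [isOpen_ne.mem_nhds hz₀] with z hz
  change phase z = phase (z / z₀) * phase z₀
  rw [← phase_mul (div_ne_zero hz hz₀) hz₀, div_mul_cancel₀ _ hz₀]

variable {k : ℕ} {p : Fin k → E3} {δ : ℝ}

/-- The phase of the tensor of a point, relative to given local sections. -/
def relPhase (a : Nut k → Fin 2 → ℂ) (b : E3) (x : Amb k) : ℂ :=
  fip (sq (nullSec b (x.2.2.2.1 none))) (matOf a x) /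
    fip (sq (nullSec b (x.2.2.2.1 none))) (sq (nullSec b (x.2.2.2.1 none)))

/-- The tensor of the local section over the directions of a point. -/
def secTensor (a : Nut k → Fin 2 → ℂ) (b : E3) (v : Option (Nut k) → E3) : Tensor k :=
  tens (fun l => sec (a l) (v (some l))) (sq (nullSec b (v none)))

/-- The directions over which the local section is defined. -/
def dirDom (a : Nut k → Fin 2 → ℂ) (b : E3) : Set (Option (Nut k) → E3) :=
  {v | (∀ l, 0 < secDen (a l) (v (some l))) ∧ cross b (v none) ≠ 0}

theorem isOpen_dirDom (a : Nut k → Fin 2 → ℂ) (b : E3) : IsOpen (dirDom a b) := by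
  have h1 : IsOpen {v : Option (Nut k) → E3 | ∀ l, 0 < secDen (a l) (v (some l))} := by
    simp only [ofPred_forall]
    exact isOpen_iInter_of_finite fun l => isOpen_lt continuous_const
      ((continuous_secDen (a l)).comp (by fun_prop))
  have h0 : Continuous fun v : Option (Nut k) → E3 => v none := by fun_prop
  have h2 : IsOpen {v : Option (Nut k) → E3 | cross b (v none) ≠ 0} :=
    (isOpen_cross_ne_zero b).preimage h0
  exact h1.inter h2

theorem contDiffOn_secTensor (a : Nut k → Fin 2 → ℂ) (b : E3) :
    ContDiffOn ℝ ∞ (secTensor a b) (dirDom a b) := by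
  refine contDiffOn_tens (fun l => ?_) (contDiff_sq.comp_contDiffOn ?_)
  · exact (contDiffOn_sec (a l)).comp (t := {v | 0 < secDen (a l) v})
      (contDiff_apply ℝ E3 (some l)).contDiffOn fun v hv => hv.1 l
  · exact (contDiffOn_nullSec b).comp (t := {c | cross b c ≠ 0})
      (contDiff_apply ℝ E3 none).contDiffOn fun v hv => hv.2

theorem fip_nullSec_ne_zero {b c : E3} (hc : ‖c‖ = 1) (hb : cross b c ≠ 0) :
    fip (sq (nullSec b c)) (sq (nullSec b c)) ≠ 0 :=
  fip_self_ne_zero (sq_ne_zero ((isNullFrame_nullSec hc hb).ne_zero hc))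

theorem contDiffOn_relPhase (a : Nut k → Fin 2 → ℂ) (b : E3) :
    ContDiffOn ℝ ∞ (relPhase a b) {x | x.2.2.2.1 ∈ dirDom a b ∧ ‖x.2.2.2.1 none‖ = 1} := by
  have h1 : ContDiffOn ℝ ∞ (fun x : Amb k => sq (nullSec b (x.2.2.2.1 none)))
      {x | x.2.2.2.1 ∈ dirDom a b ∧ ‖x.2.2.2.1 none‖ = 1} := by
    refine contDiff_sq.comp_contDiffOn ((contDiffOn_nullSec b).comp (t := {c | cross b c ≠ 0})
      ?_ fun x hx => hx.1.2)
    exact ContDiff.contDiffOn (by fun_prop)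
  have h2 := (contDiffOn_matOf a).mono
    (fun x (hx : x ∈ {x : Amb k | x.2.2.2.1 ∈ dirDom a b ∧ ‖x.2.2.2.1 none‖ = 1}) => hx.1.1)
  have h3 := (contDiffOn_fip h1 h1).inv fun x hx => fip_nullSec_ne_zero hx.2 hx.1.2
  exact ((contDiffOn_fip h1 h2).mul h3).congr fun x _ => div_eq_mul_inv _ _

theorem relPhase_of_eq {a : Nut k → Fin 2 → ℂ} {b : E3} {x : Amb k} (h : x.2.2.2.1 ∈ dirDom a b)
    (h1 : ‖x.2.2.2.1 none‖ = 1) {c : ℂ} (hc : x.2.2.2.2 = c • secTensor a b x.2.2.2.1) :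
    relPhase a b x = c := by
  have h2 : matOf a x = c • sq (nullSec b (x.2.2.2.1 none)) := by
    rw [matOf, hc, secTensor, smul_tens, contr_tens fun l => sec_ne_zero (h.1 l)]
  rw [relPhase, h2, fip_smul, mul_div_cancel_right₀ _ (fip_nullSec_ne_zero h1 h.2)]

theorem relPhase_circ {a : Nut k → Fin 2 → ℂ} {b : E3} {x : Amb k} (h : x.2.2.2.1 ∈ dirDom a b)
    (h1 : ‖x.2.2.2.1 none‖ = 1) (hT : x.2.2.2.2 = secTensor a b x.2.2.2.1) (c : ℂ) :
    relPhase a b (circ c x) = c :=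
  relPhase_of_eq (x := circ c x) h h1 (congrArg (c • ·) hT)

/-- With the spinors normalized to the sections, the null frame is `d` times its section, so the
tensor is `d²` times the section tensor. -/
theorem IsOuter.relPhase_spec {a : Nut k → Fin 2 → ℂ} {b : E3} {x : Amb k} (hx : IsOuter p δ x)
    (h : x.2.2.2.1 ∈ dirDom a b) : ‖relPhase a b x‖ = 1 ∧
      x.2.2.2.2 = relPhase a b x • secTensor a b x.2.2.2.1 := by
  obtain ⟨w, hw, hT⟩ := hx.exists_frame (z := fun l => sec (a l) (x.2.2.2.1 (some l)))
    fun l => hopf_sec (h.1 l)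
  obtain ⟨d, hd, rfl⟩ := isNullFrame_eq_smul hx.norm_none
    (isNullFrame_nullSec hx.norm_none h.2) hw
  have h1 : x.2.2.2.2 = (d ^ 2) • secTensor a b x.2.2.2.1 := by
    rw [hT, secTensor, smul_tens, sq_smul]
  have h2 := relPhase_of_eq h hx.norm_none h1
  rw [h2]
  exact ⟨by rw [norm_pow, hd, one_pow], h1⟩

theorem exists_dirDom {v : Option (Nut k) → E3} (h : ∀ l, v l ≠ 0) :
    ∃ a b, v ∈ dirDom a b := by
  choose a ha using fun l : Nut k => exists_hopf_eq (v (some l))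
  obtain ⟨b, hb⟩ := exists_cross_ne_zero (h none)
  refine ⟨a, b, fun l => ?_, hb⟩
  rw [← ha l]
  refine secDen_pos_self fun h0 => h (some l) ?_
  rw [← ha l, hopf_eq_zero.2 h0]

variable [H : Admissible p δ]

/-- A part of the total space on which the points are determined up to phase by `f` is a principal
circle bundle, if there are local sections that consist of the tensors `secTensor`. -/
theorem isPrincipalCircleBundle_of_section {V' : Type*} [NormedAddCommGroup V'] [NormedSpace ℝ V']
    {X : Set (total p δ)} {Y : Set V'} {f : Amb k → V'} (hX : X ⊆ outer p δ)
    (hm : ∀ w ∈ X, ∀ c, actT p δ c w ∈ X) (hf : ContDiff ℝ ∞ f) (hfX : ∀ w ∈ X, f w ∈ Y)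
    (hfc : ∀ c x, f (circ c x) = f x)
    (hloc : ∀ y ∈ Y, ∃ (a : Nut k → Fin 2 → ℂ) (b : E3) (U : Set V') (g : V' → Amb k), IsOpen U ∧
      y ∈ U ∧ ContDiffOn ℝ ∞ g (Y ∩ U) ∧ (∀ y' ∈ Y ∩ U, (∃ w ∈ X, (w : Amb k) = g y') ∧
        (g y').2.2.2.1 ∈ dirDom a b ∧ f (g y') = y' ∧
        (g y').2.2.2.2 = secTensor a b (g y').2.2.2.1) ∧
      ∀ w ∈ X, f w ∈ U → (w : Amb k).2.2.2.1 ∈ dirDom a b ∧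
        g (f w) = ((w : Amb k).1, (w : Amb k).2.1, (w : Amb k).2.2.1, (w : Amb k).2.2.2.1,
          secTensor a b (w : Amb k).2.2.2.1)) :
    IsPrincipalCircleBundle J5 𝓘(ℝ, V') X Y (actT p δ) fun w => f (w : Amb k) where
  action := isCircleAction_subset hX hm
  mapsTo := hfX
  smooth := (hf.contMDiff.comp contMDiff_coe).contMDiffOn
  locallyTrivial := by
    intro y hy
    obtain ⟨a, b, U, g, hU, hyU, hg, h1, h2⟩ := hloc y hy
    have hgc : ∀ y' ∈ Y ∩ U, (toSub (total p δ) g y' : Amb k) = g y' ∧ toSub (total p δ) g y' ∈ X :=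
      fun y' hy' => by
        obtain ⟨w, hw, e⟩ := (h1 y' hy').1
        have : toSub (total p δ) g y' = w :=
          Subtype.ext ((coe_toSub (e ▸ w.2)).trans e.symm)
        rw [this]
        exact ⟨e, hw⟩
    have hact : ∀ y' ∈ Y ∩ U, ∀ c : Circle,
        (actT p δ c (toSub (total p δ) g y') : Amb k) = circ (c : ℂ) (g y') := fun y' hy' c => by
      rw [coe_actT (hX (hgc y' hy').2), (hgc y' hy').1]
    have hsm : ContMDiffOn 𝓘(ℝ, V') J5 ∞ (toSub (total p δ) g) (Y ∩ U) :=
      contMDiffOn_toSub hg.contMDiffOn fun y' hy' => by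
        rw [← (hgc y' hy').1]
        exact Subtype.coe_prop _
    have hne : ∀ w ∈ X ∩ (fun w : total p δ => f (w : Amb k)) ⁻¹' U,
        ‖relPhase a b (w : Amb k)‖ = 1 := fun w hw =>
      (IsOuter.relPhase_spec (hX hw.1) (h2 w hw.1 hw.2).1).1
    -- The inverse of the trivialization takes a point to its phase relative to the section tensor
    -- and to its base point.
    refine ⟨U, hU, hyU, toSub (total p δ) g, hsm, fun y' hy' c => ?_, fun w =>
      (phase (relPhase a b (w : Amb k)), f (w : Amb k)), ?_, ?_, ?_, ?_, ?_, ?_⟩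
    · rw [hact y' hy', hfc]
      exact (h1 y' hy').2.2.1
    · exact (isCircleAction_subset hX hm).smooth.comp
        (contMDiff_fst.contMDiffOn.prodMk (hsm.comp contMDiff_snd.contMDiffOn fun q hq => hq.2))
        fun q hq => ⟨mem_univ _, (hgc q.2 hq.2).2⟩
    · refine ContMDiffOn.prodMk ?_ (hf.contMDiff.comp contMDiff_coe).contMDiffOn
      refine contMDiffOn_phase.comp (contMDiffOn_comp_coe ((contDiffOn_relPhase a b).mono ?_))
        fun w hw => norm_ne_zero_iff.1 ((hne w hw).trans_ne one_ne_zero)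
      rintro _ ⟨w, hw, rfl⟩
      exact ⟨(h2 w hw.1 hw.2).1, (hX hw.1).norm_none⟩
    · rintro ⟨c, y'⟩ ⟨-, hy'⟩
      refine ⟨hm _ (hgc y' hy').2 c, ?_⟩
      change f (actT p δ c (toSub (total p δ) g y') : Amb k) ∈ U
      rw [hact y' hy', hfc, (h1 y' hy').2.2.1]
      exact hy'.2
    · exact fun w hw => ⟨mem_univ _, hfX w hw.1, hw.2⟩
    · rintro ⟨c, y'⟩ ⟨-, hy'⟩
      obtain ⟨-, h3, h4, h5⟩ := h1 y' hy'
      have h6 : relPhase a b (circ (c : ℂ) (g y')) = c := by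
        obtain ⟨w, hw, e⟩ := (h1 y' hy').1
        have := (hX hw).norm_none
        rw [e] at this
        exact relPhase_circ h3 this h5 c
      have h7 := hact y' hy' c
      refine Prod.ext ((congrArg (fun x => phase (relPhase a b x)) h7).trans ?_)
        ((congrArg f h7).trans ((hfc _ _).trans h4))
      exact (congrArg phase h6).trans (phase_coe c)
    · rintro w hw
      obtain ⟨h3, h4⟩ := h2 w hw.1 hw.2
      obtain ⟨h5, h6⟩ := IsOuter.relPhase_spec (hX hw.1) h3
      refine Subtype.ext ?_
      refine (hact _ ⟨hfX w hw.1, hw.2⟩ (phase (relPhase a b (w : Amb k)))).trans ?_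
      rw [coe_phase h5, h4]
      exact Prod.ext rfl (Prod.ext rfl (Prod.ext rfl (Prod.ext rfl h6.symm)))

end Principal

/-! ### The circle fibrations of `X_ad` and `I_∞`. -/

section Bundles

/-- A continuous `Bool`-valued function on the bundle is constant on the fibres, as these are images
of the connected circle. It descends to the base, continuously because of the local sections, and is
constant there. -/
theorem IsPrincipalCircleBundle.isPreconnected {E H M : Type*} [NormedAddCommGroup E]
    [NormedSpace ℝ E] [TopologicalSpace H] [TopologicalSpace M] [ChartedSpace H M]
    {E' H' M' : Type*} [NormedAddCommGroup E'] [NormedSpace ℝ E'] [TopologicalSpace H']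
    [TopologicalSpace M'] [ChartedSpace H' M'] {I : ModelWithCorners ℝ E H}
    {I' : ModelWithCorners ℝ E' H'} {X : Set M} {Y Y' : Set M'} {act : Circle → M → M} {φ : M → M'}
    (h : IsPrincipalCircleBundle I I' X Y act φ) (hY : Y' ⊆ Y) (hY' : IsPreconnected Y') :
    IsPreconnected (X ∩ φ ⁻¹' Y') := by
  refine isPreconnected_of_forall_constant fun b hb => ?_
  have hσ : ∀ y ∈ Y', ∃ U : Set M', IsOpen U ∧ y ∈ U ∧ ∃ s : M' → M, ContinuousOn s (Y' ∩ U) ∧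
      (∀ y' ∈ Y' ∩ U, s y' ∈ X ∩ φ ⁻¹' Y' ∧ φ (s y') = y') ∧
      ∀ w ∈ X ∩ φ ⁻¹' Y', φ w ∈ U → b w = b (s (φ w)) := by
    intro y hy
    obtain ⟨U, hU, hyU, σ, -, h2, g, h3, -, h5, h6, -, h8⟩ := h.locallyTrivial y (hY hy)
    have hc := h3.continuousOn
    have hm : ∀ y' ∈ Y' ∩ U, ∀ c, act c (σ y') ∈ X ∩ φ ⁻¹' Y' := fun y' hy' c => by
      refine ⟨(h5 (x := (c, y')) ⟨mem_univ _, hY hy'.1, hy'.2⟩).1, ?_⟩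
      rw [mem_preimage, h2 y' ⟨hY hy'.1, hy'.2⟩]
      exact hy'.1
    refine ⟨U, hU, hyU, fun y' => act 1 (σ y'), ?_, fun y' hy' =>
      ⟨hm y' hy' 1, h2 y' ⟨hY hy'.1, hy'.2⟩ 1⟩, fun w hw hwU => ?_⟩
    · exact hc.comp (f := fun y' => ((1 : Circle), y')) (by fun_prop)
        fun y' hy' => ⟨mem_univ _, hY hy'.1, hy'.2⟩
    · have h9 := h8 ⟨hw.1, hwU⟩
      have h10 := h6 ⟨hw.1, hwU⟩
      have h11 : (g w).2 = φ w := by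
        have := h2 _ h10.2 (g w).1
        exact this.symm.trans (congrArg φ h9)
      have h12 : ContinuousOn (fun c : Circle => b (act c (σ (φ w)))) univ :=
        hb.comp (hc.comp (f := fun c : Circle => (c, φ w)) (by fun_prop)
          fun c _ => ⟨mem_univ _, hY hw.2, hwU⟩) fun c _ => hm _ ⟨hw.2, hwU⟩ c
      have h13 := isPreconnected_univ.constant h12 (mem_univ (g w).1) (mem_univ 1)
      rw [← h13]
      change act (g w).1 (σ (g w).2) = w at h9
      rw [← h11, h9]
  choose! U hU hyU s hs hm hb' using hσ
  -- The descended function. The choice of a point in the fibre does not matter, and the value over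
  -- an empty fibre is never used.
  let k : M' → Bool := fun y => open Classical in
    if h : ∃ w ∈ X ∩ φ ⁻¹' Y', φ w = y then b h.choose else false
  have hk : ∀ y (hy : y ∈ Y'), ∀ y' ∈ Y' ∩ U y, k y' = b (s y hy y') := fun y hy y' hy' => by
    have h1 : ∃ w ∈ X ∩ φ ⁻¹' Y', φ w = y' := ⟨_, hm y hy y' hy'⟩
    have h2 := h1.choose_spec
    have h3 := hb' y hy _ h2.1 (by rw [h2.2]; exact hy'.2)
    rw [h2.2] at h3
    exact (dif_pos h1).trans h3
  have hkb : ∀ w ∈ X ∩ φ ⁻¹' Y', k (φ w) = b w := fun w hw =>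
    (hk _ hw.2 _ ⟨hw.2, hyU _ hw.2⟩).trans (hb' _ hw.2 w hw (hyU _ hw.2)).symm
  have hkc : ContinuousOn k Y' := fun y hy => by
    have h1 : ContinuousOn (fun y' => b (s y hy y')) (Y' ∩ U y) :=
      hb.comp (hs y hy) fun y' hy' => (hm y hy y' hy').1
    have h2 : ContinuousWithinAt k (Y' ∩ U y) y :=
      (h1 y ⟨hy, hyU y hy⟩).congr (fun y' hy' => hk y hy y' hy') (hk y hy y ⟨hy, hyU y hy⟩)
    exact (continuousWithinAt_inter ((hU y hy).mem_nhds (hyU y hy))).1 h2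
  intro w hw w' hw'
  rw [← hkb w hw, ← hkb w' hw']
  exact hY'.constant hkc hw.2 hw'.2

variable {k : ℕ} {p : Fin k → E3} {δ : ℝ} [H : Admissible p δ]

theorem outer_of_sig_eq_zero {w : total p δ} (h : (w : Amb k).1.2 * sigh (w : Amb k) = 0) :
    w ∈ outer p δ := by
  rw [outer_eq, mem_ofPred_eq, h]
  exact H.pos

theorem ad_subset_outer : {w : total p δ | faceFun .ad (w : Amb k) = 0} ⊆ outer p δ := fun w hw => by
  refine outer_of_sig_eq_zero ?_
  change (w : Amb k).2.1 = 0 at hw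
  rw [sigh, hw, zero_mul, mul_zero]

theorem infty_subset_outer : {w : total p δ | faceFun .infty (w : Amb k) = 0} ⊆ outer p δ :=
  fun w hw => by
    refine outer_of_sig_eq_zero ?_
    change (w : Amb k).1.2 = 0 at hw
    rw [hw, zero_mul]

theorem nut_subset_outer (l : Nut k) :
    {w : total p δ | faceFun (.pt (some l)) (w : Amb k) = 0} ⊆ outer p δ := fun w hw => by
  refine outer_of_sig_eq_zero ?_
  change (w : Amb k).2.2.1 (some l) = 0 at hw
  rw [sigh, Finset.prod_eq_zero (Finset.mem_univ l) hw, mul_zero, mul_zero]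

theorem faceFun_actT {w : total p δ} (hw : w ∈ outer p δ) (c : Circle) (F : Face k) :
    faceFun F (actT p δ c w : Amb k) = faceFun F (w : Amb k) := by
  rw [coe_actT hw]
  rcases F with _ | l | _ <;> rfl

/-- The fibration of the adiabatic face. -/
def adMap (x : Amb k) : (E3 × ℝ) × (Option (Nut k) → E3) := (x.1, x.2.2.2.1)

theorem Yad_inner {y : (E3 × ℝ) × (Option (Nut k) → E3)} (hy : y ∈ Yad p) (l : Option (Nut k)) :
    inner ℝ (y.1.1 - y.1.2 • pt p l) (y.2 l) = ‖y.1.1 - y.1.2 • pt p l‖ := by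
  obtain ⟨h1, h2⟩ := hy.2 l
  nth_rw 1 [h2]
  rw [inner_smul_left, real_inner_self_eq_norm_sq, h1, one_pow, mul_one]
  rfl

/-- At `t = 0` the quotient `ε / r_q` vanishes, so every `v_q` is a unit vector. The inner product
gives a formula for `r_q` that is smooth also on the front face, where the norm of `u - s q` is not.
-/
theorem IsOuter.adMap_mem {x : Amb k} (hx : IsOuter p δ x) (h : x.2.1 = 0) :
    adMap x ∈ Yad p ∧ ∀ l, x.2.2.1 l = inner ℝ (x.1.1 - x.1.2 • pt p l) (x.2.2.2.1 l) := by
  have h1 : ∀ l, ‖x.2.2.2.1 l‖ = 1 := by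
    rintro (_ | l)
    · exact hx.norm_none
    · have := hx.norm_some l
      rwa [sden, h, zero_mul, zero_pow two_ne_zero, add_zero,
        pow_eq_one_iff_of_nonneg (norm_nonneg _) two_ne_zero] at this
  refine ⟨⟨hx.base, fun l => ⟨h1 l, ?_⟩⟩, fun l => ?_⟩
  · change x.1.1 - x.1.2 • pt p l = ‖x.1.1 - x.1.2 • pt p l‖ • x.2.2.2.1 l
    rw [hx.r_smul, norm_smul, h1, mul_one, Real.norm_of_nonneg (hx.r_nonneg l)]
  · rw [hx.r_smul, inner_smul_left, real_inner_self_eq_norm_sq, h1, one_pow, mul_one]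
    rfl

/-- A local section of the adiabatic face. -/
def adSec (p : Fin k → E3) (a : Nut k → Fin 2 → ℂ) (b : E3)
    (y : (E3 × ℝ) × (Option (Nut k) → E3)) : Amb k :=
  (y.1, 0, fun l => inner ℝ (y.1.1 - y.1.2 • pt p l) (y.2 l), y.2, secTensor a b y.2)

theorem isOuter_adSec {a : Nut k → Fin 2 → ℂ} {b : E3} {y : (E3 × ℝ) × (Option (Nut k) → E3)}
    (hy : y ∈ Yad p) (h : y.2 ∈ dirDom a b) : IsOuter p δ (adSec p a b y) := by
  refine ⟨hy.1, le_rfl, fun l => ?_, ?_, ?_, fun l => ?_, (hy.2 none).1, fun l => ?_,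
    nullSec b (y.2 none), fun l => sec (a l) (y.2 (some l)),
    isNullFrame_nullSec (hy.2 none).1 h.2, fun l => hopf_sec (h.1 l), rfl⟩
  · exact (norm_nonneg _).trans_eq (Yad_inner hy l).symm
  · rw [eps, adSec, zero_mul]
    exact pow_pos H.pos 2
  · rw [sigh, adSec, zero_mul, mul_zero]
    exact H.pos
  · exact (hy.2 l).2.trans (congrArg (· • y.2 l) (Yad_inner hy l).symm)
  · have h1 : sden (adSec p a b y) l = 0 := zero_mul _
    rw [h1, zero_pow two_ne_zero, add_zero, pow_eq_one_iff_of_nonneg (norm_nonneg _) two_ne_zero]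
    exact (hy.2 (some l)).1

/-- No direction vanishes on this face, so the section tensors exist locally everywhere, and all
other coordinates are functions of the base point in the blow-up. -/
theorem isPrincipalCircleBundle_ad : IsPrincipalCircleBundle J5
    𝓘(ℝ, (E3 × ℝ) × (Option (Nut k) → E3)) {w : total p δ | faceFun .ad (w : Amb k) = 0} (Yad p)
    (actT p δ) fun w => adMap (w : Amb k) := by
  refine isPrincipalCircleBundle_of_section ad_subset_outer (fun w hw c => ?_) ?_ (fun w hw =>
    (IsOuter.adMap_mem (ad_subset_outer hw) hw).1) (fun c x => rfl) fun y hy => ?_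
  · rw [mem_ofPred_eq, faceFun_actT (ad_subset_outer hw)]
    exact hw
  · unfold adMap
    fun_prop
  · obtain ⟨a, b, h⟩ := exists_dirDom fun l => norm_ne_zero_iff.1 ((hy.2 l).1.trans_ne one_ne_zero)
    refine ⟨a, b, Prod.snd ⁻¹' dirDom a b, adSec p a b, (isOpen_dirDom a b).preimage continuous_snd,
      h, ?_, fun y' hy' => ⟨⟨⟨_, Or.inl (isOuter_adSec hy'.1 hy'.2)⟩, rfl, rfl⟩, hy'.2, rfl, rfl⟩,
      fun w hw hwU => ⟨hwU, ?_⟩⟩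
    · refine contDiffOn_fst.prodMk (contDiffOn_const.prodMk (ContDiffOn.prodMk ?_
        (contDiffOn_snd.prodMk ((contDiffOn_secTensor a b).comp contDiffOn_snd fun y' hy' => hy'.2))))
      refine ContDiff.contDiffOn (contDiff_pi.2 fun l => ContDiff.inner ℝ ?_ ?_) <;> fun_prop
    · have h1 := (IsOuter.adMap_mem (ad_subset_outer hw) hw).2
      have h2 : (w : Amb k).2.1 = 0 := hw
      exact Prod.ext rfl (Prod.ext h2.symm (Prod.ext (funext fun l => (h1 l).symm) rfl))

/-- The fibration of the face at infinity. -/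
def inftyMap (x : Amb k) : E3 × ℝ := (x.1.1, eps x)

/-- A local section of the face at infinity. -/
def inftySec (p : Fin k → E3) (a : Nut k → Fin 2 → ℂ) (b : E3) (y : E3 × ℝ) : Amb k :=
  theta p a (sq (nullSec b y.1)) y.1 0 1 y.2

theorem good_infty {a : Nut k → Fin 2 → ℂ} {u : E3} (h : ∀ l, 0 < secDen (a l) u) :
    Good p a u 0 1 := fun l => by
  rw [dvec, one_smul, zero_smul, sub_zero]
  exact h l

/-- At `s = 0` one has `r_0 = 1` and `v_0 = u`, and `u - s q = u` never vanishes. So `(u, ε)`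
determines everything but the phase, even where `ε = 0`. -/
theorem isPrincipalCircleBundle_infty : IsPrincipalCircleBundle J5 𝓘(ℝ, E3 × ℝ)
    {w : total p δ | faceFun .infty (w : Amb k) = 0} (Metric.sphere (0 : E3) 1 ×ˢ Ico 0 (δ ^ 2))
    (actT p δ) fun w => inftyMap (w : Amb k) := by
  have hfacts : ∀ w : total p δ, faceFun .infty (w : Amb k) = 0 → (w : Amb k).1.2 = 0 ∧
      (w : Amb k).2.2.1 none = 1 ∧ (w : Amb k).1.1 = (w : Amb k).2.2.2.1 none ∧
      eps (w : Amb k) = sigh (w : Amb k) := fun w hw => by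
    have ho : IsOuter p δ (w : Amb k) := infty_subset_outer hw
    have hs : (w : Amb k).1.2 = 0 := hw
    have h1 := ho.sq_add_sq
    rw [hs, zero_pow two_ne_zero, add_zero,
      pow_eq_one_iff_of_nonneg (ho.r_nonneg none) two_ne_zero] at h1
    have h2 := ho.u_eq
    rw [h1, one_smul] at h2
    exact ⟨hs, h1, h2, by rw [eps_eq_none, h1, one_mul]⟩
  refine isPrincipalCircleBundle_of_section infty_subset_outer (fun w hw c => ?_) ?_ (fun w hw =>
    ⟨?_, eps_mem w.2⟩) (fun c x => rfl) fun y hy => ?_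
  · rw [mem_ofPred_eq, faceFun_actT (infty_subset_outer hw)]
    exact hw
  · unfold inftyMap
    fun_prop
  · rw [mem_sphere_zero_iff_norm, inftyMap, (hfacts w hw).2.2.1]
    exact (infty_subset_outer hw).norm_none
  · have hy1 : ‖y.1‖ = 1 := mem_sphere_zero_iff_norm.1 hy.1
    obtain ⟨a, b, h⟩ := exists_dirDom (v := fun _ : Option (Nut k) => y.1)
      fun l => norm_ne_zero_iff.1 (hy1.trans_ne one_ne_zero)
    have hc : Continuous fun (y : E3 × ℝ) (_ : Option (Nut k)) => y.1 := by fun_prop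
    have hO : ∀ y' ∈ (Metric.sphere (0 : E3) 1 ×ˢ Ico 0 (δ ^ 2)) ∩
        {y' : E3 × ℝ | (fun _ : Option (Nut k) => y'.1) ∈ dirDom a b},
        IsOuter p δ (inftySec p a b y') := fun y' hy' => by
      have h1 : ‖y'.1‖ = 1 := mem_sphere_zero_iff_norm.1 hy'.1.1
      refine isOuter_theta (good_infty hy'.2.1) h1 (by norm_num) le_rfl zero_le_one hy'.1.2.1
        (by rw [one_mul]; exact hy'.1.2.2) (by rw [zero_mul]; exact H.pos)
        (isNullFrame_nullSec h1 hy'.2.2)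
    refine ⟨a, b, {y' | (fun _ => y'.1) ∈ dirDom a b}, inftySec p a b,
      (isOpen_dirDom a b).preimage hc, h, ?_, fun y' hy' => ⟨⟨⟨_, Or.inl (hO y' hy')⟩, rfl, rfl⟩,
        ⟨fun l => (good_infty hy'.2.1).secDen_uvec_pos l, hy'.2.2⟩, ?_, rfl⟩, fun w hw hwU => ?_⟩
    · refine contDiffOn_theta (contDiff_sq.comp_contDiffOn ((contDiffOn_nullSec b).comp
        contDiffOn_fst fun y' hy' => hy'.2.2)) contDiffOn_fst contDiffOn_const contDiffOn_const
        contDiffOn_snd fun y' hy' => good_infty hy'.2.1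
    · refine Prod.ext (one_smul ℝ y'.1) ?_
      change eps (theta p a _ y'.1 0 1 y'.2) = y'.2
      rw [eps_theta fun l => ((good_infty hy'.2.1).rad_pos l).ne', one_mul]
    · obtain ⟨h1, h2, h3, h4⟩ := hfacts w hw
      have ho : IsOuter p δ (w : Amb k) := infty_subset_outer hw
      have hG : Good p a ((w : Amb k).2.2.2.1 none) (w : Amb k).1.2 ((w : Amb k).2.2.1 none) := by
        rw [h1, h2, ← h3]
        exact good_infty hwU.1
      refine ⟨⟨ho.mem_secDom hG, by rw [← h3]; exact hwU.2⟩, ?_⟩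
      obtain ⟨w', -, hw'⟩ := ho.exists_eq_theta hG
      rw [h1, h2, ← h3, ← h4] at hw'
      have h5 : inftySec p a b (inftyMap (w : Amb k)) =
        theta p a (sq (nullSec b (w : Amb k).1.1)) (w : Amb k).1.1 0 1 (eps (w : Amb k)) := rfl
      have hv : (w : Amb k).2.2.2.1 = (inftySec p a b (inftyMap (w : Amb k))).2.2.2.1 :=
        (congrArg (fun x : Amb k => x.2.2.2.1) hw').trans rfl
      rw [h5] at hv ⊢
      refine Prod.ext (Prod.ext (one_smul ℝ _) h1.symm)
        (Prod.ext (congrArg (fun x : Amb k => x.2.1) hw').symm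
        (Prod.ext (congrArg (fun x : Amb k => x.2.2.1) hw').symm (Prod.ext hv.symm ?_)))
      exact (congrArg (secTensor a b) hv).symm

end Bundles

/-! ### Connectedness -/

section Connected

theorem isConnected_spinors : IsConnected {z : Fin 2 → ℂ | nsq z = 1} := by
  have h : 1 < Module.rank ℝ (EuclideanSpace ℂ (Fin 2)) := by
    apply Module.lt_rank_of_lt_finrank
    rw [finrank_real_of_complex]
    simp
  have h1 := (isConnected_sphere h 0 zero_le_one).image (fun z => z.ofLp)
    (PiLp.continuous_ofLp 2 _).continuousOn
  convert h1 using 1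
  ext z
  have hn : ‖WithLp.toLp 2 z‖ ^ 2 = nsq z := by
    rw [EuclideanSpace.norm_sq_eq, Fin.sum_univ_two]
    rfl
  constructor
  · intro hz
    refine ⟨WithLp.toLp 2 z, ?_, rfl⟩
    rw [mem_sphere_zero_iff_norm, ← pow_eq_one_iff_of_nonneg (norm_nonneg _) two_ne_zero, hn]
    exact hz
  · rintro ⟨y, hy, rfl⟩
    rw [mem_sphere_zero_iff_norm] at hy
    have h2 : ‖y‖ ^ 2 = nsq y.ofLp := by
      rw [EuclideanSpace.norm_sq_eq, Fin.sum_univ_two]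
      rfl
    rw [mem_ofPred_eq, ← h2, hy, one_pow]

/-- The null vector that belongs to a spinor. -/
def nullOf (z : Fin 2 → ℂ) : Fin 3 → ℂ :=
  ![z 0 ^ 2 - z 1 ^ 2, Complex.I * (z 0 ^ 2 + z 1 ^ 2), -2 * (z 0 * z 1)]

theorem normSq_nullOf (z : Fin 2 → ℂ) :
    ‖rePart (nullOf z)‖ ^ 2 + ‖imPart (nullOf z)‖ ^ 2 = 2 * nsq z ^ 2 := by
  rw [normSq_E3, normSq_E3, nsq_eq]
  simp [rePart, imPart, nullOf, pow_two]
  ring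

/-- The equations for `z 0 ^ 2` and `z 1 ^ 2` are linear and are solved by square roots. Nullity
then gives `-2 (z 0 * z 1) = w 2` up to a sign, which is corrected in `z 1`. -/
theorem exists_nullOf {w : Fin 3 → ℂ} (h : w 0 ^ 2 + w 1 ^ 2 + w 2 ^ 2 = 0) :
    ∃ z, nullOf z = w := by
  obtain ⟨a, ha⟩ := IsAlgClosed.exists_pow_nat_eq ((w 0 - Complex.I * w 1) / 2) zero_lt_two
  obtain ⟨b, hb⟩ := IsAlgClosed.exists_pow_nat_eq (-(w 0 + Complex.I * w 1) / 2) zero_lt_two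
  have hI := Complex.I_sq
  have h0 : a ^ 2 - b ^ 2 = w 0 := by rw [ha, hb]; ring
  have h1 : Complex.I * (a ^ 2 + b ^ 2) = w 1 := by
    rw [ha, hb]
    linear_combination -w 1 * hI
  have h2 : w 2 ^ 2 = (2 * (a * b)) ^ 2 := by
    rw [mul_pow, mul_pow, ha, hb]
    linear_combination h - w 1 ^ 2 * hI
  rcases sq_eq_sq_iff_eq_or_eq_neg.1 h2 with h3 | h3
  · refine ⟨![a, -b], ?_⟩
    funext i
    fin_cases i
    · simpa [nullOf] using h0
    · simpa [nullOf] using h1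
    · simpa [nullOf] using h3.symm
  · refine ⟨![a, b], ?_⟩
    funext i
    fin_cases i
    · simpa [nullOf] using h0
    · simpa [nullOf] using h1
    · simpa [nullOf] using h3.symm

/-- Orthonormal pairs are the null vectors with `|Re| = |Im| = 1`, hence the image of `S³`; this is
the double cover `S³ → SO(3)`. -/
theorem isConnected_frames : IsConnected {Z ∈ AHhatBar | ‖imPart Z‖ = 1} := by
  have hc : Continuous nullOf := by
    unfold nullOf
    refine continuous_pi fun i => ?_
    fin_cases i <;> simp <;> fun_prop
  have h := isConnected_spinors.image nullOf hc.continuousOn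
  convert h using 1
  ext w
  constructor
  · rintro ⟨h1, h2⟩
    obtain ⟨z, rfl⟩ := exists_nullOf ((sum_sq_eq_zero_iff w).2 ⟨h1.1.trans h2.symm, h1.2.1⟩)
    refine ⟨z, ?_, rfl⟩
    have h3 := normSq_nullOf z
    rw [h1.1, h2] at h3
    rw [mem_ofPred_eq, ← pow_eq_one_iff_of_nonneg (nsq_nonneg z) two_ne_zero]
    linarith
  · rintro ⟨z, hz, rfl⟩
    have h0 : nullOf z 0 ^ 2 + nullOf z 1 ^ 2 + nullOf z 2 ^ 2 = 0 := by
      simp only [nullOf, Matrix.cons_val_zero, Matrix.cons_val_one, Matrix.cons_val]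
      linear_combination (z 0 ^ 2 + z 1 ^ 2) ^ 2 * Complex.I_sq
    obtain ⟨h1, h2⟩ := (sum_sq_eq_zero_iff _).1 h0
    have h3 := normSq_nullOf z
    rw [show nsq z = 1 from hz, h1] at h3
    have h4 : ‖imPart (nullOf z)‖ = 1 := by
      rw [← pow_eq_one_iff_of_nonneg (norm_nonneg _) two_ne_zero]
      linarith
    exact ⟨⟨h1.trans h4, h2, h4.le⟩, h4⟩

/-- The disc bundle is the image of orthonormal pairs times `[0, 1]` under `(n, v, t) ↦ n + i t v`.
Over the zero section `v` may be any unit vector perpendicular to `n`. -/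
theorem isConnected_AHhatBar : IsConnected AHhatBar := by
  have hc : Continuous fun q : (Fin 3 → ℂ) × ℝ => cvec (rePart q.1) (q.2 • imPart q.1) := by
    have h1 := contDiff_rePart.continuous
    have h2 := contDiff_imPart.continuous
    refine continuousOn_univ.1 (contDiff_cvec (contDiff_rePart.comp_contDiffOn contDiffOn_fst)
      (contDiffOn_snd.smul (contDiff_imPart.comp_contDiffOn contDiffOn_fst))).continuousOn
  have h := (isConnected_frames.prod (isConnected_Icc (zero_le_one' ℝ))).image _ hc.continuousOn
  convert h using 1
  ext Z
  constructor
  · intro hZ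
    obtain ⟨v, h1, h2, h3⟩ : ∃ v : E3, ‖v‖ = 1 ∧ inner ℝ (rePart Z) v = 0 ∧
        imPart Z = ‖imPart Z‖ • v := by
      by_cases h0 : imPart Z = 0
      · obtain ⟨b, hb⟩ := exists_cross_ne_zero (c := rePart Z) fun h => by
          have := hZ.1
          rw [h, norm_zero] at this
          exact zero_ne_one this
        have hb' := norm_ne_zero_iff.2 hb
        refine ⟨‖cross b (rePart Z)‖⁻¹ • cross b (rePart Z), ?_, ?_, ?_⟩
        · rw [norm_smul, norm_inv, norm_norm, inv_mul_cancel₀ hb']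
        · rw [inner_smul_right, inner_cross_self_right, mul_zero]
        · rw [h0, norm_zero, zero_smul]
      · have h0' := norm_ne_zero_iff.2 h0
        refine ⟨‖imPart Z‖⁻¹ • imPart Z, ?_, ?_, (smul_inv_smul₀ h0' _).symm⟩
        · rw [norm_smul, norm_inv, norm_norm, inv_mul_cancel₀ h0']
        · rw [inner_smul_right, hZ.2.1, mul_zero]
    refine ⟨(cvec (rePart Z) v, ‖imPart Z‖), ⟨⟨⟨?_, ?_, ?_⟩, ?_⟩, norm_nonneg _, hZ.2.2⟩, ?_⟩
    · rw [rePart_cvec, hZ.1]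
    · rw [rePart_cvec, imPart_cvec, h2]
    · rw [imPart_cvec, h1]
    · rw [imPart_cvec, h1]
    · simp only [rePart_cvec, imPart_cvec, ← h3]
      rfl
  · rintro ⟨⟨w, t⟩, ⟨⟨hw, h1⟩, h2, h3⟩, rfl⟩
    refine ⟨by rw [rePart_cvec, hw.1], ?_, ?_⟩
    · rw [rePart_cvec, imPart_cvec, inner_smul_right, hw.2.1, mul_zero]
    · rw [imPart_cvec, norm_smul, h1, mul_one, Real.norm_of_nonneg h2]
      exact h3

theorem isConnected_bdryTN : IsConnected {a ∈ TNbar | a.1.2 = 0} := by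
  have hc : Continuous fun z : Fin 2 → ℂ => ((hopf z, (0 : ℝ)), z) := by
    have := contDiff_hopf.continuous
    fun_prop
  have h := isConnected_spinors.image _ hc.continuousOn
  convert h using 1
  ext a
  constructor
  · rintro ⟨h1, h2⟩
    have h3 := h1.1.1
    rw [h2, ← h1.2, norm_hopf, zero_pow two_ne_zero, add_zero,
      pow_eq_one_iff_of_nonneg (nsq_nonneg _) two_ne_zero] at h3
    exact ⟨a.2, h3, Prod.ext (Prod.ext h1.2 h2.symm) rfl⟩
  · rintro ⟨z, hz, rfl⟩
    refine ⟨⟨⟨?_, le_rfl⟩, rfl⟩, rfl⟩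
    simp only [norm_hopf]
    rw [show nsq z = 1 from hz]
    norm_num

theorem nsq_smul (t : ℝ) (z : Fin 2 → ℂ) : nsq (t • z) = t ^ 2 * nsq z := by
  rw [← norm_hopf, ← norm_hopf, hopf_real_smul, norm_smul, Real.norm_of_nonneg (sq_nonneg t)]

/-- The image of `S³ × [0, 1]` under the map that scales the spinor by `t`. Its Hopf image then has
length `t²`, whence `s = √(1 - t⁴)`. -/
theorem isConnected_TNbar : IsConnected TNbar := by
  have hc : Continuous fun q : (Fin 2 → ℂ) × ℝ =>
      ((hopf (q.2 • q.1), √(1 - q.2 ^ 4)), q.2 • q.1) := by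
    have := contDiff_hopf.continuous
    fun_prop
  have h := (isConnected_spinors.prod (isConnected_Icc (zero_le_one' ℝ))).image _ hc.continuousOn
  convert h using 1
  ext a
  constructor
  · intro ha
    have h3 := ha.1.1
    rw [← ha.2, norm_hopf] at h3
    have hn := nsq_nonneg a.2
    obtain ⟨z, hz, e⟩ : ∃ z, nsq z = 1 ∧ √(nsq a.2) • z = a.2 := by
      by_cases h0 : a.2 = 0
      · obtain ⟨z, hz⟩ := isConnected_spinors.nonempty
        exact ⟨z, hz, by rw [nsq_eq_zero.2 h0, Real.sqrt_zero, zero_smul, h0]⟩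
      · have h1 : 0 < nsq a.2 := hn.lt_of_ne' fun h => h0 (nsq_eq_zero.1 h)
        have h2 := (Real.sqrt_pos.2 h1).ne'
        refine ⟨(√(nsq a.2))⁻¹ • a.2, ?_, smul_inv_smul₀ h2 _⟩
        rw [nsq_smul, inv_pow, Real.sq_sqrt hn, inv_mul_cancel₀ h1.ne']
    refine ⟨(z, √(nsq a.2)), ⟨hz, Real.sqrt_nonneg _, ?_⟩, ?_⟩
    · exact Real.sqrt_le_one.2 (by nlinarith [sq_nonneg a.1.2])
    · simp only [e]
      refine Prod.ext (Prod.ext ha.2 ?_) rfl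
      have h4 : √(nsq a.2) ^ 4 = nsq a.2 ^ 2 := by
        rw [show 4 = 2 * 2 from rfl, pow_mul, Real.sq_sqrt hn]
      change √(1 - √(nsq a.2) ^ 4) = a.1.2
      rw [h4, ← h3, add_sub_cancel_left, Real.sqrt_sq ha.1.2]
  · rintro ⟨⟨z, t⟩, ⟨hz, h1, h2⟩, rfl⟩
    refine ⟨⟨?_, Real.sqrt_nonneg _⟩, rfl⟩
    have h3 : t ^ 4 ≤ 1 := pow_le_one₀ h1 h2
    simp only [norm_hopf, nsq_smul]
    rw [show nsq z = 1 from hz, Real.sq_sqrt (by linarith)]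
    ring

variable {k : ℕ} {p : Fin k → E3}

/-- The interior points of the blow-up. -/
def blow (p : Fin k → E3) (x : E3) : (E3 × ℝ) × (Option (Nut k) → E3) :=
  (toRbar x, fun l => ‖x - pt p l‖⁻¹ • (x - pt p l))

theorem toRbar_mem (x : E3) : toRbar x ∈ Rbar := by
  have h := sqrt_one_add_norm_pos x
  refine ⟨?_, (inv_pos.2 h).le⟩
  have h1 : √(1 + ‖x‖ ^ 2) ^ 2 = 1 + ‖x‖ ^ 2 := Real.sq_sqrt (by positivity)
  have h2 : (1 + ‖x‖ ^ 2) ≠ 0 := by positivity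
  rw [toRbar, norm_smul, mul_pow, Real.norm_of_nonneg (inv_pos.2 h).le, inv_pow, h1]
  field_simp
  ring

theorem continuous_toRbar : Continuous toRbar := by
  have h : Continuous fun x : E3 => (√(1 + ‖x‖ ^ 2))⁻¹ :=
    Continuous.inv₀ (by fun_prop) fun x => (sqrt_one_add_norm_pos x).ne'
  exact (h.smul continuous_id).prodMk h

theorem blow_mem {x : E3} (hx : ∀ l, x ≠ pt p l) : blow p x ∈ Yad p := by
  refine ⟨toRbar_mem x, fun l => ?_⟩
  have h := sqrt_one_add_norm_pos x
  have h0 := norm_ne_zero_iff.2 (sub_ne_zero.2 (hx l))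
  constructor
  · simp only [blow]
    rw [norm_smul, norm_inv, norm_norm, inv_mul_cancel₀ h0]
  · simp only [blow, toRbar]
    rw [← smul_sub, norm_smul, Real.norm_of_nonneg (inv_pos.2 h).le, mul_smul, smul_inv_smul₀ h0]

theorem continuousOn_blow : ContinuousOn (blow p) {x | ∀ l, x ≠ pt p l} := by
  refine continuous_toRbar.continuousOn.prodMk (continuousOn_pi.2 fun l => ?_)
  have h1 : ContinuousOn (fun x : E3 => ‖x - pt p l‖) {x | ∀ l, x ≠ pt p l} := by fun_prop
  have h2 : ContinuousOn (fun x : E3 => x - pt p l) {x | ∀ l, x ≠ pt p l} := by fun_prop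
  exact (h1.inv₀ fun x hx => norm_ne_zero_iff.2 (sub_ne_zero.2 (hx l))).smul h2

theorem isConnected_compl_pt : IsConnected {x : E3 | ∀ l, x ≠ pt p l} := by
  have h : 1 < Module.rank ℝ E3 := by
    apply Module.lt_rank_of_lt_finrank
    simp
  have h1 := (finite_range (pt p)).countable.isConnected_compl_of_one_lt_rank h
  convert h1 using 1
  ext x
  simp [eq_comm]

theorem normalize_smul {t : ℝ} (ht : 0 < t) (v : E3) : ‖t • v‖⁻¹ • t • v = ‖v‖⁻¹ • v := by
  rw [norm_smul, Real.norm_of_nonneg ht.le, smul_smul, mul_inv, mul_right_comm,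
    inv_mul_cancel₀ ht.ne', one_mul]

theorem normalize_of_eq {v w : E3} (hw : ‖w‖ = 1) (h : v = ‖v‖ • w) (h0 : v ≠ 0) :
    ‖v‖⁻¹ • v = w := by
  nth_rw 2 [h]
  rw [inv_smul_smul₀ (norm_ne_zero_iff.2 h0)]

theorem continuousAt_normalize {v : E3} (h0 : v ≠ 0) : ContinuousAt (fun v : E3 => ‖v‖⁻¹ • v) v :=
  (continuousAt_id.norm.inv₀ (norm_ne_zero_iff.2 h0)).smul continuousAt_id

/-- Each point is the limit of a curve in the interior: `u / t` at infinity, `q + t v_q` on the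
front face over `q`, where it has the prescribed direction, and a constant curve otherwise. -/
theorem Yad_subset_closure (hi : Function.Injective (pt p)) :
    Yad p ⊆ closure (blow p '' {x | ∀ l, x ≠ pt p l}) := by
  rintro ⟨⟨u, s⟩, v⟩ hy
  have hs : 0 ≤ s := hy.1.2
  have hv : ∀ l, ‖v l‖ = 1 ∧ u - s • pt p l = ‖u - s • pt p l‖ • v l := hy.2
  have hn : ‖u‖ ^ 2 + s ^ 2 = 1 := hy.1.1
  have hpos : ∀ᶠ t : ℝ in 𝓝[>] 0, 0 < t := self_mem_nhdsWithin
  have hle : 𝓝[>] (0 : ℝ) ≤ 𝓝 0 := nhdsWithin_le_nhds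
  -- it suffices to find a curve in the interior
  suffices h : ∃ (x : ℝ → E3), (∀ᶠ t in 𝓝[>] (0 : ℝ), ∀ l, x t ≠ pt p l) ∧
      Filter.Tendsto (fun t => blow p (x t)) (𝓝[>] 0) (𝓝 ((u, s), v)) by
    obtain ⟨x, h1, h2⟩ := h
    exact mem_closure_of_tendsto h2 (h1.mono fun t ht => ⟨x t, ht, rfl⟩)
  rcases hs.eq_or_lt' with rfl | hs
  · have hu : ‖u‖ = 1 := by
      rwa [zero_pow two_ne_zero, add_zero,
        pow_eq_one_iff_of_nonneg (norm_nonneg _) two_ne_zero] at hn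
    have hvu : ∀ l, v l = u := fun l => by
      have := (hv l).2
      rw [zero_smul, sub_zero, hu, one_smul] at this
      exact this.symm
    have hl : ∀ l, Filter.Tendsto (fun t : ℝ => u - t • pt p l) (𝓝[>] 0) (𝓝 u) := fun l => by
      have h : Continuous fun t : ℝ => u - t • pt p l := by fun_prop
      have := (h.tendsto 0).mono_left hle
      rwa [zero_smul, sub_zero] at this
    have hu0 : u ≠ 0 := norm_ne_zero_iff.1 (hu.trans_ne one_ne_zero)
    refine ⟨fun t => t⁻¹ • u, ?_, Filter.Tendsto.prodMk_nhds ?_ (tendsto_pi_nhds.2 fun l => ?_)⟩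
    · rw [Filter.eventually_all]
      intro l
      filter_upwards [(hl l).eventually_ne hu0, hpos] with t h1 h2 h3
      rw [← h3, smul_inv_smul₀ h2.ne', sub_self] at h1
      exact h1 rfl
    · have h : Continuous fun t : ℝ => ((√(1 + t ^ 2))⁻¹ • u, t * (√(1 + t ^ 2))⁻¹) := by
        have : Continuous fun t : ℝ => (√(1 + t ^ 2))⁻¹ :=
          Continuous.inv₀ (by fun_prop) fun t => (sqrt_one_add_pos t).ne'
        fun_prop
      have h1 := (h.tendsto 0).mono_left hle
      simp only [zero_pow two_ne_zero, add_zero, Real.sqrt_one, inv_one, one_smul, zero_mul] at h1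
      refine h1.congr' (hpos.mono fun t ht => ?_)
      have h2 : √(1 + ‖t⁻¹ • u‖ ^ 2) = t⁻¹ * √(1 + t ^ 2) := by
        rw [norm_smul, hu, mul_one, norm_inv, Real.norm_of_nonneg ht.le]
        rw [show 1 + t⁻¹ ^ 2 = t⁻¹ ^ 2 * (1 + t ^ 2) by field_simp; ring,
          Real.sqrt_mul (sq_nonneg _), Real.sqrt_sq (inv_pos.2 ht).le]
      simp only [blow, toRbar, h2, mul_inv, inv_inv]
      rw [smul_smul, mul_right_comm, mul_inv_cancel₀ ht.ne', one_mul]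
    · change Filter.Tendsto (fun t : ℝ => ‖t⁻¹ • u - pt p l‖⁻¹ • (t⁻¹ • u - pt p l)) _ (𝓝 (v l))
      have h1 := (continuousAt_normalize hu0).tendsto.comp (hl l)
      rw [hvu]
      have h3 : ‖u‖⁻¹ • u = u := by rw [hu, inv_one, one_smul]
      rw [h3] at h1
      refine h1.congr' (hpos.mono fun t ht => ?_)
      have h2 : u - t • pt p l = t • (t⁻¹ • u - pt p l) := by
        rw [smul_sub, smul_inv_smul₀ ht.ne']
      rw [Function.comp_apply, h2, normalize_smul ht]
  · have hb : ∀ q : E3, u = s • q → ((u, s) : E3 × ℝ) = toRbar q := by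
      rintro q rfl
      have h1 : s ^ 2 * (1 + ‖q‖ ^ 2) = 1 := by
        rw [norm_smul, Real.norm_of_nonneg hs.le] at hn
        linarith
      have h2 : s = (√(1 + ‖q‖ ^ 2))⁻¹ := by
        refine eq_inv_of_mul_eq_one_left ?_
        rw [← sq_eq_sq₀ (by positivity) zero_le_one, mul_pow, Real.sq_sqrt (by positivity), h1,
          one_pow]
      rw [toRbar, ← h2]
    have hq : u = s • s⁻¹ • u := (smul_inv_smul₀ hs.ne' u).symm
    set q := s⁻¹ • u
    have hvq : ∀ l, q ≠ pt p l → ‖q - pt p l‖⁻¹ • (q - pt p l) = v l := fun l hl => by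
      rw [← normalize_smul hs, smul_sub, ← hq]
      refine normalize_of_eq (hv l).1 (hv l).2 fun h => hl ?_
      rw [hq, ← smul_sub, smul_eq_zero, or_iff_right hs.ne', sub_eq_zero] at h
      exact h
    by_cases hl : ∃ l, q = pt p l
    · obtain ⟨l, hl⟩ := hl
      have hc : Continuous fun t : ℝ => q + t • v l := by fun_prop
      have h1 : Filter.Tendsto (fun t : ℝ => q + t • v l) (𝓝[>] 0) (𝓝 q) := by
        have := (hc.tendsto 0).mono_left hle
        rwa [zero_smul, add_zero] at this
      have h2 : ∀ m, m ≠ l → q ≠ pt p m := fun m hm h => hm (hi (h.symm.trans hl))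
      have h3 : v l ≠ 0 := norm_ne_zero_iff.1 ((hv l).1.trans_ne one_ne_zero)
      refine ⟨fun t => q + t • v l, ?_,
        Filter.Tendsto.prodMk_nhds ?_ (tendsto_pi_nhds.2 fun m => ?_)⟩
      · rw [Filter.eventually_all]
        intro m
        by_cases hm : m = l
        · filter_upwards [hpos] with t ht h4
          rw [hm, ← hl, add_eq_left, smul_eq_zero] at h4
          exact h4.elim ht.ne' h3
        · exact h1.eventually_ne (h2 m hm)
      · rw [hb q hq]
        exact (continuous_toRbar.tendsto q).comp h1
      · change Filter.Tendsto (fun t : ℝ => ‖q + t • v l - pt p m‖⁻¹ • (q + t • v l - pt p m)) _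
          (𝓝 (v m))
        by_cases hm : m = l
        · refine tendsto_const_nhds.congr' (hpos.mono fun t ht => ?_)
          rw [hm, ← hl]
          simp only [add_sub_cancel_left]
          rw [normalize_smul ht, (hv l).1, inv_one, one_smul]
        · rw [← hvq m (h2 m hm)]
          exact (continuousAt_normalize (sub_ne_zero.2 (h2 m hm))).tendsto.comp
            (h1.sub_const (pt p m))
    · push Not at hl
      refine ⟨fun _ => q, Filter.Eventually.of_forall fun _ => hl, ?_⟩
      have : blow p q = ((u, s), v) := Prod.ext (hb q hq).symm (funext fun l => hvq l (hl l))
      rw [← this]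
      exact tendsto_const_nhds

theorem isConnected_Yad (hi : Function.Injective (pt p)) : IsConnected (Yad p) := by
  have h := isConnected_compl_pt.image (blow p) continuousOn_blow
  have h1 : blow p '' {x | ∀ l, x ≠ pt p l} ⊆ Yad p := by
    rintro _ ⟨x, hx, rfl⟩
    exact blow_mem hx
  exact ⟨h.nonempty.mono h1, h.isPreconnected.subset_closure h1 (Yad_subset_closure hi)⟩

end Connected

/-! ### The boundary hypersurfaces -/

section Boundary

section General

variable {E H M : Type*} [NormedAddCommGroup E]
    [NormedSpace ℝ E] [TopologicalSpace H] [TopologicalSpace M] [ChartedSpace H M]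
    {E' H' M' : Type*} [NormedAddCommGroup E'] [NormedSpace ℝ E'] [TopologicalSpace H']
    [TopologicalSpace M'] [ChartedSpace H' M'] {I : ModelWithCorners ℝ E H}
    {I' : ModelWithCorners ℝ E' H'}

theorem IsPrincipalCircleBundle.exists_preimage {X : Set M} {Y : Set M'} {act : Circle → M → M}
    {φ : M → M'} (h : IsPrincipalCircleBundle I I' X Y act φ) {y : M'} (hy : y ∈ Y) :
    ∃ w ∈ X, φ w = y := by
  obtain ⟨U, -, hyU, σ, -, h2, g, -, -, h5, -⟩ := h.locallyTrivial y hy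
  exact ⟨act 1 (σ y), (h5 (x := (1, y)) ⟨mem_univ _, hy, hyU⟩).1, h2 y ⟨hy, hyU⟩ 1⟩

theorem IsDiffeoOn.image_eq {f : M → M'} {A : Set M} {B : Set M'} (h : IsDiffeoOn I I' f A B) :
    f '' A = B := by
  obtain ⟨g, -, -, h3, h4, -, h6⟩ := h
  exact Subset.antisymm (image_subset_iff.2 h3) fun b hb => ⟨g b, h4 hb, h6 hb⟩

theorem IsDiffeoOn.isConnected {f : M → M'} {A A' : Set M} {B : Set M'} (h : IsDiffeoOn I I' f A B)
    (hA : A' ⊆ A) (hc : IsConnected A') : IsConnected (f '' A') := by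
  obtain ⟨g, h1, -⟩ := h
  exact hc.image f (h1.continuousOn.mono hA)

/-- The components of a finite disjoint union of closed connected sets. -/
theorem connectedComponentIn_iUnion {X ι : Type*} [TopologicalSpace X] [Finite ι] {C : ι → Set X}
    (hC : ∀ i, IsClosed (C i)) (hp : ∀ i, IsPreconnected (C i))
    (hd : ∀ i j, i ≠ j → Disjoint (C i) (C j)) {i : ι} {w : X} (hw : w ∈ C i) :
    connectedComponentIn (⋃ j, C j) w = C i := by
  have hsub : C i ⊆ ⋃ j, C j := subset_iUnion C i
  refine Subset.antisymm ?_ ((hp i).subset_connectedComponentIn hw hsub)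
  have h1 := isPreconnected_connectedComponentIn (x := w) (F := ⋃ j, C j)
  have hw' := mem_connectedComponentIn (hsub hw)
  have hdis : C i ∩ ⋃ j : {j // j ≠ i}, C j = ∅ := by
    rw [← disjoint_iff_inter_eq_empty, disjoint_iUnion_right]
    exact fun j => hd _ _ j.2.symm
  have hcov : (⋃ j, C j) ⊆ C i ∪ ⋃ j : {j // j ≠ i}, C j := iUnion_subset fun j => by
    by_cases hj : j = i
    · exact hj ▸ subset_union_left
    · exact (subset_iUnion (fun j : {j // j ≠ i} => C j) ⟨j, hj⟩).trans subset_union_right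
  rcases isPreconnected_iff_subset_of_disjoint_closed.1 h1 (C i) (⋃ j : {j // j ≠ i}, C j) (hC i)
    (isClosed_iUnion_of_finite fun j => hC j) ((connectedComponentIn_subset _ _).trans hcov)
    (by rw [hdis, inter_empty]) with h | h
  · exact h
  · have : w ∈ C i ∩ ⋃ j : {j // j ≠ i}, C j := ⟨hw, h hw'⟩
    rw [hdis] at this
    exact this.elim

end General

variable {k : ℕ} (p : Fin k → E3) (δ : ℝ) [H : Admissible p δ]

/-- The boundary hypersurfaces. -/
def face (F : Face k) : Set (total p δ) := {w | faceFun F (w : Amb k) = 0}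

variable {p δ}

theorem isClosed_face (F : Face k) : IsClosed (face p δ F) :=
  isClosed_eq ((contDiff_faceFun F).continuous.comp continuous_subtype_val) continuous_const

theorem face_disjoint {F G : Face k} (hF : F ≠ .ad) (hG : G ≠ .ad) (h : F ≠ G) :
    Disjoint (face p δ F) (face p δ G) :=
  disjoint_left.2 fun w h1 h2 => h (face_eq_of_zero w.2 hF hG h1 h2)

theorem eq_faceHA {w : total p δ} (hw : w ∈ face p δ (.pt none)) :
    ∃ Z ∈ AHhatBar, w = faceHA p δ (sq Z) ∧ (w : Amb k) = alpha p Z 0 := by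
  obtain ⟨Z, hZ, e⟩ := eq_alpha_zero w.2 hw
  exact ⟨Z, hZ, Subtype.ext (e.trans (coe_faceHA hZ).symm), e⟩

theorem faceHA_mem {Z : Fin 3 → ℂ} (hZ : Z ∈ AHhatBar) :
    faceHA p δ (sq Z) ∈ face p δ (.pt none) :=
  (isDiffeoOn_faceHA (p := p) (δ := δ)).image_eq.subset (mem_image_of_mem _ ⟨Z, hZ, rfl⟩)

theorem ad_inter_faceHA : face p δ .ad ∩ face p δ (.pt none) =
    faceHA p δ '' (sq '' {Z ∈ AHhatBar | ‖imPart Z‖ = 1}) := by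
  have h1 : ∀ {Z : Fin 3 → ℂ}, Z ∈ AHhatBar → ((alpha p Z 0).2.1 = 0 ↔ ‖imPart Z‖ = 1) :=
    fun hZ => (alpha_mem_bdry H.lt_norm (domA_zero H.pos hZ)).2.2.2.1
  ext w
  constructor
  · rintro ⟨h, h0⟩
    obtain ⟨Z, hZ, e, e'⟩ := eq_faceHA h0
    change (w : Amb k).2.1 = 0 at h
    rw [e', h1 hZ] at h
    exact ⟨_, ⟨Z, ⟨hZ, h⟩, rfl⟩, e.symm⟩
  · rintro ⟨_, ⟨Z, ⟨hZ, h⟩, rfl⟩, rfl⟩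
    refine ⟨?_, faceHA_mem hZ⟩
    change (faceHA p δ (sq Z) : Amb k).2.1 = 0
    rw [coe_faceHA hZ, h1 hZ]
    exact h

theorem faceHA_inter_outer : face p δ (.pt none) ∩ outer p δ =
    faceHA p δ '' (sq '' {Z ∈ AHhatBar | 1 - ‖imPart Z‖ ^ 2 < δ}) := by
  have h1 : ∀ {Z : Fin 3 → ℂ}, Z ∈ AHhatBar →
      (alpha p Z 0).1.2 * sigh (alpha p Z 0) = 1 - ‖imPart Z‖ ^ 2 :=
    fun hZ => sig_alpha H.lt_norm (domA_zero H.pos hZ)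
  rw [outer_eq]
  ext w
  constructor
  · rintro ⟨h0, h⟩
    obtain ⟨Z, hZ, e, e'⟩ := eq_faceHA h0
    rw [mem_ofPred_eq, e', h1 hZ] at h
    exact ⟨_, ⟨Z, ⟨hZ, h⟩, rfl⟩, e.symm⟩
  · rintro ⟨_, ⟨Z, ⟨hZ, h⟩, rfl⟩, rfl⟩
    refine ⟨faceHA_mem hZ, ?_⟩
    rw [mem_ofPred_eq, coe_faceHA hZ, h1 hZ]
    exact h

theorem faceTN_mem {a : (E3 × ℝ) × (Fin 2 → ℂ)} (ha : a ∈ TNbar) (l : Nut k) :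
    faceTN p δ l a ∈ face p δ (.pt (some l)) :=
  (isDiffeoOn_faceTN (p := p) (δ := δ) l).image_eq.subset (mem_image_of_mem _ ha)

theorem ad_inter_faceTN (l : Nut k) : face p δ .ad ∩ face p δ (.pt (some l)) =
    faceTN p δ l '' {a ∈ TNbar | a.1.2 = 0} := by
  have h1 : ∀ a ∈ TNbar, faceTN p δ l a ∈ face p δ .ad ↔ a.1.2 = 0 := fun a ha => by
    change (faceTN p δ l a : Amb k).2.1 = 0 ↔ _
    rw [coe_faceTN ha, (nutMap_face δ l).2]
  ext w
  constructor
  · rintro ⟨h, h0⟩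
    obtain ⟨a, ha, rfl⟩ := (isDiffeoOn_faceTN (p := p) (δ := δ) l).image_eq.symm.subset h0
    exact ⟨a, ⟨ha, (h1 a ha).1 h⟩, rfl⟩
  · rintro ⟨a, ⟨ha, h⟩, rfl⟩
    exact ⟨(h1 a ha).2 h, faceTN_mem ha l⟩

/-- No radius vanishes at infinity, so there `t = 0` is equivalent to `ε = 0`. -/
theorem ad_inter_infty : face p δ .ad ∩ face p δ .infty =
    face p δ .infty ∩ (fun w : total p δ => inftyMap (w : Amb k)) ⁻¹'
      (Metric.sphere (0 : E3) 1 ×ˢ {0}) := by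
  ext w
  constructor
  · rintro ⟨h, h0⟩
    refine ⟨h0, (isPrincipalCircleBundle_infty.mapsTo h0).1, ?_⟩
    exact (eps_eq_zero_iff _).2 (Or.inl h)
  · rintro ⟨h0, -, h⟩
    refine ⟨((eps_eq_zero_iff _).1 h).resolve_right ?_, h0⟩
    rintro ⟨l, hl⟩
    have := face_eq_of_zero w.2 (by simp) (by simp) h0 hl
    simp at this

theorem isConnected_sphere_E3 : IsConnected (Metric.sphere (0 : E3) 1) := by
  refine isConnected_sphere ?_ 0 zero_le_one
  apply Module.lt_rank_of_lt_finrank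
  simp

/-- The intersections are an image of the orthonormal frames, a copy of `S³` for each point of `P`,
and a circle bundle over `S² × {0}`. -/
theorem isConnected_ad_inter {F : Face k} (hF : F ≠ .ad) :
    IsConnected (face p δ .ad ∩ face p δ F) := by
  rcases F with _ | (_ | l) | _
  · exact absurd rfl hF
  · rw [ad_inter_faceHA]
    refine isDiffeoOn_faceHA.isConnected ?_ (isConnected_frames.image _
      contDiff_sq.continuous.continuousOn)
    exact image_mono fun Z hZ => hZ.1
  · rw [ad_inter_faceTN]
    exact (isDiffeoOn_faceTN l).isConnected (fun a ha => ha.1) isConnected_bdryTN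
  · have h0 : (0 : ℝ) ∈ Ico 0 (δ ^ 2) := ⟨le_rfl, pow_pos H.pos 2⟩
    have h1 : Metric.sphere (0 : E3) 1 ×ˢ {(0 : ℝ)} ⊆
        Metric.sphere (0 : E3) 1 ×ˢ Ico 0 (δ ^ 2) := prod_mono_right (by simpa using h0)
    rw [ad_inter_infty]
    refine ⟨?_, isPrincipalCircleBundle_infty.isPreconnected h1
      (isConnected_sphere_E3.prod isConnected_singleton).isPreconnected⟩
    obtain ⟨y, hy⟩ := isConnected_sphere_E3.nonempty
    obtain ⟨w, hw, e⟩ := (isPrincipalCircleBundle_infty (p := p) (δ := δ)).exists_preimage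
      (h1 (show ((y, 0) : E3 × ℝ) ∈ _ from ⟨hy, rfl⟩))
    exact ⟨w, hw, by rw [mem_preimage, e]; exact ⟨hy, rfl⟩⟩

theorem isConnected_face (F : Face k) : IsConnected (face p δ F) := by
  rcases F with _ | (_ | l) | _
  · refine ⟨(isConnected_ad_inter (F := .infty) (by simp)).nonempty.mono inter_subset_left, ?_⟩
    have h := (isPrincipalCircleBundle_ad (p := p) (δ := δ)).isPreconnected Subset.rfl
      (isConnected_Yad H.inj).isPreconnected
    exact (inter_eq_left.2 (isPrincipalCircleBundle_ad (p := p) (δ := δ)).mapsTo).subst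
      (motive := IsPreconnected) h
  · rw [face, ← isDiffeoOn_faceHA.image_eq]
    exact isDiffeoOn_faceHA.isConnected Subset.rfl (isConnected_AHhatBar.image _
      contDiff_sq.continuous.continuousOn)
  · rw [face, ← (isDiffeoOn_faceTN l).image_eq]
    exact (isDiffeoOn_faceTN l).isConnected Subset.rfl isConnected_TNbar
  · refine ⟨(isConnected_ad_inter (F := .infty) (by simp)).nonempty.mono inter_subset_right, ?_⟩
    have h := (isPrincipalCircleBundle_infty (p := p) (δ := δ)).isPreconnected Subset.rfl
      (isConnected_sphere_E3.prod (isConnected_Ico (pow_pos H.pos 2))).isPreconnected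
    exact (inter_eq_left.2 (isPrincipalCircleBundle_infty (p := p) (δ := δ)).mapsTo).subst
      (motive := IsPreconnected) h

theorem isBoundaryFamily : IsBoundaryFamily J5 (face p δ) fun F w => faceFun F (w : Amb k) where
  smooth := fun F => (contDiff_faceFun F).contMDiff.comp contMDiff_coe
  nonneg := fun F w => total_nonneg w.2 F
  zero_set := fun F => rfl
  connected := isConnected_face
  iUnion_eq := by
    ext w
    rw [mem_boundary_iff, mem_bdry_iff, mem_iUnion]
    rfl
  transversal := fun w => linearIndependent_faces w

/-- The faces other than `X_ad` are disjoint, so every corner is an intersection with `X_ad`. -/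
theorem corners_eq : corners (total p δ) = ⋃ F : {F : Face k // F ≠ .ad},
    face p δ .ad ∩ face p δ F := by
  ext w
  rw [mem_corners_iff, mem_corn_iff, mem_iUnion]
  constructor
  · rintro ⟨h, F, hF, h'⟩
    exact ⟨⟨F, hF⟩, h, h'⟩
  · rintro ⟨F, h, h'⟩
    exact ⟨h, F.1, F.2, h'⟩

theorem corners_subset : corners (total p δ) ⊆ face p δ .ad := by
  rw [corners_eq]
  exact iUnion_subset fun F => inter_subset_left

theorem face_inter_corners {F : Face k} (hF : F ≠ .ad) :
    face p δ F ∩ corners (total p δ) = face p δ .ad ∩ face p δ F := by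
  ext w
  rw [mem_inter_iff, mem_corners_iff, mem_corn_iff]
  exact ⟨fun h => ⟨h.2.1, h.1⟩, fun h => ⟨h.2, h.1, F, hF, h.2⟩⟩

theorem connectedComponentIn_corners {F : Face k} (hF : F ≠ .ad) {w : total p δ}
    (hw : w ∈ face p δ .ad ∩ face p δ F) :
    connectedComponentIn (face p δ .ad ∩ corners (total p δ)) w = face p δ .ad ∩ face p δ F := by
  rw [inter_eq_right.2 corners_subset, corners_eq]
  exact connectedComponentIn_iUnion (C := fun F : {F : Face k // F ≠ .ad} =>
    face p δ .ad ∩ face p δ F.1) (fun F => (isClosed_face _).inter (isClosed_face _))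
    (fun F => (isConnected_ad_inter F.2).isPreconnected)
    (fun F G h => (face_disjoint F.2 G.2 fun e => h (Subtype.ext e)).mono inter_subset_right
      inter_subset_right) (i := ⟨F, hF⟩) hw

theorem prod_face (g : Face k → ℝ) : ∏ F, g F = g .ad * (g .infty * ∏ l, g (.pt l)) := by
  rw [← Equiv.prod_comp ((Equiv.refl _ : Option (Option (Option (Nut k))) ≃ _).trans
    { toFun := fun a => match a with
        | none => Face.ad
        | some none => .infty
        | some (some l) => .pt l
      invFun := fun F => match F with
        | .ad => none
        | .infty => some none
        | .pt l => some (some l)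
      left_inv := by rintro (_ | _ | _) <;> rfl
      right_inv := by rintro (_ | _ | _) <;> rfl }) g, Fintype.prod_option, Fintype.prod_option]
  rfl

theorem isBFibration : IsBFibration J5 (fun F (w : total p δ) => faceFun F (w : Amb k))
    fun w => (proj p δ w : ℝ) where
  smooth := contDiff_eps.contMDiff.comp contMDiff_coe
  bMap := by
    -- `ε` is the product of all defining functions except that of `I_∞`, with positive factor `1`.
    refine ⟨fun F => match F with | .infty => 0 | _ => 1, fun _ => 1, contMDiff_const,
      fun _ => zero_lt_one, fun w => ?_⟩
    rw [prod_face, one_mul, pow_one, pow_zero, one_mul]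
    simp only [pow_one]
    rfl
  bSubmersion := by
    intro w h
    obtain ⟨v, h1, h2⟩ := hasFibreTransversal w (Or.inl h)
    refine ⟨v, fun F hF => ?_, h1⟩
    rcases F with _ | l | _
    · exact absurd ((eps_eq_zero_iff _).2 (Or.inl hF)) h.ne'
    · exact absurd ((eps_eq_zero_iff _).2 (Or.inr ⟨l, hF⟩)) h.ne'
    · exact h2 hF

theorem image_proj_infty : proj p δ '' face p δ .infty = univ := by
  refine eq_univ_of_forall fun ε => ?_
  obtain ⟨y, hy⟩ := isConnected_sphere_E3.nonempty
  obtain ⟨w, hw, e⟩ := (isPrincipalCircleBundle_infty (p := p) (δ := δ)).exists_preimage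
    (show ((y, (ε : ℝ)) : E3 × ℝ) ∈ _ from ⟨hy, ε.2⟩)
  exact ⟨w, hw, Subtype.ext (congrArg Prod.snd e)⟩

/-- The face is mapped onto the half-open interval `[0, δ²)`, which is not compact. -/
theorem not_isCompact_infty : ¬ IsCompact (face p δ .infty) := fun h => by
  have h1 := h.image continuous_proj
  rw [image_proj_infty, ← isCompact_iff_isCompact_univ] at h1
  have h2 := h1.isClosed.closure_eq
  have h3 : 0 < δ ^ 2 := pow_pos H.pos 2
  rw [closure_Ico h3.ne] at h2
  exact lt_irrefl _ (h2.subset (right_mem_Icc.2 h3.le)).2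

theorem proj_eq_zero : {w : total p δ | (proj p δ w : ℝ) = 0} =
    face p δ .ad ∪ ⋃ l, face p δ (.pt l) := by
  ext w
  rw [mem_union, mem_iUnion]
  exact eps_eq_zero_iff _

variable (p δ) in
/-- The involution. -/
def involT (w : total p δ) : total p δ := ⟨invol (w : Amb k), invol_mem w.2⟩

theorem contMDiff_involT : ContMDiff J5 J5 ∞ (involT p δ) := by
  rw [← contMDiffOn_univ]
  exact contMDiffOn_of_coe (contDiff_invol.contMDiff.comp contMDiff_coe).contMDiffOn

theorem faceFun_neg_invol (F : Face k) (x : Amb k) : faceFun F.neg (invol x) = faceFun F x := by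
  rcases F with _ | (_ | ⟨ν, b⟩) | _
  · rfl
  · rfl
  · change x.2.2.1 (some (ν, !!b)) = x.2.2.1 (some (ν, b))
    rw [Bool.not_not]
  · rfl

theorem star_mem_AHhatBar {Z : Fin 3 → ℂ} (hZ : Z ∈ AHhatBar) : star Z ∈ AHhatBar := by
  refine ⟨?_, ?_, ?_⟩
  · rw [rePart_star, hZ.1]
  · rw [rePart_star, imPart_star, inner_neg_right, hZ.2.1, neg_zero]
  · rw [imPart_star, norm_neg]
    exact hZ.2.2

end Boundary

end GluingSpace

end

/-! ### The theorem. -/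

open GluingSpace in
theorem mainTheorem7 (k : ℕ) (p : Fin k → E3) (hp : Function.Injective (pt p))
    (δ : ℝ) (hδ₀ : 0 < δ) (hδ₁ : δ < 1 / 2) (hδp : ∀ ν, δ < ‖p ν‖) :
    ∃ (ε₀ : ℝ) (_ : 0 < ε₀) (_ : ε₀ ≤ δ ^ 2)
      -- the 5-manifold with corners up to codimension 2
      (W : Type) (_ : TopologicalSpace W) (_ : T2Space W) (_ : SecondCountableTopology W)
      (_ : ChartedSpace Corner5 W) (_ : IsManifold J5 ∞ W)
      -- the projection, the boundary hypersurfaces and their defining functions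
      (π : W → Set.Ico (0 : ℝ) ε₀) (X : Face k → Set W) (ρ : Face k → W → ℝ)
      -- the circle-fibred region, the circle action and the map to the compactified `ℝ³` on it
      (W₁ : Set W) (act : Circle → W → W) (x : W → E3 × ℝ)
      -- the fibration of `X_ad`, the identifications of `X_0` and `X_p`, the involution
      (φad : W → (E3 × ℝ) × (Option (Nut k) → E3))
      (e₀ : Mat3 → W) (e : Nut k → (E3 × ℝ) × (Fin 2 → ℂ) → W) (ι : W → W),
      -- general structure
      IsBoundaryFamily J5 X ρ ∧
      IsOpen W₁ ∧ X .ad ⊆ W₁ ∧ X .infty ⊆ W₁ ∧ (∀ l, X (.pt (some l)) ⊆ W₁) ∧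
      X (.pt none) ∩ W₁ = e₀ '' (sq '' {Z ∈ AHhatBar | 1 - ‖imPart Z‖ ^ 2 < δ}) ∧
      IsCircleAction J5 W₁ act ∧
      ContMDiffOn J5 𝓘(ℝ, E3 × ℝ) ∞ x W₁ ∧ Set.MapsTo x W₁ Rbar ∧
      (∀ w ∈ W₁, ∀ c, x (act c w) = x w ∧ π (act c w) = π w) ∧
      (∀ l, ∀ w ∈ X (.pt l) ∩ W₁, x w = toRbar (pt p l)) ∧
      -- (i)
      IsProperMap π ∧ IsBFibration J5 ρ (fun w => (π w : ℝ)) ∧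
      (∀ ε ∈ Set.Ioo 0 ε₀, IsCompactifiedSen p δ ε J5 {w | (π w : ℝ) = ε}
        ({w | (π w : ℝ) = ε} ∩ W₁) ({w | (π w : ℝ) = ε} ∩ X .infty) x act) ∧
      -- (ii)
      IsDiffeoOn 𝓘(ℝ, Mat3) J5 e₀ HAbar (X (.pt none)) ∧
      (∀ l, IsDiffeoOn 𝓘(ℝ, (E3 × ℝ) × (Fin 2 → ℂ)) J5 (e l) TNbar (X (.pt (some l)))) ∧
      {w | (π w : ℝ) = 0} = X .ad ∪ ⋃ l, X (.pt l) ∧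
      -- (iii)
      ¬ IsCompact (X .infty) ∧ π '' X .infty = Set.univ ∧
      (∀ w ∈ X .infty, ∃ v, diff J5 (ρ .infty) w v = 0 ∧ diff J5 (fun w => (π w : ℝ)) w v ≠ 0) ∧
      (∀ ε ∈ Set.Ioo 0 ε₀, ∃ j : (E3 × ℝ) × Tensor k → W,
        IsDiffeoOn 𝓘(ℝ, (E3 × ℝ) × Tensor k) J5 j (bdryMbar p ε)
          ({w | (π w : ℝ) = ε} ∩ X .infty)) ∧
      -- (iv)
      IsPrincipalCircleBundle J5 𝓘(ℝ, (E3 × ℝ) × (Option (Nut k) → E3)) (X .ad) (Yad p) act φad ∧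
      (∀ w ∈ X .ad, (φad w).1 = x w) ∧
      IsPrincipalCircleBundle J5 𝓘(ℝ, E3 × ℝ) (X .infty)
        (Metric.sphere (0 : E3) 1 ×ˢ Set.Ico 0 ε₀) act (fun w => ((x w).1, (π w : ℝ))) ∧
      -- (v)
      X .ad ∩ corners W = ⋃ F ∈ {F | F ≠ Face.ad}, X .ad ∩ X F ∧
      (∀ F, F ≠ .ad → (X .ad ∩ X F).Nonempty ∧
        X F ∩ corners W = X .ad ∩ X F ∧
        (∀ w ∈ X .ad ∩ X F, connectedComponentIn (X .ad ∩ corners W) w = X .ad ∩ X F) ∧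
        ∀ F', F' ≠ .ad → F ≠ F' → Disjoint (X F) (X F')) ∧
      X .ad ∩ X (.pt none) = e₀ '' (sq '' {Z ∈ AHhatBar | ‖imPart Z‖ = 1}) ∧
      (∀ l, X .ad ∩ X (.pt (some l)) = e l '' {a ∈ TNbar | a.1.2 = 0}) ∧
      (∀ Z ∈ AHhatBar, ‖imPart Z‖ = 1 → (φad (e₀ (sq Z))).2 none = axis Z) ∧
      (∀ l, ∀ a ∈ TNbar, a.1.2 = 0 → (φad (e l a)).2 (some l) = a.1.1) ∧
      (∀ Z ∈ AHhatBar, 1 - ‖imPart Z‖ ^ 2 < δ → ∀ θ : ℝ,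
        act (Circle.exp θ) (e₀ (sq Z)) = e₀ (sq (rot (θ / 2) Z))) ∧
      (∀ l, ∀ a ∈ TNbar, ∀ c : Circle, act c (e l a) = e l (a.1, (c : ℂ) • a.2)) ∧
      -- (vi)
      ContMDiff J5 J5 ∞ ι ∧ Function.Involutive ι ∧ (∀ w, π (ι w) = π w) ∧
      (∀ F, Set.MapsTo ι (X F) (X F.neg)) ∧ Set.MapsTo ι W₁ W₁ ∧
      (∀ w ∈ W₁, x (ι w) = (-(x w).1, (x w).2)) ∧
      (∀ w ∈ X .ad, φad (ι w) = negYad (φad w)) ∧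
      (∀ Z ∈ AHhatBar, ι (e₀ (sq Z)) = e₀ (sq (star Z))) := by
  haveI H : Admissible p δ := ⟨hp, hδ₀, hδ₁, hδp⟩
  have hbig : ∀ {Z : Fin 3 → ℂ}, 1 - ‖imPart Z‖ ^ 2 < δ → 1 / 2 ≤ ‖imPart Z‖ ^ 2 := fun h => by
    linarith
  have hne : ∀ {Z : Fin 3 → ℂ}, 1 / 2 ≤ ‖imPart Z‖ ^ 2 → imPart Z ≠ 0 := fun h h0 => by
    rw [h0] at h
    norm_num at h
  -- The choice `ε₀ = δ²` is the full range in which the gluing region `ε / δ < |x| < δ` is not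
  -- empty.
  refine ⟨δ ^ 2, pow_pos hδ₀ 2, le_rfl, total p δ, inferInstance, inferInstance, inferInstance,
    inferInstance, inferInstance, proj p δ, face p δ, fun F w => faceFun F (w : Amb k), outer p δ,
    actT p δ, baseT p δ, fun w => adMap (w : Amb k), faceHA p δ, faceTN p δ, involT p δ,
    isBoundaryFamily, isOpen_outer, ad_subset_outer, infty_subset_outer, nut_subset_outer,
    faceHA_inter_outer, isCircleAction_subset Subset.rfl fun w hw c => actT_mem hw c,
    (contDiff_fst.contMDiff.comp contMDiff_coe).contMDiffOn, fun w hw => hw.base,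
    fun w hw c => ?_, fun l w hw => base_eq_toRbar hw.2 (base_of_r_eq_zero w.2 hw.1).1,
    isProperMap_proj, isBFibration, fun ε hε => isCompactifiedSen hε.1 hε.2, isDiffeoOn_faceHA,
    isDiffeoOn_faceTN, proj_eq_zero, not_isCompact_infty, image_proj_infty, fun w hw => ?_,
    fun ε hε => ⟨_, isDiffeoOn_bdry hε.1 hε.2⟩, isPrincipalCircleBundle_ad, fun w _ => rfl,
    isPrincipalCircleBundle_infty, ?_, fun F hF => ⟨(isConnected_ad_inter hF).nonempty,
      face_inter_corners hF, fun w hw => connectedComponentIn_corners hF hw,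
      fun F' hF' h => face_disjoint hF hF' h⟩, ad_inter_faceHA, ad_inter_faceTN,
    fun Z hZ h => ?_, fun l a ha _ => ?_, fun Z hZ h θ => Subtype.ext ?_,
    fun l a ha c => Subtype.ext ?_, contMDiff_involT, fun w => Subtype.ext (invol_invol _),
    fun w => Subtype.ext (eps_invol _), fun F w hw => (faceFun_neg_invol F _).trans hw,
    fun w hw => IsOuter.invol hw, fun w _ => rfl, fun w _ => rfl, fun Z hZ => Subtype.ext ?_⟩
  · have h := coe_actT hw c
    exact ⟨(congrArg (fun x : Amb k => x.1) h).trans rfl, Subtype.ext ((congrArg eps h).trans rfl)⟩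
  · obtain ⟨v, h1, h2⟩ := hasFibreTransversal w (Or.inr hw)
    exact ⟨v, h2 hw, h1⟩
  · rw [inter_eq_right.2 corners_subset, corners_eq, iUnion_subtype]
    rfl
  · have h1 : 1 / 2 ≤ ‖imPart Z‖ ^ 2 := by
      rw [h]
      norm_num
    simp only [adMap, coe_faceHA hZ]
    rw [alpha_c, axA_eq_axis hZ h1]
  · simp only [adMap, coe_faceTN ha]
    rw [nutMap, bet_v_self]
    exact ha.2
  · have h1 := hbig h
    have h2 : faceHA p δ (sq Z) ∈ outer p δ :=
      (faceHA_inter_outer.symm.subset ⟨_, ⟨Z, ⟨hZ, h⟩, rfl⟩, rfl⟩).2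
    rw [coe_actT h2, coe_faceHA hZ, circ_alpha p hZ h1, coe_faceHA (rot_mem hZ (hne h1) _).1]
  · have h1 : ((a.1, (c : ℂ) • a.2) : (E3 × ℝ) × (Fin 2 → ℂ)) ∈ TNbar :=
      ⟨ha.1, (hopf_smul_of_norm_one (Circle.norm_coe c) _).trans ha.2⟩
    rw [coe_actT (nut_subset_outer l (faceTN_mem ha l)), coe_faceTN ha, coe_faceTN h1,
      circ_nutMap _ _ _ (Circle.norm_coe c)]
  · change invol (faceHA p δ (sq Z) : Amb k) = _
    rw [coe_faceHA hZ, invol_alpha, coe_faceHA (star_mem_AHhatBar hZ)]
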